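/- Let $n=p+q\ge 3$ and let $(M,\mathrm g)$ be a conformally flat pseudo-Riemannian manifold of dimension $n$ and signature $(p,q)$: near every point there are *adapted* coordinates, i.e. coordinates in which $\mathrm g=F\,\eta$ with a function $F>0$ and $\eta=\mathrm{diag}(1,\dots,1,-1,\dots,-1)$ ($p$ times $1$, $q$ times $-1$). For a number $w$ (real, or complex, with complex-valued functions throughout) let $\mathcal F_w(M)$ be the space of smooth densities of degree $w$, i.e. of smooth sections of $|\Lambda^nT^*M|^{\otimes w}$. Let $\lambda,\mu$ be numbers, put $\delta=\mu-\lambda$, and assume $$\delta\notin\Big\{\tfrac2n,\ \tfrac{n+2}{2n},\ 1,\ \tfrac{n+1}n,\ \tfrac{n+2}n\Big\}.$$ Let $\mathcal D^2_{\lambda,\mu}(M)$ be the space of differential operators of order at most $2$ from $\mathcal F_\lambda(M)$ to $\mathcal F_\mu(M)$, and let $\mathcal S^2_\delta(M)$ be the space of symbols $P(\xi)=P_2^{ij}\xi_i\xi_j+P_1^i\xi_i+P_0$, where $P_2,P_1,P_0$ are smooth symmetric contravariant tensor fields of rank $2,1,0$ with values in the densities of degree $\delta$. The Lie algebra $\mathrm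 o(p+1,q+1)$ acts locally on $M$ by the vector fields which in adapted coordinates are spanned by $$\partial_i,\quad x_i\partial_j-x_j\partial_i,\quad x^i\partial_i,\quad x_jx^j\partial_i-2x_ix^j\partial_j\qquad(x_i=\eta_{ij}x^j),$$ hence, by the Lie derivatives $L_X^\delta$ on symbols and $L_X^{\lambda,\mu}(A)=L_X^\mu A-A\,L_X^\lambda$ on operators, on $\mathcal S^2_\delta$ and $\mathcal D^2_{\lambda,\mu}$. A linear map $\mathcal Q:\mathcal S^2_\delta(M)\to\mathcal D^2_{\lambda,\mu}(M)$ is called *conformally equivariant* if $\mathcal Q(L_X^\delta P)=L_X^{\lambda,\mu}(\mathcal Q(P))$ locally, that is: on the domain of every adapted coordinate system, for every $X$ as above, $\mathcal Q(P')=L_X^{\lambda,\mu}(\mathcal Q(P))$ there whenever $P'=L_X^\delta P$ there. It *preserves the principal symbol* if, for every homogeneous symbol $P$ of degree $k\in\{0,1,2\}$, $\mathcal Q(P)$ is of order at most $k$ with principal symbol $P$. **Theorem.** There is exactly one linear isomorphism $\mathcal Q_{\lambda,\mu}:\mathcal S^2_\delta(M)\to\mathcal D^2_{\lambda,\mu}(M)$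 which is conformally equivariant and preserves the principal symbol. On homogeneous quadratic symbols $P(\xi)=P^{ij}\xi_i\xi_j$ it is given, in every local coordinate system of $M$, by $$\mathcal Q_{\lambda,\mu}(P)=P^{ij}\nabla_i\nabla_j+\big(\beta_1\nabla_iP^{ij}+\beta_2\,\mathrm g^{ij}\mathrm g_{kl}\nabla_iP^{kl}\big)\nabla_j+\beta_3\nabla_i\nabla_j(P^{ij})+\beta_4\,\mathrm g^{ij}\mathrm g_{kl}\nabla_i\nabla_j(P^{kl})+\beta_5R_{ij}P^{ij}+\beta_6R\,\mathrm g_{ij}P^{ij},$$ where $\nabla$ is the Levi-Civita connection of $\mathrm g$ on tensor fields with values in densities (with $\nabla_i\phi=\partial_i\phi-\lambda\Gamma^j_{ij}\phi$ for $\phi\in\mathcal F_\lambda$), $R_{ij}$ and $R$ are the Ricci tensor and the scalar curvature of $\mathrm g$ (positive for round spheres), and $$\beta_1=\frac{2(n\lambda+1)}{2+n(1-\delta)},\qquad \beta_2=\frac{n(\lambda+\mu-1)}{(2+n(1-\delta))(2-n\delta)},\qquad \beta_3=\frac{n\lambda(n\lambda+1)}{(1+n(1-\delta))(2+n(1-\delta))},$$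 $$\beta_4=\frac{n\lambda\big(n^2\mu(2-\lambda-\mu)+2(n\lambda+1)^2-n(n+1)\big)}{(1+n(1-\delta))(2+n(1-\delta))(2+n(1-2\delta))(2-n\delta)},$$ $$\beta_5=\frac{n^2\lambda(\mu-1)}{(n-2)(1+n(1-\delta))},\qquad \beta_6=\frac{n^2\lambda(\mu-1)(n\delta-2)}{(n-1)(n-2)(1+n(1-\delta))(2+n(1-2\delta))}.$$ -/

import Mathlib

open scoped Manifold ContDiff

noncomputable section

namespace ConfQuant

/-! ### Charts, coordinate derivatives, densities and symbols -/

/-- The model space `ℝⁿ`. -/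
abbrev E (n : ℕ) : Type := EuclideanSpace ℝ (Fin n)

/-- The `i`-th partial derivative of a function on `ℝⁿ`. -/
def pd {n : ℕ} {V : Type*} [NormedAddCommGroup V] [NormedSpace ℝ V]
    (i : Fin n) (f : E n → V) (x : E n) : V :=
  fderiv ℝ f x (EuclideanSpace.single i 1)

/-- Local coordinate systems of `M`: all charts of the maximal smooth atlas. -/
abbrev Chart (n : ℕ) (M : Type*) [TopologicalSpace M] [ChartedSpace (E n) M] : Type _ :=
  {e : OpenPartialHomeomorph M (E n) // e ∈ IsManifold.maximalAtlas 𝓘(ℝ, E n) ∞ M}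

section Tensors

variable {n : ℕ} {M : Type*} [TopologicalSpace M] [ChartedSpace (E n) M]

/-- The domain of the change of coordinates from `e` to `e'`, in the coordinates of `e`. -/
def overlap (e e' : Chart n M) : Set (E n) :=
  {x | x ∈ e.1.target ∧ e.1.symm x ∈ e'.1.source}

/-- The change of coordinates from `e` to `e'`. -/
def trans (e e' : Chart n M) (x : E n) : E n := e'.1 (e.1.symm x)

/-- The Jacobian matrix `∂x'^i/∂x^j` of the change of coordinates from `e` to `e'`. -/
def jac (e e' : Chart n M) (x : E n) : Matrix (Fin n) (Fin n) ℝ :=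
  Matrix.of fun i j => pd j (fun y => trans e e' y i) x

end Tensors

/-- `|J| ^ w` for a real number `J ≠ 0` and a real or complex exponent `w`. -/
def absPow {𝕜 : Type*} [RCLike 𝕜] (J : ℝ) (w : 𝕜) : 𝕜 :=
  NormedSpace.exp (w * ((Real.log |J| : ℝ) : 𝕜))

section Modules

variable {𝕜 : Type*} [RCLike 𝕜] (n : ℕ) (M : Type*) [TopologicalSpace M] [ChartedSpace (E n) M]

/-- The space `F_w` of smooth densities of degree `w`, i.e. of sections `φ = φ_e |dx|^w` of
`|Λⁿ T*M|^w`. A density is given by its components `φ_e`, one for each chart `e`, on the range of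
`e`. (Outside of that range the component is `0` by convention, so that equal sections are
equal.) -/
def Density (w : 𝕜) : Submodule 𝕜 (Chart n M → E n → 𝕜) where
  carrier := {φ |
    (∀ e : Chart n M, ContDiffOn ℝ ∞ (φ e) e.1.target) ∧
    (∀ (e : Chart n M) (x : E n), x ∉ e.1.target → φ e x = 0) ∧
    (∀ (e e' : Chart n M) (x : E n), x ∈ overlap e e' →
      φ e' (trans e e' x) = absPow (jac e e' x).det (-w) * φ e x)}
  zero_mem' := ⟨fun _ => contDiffOn_const, fun _ _ _ => rfl, fun _ _ _ _ => by simp⟩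
  add_mem' := by
    rintro a b ⟨ha1, ha2, ha3⟩ ⟨hb1, hb2, hb3⟩
    refine ⟨fun e => (ha1 e).add (hb1 e), fun e x hx => ?_, fun e e' x hx => ?_⟩
    · simp [ha2 e x hx, hb2 e x hx]
    · simp only [Pi.add_apply, ha3 e e' x hx, hb3 e e' x hx, mul_add]
  smul_mem' := by
    rintro c a ⟨ha1, ha2, ha3⟩
    refine ⟨fun e => (ha1 e).const_smul c, fun e x hx => ?_, fun e e' x hx => ?_⟩
    · simp [ha2 e x hx]
    · simp only [Pi.smul_apply, smul_eq_mul, ha3 e e' x hx]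
      ring

/-- The space `S_{1,w}` of symbols `P^i ξ_i`: smooth vector fields with values in the densities of
degree `w`. -/
def Symbol1 (w : 𝕜) : Submodule 𝕜 (Chart n M → E n → Fin n → 𝕜) where
  carrier := {P |
    (∀ (e : Chart n M) (i : Fin n), ContDiffOn ℝ ∞ (fun x => P e x i) e.1.target) ∧
    (∀ (e : Chart n M) (x : E n), x ∉ e.1.target → P e x = 0) ∧
    (∀ (e e' : Chart n M) (x : E n), x ∈ overlap e e' → ∀ i : Fin n,
      P e' (trans e e' x) i = absPow (jac e e' x).det (-w) *
        ∑ k, ((jac e e' x i k : ℝ) : 𝕜) * P e x k)}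
  zero_mem' := ⟨fun _ _ => contDiffOn_const, fun _ _ _ => rfl, fun _ _ _ _ _ => by simp⟩
  add_mem' := by
    rintro a b ⟨ha1, ha2, ha3⟩ ⟨hb1, hb2, hb3⟩
    refine ⟨fun e i => (ha1 e i).add (hb1 e i), fun e x hx => ?_, fun e e' x hx i => ?_⟩
    · simp [ha2 e x hx, hb2 e x hx]
    · simp only [Pi.add_apply, ha3 e e' x hx, hb3 e e' x hx, mul_add, Finset.sum_add_distrib]
  smul_mem' := by
    rintro c a ⟨ha1, ha2, ha3⟩
    refine ⟨fun e i => (ha1 e i).const_smul c, fun e x hx => ?_, fun e e' x hx i => ?_⟩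
    · simp [ha2 e x hx]
    · simp only [Pi.smul_apply, smul_eq_mul, ha3 e e' x hx, Finset.mul_sum]
      exact Finset.sum_congr rfl fun k _ => by ring

/-- The space `S_{2,w}` of homogeneous quadratic symbols `P^{ij} ξ_i ξ_j`: smooth symmetric
contravariant tensor fields of rank two with values in the densities of degree `w`. -/
def Symbol2 (w : 𝕜) : Submodule 𝕜 (Chart n M → E n → Fin n → Fin n → 𝕜) where
  carrier := {P |
    (∀ (e : Chart n M) (i j : Fin n), ContDiffOn ℝ ∞ (fun x => P e x i j) e.1.target) ∧
    (∀ (e : Chart n M) (x : E n), x ∉ e.1.target → P e x = 0) ∧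
    (∀ (e : Chart n M) (x : E n) (i j : Fin n), P e x i j = P e x j i) ∧
    (∀ (e e' : Chart n M) (x : E n), x ∈ overlap e e' → ∀ i j : Fin n,
      P e' (trans e e' x) i j = absPow (jac e e' x).det (-w) *
        ∑ k, ∑ l, ((jac e e' x i k : ℝ) : 𝕜) * ((jac e e' x j l : ℝ) : 𝕜) * P e x k l)}
  zero_mem' := ⟨fun _ _ _ => contDiffOn_const, fun _ _ _ => rfl, fun _ _ _ _ => rfl,
    fun _ _ _ _ _ _ => by simp⟩
  add_mem' := by
    rintro a b ⟨ha1, ha2, ha3, ha4⟩ ⟨hb1, hb2, hb3, hb4⟩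
    refine ⟨fun e i j => (ha1 e i j).add (hb1 e i j), fun e x hx => ?_, fun e x i j => ?_,
      fun e e' x hx i j => ?_⟩
    · simp [ha2 e x hx, hb2 e x hx]
    · simp only [Pi.add_apply, ha3 e x i j, hb3 e x i j]
    · simp only [Pi.add_apply, ha4 e e' x hx, hb4 e e' x hx, mul_add, Finset.sum_add_distrib]
  smul_mem' := by
    rintro c a ⟨ha1, ha2, ha3, ha4⟩
    refine ⟨fun e i j => (ha1 e i j).const_smul c, fun e x hx => ?_,
      fun e x i j => ?_, fun e e' x hx i j => ?_⟩
    · simp [ha2 e x hx]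
    · simp only [Pi.smul_apply, ha3 e x i j]
    · simp only [Pi.smul_apply, smul_eq_mul, ha4 e e' x hx, Finset.mul_sum]
      exact Finset.sum_congr rfl fun k _ => Finset.sum_congr rfl fun l _ => by ring

/-- The space `S²_w = S_{2,w} ⊕ S_{1,w} ⊕ S_{0,w}` of symbols of degree at most two,
`P(ξ) = P₂^{ij} ξ_i ξ_j + P₁^i ξ_i + P₀`. -/
abbrev Symbols (w : 𝕜) : Type _ := Symbol2 n M w × Symbol1 n M w × Density n M w

end Modules

/-! ### Differential operators of order at most two -/

section Operators

variable {𝕜 : Type*} [RCLike 𝕜] {n : ℕ}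

/-- The operator `a₂^{ij} ∂_i ∂_j + a₁^i ∂_i + a₀` applied to `f`. -/
def coordOp (a₂ : E n → Fin n → Fin n → 𝕜) (a₁ : E n → Fin n → 𝕜) (a₀ : E n → 𝕜)
    (f : E n → 𝕜) (x : E n) : 𝕜 :=
  ∑ i, ∑ j, a₂ x i j * pd i (pd j f) x + ∑ i, a₁ x i * pd i f x + a₀ x * f x

variable {M : Type*} [TopologicalSpace M] [ChartedSpace (E n) M]

/-- In the coordinate system `e` the operator `A` is the differential operator
`a₂^{ij} ∂_i ∂_j + a₁^i ∂_i + a₀`, with smooth coefficients and `a₂` symmetric. -/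
structure HasCoeffs {lam mu : 𝕜} (A : Density n M lam →ₗ[𝕜] Density n M mu) (e : Chart n M)
    (a₂ : E n → Fin n → Fin n → 𝕜) (a₁ : E n → Fin n → 𝕜) (a₀ : E n → 𝕜) : Prop where
  smooth₂ : ∀ i j, ContDiffOn ℝ ∞ (fun x => a₂ x i j) e.1.target
  smooth₁ : ∀ i, ContDiffOn ℝ ∞ (fun x => a₁ x i) e.1.target
  smooth₀ : ContDiffOn ℝ ∞ a₀ e.1.target
  symm : ∀ x ∈ e.1.target, ∀ i j, a₂ x i j = a₂ x j i
  apply_eq : ∀ φ : Density n M lam, ∀ x ∈ e.1.target,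
    (A φ).1 e x = coordOp a₂ a₁ a₀ (φ.1 e) x

variable (n M) in
/-- The space `D²_{λ,μ}` of differential operators of order at most two from densities of degree
`λ` to densities of degree `μ`. -/
def DiffOp2 (lam mu : 𝕜) : Submodule 𝕜 (Density n M lam →ₗ[𝕜] Density n M mu) where
  carrier := {A | ∀ e : Chart n M, ∃ a₂ a₁ a₀, HasCoeffs A e a₂ a₁ a₀}
  zero_mem' := fun e => ⟨0, 0, 0, fun _ _ => contDiffOn_const, fun _ => contDiffOn_const,
    contDiffOn_const, fun _ _ _ _ => rfl, fun φ x _ => by simp [coordOp]⟩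
  add_mem' := by
    intro A B hA hB e
    obtain ⟨a₂, a₁, a₀, ha⟩ := hA e
    obtain ⟨b₂, b₁, b₀, hb⟩ := hB e
    refine ⟨a₂ + b₂, a₁ + b₁, a₀ + b₀, fun i j => (ha.smooth₂ i j).add (hb.smooth₂ i j),
      fun i => (ha.smooth₁ i).add (hb.smooth₁ i), ha.smooth₀.add hb.smooth₀,
      fun x hx i j => ?_, fun φ x hx => ?_⟩
    · simp only [Pi.add_apply, ha.symm x hx i j, hb.symm x hx i j]
    · have h1 := ha.apply_eq φ x hx
      have h2 := hb.apply_eq φ x hx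
      simp only [coordOp] at h1 h2
      simp only [LinearMap.add_apply, Submodule.coe_add, Pi.add_apply, h1, h2, coordOp, add_mul,
        Finset.sum_add_distrib]
      ring
  smul_mem' := by
    intro c A hA e
    obtain ⟨a₂, a₁, a₀, ha⟩ := hA e
    refine ⟨c • a₂, c • a₁, c • a₀, fun i j => (ha.smooth₂ i j).const_smul c,
      fun i => (ha.smooth₁ i).const_smul c, ha.smooth₀.const_smul c,
      fun x hx i j => ?_, fun φ x hx => ?_⟩
    · simp only [Pi.smul_apply, ha.symm x hx i j]
    · have h1 := ha.apply_eq φ x hx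
      simp only [coordOp] at h1
      simp only [LinearMap.smul_apply, Submodule.coe_smul, Pi.smul_apply, h1, coordOp,
        smul_eq_mul, mul_add, Finset.mul_sum, mul_assoc]

/-- The map `Q` preserves the principal symbol at each order: for `k = 0, 1, 2`, the image of a
homogeneous symbol `P` of degree `k` has order at most `k` and its part of order `k` is `P`. -/
def PreservesPrincipalSymbol {lam mu : 𝕜}
    (Q : Symbols n M (mu - lam) →ₗ[𝕜] DiffOp2 n M lam mu) : Prop :=
  (∀ (P : Symbol2 n M (mu - lam)) (e : Chart n M),
    ∃ a₁ a₀, HasCoeffs (Q (P, 0, 0)).1 e (P.1 e) a₁ a₀) ∧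
  (∀ (P : Symbol1 n M (mu - lam)) (e : Chart n M),
    ∃ a₀, HasCoeffs (Q (0, P, 0)).1 e 0 (P.1 e) a₀) ∧
  (∀ (P : Density n M (mu - lam)) (e : Chart n M),
    HasCoeffs (Q (0, 0, P)).1 e 0 0 (P.1 e))

end Operators

/-! ### Lie derivatives in coordinates -/

section LieDerivatives

variable {𝕜 : Type*} [RCLike 𝕜] {n : ℕ}

/-- The divergence of a vector field on (an open subset of) `ℝⁿ`. -/
def divergence (X : E n → E n) (x : E n) : ℝ := ∑ i, pd i (fun y => X y i) x

/-- The Lie derivative of a density of degree `w`: `X^k ∂_k f + w (div X) f`. -/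
def lieDensity (w : 𝕜) (X : E n → E n) (f : E n → 𝕜) (x : E n) : 𝕜 :=
  ∑ k, ((X x k : ℝ) : 𝕜) * pd k f x + w * ((divergence X x : ℝ) : 𝕜) * f x

/-- The Lie derivative of a symbol of degree one with values in the densities of degree `w`. -/
def lieSymbol1 (w : 𝕜) (X : E n → E n) (P : E n → Fin n → 𝕜) (x : E n) (i : Fin n) : 𝕜 :=
  lieDensity w X (fun y => P y i) x - ∑ k, P x k * ((pd k (fun y => X y i) x : ℝ) : 𝕜)

/-- The Lie derivative of a quadratic symbol with values in the densities of degree `w`. -/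
def lieSymbol2 (w : 𝕜) (X : E n → E n) (P : E n → Fin n → Fin n → 𝕜) (x : E n)
    (i j : Fin n) : 𝕜 :=
  lieDensity w X (fun y => P y i j) x
    - ∑ k, P x k j * ((pd k (fun y => X y i) x : ℝ) : 𝕜)
    - ∑ k, P x i k * ((pd k (fun y => X y j) x : ℝ) : 𝕜)

end LieDerivatives

/-! ### Flat conformal structures -/

section Conformal

/-- The diagonal entries `1, …, 1, -1, …, -1` (with `p` entries `1`) of the flat metric. -/
def eta {n : ℕ} (p : ℕ) (i : Fin n) : ℝ := if (i : ℕ) < p then 1 else -1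

/-- The conformal Lie algebra `o(p+1, q+1)`, with `p + q = n`, of vector fields on `ℝⁿ`, spanned by
`X_i = ∂_i`, `X_{ij} = x_i ∂_j - x_j ∂_i`, `X_0 = x^i ∂_i` and
`X̄_i = x_j x^j ∂_i - 2 x_i x^j ∂_j`, where `x_i = η_{ij} x^j`. -/
def confAlgebra (n p : ℕ) : Submodule ℝ (E n → E n) :=
  Submodule.span ℝ (
    {X | ∃ i : Fin n, X = fun _ => EuclideanSpace.single i 1} ∪
    {X | ∃ i j : Fin n, X = fun x =>
      (eta p i * x i) • EuclideanSpace.single j 1 - (eta p j * x j) • EuclideanSpace.single i 1} ∪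
    {X | X = fun x => x} ∪
    {X | ∃ i : Fin n, X = fun x =>
      (∑ j, eta p j * x j * x j) • EuclideanSpace.single i 1 - (2 * (eta p i * x i)) • x})

/-- A (smooth) pseudo-Riemannian metric on `M`, given by its components `g_{ij}` in all coordinate
systems. -/
structure PseudoMetric (n : ℕ) (M : Type*) [TopologicalSpace M] [ChartedSpace (E n) M] where
  /-- The matrix of components in the chart `e` (meaningful on the range of `e`). -/
  comp : Chart n M → E n → Matrix (Fin n) (Fin n) ℝ
  smooth : ∀ (e : Chart n M) (i j : Fin n), ContDiffOn ℝ ∞ (fun x => comp e x i j) e.1.target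
  symm : ∀ (e : Chart n M), ∀ x ∈ e.1.target, (comp e x).IsSymm
  nondeg : ∀ (e : Chart n M), ∀ x ∈ e.1.target, (comp e x).det ≠ 0
  transform : ∀ (e e' : Chart n M), ∀ x ∈ overlap e e',
    comp e x = (jac e e' x).transpose * comp e' (trans e e' x) * jac e e' x

variable {n : ℕ} {M : Type*} [TopologicalSpace M] [ChartedSpace (E n) M]

/-- The coordinate system `e` is adapted to the conformal class of `g`: there `g` is a positive
multiple of the flat metric of signature `(p, n - p)`. -/
def IsAdapted (p : ℕ) (g : PseudoMetric n M) (e : Chart n M) : Prop :=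
  ∃ F : E n → ℝ, ∀ x ∈ e.1.target, 0 < F x ∧ g.comp e x = F x • Matrix.diagonal (eta p)

/-- The metric `g` is conformally flat of signature `(p, n - p)`: there are adapted coordinates near
every point. -/
def IsConformallyFlat (p : ℕ) (g : PseudoMetric n M) : Prop :=
  ∀ m : M, ∃ e : Chart n M, m ∈ e.1.source ∧ IsAdapted p g e

/-- Equivariance of `Q : S²_δ → D²_{λ,μ}` (`δ = μ - λ`) with respect to the local action of
`o(p+1, q+1)` on `M`, that is, `Q(L_X^δ P) = L_X^μ ∘ Q(P) - Q(P) ∘ L_X^λ` for all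
`X ∈ o(p+1, q+1)` on the domain of each adapted coordinate system. As `X` is only defined on
that domain, `L_X^δ P` and `L_X^λ φ` enter through any global `P'` and `φ'` which
coincide with them there. -/
def IsConfEquivariant {𝕜 : Type*} [RCLike 𝕜] (p : ℕ) (g : PseudoMetric n M) {lam mu : 𝕜}
    (Q : Symbols n M (mu - lam) →ₗ[𝕜] DiffOp2 n M lam mu) : Prop :=
  ∀ e : Chart n M, IsAdapted p g e → ∀ X ∈ confAlgebra n p,
  ∀ P P' : Symbols n M (mu - lam),
    (∀ x ∈ e.1.target,
      P'.1.1 e x = lieSymbol2 (mu - lam) X (P.1.1 e) x ∧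
      P'.2.1.1 e x = lieSymbol1 (mu - lam) X (P.2.1.1 e) x ∧
      P'.2.2.1 e x = lieDensity (mu - lam) X (P.2.2.1 e) x) →
  ∀ φ φ' : Density n M lam,
    (∀ x ∈ e.1.target, φ'.1 e x = lieDensity lam X (φ.1 e) x) →
  ∀ x ∈ e.1.target,
    ((Q P').1 φ).1 e x = lieDensity mu X (((Q P).1 φ).1 e) x - ((Q P).1 φ').1 e x

end Conformal

/-! ### The Levi-Civita connection in coordinates -/

section LeviCivita

variable {n : ℕ} (g : E n → Matrix (Fin n) (Fin n) ℝ)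

/-- The Christoffel symbols `Γ^k_{ij}` of the metric `g`. -/
def christoffel (k i j : Fin n) (x : E n) : ℝ :=
  (1 / 2) * ∑ l, (g x)⁻¹ k l *
    (pd i (fun y => g y j l) x + pd j (fun y => g y i l) x - pd l (fun y => g y i j) x)

/-- `Γ_i = Γ^j_{ij}`. -/
def christoffelTr (i : Fin n) (x : E n) : ℝ := ∑ j, christoffel g j i j x

/-- The components `R_{ij}` of the Ricci tensor (positive on round spheres). -/
def ricci (i j : Fin n) (x : E n) : ℝ :=
  ∑ k, (pd k (christoffel g k i j) x - pd j (christoffel g k i k) x)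
    + ∑ k, ∑ l, (christoffel g k k l x * christoffel g l i j x
        - christoffel g k j l x * christoffel g l i k x)

/-- The scalar curvature `R = g^{ij} R_{ij}`. -/
def scalarCurv (x : E n) : ℝ := ∑ i, ∑ j, (g x)⁻¹ i j * ricci g i j x

variable {𝕜 : Type*} [RCLike 𝕜] (w : 𝕜)

/-- `∇_i φ = ∂_i φ - w Γ_i φ` for a density `φ` of degree `w`. -/
def nablaD (φ : E n → 𝕜) (i : Fin n) (x : E n) : 𝕜 :=
  pd i φ x - w * ((christoffelTr g i x : ℝ) : 𝕜) * φ x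

/-- `∇_i ∇_j φ` for a density `φ` of degree `w`. -/
def nablaNablaD (φ : E n → 𝕜) (i j : Fin n) (x : E n) : 𝕜 :=
  pd i (nablaD g w φ j) x
    - ∑ k, ((christoffel g k i j x : ℝ) : 𝕜) * nablaD g w φ k x
    - w * ((christoffelTr g i x : ℝ) : 𝕜) * nablaD g w φ j x

/-- `∇_k P^{ij}` for a contravariant tensor with values in the densities of degree `w`. -/
def nablaP (P : E n → Fin n → Fin n → 𝕜) (k i j : Fin n) (x : E n) : 𝕜 :=
  pd k (fun y => P y i j) x
    + ∑ l, ((christoffel g i k l x : ℝ) : 𝕜) * P x l j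
    + ∑ l, ((christoffel g j k l x : ℝ) : 𝕜) * P x i l
    - w * ((christoffelTr g k x : ℝ) : 𝕜) * P x i j

/-- `∇_l ∇_k P^{ij}` for a contravariant tensor with values in the densities of degree `w`. -/
def nablaNablaP (P : E n → Fin n → Fin n → 𝕜) (l k i j : Fin n) (x : E n) : 𝕜 :=
  pd l (nablaP g w P k i j) x
    + ∑ m, ((christoffel g i l m x : ℝ) : 𝕜) * nablaP g w P k m j x
    + ∑ m, ((christoffel g j l m x : ℝ) : 𝕜) * nablaP g w P k i m x
    - ∑ m, ((christoffel g m l k x : ℝ) : 𝕜) * nablaP g w P m i j x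
    - w * ((christoffelTr g l x : ℝ) : 𝕜) * nablaP g w P k i j x

end LeviCivita

/-! ### The quantization formula -/

section Formula

variable {𝕜 : Type*} [RCLike 𝕜]

/-- `δ ∉ {2/n, (n+2)/(2n), 1, (n+1)/n, (n+2)/n}`. -/
def NonResonant (n : ℕ) (δ : 𝕜) : Prop :=
  δ ≠ 2 / (n : 𝕜) ∧ δ ≠ ((n : 𝕜) + 2) / (2 * (n : 𝕜)) ∧ δ ≠ 1 ∧
    δ ≠ ((n : 𝕜) + 1) / (n : 𝕜) ∧ δ ≠ ((n : 𝕜) + 2) / (n : 𝕜)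

/-- The coefficient `β₁`, where `N = n` and `δ = μ - λ`; similarly below. -/
def beta1 (N lam mu : 𝕜) : 𝕜 := 2 * (N * lam + 1) / (2 + N * (1 - (mu - lam)))

/-- The coefficient `β₂`. -/
def beta2 (N lam mu : 𝕜) : 𝕜 :=
  N * (lam + mu - 1) / ((2 + N * (1 - (mu - lam))) * (2 - N * (mu - lam)))

/-- The coefficient `β₃`. -/
def beta3 (N lam mu : 𝕜) : 𝕜 :=
  N * lam * (N * lam + 1) / ((1 + N * (1 - (mu - lam))) * (2 + N * (1 - (mu - lam))))

/-- The coefficient `β₄`. -/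
def beta4 (N lam mu : 𝕜) : 𝕜 :=
  N * lam * (N ^ 2 * mu * (2 - lam - mu) + 2 * (N * lam + 1) ^ 2 - N * (N + 1)) /
    ((1 + N * (1 - (mu - lam))) * (2 + N * (1 - (mu - lam))) *
      (2 + N * (1 - 2 * (mu - lam))) * (2 - N * (mu - lam)))

/-- The coefficient `β₅`. -/
def beta5 (N lam mu : 𝕜) : 𝕜 :=
  N ^ 2 * lam * (mu - 1) / ((N - 2) * (1 + N * (1 - (mu - lam))))

/-- The coefficient `β₆`. -/
def beta6 (N lam mu : 𝕜) : 𝕜 :=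
  N ^ 2 * lam * (mu - 1) * (N * (mu - lam) - 2) /
    ((N - 1) * (N - 2) * (1 + N * (1 - (mu - lam))) * (2 + N * (1 - 2 * (mu - lam))))

/-- The component, in a coordinate system in which the metric is `g` and the density of degree `λ`
is `φ`, of the density of degree `μ`
`P^{ij} ∇_i ∇_j φ + (β₁ ∇_i P^{ij} + β₂ g^{ij} g_{kl} ∇_i P^{kl}) ∇_j φ
+ (β₃ ∇_i ∇_j P^{ij} + β₄ g^{ij} g_{kl} ∇_i ∇_j P^{kl} + β₅ R_{ij} P^{ij} + β₆ R g_{ij} P^{ij}) φ`. -/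
def quantFormula {n : ℕ} (lam mu : 𝕜) (g : E n → Matrix (Fin n) (Fin n) ℝ)
    (P : E n → Fin n → Fin n → 𝕜) (φ : E n → 𝕜) (x : E n) : 𝕜 :=
  ∑ i, ∑ j, P x i j * nablaNablaD g lam φ i j x
  + ∑ j, (beta1 (n : 𝕜) lam mu * ∑ i, nablaP g (mu - lam) P i i j x
      + beta2 (n : 𝕜) lam mu * ∑ i, ∑ k, ∑ l,
          (((g x)⁻¹ i j * g x k l : ℝ) : 𝕜) * nablaP g (mu - lam) P i k l x)
      * nablaD g lam φ j x
  + (beta3 (n : 𝕜) lam mu * ∑ i, ∑ j, nablaNablaP g (mu - lam) P i j i j x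
      + beta4 (n : 𝕜) lam mu * ∑ i, ∑ j, ∑ k, ∑ l,
          (((g x)⁻¹ i j * g x k l : ℝ) : 𝕜) * nablaNablaP g (mu - lam) P i j k l x
      + beta5 (n : 𝕜) lam mu * ∑ i, ∑ j, ((ricci g i j x : ℝ) : 𝕜) * P x i j
      + beta6 (n : 𝕜) lam mu * ((scalarCurv g x : ℝ) : 𝕜) *
          ∑ i, ∑ j, ((g x i j : ℝ) : 𝕜) * P x i j) * φ x

end Formula

end ConfQuant

end

open scoped Manifold ContDiff

noncomputable section

namespace ConfQuant

/-! ### Calculus of partial derivatives -/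

section PartialDerivatives

variable {n : ℕ} {𝕜 : Type*} [RCLike 𝕜] {V : Type*} [NormedAddCommGroup V] [NormedSpace ℝ V]

/-! Existence is proved by examining an explicit map. On quadratic symbols it is the stated
expression; on symbols of degree one it is $P^i\nabla_i+\frac{\lambda}{1-\delta}\nabla_iP^i$, from
which the connection drops out; on symbols of degree zero it is multiplication. Each term is a
complete contraction of objects with known transformation laws, so the result is a density of degree
$\mu$ in every chart (`IsMetricChange.quantFormula_eq`). The key input is the transformation law of
the Christoffel symbols: its trace produces the logarithmic derivative of the Jacobian determinant,
which is exactly what the weight term of $\nabla$ absorbs.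

In adapted coordinates $\mathrm g=e^{2u}\eta$, and the expression becomes polynomial in the
derivatives of $u$. All terms containing $u$ cancel (`IsConformalTo.quantFormula_eq`), so only the
flat formula remains. The conditions for this cancellation are the relations `beta1_rel` to
`beta6_rel'` between the coefficients. For a conformal field $X$, the failure of second derivatives,
divergences and the gradient of the trace to commute with $L_X$ is linear in the constant covector
$h=\frac1n\,d(\operatorname{div}X)$. In the flat formula these failures add up to zero by the first
four of the same relations (`IsConfField.flatFormula_lie`).

Uniqueness rests on the Casimir operator of $\mathrm o(p+1,q+1)$. The difference $T$ of two
quantizations is equivariant and lowers the order. It is local, because equivariance may be applied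
with $X=0$ on arbitrarily small adapted charts (`IsConfEquivariant.apply_eq_zero`). The Casimir
operator, written as a quadratic expression in Lie derivatives, contains no derivatives at all
(`casimir_eq`) and acts on the fibres: by a scalar on densities and on vector fields, and with two
eigenvalues on quadratic symbols, for the trace-free part and for the trace part. A map intertwining
the Lie derivatives intertwines the Casimir operators, so it vanishes if the eigenvalues differ
(`eq_zero_of_intertwines`). Up to nonzero constants the five differences are $1-\delta$ (degree one
to zero), $2+n(1-\delta)$ and $2-n\delta$ (degree two to one), $1+n(1-\delta)$ and $2+n(1-2\delta)$
(degree two to zero). Their zeros are the five excluded values. The argument is run on symbols with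
compact support in a chart, since these and their Lie derivatives extend by zero to $M$; locality
carries the conclusion to all symbols.

Bijectivity is triangularity with respect to the order: the leading coefficients of an operator form
a symbol of degree $\mu-\lambda$, and subtracting its quantization lowers the order. -/

theorem differentiableAt_of_smooth {f : E n → V} {x : E n} (hf : ContDiffAt ℝ ∞ f x) :
    DifferentiableAt ℝ f x :=
  hf.differentiableAt (by simp)

@[fun_prop]
theorem contDiffAt_pd {f : E n → V} {x : E n} (i : Fin n) (hf : ContDiffAt ℝ ∞ f x) :
    ContDiffAt ℝ ∞ (fun y => pd i f y) x :=
  (hf.fderiv_right (m := ∞) (by simp)).clm_apply contDiffAt_const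

@[fun_prop]
theorem contDiffAt_ofReal {f : E n → ℝ} {x : E n} (hf : ContDiffAt ℝ ∞ f x) :
    ContDiffAt ℝ ∞ (fun y => ((f y : ℝ) : 𝕜)) x :=
  (RCLike.ofRealCLM (K := 𝕜)).contDiff.contDiffAt.comp x hf

@[fun_prop]
theorem contDiffAt_sum {ι : Type*} {s : Finset ι} {f : ι → E n → V} {x : E n}
    (hf : ∀ i, ContDiffAt ℝ ∞ (f i) x) :
    ContDiffAt ℝ ∞ (fun y => ∑ i ∈ s, f i y) x :=
  ContDiffAt.sum fun i _ => hf i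

@[fun_prop]
theorem contDiffAt_coord (i : Fin n) {x : E n} : ContDiffAt ℝ ∞ (fun y : E n => y i) x :=
  (EuclideanSpace.proj (𝕜 := ℝ) i).contDiff.contDiffAt

/-- Components of fields are meaningful only on the range of a chart, so equality is required on an
open set rather than everywhere. -/
theorem pd_congr {f g : E n → V} {U : Set (E n)} (hU : IsOpen U) (h : ∀ y ∈ U, f y = g y)
    {x : E n} (hx : x ∈ U) (i : Fin n) : pd i f x = pd i g x := by
  have : f =ᶠ[nhds x] g := Filter.eventuallyEq_of_mem (hU.mem_nhds hx) h
  simp only [pd, this.fderiv_eq]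

theorem contDiffAt_congr {f g : E n → V} {U : Set (E n)} (hU : IsOpen U)
    (h : ∀ y ∈ U, f y = g y) {x : E n} (hx : x ∈ U) (hg : ContDiffAt ℝ ∞ g x) :
    ContDiffAt ℝ ∞ f x :=
  hg.congr_of_eventuallyEq (Filter.eventuallyEq_of_mem (hU.mem_nhds hx) h)

@[simp]
theorem pd_const (i : Fin n) (c : V) (x : E n) : pd i (fun _ => c) x = 0 := by
  simp [pd]

theorem pd_add (i : Fin n) {f g : E n → V} {x : E n} (hf : ContDiffAt ℝ ∞ f x)
    (hg : ContDiffAt ℝ ∞ g x) : pd i (fun y => f y + g y) x = pd i f x + pd i g x := by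
  simp [pd, fderiv_fun_add (differentiableAt_of_smooth hf) (differentiableAt_of_smooth hg)]

theorem pd_sub (i : Fin n) {f g : E n → V} {x : E n} (hf : ContDiffAt ℝ ∞ f x)
    (hg : ContDiffAt ℝ ∞ g x) : pd i (fun y => f y - g y) x = pd i f x - pd i g x := by
  simp [pd, fderiv_fun_sub (differentiableAt_of_smooth hf) (differentiableAt_of_smooth hg)]

theorem pd_sum (i : Fin n) {ι : Type*} {s : Finset ι} {f : ι → E n → V} {x : E n}
    (hf : ∀ j, ContDiffAt ℝ ∞ (f j) x) :
    pd i (fun y => ∑ j ∈ s, f j y) x = ∑ j ∈ s, pd i (f j) x := by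
  simp [pd, fderiv_fun_sum fun j _ => differentiableAt_of_smooth (hf j)]

theorem pd_mul (i : Fin n) {f g : E n → 𝕜} {x : E n} (hf : ContDiffAt ℝ ∞ f x)
    (hg : ContDiffAt ℝ ∞ g x) :
    pd i (fun y => f y * g y) x = pd i f x * g x + f x * pd i g x := by
  simp [pd, fderiv_fun_mul (differentiableAt_of_smooth hf) (differentiableAt_of_smooth hg)]
  ring

theorem pd_const_mul (i : Fin n) (c : 𝕜) {f : E n → 𝕜} {x : E n} (hf : ContDiffAt ℝ ∞ f x) :
    pd i (fun y => c * f y) x = c * pd i f x := by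
  simp [pd_mul i contDiffAt_const hf]

theorem pd_mul_const (i : Fin n) (c : 𝕜) {f : E n → 𝕜} {x : E n} (hf : ContDiffAt ℝ ∞ f x) :
    pd i (fun y => f y * c) x = pd i f x * c := by
  simp [pd_mul i hf contDiffAt_const]

theorem pd_smul {W : Type*} [NormedAddCommGroup W] [NormedSpace ℝ W] (i : Fin n)
    {f : E n → ℝ} {g : E n → W} {x : E n} (hf : ContDiffAt ℝ ∞ f x)
    (hg : ContDiffAt ℝ ∞ g x) :
    pd i (fun y => f y • g y) x = pd i f x • g x + f x • pd i g x := by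
  simp [pd, fderiv_fun_smul (differentiableAt_of_smooth hf) (differentiableAt_of_smooth hg), add_comm]

theorem pd_clm {W : Type*} [NormedAddCommGroup W] [NormedSpace ℝ W] (L : V →L[ℝ] W) (i : Fin n)
    {f : E n → V} {x : E n} (hf : ContDiffAt ℝ ∞ f x) :
    pd i (fun y => L (f y)) x = L (pd i f x) := by
  have := (L.hasFDerivAt.comp x (differentiableAt_of_smooth hf).hasFDerivAt).fderiv
  simp only [pd]
  rw [show (fun y => L (f y)) = L ∘ f from rfl, this]
  rfl

theorem pd_ofReal (i : Fin n) {f : E n → ℝ} {x : E n} (hf : ContDiffAt ℝ ∞ f x) :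
    pd i (fun y => ((f y : ℝ) : 𝕜)) x = ((pd i f x : ℝ) : 𝕜) :=
  pd_clm (RCLike.ofRealCLM (K := 𝕜)) i hf

theorem pd_coord (i j : Fin n) (x : E n) :
    pd i (fun y : E n => y j) x = if j = i then 1 else 0 := by
  have : fderiv ℝ (fun y : E n => y j) x = EuclideanSpace.proj (𝕜 := ℝ) j :=
    (EuclideanSpace.proj (𝕜 := ℝ) j).hasFDerivAt.fderiv
  simp [pd, this, PiLp.single_apply]

theorem pd_pi {ι : Type*} [Fintype ι] {W : ι → Type*} [∀ k, NormedAddCommGroup (W k)]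
    [∀ k, NormedSpace ℝ (W k)] (i : Fin n) {f : E n → ∀ k, W k} {x : E n}
    (hf : ContDiffAt ℝ ∞ f x) (k : ι) : pd i f x k = pd i (fun y => f y k) x :=
  (pd_clm (ContinuousLinearMap.proj (R := ℝ) (φ := W) k) i hf).symm

theorem fderiv_apply_eq_sum (f : E n → V) (x v : E n) :
    fderiv ℝ f x v = ∑ i, v i • pd i f x := by
  conv_lhs => rw [← (EuclideanSpace.basisFun (Fin n) ℝ).sum_repr v]
  simp [pd, map_sum]

/-- The chain rule. -/
theorem pd_comp (k : Fin n) {f : E n → V} {ψ : E n → E n} {x : E n}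
    (hf : ContDiffAt ℝ ∞ f (ψ x)) (hψ : ContDiffAt ℝ ∞ ψ x) :
    pd k (fun y => f (ψ y)) x = ∑ i, pd k (fun y => ψ y i) x • pd i f (ψ x) := by
  have h1 := ((differentiableAt_of_smooth hf).hasFDerivAt.comp x
    (differentiableAt_of_smooth hψ).hasFDerivAt).fderiv
  have h2 : ∀ i, pd k (fun y => ψ y i) x = (pd k ψ x) i := fun i =>
    pd_clm (EuclideanSpace.proj (𝕜 := ℝ) i) k hψ
  simp only [h2, ← fderiv_apply_eq_sum]
  simp only [pd]
  rw [show (fun y => f (ψ y)) = f ∘ ψ from rfl, h1]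
  rfl

theorem pd_comm (i j : Fin n) {f : E n → V} {x : E n} (hf : ContDiffAt ℝ ∞ f x) :
    pd i (fun y => pd j f y) x = pd j (fun y => pd i f y) x := by
  have hs : IsSymmSndFDerivAt ℝ f x :=
    hf.isSymmSndFDerivAt (by
      rw [minSmoothness_of_isRCLikeNormedField]; exact WithTop.coe_le_coe.2 le_top)
  have hd : DifferentiableAt ℝ (fderiv ℝ f) x :=
    (hf.fderiv_right (m := ∞) (by simp)).differentiableAt (by simp)
  have key : ∀ a b : Fin n, pd a (fun y => pd b f y) x =
      fderiv ℝ (fderiv ℝ f) x (EuclideanSpace.single a 1) (EuclideanSpace.single b 1) := by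
    intro a b
    simp only [pd]
    rw [fderiv_clm_apply hd (by fun_prop)]
    simp
  rw [key, key, hs]

theorem pd_comp_mul (k : Fin n) {f : E n → 𝕜} {ψ : E n → E n} {x : E n}
    (hf : ContDiffAt ℝ ∞ f (ψ x)) (hψ : ContDiffAt ℝ ∞ ψ x) :
    pd k (fun y => f (ψ y)) x =
      ∑ i, ((pd k (fun y => ψ y i) x : ℝ) : 𝕜) * pd i f (ψ x) := by
  rw [pd_comp k hf hψ]
  simp [RCLike.real_smul_eq_coe_mul]

end PartialDerivatives

/-! ### Relations between the coefficients -/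

section Coefficients

variable {𝕜 : Type*} [RCLike 𝕜]

/-- The denominators of the coefficients do not vanish. -/
structure CoeffDenoms (N lam mu : 𝕜) : Prop where
  two : 2 + N * (1 - (mu - lam)) ≠ 0
  one : 1 + N * (1 - (mu - lam)) ≠ 0
  trace : 2 - N * (mu - lam) ≠ 0
  half : 2 + N * (1 - 2 * (mu - lam)) ≠ 0
  top : 1 - (mu - lam) ≠ 0
  dim : N ≠ 0
  dim_one : N - 1 ≠ 0
  dim_two : N - 2 ≠ 0

/-- Each excluded value is the zero of one factor: $(n+2)/n$ of $2+n(1-\delta)$, $(n+1)/n$ of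
$1+n(1-\delta)$, $2/n$ of $2-n\delta$, $(n+2)/(2n)$ of $2+n(1-2\delta)$, and $1$ of $1-\delta$. The
bound on $n$ provides the remaining three factors. -/
theorem NonResonant.coeffDenoms {n : ℕ} (hn : 3 ≤ n) {lam mu : 𝕜}
    (h : NonResonant n (mu - lam)) : CoeffDenoms (n : 𝕜) lam mu := by
  obtain ⟨h1, h2, h3, h4, h5⟩ := h
  have hN : (n : 𝕜) ≠ 0 := by exact_mod_cast (by omega : n ≠ 0)
  have hN1 : (n : 𝕜) - 1 ≠ 0 := by
    rw [sub_ne_zero]; exact_mod_cast (by omega : n ≠ 1)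
  have hN2 : (n : 𝕜) - 2 ≠ 0 := by
    rw [sub_ne_zero]; exact_mod_cast (by omega : n ≠ 2)
  refine ⟨fun h => h5 ?_, fun h => h4 ?_, fun h => h1 ?_, fun h => h2 ?_, fun h => h3 ?_, hN,
    hN1, hN2⟩
  · rw [eq_div_iff hN]; linear_combination -h
  · rw [eq_div_iff hN]; linear_combination -h
  · rw [eq_div_iff hN]; linear_combination -h
  · rw [eq_div_iff (mul_ne_zero two_ne_zero hN)]; linear_combination -h
  · linear_combination -h

variable {N lam mu : 𝕜}

/-- The later cancellations use these relations and not the quotients themselves. This one removes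
$P^{ij}u_i\partial_j\varphi$ under the conformal change $\mathrm g=e^{2u}\eta$ and, with $h$ in
place of $du$, the corresponding term of the Lie derivative. -/
theorem beta1_rel (h : CoeffDenoms N lam mu) :
    beta1 N lam mu * (N + 2 - N * (mu - lam)) = 2 * (N * lam + 1) := by
  have h1 := h.two
  rw [beta1, div_mul_eq_mul_div, div_eq_iff h1]
  ring

/-- Removes $\operatorname{tr}P\,\langle du,d\varphi\rangle$, and its analogue with $h$. -/
theorem beta2_rel (h : CoeffDenoms N lam mu) :
    beta2 N lam mu * (2 - N * (mu - lam)) = beta1 N lam mu - 1 := by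
  have h1 := h.two
  have h2 := h.trace
  rw [beta1, beta2]
  field_simp
  ring

/-- Removes $u_i\,\partial_jP^{ij}\varphi$, and its analogue with $h$. -/
theorem beta3_rel (h : CoeffDenoms N lam mu) :
    2 * beta3 N lam mu * (N + 1 - N * (mu - lam)) = N * lam * beta1 N lam mu := by
  have h1 := h.two
  have h2 := h.one
  rw [beta1, beta3]
  field_simp
  ring

/-- Removes $\langle du,d\operatorname{tr}P\rangle\varphi$, and its analogue with $h$. -/
theorem beta4_rel (h : CoeffDenoms N lam mu) :
    beta4 N lam mu * (N + 2 - 2 * N * (mu - lam)) =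
      N * lam * beta2 N lam mu + beta3 N lam mu := by
  have h1 := h.two
  have h2 := h.one
  have h3 := h.trace
  have h4 := h.half
  rw [beta2, beta3, beta4]
  field_simp
  ring

/-- Removes $P^{ij}\,\partial_i\partial_ju\,\varphi$. The curvature terms enter only through the
conformal factor and play no part in the flat formula. -/
theorem beta5_rel (h : CoeffDenoms N lam mu) :
    (N - 2) * beta5 N lam mu =
      beta3 N lam mu * (N + 2 - N * (mu - lam)) - N * lam := by
  have h1 := h.two
  have h2 := h.one
  have h4 := h.dim_two
  rw [beta3, beta5]
  field_simp
  ring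

/-- Needed, together with `beta6_rel'`, for the coefficient of $|du|^2\operatorname{tr}P\,\varphi$.
-/
theorem beta6_rel (h : CoeffDenoms N lam mu) :
    (2 - N * (mu - lam)) * beta5 N lam mu +
      (N - 1) * (N + 2 - 2 * N * (mu - lam)) * beta6 N lam mu = 0 := by
  have h2 := h.one
  have h3 := h.half
  have h4 := h.dim_two
  have h5 := h.dim_one
  rw [beta5, beta6]
  field_simp
  ring

/-- Removes $\Delta u\operatorname{tr}P\,\varphi$. That the single number $\beta_6$ satisfies this
and `beta6_rel` is a consistency property of the system. -/
theorem beta6_rel' (h : CoeffDenoms N lam mu) :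
    2 * (N - 1) * beta6 N lam mu =
      beta4 N lam mu * (2 - N * (mu - lam)) - beta3 N lam mu - beta5 N lam mu := by
  have h1 := h.two
  have h2 := h.one
  have h3 := h.trace
  have h4 := h.half
  have h5 := h.dim_one
  have h6 := h.dim_two
  rw [beta6, beta3, beta4, beta5]
  field_simp
  ring

end Coefficients

/-! ### Conformally flat metrics in adapted coordinates -/

section ConformallyFlatMetric

variable {n : ℕ} {p : ℕ}

theorem eta_mul_self (i : Fin n) : eta p i * eta p i = 1 := by
  unfold eta; split_ifs <;> simp

theorem eta_ne_zero (i : Fin n) : eta p i ≠ 0 := by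
  unfold eta; split_ifs <;> simp

theorem inv_smul_diagonal_eta {c : ℝ} (hc : c ≠ 0) :
    (c • Matrix.diagonal (eta (n := n) p))⁻¹ = c⁻¹ • Matrix.diagonal (eta (n := n) p) := by
  apply Matrix.inv_eq_right_inv
  rw [Matrix.smul_mul, Matrix.mul_smul, smul_smul, mul_inv_cancel₀ hc, one_smul,
    Matrix.diagonal_mul_diagonal]
  simp [eta_mul_self]

/-- In the coordinates of the open set `U`, the metric is `exp (2 u) η`. -/
structure IsConformalTo (p : ℕ) (g : E n → Matrix (Fin n) (Fin n) ℝ) (u : E n → ℝ)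
    (U : Set (E n)) : Prop where
  isOpen : IsOpen U
  smooth : ∀ y ∈ U, ContDiffAt ℝ ∞ u y
  eq : ∀ y ∈ U, g y = Real.exp (2 * u y) • Matrix.diagonal (eta p)

variable {g : E n → Matrix (Fin n) (Fin n) ℝ} {u : E n → ℝ} {U : Set (E n)}

/-- As $\eta$ is constant, only the factor $e^{2u}$ is differentiated, and it cancels against the
factor $e^{-2u}$ of the inverse metric. -/
theorem IsConformalTo.christoffel_eq (h : IsConformalTo p g u U) {x : E n} (hx : x ∈ U)
    (k i j : Fin n) : christoffel g k i j x =
      (if k = i then pd j u x else 0) + (if k = j then pd i u x else 0)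
        - (if i = j then eta p i * eta p k * pd k u x else 0) := by
  have hu := h.smooth x hx
  have hexp : ContDiffAt ℝ ∞ (fun y => Real.exp (2 * u y)) x := by fun_prop
  have hder : ∀ m : Fin n, pd m (fun y => Real.exp (2 * u y)) x =
      2 * Real.exp (2 * u x) * pd m u x := by
    intro m
    have := ((differentiableAt_of_smooth hu).hasFDerivAt.const_mul 2).exp.fderiv
    simp only [pd, this]
    simp
    ring
  have hg : ∀ m a b : Fin n, pd m (fun y => g y a b) x =
      2 * Real.exp (2 * u x) * pd m u x * (if a = b then eta p a else 0) := by
    intro m a b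
    rw [pd_congr h.isOpen (g := fun y => Real.exp (2 * u y) * (if a = b then eta p a else 0))
      (fun y hy => by simp [h.eq y hy, Matrix.diagonal_apply]) hx]
    have := pd_mul_const (𝕜 := ℝ) m (if a = b then eta p a else 0) hexp
    rw [this, hder]
  have hne : Real.exp (2 * u x) ≠ 0 := (Real.exp_pos _).ne'
  have hne' : ∀ a b : Fin n, (g x)⁻¹ a b =
      (Real.exp (2 * u x))⁻¹ * (if a = b then eta p a else 0) := by
    intro a b
    rw [h.eq x hx, inv_smul_diagonal_eta hne]
    simp [Matrix.diagonal_apply]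
  have he := eta_mul_self (n := n) (p := p)
  simp only [christoffel, hg, hne']
  -- The inverse metric is diagonal, so only $l=k$ contributes.
  rw [Finset.sum_eq_single k]
  · generalize Real.exp (2 * u x) = c at *
    have hc : c⁻¹ * c = 1 := inv_mul_cancel₀ hne
    have hk := he k
    by_cases h1 : k = i
    · subst h1
      by_cases h2 : k = j
      · subst h2
        simp only [if_true]
        linear_combination (eta p k * eta p k * pd k u x) * hc + 2 * pd k u x * hk
      · simp only [h2, Ne.symm h2, if_true, if_false]
        linear_combination (eta p k * eta p k * pd j u x) * hc + pd j u x * hk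
    · by_cases h2 : k = j
      · subst h2
        simp only [h1, Ne.symm h1, if_true, if_false]
        linear_combination (eta p k * eta p k * pd i u x) * hc + pd i u x * hk
      · by_cases h3 : i = j
        · subst h3
          simp only [h1, Ne.symm h1, if_true, if_false]
          linear_combination (-(eta p k * eta p i * pd k u x)) * hc
        · simp [h1, h2, h3, Ne.symm h1, Ne.symm h2]
  · intro b _ hb
    simp [Ne.symm hb]
  · simp

theorem IsConformalTo.christoffelTr_eq (h : IsConformalTo p g u U) {x : E n} (hx : x ∈ U)
    (i : Fin n) : christoffelTr g i x = n * pd i u x := by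
  simp only [christoffelTr, h.christoffel_eq hx, Finset.sum_add_distrib, Finset.sum_sub_distrib]
  simp [eta_mul_self]

/-- The conformal change of the Ricci tensor starting from a flat metric: the derivatives of
$\Gamma$ give the second derivatives of $u$, and the products of $\Gamma$ give the terms quadratic
in $du$. -/
theorem IsConformalTo.ricci_eq (h : IsConformalTo p g u U) {x : E n} (hx : x ∈ U)
    (i j : Fin n) : ricci g i j x =
      -((n : ℝ) - 2) * (pd i (fun y => pd j u y) x - pd i u x * pd j u x)
        - if i = j then eta p i * (∑ k, eta p k * pd k (fun y => pd k u y) x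
          + ((n : ℝ) - 2) * ∑ k, eta p k * (pd k u x * pd k u x)) else 0 := by
  have hu := h.smooth x hx
  have hd : ∀ m k i j : Fin n, pd m (christoffel g k i j) x =
      (if k = i then pd m (fun y => pd j u y) x else 0)
        + (if k = j then pd m (fun y => pd i u y) x else 0)
        - (if i = j then eta p i * eta p k * pd m (fun y => pd k u y) x else 0) := by
    intro m k i j
    rw [pd_congr h.isOpen (fun y hy => h.christoffel_eq hy k i j) hx]
    split_ifs <;>
      simp (disch := fun_prop) only [pd_add, pd_sub, pd_const, pd_const_mul]
  have hsym : pd j (fun y => pd i u y) x = pd i (fun y => pd j u y) x := pd_comm j i hu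
  simp only [ricci, hd, h.christoffel_eq hx]
  simp only [mul_add, add_mul, sub_mul, mul_sub, Finset.sum_add_distrib, Finset.sum_sub_distrib,
    ite_mul, mul_ite, zero_mul, mul_zero, Finset.sum_ite_eq, Finset.sum_ite_eq',
    Finset.mem_univ, if_true, Finset.sum_ite_irrel, Finset.sum_const_zero, Finset.sum_const,
    Finset.card_univ, Fintype.card_fin, nsmul_eq_mul, hsym]
  have hi := eta_mul_self (p := p) i
  have hj := eta_mul_self (p := p) j
  have e1 : ∀ c : ℝ, ∑ k, c * eta p k * pd k (fun y => pd k u y) x =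
      c * ∑ k, eta p k * pd k (fun y => pd k u y) x := fun c => by
    simp only [Finset.mul_sum, mul_assoc]
  have e2 : ∀ c : ℝ, ∑ k, pd k u x * (c * eta p k * pd k u x) =
      c * ∑ k, eta p k * (pd k u x * pd k u x) := fun c => by
    rw [Finset.mul_sum]; exact Finset.sum_congr rfl fun k _ => by ring
  have e3 : ∀ c : ℝ, ∑ k, c * eta p k * pd k u x * pd k u x =
      c * ∑ k, eta p k * (pd k u x * pd k u x) := fun c => by
    rw [Finset.mul_sum]; exact Finset.sum_congr rfl fun k _ => by ring
  have e4 : ∑ k, eta p k * eta p k * pd k u x * (eta p i * eta p k * pd k u x) =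
      eta p i * ∑ k, eta p k * (pd k u x * pd k u x) := by
    rw [Finset.mul_sum]
    exact Finset.sum_congr rfl fun k _ => by rw [eta_mul_self]; ring
  simp only [e1, e2, e3, e4]
  generalize ∑ k, eta p k * pd k (fun y => pd k u y) x = S
  generalize ∑ k, eta p k * (pd k u x * pd k u x) = T
  by_cases hij : i = j
  · subst hij
    simp only [if_true]
    linear_combination (pd i (fun y => pd i u y) x - pd i u x * pd i u x
      - pd i u x * pd i u x * (eta p i * eta p i)) * hi
  · simp only [hij, Ne.symm hij, if_false]
    linear_combination (pd i (fun y => pd j u y) x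
      - pd i u x * pd j u x) * hi - pd i u x * pd j u x * (eta p i * eta p i) * hj

end ConformallyFlatMetric

/-! ### Contractions of covariant derivatives -/

section Contractions

variable {n : ℕ} {𝕜 : Type*} [RCLike 𝕜]

theorem contDiffAt_nablaP {g : E n → Matrix (Fin n) (Fin n) ℝ} {w : 𝕜}
    {P : E n → Fin n → Fin n → 𝕜} {x : E n}
    (hG : ∀ k i j, ContDiffAt ℝ ∞ (christoffel g k i j) x)
    (hP : ∀ i j, ContDiffAt ℝ ∞ (fun y => P y i j) x) (k i j : Fin n) :
    ContDiffAt ℝ ∞ (nablaP g w P k i j) x := by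
  unfold nablaP christoffelTr
  fun_prop

/-- Contraction commutes with $\nabla$: the connection terms for the upper index $j$ and for the
derivative index $j$ cancel after renaming the summation indices. What is left is the covariant
derivative of the vector field $\nabla_jP^{ij}$. -/
theorem sum_nablaNablaP_right {g : E n → Matrix (Fin n) (Fin n) ℝ} {w : 𝕜}
    {P : E n → Fin n → Fin n → 𝕜} {x : E n}
    (hG : ∀ k i j, ContDiffAt ℝ ∞ (christoffel g k i j) x)
    (hP : ∀ i j, ContDiffAt ℝ ∞ (fun y => P y i j) x) (l i : Fin n) :
    ∑ j, nablaNablaP g w P l j i j x =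
      pd l (fun y => ∑ j, nablaP g w P j i j y) x
        + ∑ m, ((christoffel g i l m x : ℝ) : 𝕜) * ∑ j, nablaP g w P j m j x
        - w * ((christoffelTr g l x : ℝ) : 𝕜) * ∑ j, nablaP g w P j i j x := by
  have hN := contDiffAt_nablaP (w := w) hG hP
  simp (disch := fun_prop) only [nablaNablaP, pd_sum, Finset.sum_add_distrib,
    Finset.sum_sub_distrib, Finset.mul_sum]
  rw [Finset.sum_comm (f := fun j m => ((christoffel g i l m x : ℝ) : 𝕜) * nablaP g w P j m j x),
    Finset.sum_comm (f := fun j m => ((christoffel g m l j x : ℝ) : 𝕜) * nablaP g w P m i j x)]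
  ring

end Contractions

/-! ### Covariant derivatives of a conformally flat metric in adapted coordinates -/

section Conformal

variable {n p : ℕ} {𝕜 : Type*} [RCLike 𝕜]

/-- The quantization of a quadratic symbol in adapted coordinates. -/
def flatFormula (p : ℕ) (lam mu : 𝕜) (P : E n → Fin n → Fin n → 𝕜) (φ : E n → 𝕜) (x : E n) : 𝕜 :=
  ∑ i, ∑ j, P x i j * pd i (fun y => pd j φ y) x
  + ∑ j, (beta1 (n : 𝕜) lam mu * ∑ i, pd i (fun y => P y i j) x
      + beta2 (n : 𝕜) lam mu * (((eta p j : ℝ) : 𝕜) *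
          pd j (fun y => ∑ k, ((eta p k : ℝ) : 𝕜) * P y k k) x)) * pd j φ x
  + (beta3 (n : 𝕜) lam mu * ∑ i, pd i (fun y => ∑ j, pd j (fun z => P z i j) y) x
      + beta4 (n : 𝕜) lam mu * ∑ i, ((eta p i : ℝ) : 𝕜) *
          pd i (fun y => pd i (fun z => ∑ k, ((eta p k : ℝ) : 𝕜) * P z k k) y) x) * φ x

theorem ofReal_eta_mul_self (i : Fin n) : ((eta p i : ℝ) : 𝕜) * ((eta p i : ℝ) : 𝕜) = 1 := by
  rw [← RCLike.ofReal_mul, eta_mul_self, RCLike.ofReal_one]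

variable {g : E n → Matrix (Fin n) (Fin n) ℝ} {u : E n → ℝ} {U : Set (E n)}

theorem IsConformalTo.sum_christoffel_mul (h : IsConformalTo p g u U) {x : E n} (hx : x ∈ U)
    (i k : Fin n) (v : Fin n → 𝕜) :
    ∑ l, ((christoffel g i k l x : ℝ) : 𝕜) * v l =
      (if i = k then ∑ l, ((pd l u x : ℝ) : 𝕜) * v l else 0) + ((pd k u x : ℝ) : 𝕜) * v i
        - ((eta p k : ℝ) : 𝕜) * ((eta p i : ℝ) : 𝕜) * ((pd i u x : ℝ) : 𝕜) * v k := by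
  simp only [h.christoffel_eq hx, RCLike.ofReal_sub, RCLike.ofReal_add,
    apply_ite (RCLike.ofReal : ℝ → 𝕜),
    RCLike.ofReal_zero, RCLike.ofReal_mul, sub_mul, add_mul, ite_mul, zero_mul,
    Finset.sum_sub_distrib, Finset.sum_add_distrib, Finset.sum_ite_eq, Finset.mem_univ,
    if_true, Finset.sum_ite_irrel, Finset.sum_const_zero]

theorem IsConformalTo.contDiffAt_christoffel (h : IsConformalTo p g u U) {x : E n} (hx : x ∈ U)
    (k i j : Fin n) : ContDiffAt ℝ ∞ (christoffel g k i j) x := by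
  refine contDiffAt_congr h.isOpen (fun y hy => h.christoffel_eq hy k i j) hx ?_
  have hu := h.smooth x hx
  split_ifs <;> fun_prop

theorem IsConformalTo.nablaD_eq (h : IsConformalTo p g u U) {x : E n} (hx : x ∈ U) (w : 𝕜)
    (φ : E n → 𝕜) (i : Fin n) :
    nablaD g w φ i x = pd i φ x - n * w * ((pd i u x : ℝ) : 𝕜) * φ x := by
  rw [nablaD, h.christoffelTr_eq hx]
  push_cast
  ring

theorem IsConformalTo.nablaP_eq (h : IsConformalTo p g u U) {x : E n} (hx : x ∈ U) (w : 𝕜)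
    (P : E n → Fin n → Fin n → 𝕜) (k i j : Fin n) :
    nablaP g w P k i j x = pd k (fun y => P y i j) x
      + (2 - n * w) * ((pd k u x : ℝ) : 𝕜) * P x i j
      + (if i = k then ∑ l, ((pd l u x : ℝ) : 𝕜) * P x l j else 0)
      + (if j = k then ∑ l, ((pd l u x : ℝ) : 𝕜) * P x i l else 0)
      - ((eta p k : ℝ) : 𝕜) * ((eta p i : ℝ) : 𝕜) * ((pd i u x : ℝ) : 𝕜) * P x k j
      - ((eta p k : ℝ) : 𝕜) * ((eta p j : ℝ) : 𝕜) * ((pd j u x : ℝ) : 𝕜) * P x i k := by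
  rw [nablaP, h.christoffelTr_eq hx, h.sum_christoffel_mul hx i k (fun l => P x l j),
    h.sum_christoffel_mul hx j k (fun l => P x i l)]
  push_cast
  ring

/-- Contracting `nablaP_eq` gives $du$ paired with $P$ the multiplicities $2-nw$, $1$, $n$ and $-1$,
whose sum is $n+2-nw$. The symmetry of $P$ identifies the pairings with its two indices. -/
theorem IsConformalTo.div_eq (h : IsConformalTo p g u U) {x : E n} (hx : x ∈ U) (w : 𝕜)
    {P : E n → Fin n → Fin n → 𝕜} (hsym : ∀ i j, P x i j = P x j i) (i : Fin n) :
    ∑ j, nablaP g w P j i j x = ∑ j, pd j (fun y => P y i j) x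
      + (n + 2 - n * w) * ∑ l, ((pd l u x : ℝ) : 𝕜) * P x i l
      - ((eta p i : ℝ) : 𝕜) * ((pd i u x : ℝ) : 𝕜) * ∑ k, ((eta p k : ℝ) : 𝕜) * P x k k := by
  simp only [h.nablaP_eq hx, Finset.sum_add_distrib, Finset.sum_sub_distrib, Finset.sum_ite_eq,
    Finset.mem_univ, if_true, Finset.sum_const, Finset.card_univ, Fintype.card_fin,
    nsmul_eq_mul, ofReal_eta_mul_self, one_mul]
  have e0 : ∑ l, ((pd l u x : ℝ) : 𝕜) * P x l i = ∑ l, ((pd l u x : ℝ) : 𝕜) * P x i l :=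
    Finset.sum_congr rfl fun l _ => by rw [hsym l i]
  have e1 : ∑ j, (2 - n * w) * ((pd j u x : ℝ) : 𝕜) * P x i j =
      (2 - n * w) * ∑ l, ((pd l u x : ℝ) : 𝕜) * P x i l := by
    simp only [Finset.mul_sum, mul_assoc]
  have e2 : ∑ j, ((eta p j : ℝ) : 𝕜) * ((eta p i : ℝ) : 𝕜) * ((pd i u x : ℝ) : 𝕜) * P x j j =
      ((eta p i : ℝ) : 𝕜) * ((pd i u x : ℝ) : 𝕜) * ∑ k, ((eta p k : ℝ) : 𝕜) * P x k k := by
    rw [Finset.mul_sum]; exact Finset.sum_congr rfl fun k _ => by ring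
  rw [e0, e1, e2]
  ring

/-- The trace with $\eta=e^{-2u}\mathrm g$ is $e^{-2u}$ times the metric trace, which commutes with
$\nabla$. Differentiating $e^{2u}$ gives the $2$ and the weight gives the $-nw$. -/
theorem IsConformalTo.sum_eta_nablaP (h : IsConformalTo p g u U) {x : E n} (hx : x ∈ U) (w : 𝕜)
    {P : E n → Fin n → Fin n → 𝕜} (hP : ∀ i j, ContDiffAt ℝ ∞ (fun y => P y i j) x)
    (hsym : ∀ i j, P x i j = P x j i) (l : Fin n) :
    ∑ k, ((eta p k : ℝ) : 𝕜) * nablaP g w P l k k x =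
      pd l (fun y => ∑ k, ((eta p k : ℝ) : 𝕜) * P y k k) x
      + (2 - n * w) * ((pd l u x : ℝ) : 𝕜) * ∑ k, ((eta p k : ℝ) : 𝕜) * P x k k := by
  simp (disch := fun_prop) only [h.nablaP_eq hx, pd_sum, pd_const_mul]
  simp only [mul_add, mul_sub, mul_ite, mul_zero, Finset.sum_add_distrib, Finset.sum_sub_distrib,
    Finset.sum_ite_eq', Finset.mem_univ, if_true]
  have e0 : ∀ k, ((eta p k : ℝ) : 𝕜) * (((eta p l : ℝ) : 𝕜) * ((eta p k : ℝ) : 𝕜) *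
      ((pd k u x : ℝ) : 𝕜) * P x l k) = ((eta p l : ℝ) : 𝕜) * (((pd k u x : ℝ) : 𝕜) * P x l k) :=
    fun k => by
      linear_combination (((eta p l : ℝ) : 𝕜) * ((pd k u x : ℝ) : 𝕜) * P x l k) *
        ofReal_eta_mul_self (𝕜 := 𝕜) (p := p) k
  simp only [hsym _ l, e0, ← Finset.mul_sum]
  have e1 : ∑ j, ((eta p j : ℝ) : 𝕜) * ((2 - n * w) * ((pd l u x : ℝ) : 𝕜) * P x j j) =
      (2 - n * w) * ((pd l u x : ℝ) : 𝕜) * ∑ k, ((eta p k : ℝ) : 𝕜) * P x k k := by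
    rw [Finset.mul_sum]; exact Finset.sum_congr rfl fun k _ => by ring
  rw [e1]
  ring

/-- As for the first derivative: $\eta$ differs from the parallel $\mathrm g$ by $e^{-2u}$, so the
trace passes through the outer $\nabla$ at the cost of $(2-nw)\,\partial_iu$. The Christoffel term
of the inner derivative index stays. -/
theorem IsConformalTo.sum_eta_nablaNablaP (h : IsConformalTo p g u U) {x : E n} (hx : x ∈ U)
    (w : 𝕜) {P : E n → Fin n → Fin n → 𝕜} (hP : ∀ i j, ContDiffAt ℝ ∞ (fun y => P y i j) x)
    (i j : Fin n) :
    ∑ k, ((eta p k : ℝ) : 𝕜) * nablaNablaP g w P i j k k x =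
      pd i (fun y => ∑ k, ((eta p k : ℝ) : 𝕜) * nablaP g w P j k k y) x
      - ∑ m, ((christoffel g m i j x : ℝ) : 𝕜) *
          ∑ k, ((eta p k : ℝ) : 𝕜) * nablaP g w P m k k x
      + (2 - n * w) * ((pd i u x : ℝ) : 𝕜) *
          ∑ k, ((eta p k : ℝ) : 𝕜) * nablaP g w P j k k x := by
  have hN := contDiffAt_nablaP (w := w) (h.contDiffAt_christoffel hx) hP
  set X : Fin n → Fin n → Fin n → 𝕜 := fun m k l => nablaP g w P m k l x with hX
  have e1 : ∀ k, ∑ m, ((christoffel g k i m x : ℝ) : 𝕜) * nablaP g w P j m k x =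
      (if k = i then ∑ l, ((pd l u x : ℝ) : 𝕜) * X j l k else 0)
        + ((pd i u x : ℝ) : 𝕜) * X j k k
        - ((eta p i : ℝ) : 𝕜) * ((eta p k : ℝ) : 𝕜) * ((pd k u x : ℝ) : 𝕜) * X j i k :=
    fun k => h.sum_christoffel_mul hx k i (fun m => X j m k)
  have e2 : ∀ k, ∑ m, ((christoffel g k i m x : ℝ) : 𝕜) * nablaP g w P j k m x =
      (if k = i then ∑ l, ((pd l u x : ℝ) : 𝕜) * X j k l else 0)
        + ((pd i u x : ℝ) : 𝕜) * X j k k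
        - ((eta p i : ℝ) : 𝕜) * ((eta p k : ℝ) : 𝕜) * ((pd k u x : ℝ) : 𝕜) * X j k i :=
    fun k => h.sum_christoffel_mul hx k i (fun m => X j k m)
  have e3 : ∀ k (a : 𝕜), ((eta p k : ℝ) : 𝕜) * (((eta p i : ℝ) : 𝕜) * ((eta p k : ℝ) : 𝕜) *
      ((pd k u x : ℝ) : 𝕜) * a) = ((eta p i : ℝ) : 𝕜) * (((pd k u x : ℝ) : 𝕜) * a) :=
    fun k a => by
      linear_combination (((eta p i : ℝ) : 𝕜) * ((pd k u x : ℝ) : 𝕜) * a) *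
        ofReal_eta_mul_self (𝕜 := 𝕜) (p := p) k
  have e4 : ∑ k, ((eta p k : ℝ) : 𝕜) * (((pd i u x : ℝ) : 𝕜) * X j k k) =
      ((pd i u x : ℝ) : 𝕜) * ∑ k, ((eta p k : ℝ) : 𝕜) * X j k k := by
    rw [Finset.mul_sum]; exact Finset.sum_congr rfl fun k _ => by ring
  have e5 : ∑ k, ((eta p k : ℝ) : 𝕜) * ∑ m, ((christoffel g m i j x : ℝ) : 𝕜) * X m k k =
      ∑ m, ((christoffel g m i j x : ℝ) : 𝕜) * ∑ k, ((eta p k : ℝ) : 𝕜) * X m k k := by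
    simp only [Finset.mul_sum]
    rw [Finset.sum_comm]
    exact Finset.sum_congr rfl fun k _ => Finset.sum_congr rfl fun m _ => by ring
  have e6 : ∑ k, ((eta p k : ℝ) : 𝕜) * (w * ((christoffelTr g i x : ℝ) : 𝕜) * X j k k) =
      w * ((christoffelTr g i x : ℝ) : 𝕜) * ∑ k, ((eta p k : ℝ) : 𝕜) * X j k k := by
    rw [Finset.mul_sum]; exact Finset.sum_congr rfl fun k _ => by ring
  simp (disch := fun_prop) only [nablaNablaP, pd_sum, pd_const_mul, mul_add, mul_sub,
    Finset.sum_add_distrib, Finset.sum_sub_distrib, e1, e2, e3, mul_ite, mul_zero,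
    Finset.sum_ite_eq', Finset.mem_univ, if_true, ← Finset.mul_sum]
  rw [e4, e5, e6, h.christoffelTr_eq hx]
  push_cast
  ring

end Conformal

/-! ### Second covariant derivatives in terms of the conformal factor -/

section ConformalInvariance

variable {n p : ℕ} {𝕜 : Type*} [RCLike 𝕜]

variable {g : E n → Matrix (Fin n) (Fin n) ℝ} {u : E n → ℝ} {U : Set (E n)}

/-- Contraction over the upper index, as it occurs in derivatives of covectors;
`sum_christoffel_mul` treats a lower index, as it occurs for vectors. -/
theorem IsConformalTo.sum_christoffel_mul_up (h : IsConformalTo p g u U) {x : E n} (hx : x ∈ U)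
    (i j : Fin n) (v : Fin n → 𝕜) :
    ∑ k, ((christoffel g k i j x : ℝ) : 𝕜) * v k =
      ((pd j u x : ℝ) : 𝕜) * v i + ((pd i u x : ℝ) : 𝕜) * v j
        - (if i = j then ((eta p i : ℝ) : 𝕜) *
          ∑ k, ((eta p k : ℝ) : 𝕜) * (((pd k u x : ℝ) : 𝕜) * v k) else 0) := by
  simp only [h.christoffel_eq hx, RCLike.ofReal_sub, RCLike.ofReal_add,
    apply_ite (RCLike.ofReal : ℝ → 𝕜),
    RCLike.ofReal_zero, RCLike.ofReal_mul, sub_mul, add_mul, ite_mul, zero_mul,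
    Finset.sum_sub_distrib, Finset.sum_add_distrib, Finset.sum_ite_eq', Finset.mem_univ,
    if_true, Finset.sum_ite_irrel, Finset.sum_const_zero, Finset.mul_sum, mul_assoc]

theorem IsConformalTo.sum_mul_nablaNablaD (h : IsConformalTo p g u U) {x : E n} (hx : x ∈ U)
    (w : 𝕜) {P : Fin n → Fin n → 𝕜} (hsym : ∀ i j, P i j = P j i)
    {φ : E n → 𝕜} (hφ : ContDiffAt ℝ ∞ φ x) :
    ∑ i, ∑ j, P i j * nablaNablaD g w φ i j x =
      ∑ i, ∑ j, P i j * pd i (fun y => pd j φ y) x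
      - n * w * (∑ i, ∑ j, P i j * ((pd i (fun y => pd j u y) x : ℝ) : 𝕜)) * φ x
      - (2 + 2 * n * w) * ∑ i, ∑ j, P i j * (((pd i u x : ℝ) : 𝕜) * pd j φ x)
      + (2 + n * w) * (n * w) *
        (∑ i, ∑ j, P i j * (((pd i u x : ℝ) : 𝕜) * ((pd j u x : ℝ) : 𝕜))) * φ x
      + (∑ k, ((eta p k : ℝ) : 𝕜) * P k k) *
        (∑ k, ((eta p k : ℝ) : 𝕜) * (((pd k u x : ℝ) : 𝕜) * pd k φ x)
        - n * w * (∑ k, ((eta p k : ℝ) : 𝕜) * (((pd k u x : ℝ) : 𝕜) * ((pd k u x : ℝ) : 𝕜)))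
          * φ x) := by
  have hu := h.smooth x hx
  have e1 : ∀ i j, pd i (nablaD g w φ j) x = pd i (fun y => pd j φ y) x
      - n * w * (((pd i (fun y => pd j u y) x : ℝ) : 𝕜) * φ x
        + ((pd j u x : ℝ) : 𝕜) * pd i φ x) := by
    intro i j
    rw [pd_congr h.isOpen (fun y hy => h.nablaD_eq hy w φ j) hx]
    simp (disch := fun_prop) only [pd_sub, pd_mul, pd_const, pd_ofReal]
    ring
  have e2 : ∑ k, ((eta p k : ℝ) : 𝕜) * (((pd k u x : ℝ) : 𝕜) * nablaD g w φ k x) =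
      ∑ k, ((eta p k : ℝ) : 𝕜) * (((pd k u x : ℝ) : 𝕜) * pd k φ x)
        - n * w * (∑ k, ((eta p k : ℝ) : 𝕜) * (((pd k u x : ℝ) : 𝕜) * ((pd k u x : ℝ) : 𝕜)))
          * φ x := by
    simp only [h.nablaD_eq hx, Finset.mul_sum, Finset.sum_mul, ← Finset.sum_sub_distrib]
    exact Finset.sum_congr rfl fun k _ => by ring
  have e3 : ∑ i, ∑ j, P i j * (((pd j u x : ℝ) : 𝕜) * pd i φ x) =
      ∑ i, ∑ j, P i j * (((pd i u x : ℝ) : 𝕜) * pd j φ x) := by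
    rw [Finset.sum_comm]
    exact Finset.sum_congr rfl fun j _ => Finset.sum_congr rfl fun i _ => by rw [hsym i j]
  have e4 : ∀ c : 𝕜, ∑ i, ∑ j, P i j * (if i = j then ((eta p i : ℝ) : 𝕜) * c else 0) =
      (∑ k, ((eta p k : ℝ) : 𝕜) * P k k) * c := by
    intro c
    simp only [mul_ite, mul_zero, Finset.sum_ite_eq, Finset.mem_univ, if_true, Finset.sum_mul]
    exact Finset.sum_congr rfl fun k _ => by ring
  rw [← e2, ← e4]
  -- The mixed term is split into two equal halves, with the roles of $i$ and $j$ exchanged, so that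
  -- the claimed identity holds summand by summand.
  have e5 : (2 + 2 * n * w) * ∑ i, ∑ j, P i j * (((pd i u x : ℝ) : 𝕜) * pd j φ x) =
      (1 + n * w) * ∑ i, ∑ j, P i j * (((pd i u x : ℝ) : 𝕜) * pd j φ x) +
      (1 + n * w) * ∑ i, ∑ j, P i j * (((pd j u x : ℝ) : 𝕜) * pd i φ x) := by
    rw [e3]; ring
  rw [e5]
  simp only [Finset.mul_sum, Finset.sum_mul, ← Finset.sum_sub_distrib, ← Finset.sum_add_distrib]
  refine Finset.sum_congr rfl fun i _ => Finset.sum_congr rfl fun j _ => ?_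
  simp only [nablaNablaD, e1, h.sum_christoffel_mul_up hx, h.christoffelTr_eq hx]
  simp only [h.nablaD_eq hx, Finset.mul_sum]
  push_cast
  ring

variable {w : 𝕜} {P : E n → Fin n → Fin n → 𝕜}

/-- This is the divergence of the vector field computed in `div_eq`. On vector fields the connection
adds $(n-nw)\,du$ to the coordinate divergence, since $\Gamma^i_{im}=n\,\partial_mu$ and the weight
contributes $-nw$. -/
theorem IsConformalTo.div_div_eq (h : IsConformalTo p g u U) {x : E n} (hx : x ∈ U)
    (hP : ∀ y ∈ U, ∀ i j, ContDiffAt ℝ ∞ (fun z => P z i j) y)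
    (hsym : ∀ y ∈ U, ∀ i j, P y i j = P y j i) :
    ∑ i, ∑ j, nablaNablaP g w P i j i j x =
      ∑ i, pd i (fun y => ∑ j, pd j (fun z => P z i j) y) x
      + (n + 2 - n * w) * (∑ i, ∑ j, P x i j * ((pd i (fun y => pd j u y) x : ℝ) : 𝕜))
      + (2 * n + 2 - 2 * n * w) *
        ∑ l, ((pd l u x : ℝ) : 𝕜) * ∑ j, pd j (fun z => P z l j) x
      + (n - n * w) * (n + 2 - n * w) *
        (∑ i, ∑ j, P x i j * (((pd i u x : ℝ) : 𝕜) * ((pd j u x : ℝ) : 𝕜)))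
      - (∑ k, ((eta p k : ℝ) : 𝕜) * ((pd k (fun y => pd k u y) x : ℝ) : 𝕜)) *
        (∑ k, ((eta p k : ℝ) : 𝕜) * P x k k)
      - ∑ k, ((eta p k : ℝ) : 𝕜) * (((pd k u x : ℝ) : 𝕜) *
        pd k (fun y => ∑ k, ((eta p k : ℝ) : 𝕜) * P y k k) x)
      - (n - n * w) *
        (∑ k, ((eta p k : ℝ) : 𝕜) * (((pd k u x : ℝ) : 𝕜) * ((pd k u x : ℝ) : 𝕜))) *
        (∑ k, ((eta p k : ℝ) : 𝕜) * P x k k) := by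
  have hu := h.smooth x hx
  have hPx := hP x hx
  have e1 : ∀ i, pd i (fun y => ∑ j, nablaP g w P j i j y) x =
      pd i (fun y => ∑ j, pd j (fun z => P z i j) y) x
      + (n + 2 - n * w) * (∑ j, P x i j * ((pd i (fun y => pd j u y) x : ℝ) : 𝕜)
        + ∑ l, ((pd l u x : ℝ) : 𝕜) * pd i (fun y => P y i l) x)
      - ((eta p i : ℝ) : 𝕜) * (((pd i (fun y => pd i u y) x : ℝ) : 𝕜) *
          (∑ k, ((eta p k : ℝ) : 𝕜) * P x k k)
        + ((pd i u x : ℝ) : 𝕜) * pd i (fun y => ∑ k, ((eta p k : ℝ) : 𝕜) * P y k k) x) := by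
    intro i
    rw [pd_congr h.isOpen (fun y hy => h.div_eq hy w (hsym y hy) i) hx]
    rw [pd_sub i (by fun_prop) (by fun_prop), pd_add i (by fun_prop) (by fun_prop),
      pd_const_mul i _ (by fun_prop),
      pd_sum i (f := fun l y => ((pd l u y : ℝ) : 𝕜) * P y i l) (fun j => by fun_prop),
      pd_mul (𝕜 := 𝕜) i (f := fun y => ((eta p i : ℝ) : 𝕜) * ((pd i u y : ℝ) : 𝕜)) (by fun_prop) (by fun_prop),
      pd_const_mul i _ (by fun_prop), pd_ofReal i (by fun_prop)]
    simp (disch := fun_prop) only [pd_mul, pd_ofReal, Finset.sum_add_distrib]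
    rw [Finset.sum_congr rfl fun j _ => mul_comm ((pd i (fun y => pd j u y) x : ℝ) : 𝕜) (P x i j)]
    ring
  -- The trace here is over the first lower slot, whereas `christoffelTr` uses the second; the two
  -- agree because $\Gamma$ is symmetric.
  have e2 : ∑ i, ∑ m, ((christoffel g i i m x : ℝ) : 𝕜) * ∑ j, nablaP g w P j m j x =
      ∑ m, n * (((pd m u x : ℝ) : 𝕜) * ∑ j, nablaP g w P j m j x) := by
    rw [Finset.sum_comm]
    refine Finset.sum_congr rfl fun m _ => ?_
    have : ((christoffelTr g m x : ℝ) : 𝕜) = ∑ i, ((christoffel g i i m x : ℝ) : 𝕜) := by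
      rw [christoffelTr, RCLike.ofReal_sum]
      refine Finset.sum_congr rfl fun i _ => ?_
      rw [h.christoffel_eq hx, h.christoffel_eq hx]
      by_cases him : i = m
      · subst him; rfl
      · simp [him, Ne.symm him]
    rw [← Finset.sum_mul, ← this, h.christoffelTr_eq hx]
    push_cast
    ring
  have e3 : ∑ i, ∑ l, ((pd l u x : ℝ) : 𝕜) * pd i (fun y => P y i l) x =
      ∑ l, ((pd l u x : ℝ) : 𝕜) * ∑ j, pd j (fun z => P z l j) x := by
    rw [Finset.sum_comm]
    refine Finset.sum_congr rfl fun l _ => ?_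
    rw [Finset.mul_sum]
    refine Finset.sum_congr rfl fun i _ => ?_
    rw [pd_congr h.isOpen (fun y hy => hsym y hy i l) hx]
  have e4 : ∑ m, ((pd m u x : ℝ) : 𝕜) * ∑ j, nablaP g w P j m j x =
      ∑ l, ((pd l u x : ℝ) : 𝕜) * ∑ j, pd j (fun z => P z l j) x
      + (n + 2 - n * w) * (∑ i, ∑ j, P x i j * (((pd i u x : ℝ) : 𝕜) * ((pd j u x : ℝ) : 𝕜)))
      - (∑ k, ((eta p k : ℝ) : 𝕜) * (((pd k u x : ℝ) : 𝕜) * ((pd k u x : ℝ) : 𝕜))) *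
        (∑ k, ((eta p k : ℝ) : 𝕜) * P x k k) := by
    simp only [h.div_eq hx w (hsym x hx)]
    rw [Finset.mul_sum, Finset.sum_mul]
    simp only [← Finset.sum_sub_distrib, ← Finset.sum_add_distrib]
    refine Finset.sum_congr rfl fun i _ => ?_
    rw [Finset.sum_congr rfl fun j _ => show P x i j * (((pd i u x : ℝ) : 𝕜) *
      ((pd j u x : ℝ) : 𝕜)) = ((pd i u x : ℝ) : 𝕜) * (((pd j u x : ℝ) : 𝕜) * P x i j) by ring,
      ← Finset.mul_sum]
    ring
  have e5 : ∑ i, w * ((christoffelTr g i x : ℝ) : 𝕜) * ∑ j, nablaP g w P j i j x =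
      n * w * ∑ m, ((pd m u x : ℝ) : 𝕜) * ∑ j, nablaP g w P j m j x := by
    rw [Finset.mul_sum]
    refine Finset.sum_congr rfl fun i _ => ?_
    rw [h.christoffelTr_eq hx]
    push_cast
    ring
  simp only [sum_nablaNablaP_right (h.contDiffAt_christoffel hx) hPx, Finset.sum_sub_distrib,
    Finset.sum_add_distrib]
  rw [e2, e5, ← Finset.mul_sum, e4]
  simp only [e1, Finset.sum_add_distrib, Finset.sum_sub_distrib, ← Finset.mul_sum, e3, mul_add]
  simp only [← mul_assoc, ← Finset.sum_mul]
  ring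

theorem IsConformalTo.trace_eq (h : IsConformalTo p g u U) {x : E n} (hx : x ∈ U)
    (hP : ∀ y ∈ U, ∀ i j, ContDiffAt ℝ ∞ (fun z => P z i j) y)
    (hsym : ∀ y ∈ U, ∀ i j, P y i j = P y j i) :
    ∑ i, ((eta p i : ℝ) : 𝕜) * ∑ k, ((eta p k : ℝ) : 𝕜) * nablaNablaP g w P i i k k x =
      ∑ i, ((eta p i : ℝ) : 𝕜) *
          pd i (fun y => pd i (fun z => ∑ k, ((eta p k : ℝ) : 𝕜) * P z k k) y) x
      + (2 - n * w) *
        (∑ k, ((eta p k : ℝ) : 𝕜) * ((pd k (fun y => pd k u y) x : ℝ) : 𝕜)) *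
        (∑ k, ((eta p k : ℝ) : 𝕜) * P x k k)
      + (n + 2 - 2 * n * w) * ∑ k, ((eta p k : ℝ) : 𝕜) * (((pd k u x : ℝ) : 𝕜) *
        pd k (fun y => ∑ k, ((eta p k : ℝ) : 𝕜) * P y k k) x)
      + (n - n * w) * (2 - n * w) *
        (∑ k, ((eta p k : ℝ) : 𝕜) * (((pd k u x : ℝ) : 𝕜) * ((pd k u x : ℝ) : 𝕜))) *
        (∑ k, ((eta p k : ℝ) : 𝕜) * P x k k) := by
  have hu := h.smooth x hx
  have hPx := hP x hx
  have ht : ContDiffAt ℝ ∞ (fun y => ∑ k, ((eta p k : ℝ) : 𝕜) * P y k k) x := by fun_prop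
  have hW := fun {y} hy => h.sum_eta_nablaP (x := y) hy w (hP y hy) (hsym y hy)
  have e1 : ∀ i, pd i (fun y => ∑ k, ((eta p k : ℝ) : 𝕜) * nablaP g w P i k k y) x =
      pd i (fun y => pd i (fun z => ∑ k, ((eta p k : ℝ) : 𝕜) * P z k k) y) x
      + (2 - n * w) * (((pd i (fun y => pd i u y) x : ℝ) : 𝕜) *
          (∑ k, ((eta p k : ℝ) : 𝕜) * P x k k)
        + ((pd i u x : ℝ) : 𝕜) * pd i (fun y => ∑ k, ((eta p k : ℝ) : 𝕜) * P y k k) x) := by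
    -- Stated for an arbitrary function $t$, so that the trace of $P$ is differentiated as a whole
    -- and not expanded.
    have key : ∀ t : E n → 𝕜, ContDiffAt ℝ ∞ t x → ∀ i,
        pd i (fun y => pd i t y + (2 - n * w) * ((pd i u y : ℝ) : 𝕜) * t y) x =
          pd i (fun y => pd i t y) x + (2 - n * w) * (((pd i (fun y => pd i u y) x : ℝ) : 𝕜) *
            t x + ((pd i u x : ℝ) : 𝕜) * pd i t x) := by
      intro t ht i
      simp (disch := fun_prop) only [pd_add, pd_mul, pd_const, pd_ofReal]
      ring
    intro i
    rw [pd_congr h.isOpen (fun y hy => hW hy i) hx]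
    exact key _ ht i
  simp only [h.sum_eta_nablaNablaP hx w hPx, e1, h.sum_christoffel_mul_up hx, if_true, hW hx]
  generalize (fun y => ∑ k, ((eta p k : ℝ) : 𝕜) * P y k k) = t
  generalize ∑ k, ((eta p k : ℝ) : 𝕜) * P x k k = t₀
  set S := ∑ k, ((eta p k : ℝ) : 𝕜) * (((pd k u x : ℝ) : 𝕜) *
    (pd k t x + (2 - n * w) * ((pd k u x : ℝ) : 𝕜) * t₀)) with hS
  -- Tracing the two lower indices of $\Gamma$ gives $-2b+nS$. The $-2b$ cancels against the $2$ in
  -- $2-nw$, and $\eta_i^2=1$ turns the sum of the $S$ terms into $nS$.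
  have e2 : ∀ a b : Fin n → 𝕜, ∑ i, ((eta p i : ℝ) : 𝕜) * (a i - (b i + b i -
      ((eta p i : ℝ) : 𝕜) * S) + (2 - n * w) * b i) =
      ∑ i, ((eta p i : ℝ) : 𝕜) * a i - n * w * ∑ i, ((eta p i : ℝ) : 𝕜) * b i + n * S := by
    intro a b
    have : (n : 𝕜) * S = ∑ i : Fin n, ((eta p i : ℝ) : 𝕜) * (((eta p i : ℝ) : 𝕜) * S) := by
      simp [← mul_assoc, ofReal_eta_mul_self]
    rw [this]
    simp only [Finset.mul_sum, ← Finset.sum_sub_distrib, ← Finset.sum_add_distrib]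
    exact Finset.sum_congr rfl fun i _ => by ring
  have e3 : S = ∑ k, ((eta p k : ℝ) : 𝕜) * (((pd k u x : ℝ) : 𝕜) * pd k t x) +
      (2 - n * w) * (∑ k, ((eta p k : ℝ) : 𝕜) *
        (((pd k u x : ℝ) : 𝕜) * ((pd k u x : ℝ) : 𝕜))) * t₀ := by
    rw [hS]
    simp only [Finset.mul_sum, Finset.sum_mul, ← Finset.sum_add_distrib]
    exact Finset.sum_congr rfl fun i _ => by ring
  simp only [mul_assoc (2 - (n : 𝕜) * w)] at hS ⊢
  rw [e2, ← hS, e3]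
  have e4 : ∑ i, ((eta p i : ℝ) : 𝕜) * (pd i (fun y => pd i t y) x +
      (2 - n * w) * (((pd i (fun y => pd i u y) x : ℝ) : 𝕜) * t₀
        + ((pd i u x : ℝ) : 𝕜) * pd i t x)) =
      ∑ i, ((eta p i : ℝ) : 𝕜) * pd i (fun y => pd i t y) x
      + (2 - n * w) * (∑ k, ((eta p k : ℝ) : 𝕜) * ((pd k (fun y => pd k u y) x : ℝ) : 𝕜)) * t₀
      + (2 - n * w) * ∑ k, ((eta p k : ℝ) : 𝕜) * (((pd k u x : ℝ) : 𝕜) * pd k t x) := by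
    simp only [Finset.mul_sum, Finset.sum_mul, ← Finset.sum_add_distrib]
    exact Finset.sum_congr rfl fun i _ => by ring
  rw [e4]
  ring

end ConformalInvariance

/-! ### Cancellation of the conformal factor in the quantization formula -/

section ConformalInvariance

variable {n p : ℕ} {𝕜 : Type*} [RCLike 𝕜]

variable {g : E n → Matrix (Fin n) (Fin n) ℝ} {u : E n → ℝ} {U : Set (E n)}

/-- The algebra of the first-order part, with all analytic quantities replaced by arbitrary vectors.
After expansion the identity holds for each index $j$ separately. -/
theorem sum_first_order_combination (a b η D T W v ψ : Fin n → 𝕜) (β₁ β₂ c d e t f : 𝕜)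
    (ha : ∀ j, a j = D j + c * W j - η j * v j * t)
    (hb : ∀ j, b j = T j + d * v j * t) :
    ∑ j, (β₁ * a j + β₂ * (η j * b j)) * (ψ j - e * v j * f) =
      ∑ j, (β₁ * D j + β₂ * (η j * T j)) * ψ j + β₁ * c * ∑ j, W j * ψ j
      - β₁ * e * (∑ j, v j * D j) * f - β₁ * e * c * (∑ j, W j * v j) * f
      - β₂ * e * (∑ j, η j * (v j * T j)) * f
      + (β₂ * d - β₁) * t * (∑ j, η j * (v j * ψ j) - e * (∑ j, η j * (v j * v j)) * f) := by
  simp only [ha, hb, Finset.mul_sum, Finset.sum_mul, ← Finset.sum_sub_distrib,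
    ← Finset.sum_add_distrib]
  exact Finset.sum_congr rfl fun j _ => by ring

/-- The factors $e^{-2u}$ and $e^{2u}$ of $\mathrm g^{ij}$ and $\mathrm g_{kl}$ cancel, so both may
be replaced by $\eta$. -/
theorem IsConformalTo.sum_inv_mul (h : IsConformalTo p g u U) {x : E n} (hx : x ∈ U) (j : Fin n)
    (v : Fin n → Fin n → Fin n → 𝕜) :
    ∑ i, ∑ k, ∑ l, (((g x)⁻¹ i j * g x k l : ℝ) : 𝕜) * v i k l =
      ((eta p j : ℝ) : 𝕜) * ∑ k, ((eta p k : ℝ) : 𝕜) * v j k k := by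
  have hne : Real.exp (2 * u x) ≠ 0 := (Real.exp_pos _).ne'
  have e1 : ∀ i k l, (g x)⁻¹ i j * g x k l =
      if i = j then (if k = l then eta p j * eta p k else 0) else 0 := by
    intro i k l
    rw [h.eq x hx, inv_smul_diagonal_eta hne]
    by_cases h1 : i = j
    · subst h1
      by_cases h2 : k = l
      · subst h2
        simp only [Matrix.smul_apply, Matrix.diagonal_apply_eq, smul_eq_mul, if_true]
        field_simp
      · simp [h2]
    · simp [h1]
  simp only [e1, apply_ite (RCLike.ofReal : ℝ → 𝕜), RCLike.ofReal_zero, RCLike.ofReal_mul,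
    ite_mul, zero_mul, Finset.sum_ite_eq, Finset.sum_ite_eq', Finset.mem_univ, if_true,
    Finset.sum_ite_irrel, Finset.sum_const_zero, Finset.mul_sum, mul_assoc]

theorem IsConformalTo.sum_ricci_mul (h : IsConformalTo p g u U) {x : E n} (hx : x ∈ U)
    (v : Fin n → Fin n → 𝕜) :
    ∑ i, ∑ j, ((ricci g i j x : ℝ) : 𝕜) * v i j =
      -((n : 𝕜) - 2) * (∑ i, ∑ j, v i j * ((pd i (fun y => pd j u y) x : ℝ) : 𝕜)
        - ∑ i, ∑ j, v i j * (((pd i u x : ℝ) : 𝕜) * ((pd j u x : ℝ) : 𝕜)))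
      - (∑ k, ((eta p k : ℝ) : 𝕜) * ((pd k (fun y => pd k u y) x : ℝ) : 𝕜)
        + ((n : 𝕜) - 2) *
          ∑ k, ((eta p k : ℝ) : 𝕜) * (((pd k u x : ℝ) : 𝕜) * ((pd k u x : ℝ) : 𝕜)))
        * ∑ k, ((eta p k : ℝ) : 𝕜) * v k k := by
  have e1 : ∀ c : 𝕜, c * ∑ k, ((eta p k : ℝ) : 𝕜) * v k k =
      ∑ i, ∑ j, (if i = j then ((eta p i : ℝ) : 𝕜) * c else 0) * v i j := by
    intro c
    simp only [ite_mul, zero_mul, Finset.sum_ite_eq, Finset.mem_univ, if_true, Finset.mul_sum]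
    exact Finset.sum_congr rfl fun k _ => by ring
  have hc : ((∑ k, eta p k * pd k (fun y => pd k u y) x
      + ((n : ℝ) - 2) * ∑ k, eta p k * (pd k u x * pd k u x) : ℝ) : 𝕜) =
      ∑ k, ((eta p k : ℝ) : 𝕜) * ((pd k (fun y => pd k u y) x : ℝ) : 𝕜)
        + ((n : 𝕜) - 2) *
          ∑ k, ((eta p k : ℝ) : 𝕜) * (((pd k u x : ℝ) : 𝕜) * ((pd k u x : ℝ) : 𝕜)) := by
    push_cast
    rfl
  rw [← hc]
  have hR := fun i j => h.ricci_eq hx i j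
  generalize ∑ k, eta p k * pd k (fun y => pd k u y) x
    + ((n : ℝ) - 2) * ∑ k, eta p k * (pd k u x * pd k u x) = c at hR ⊢
  rw [e1]
  simp only [Finset.mul_sum, ← Finset.sum_sub_distrib]
  refine Finset.sum_congr rfl fun i _ => Finset.sum_congr rfl fun j _ => ?_
  rw [hR, RCLike.ofReal_sub, apply_ite (RCLike.ofReal : ℝ → 𝕜),
    RCLike.ofReal_mul (eta p i), RCLike.ofReal_zero]
  push_cast
  ring

/-- Scalar curvature and metric trace are treated as a product because each alone carries an
exponential of $u$ and these cancel. -/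
theorem IsConformalTo.scalarCurv_mul (h : IsConformalTo p g u U) {x : E n} (hx : x ∈ U)
    (v : Fin n → Fin n → 𝕜) :
    ((scalarCurv g x : ℝ) : 𝕜) * ∑ i, ∑ j, ((g x i j : ℝ) : 𝕜) * v i j =
      -((2 * ((n : 𝕜) - 1)) *
          (∑ k, ((eta p k : ℝ) : 𝕜) * ((pd k (fun y => pd k u y) x : ℝ) : 𝕜))
        + ((n : 𝕜) - 1) * ((n : 𝕜) - 2) *
          ∑ k, ((eta p k : ℝ) : 𝕜) * (((pd k u x : ℝ) : 𝕜) * ((pd k u x : ℝ) : 𝕜)))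
        * ∑ k, ((eta p k : ℝ) : 𝕜) * v k k := by
  have hne : ((Real.exp (2 * u x) : ℝ) : 𝕜) ≠ 0 := by
    exact_mod_cast (Real.exp_pos _).ne'
  have e1 : ∑ i, ∑ j, ((g x i j : ℝ) : 𝕜) * v i j =
      ((Real.exp (2 * u x) : ℝ) : 𝕜) * ∑ k, ((eta p k : ℝ) : 𝕜) * v k k := by
    simp only [h.eq x hx, Matrix.smul_apply, Matrix.diagonal_apply, smul_eq_mul, mul_ite,
      mul_zero, apply_ite (RCLike.ofReal : ℝ → 𝕜), RCLike.ofReal_zero, ite_mul, zero_mul,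
      Finset.sum_ite_eq, Finset.mem_univ, if_true, RCLike.ofReal_mul, Finset.mul_sum, mul_assoc]
  have e2 : ((scalarCurv g x : ℝ) : 𝕜) = ((Real.exp (2 * u x) : ℝ) : 𝕜)⁻¹ *
      ∑ i, ∑ j, ((ricci g i j x : ℝ) : 𝕜) * (if i = j then ((eta p i : ℝ) : 𝕜) else 0) := by
    rw [scalarCurv, RCLike.ofReal_sum, Finset.mul_sum]
    refine Finset.sum_congr rfl fun i _ => ?_
    rw [RCLike.ofReal_sum, Finset.mul_sum]
    refine Finset.sum_congr rfl fun j _ => ?_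
    rw [h.eq x hx, inv_smul_diagonal_eta (Real.exp_pos _).ne']
    by_cases hij : i = j
    · subst hij
      simp only [Matrix.smul_apply, Matrix.diagonal_apply_eq, smul_eq_mul, if_true]
      push_cast
      ring
    · simp [hij]
  have e3 : ∀ w : Fin n → Fin n → 𝕜, ∑ i, ∑ j, (if i = j then ((eta p i : ℝ) : 𝕜) else 0) * w i j
      = ∑ k, ((eta p k : ℝ) : 𝕜) * w k k := fun w => by
    simp only [ite_mul, zero_mul, Finset.sum_ite_eq, Finset.mem_univ, if_true]
  rw [e1, e2, h.sum_ricci_mul hx, e3, e3]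
  simp only [if_true, ofReal_eta_mul_self]
  rw [Finset.sum_const, Finset.card_univ, Fintype.card_fin, nsmul_eq_mul]
  field_simp
  ring

/-- Conformal invariance: for a conformally flat metric, the quantization formula takes its flat
form in adapted coordinates. -/
theorem IsConformalTo.quantFormula_eq (h : IsConformalTo p g u U) {x : E n} (hx : x ∈ U)
    {lam mu : 𝕜} (hc : CoeffDenoms (n : 𝕜) lam mu) {P : E n → Fin n → Fin n → 𝕜}
    (hP : ∀ y ∈ U, ∀ i j, ContDiffAt ℝ ∞ (fun z => P z i j) y)
    (hsym : ∀ y ∈ U, ∀ i j, P y i j = P y j i) {φ : E n → 𝕜} (hφ : ContDiffAt ℝ ∞ φ x) :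
    quantFormula lam mu g P φ x = flatFormula p lam mu P φ x := by
  have hPx := hP x hx
  have hs : ∀ j, ∑ l, ((pd l u x : ℝ) : 𝕜) * P x l j = ∑ l, ((pd l u x : ℝ) : 𝕜) * P x j l :=
    fun j => Finset.sum_congr rfl fun l _ => by rw [hsym x hx l j]
  have hdiv : ∀ j, ∑ i, nablaP g (mu - lam) P i i j x = ∑ i, nablaP g (mu - lam) P i j i x := by
    intro j
    refine Finset.sum_congr rfl fun i _ => ?_
    rw [h.nablaP_eq hx, h.nablaP_eq hx, pd_congr h.isOpen (fun y hy => hsym y hy i j) hx,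
      hs i, hs j, hsym x hx j i]
    ring
  have hdivP : ∀ j, ∑ i, pd i (fun y => P y i j) x = ∑ i, pd i (fun y => P y j i) x := fun j =>
    Finset.sum_congr rfl fun i _ => pd_congr h.isOpen (fun y hy => hsym y hy i j) hx i
  have e1 : ∑ i, ∑ j, ∑ k, ∑ l,
          (((g x)⁻¹ i j * g x k l : ℝ) : 𝕜) * nablaNablaP g (mu - lam) P i j k l x =
      ∑ i, ((eta p i : ℝ) : 𝕜) *
        ∑ k, ((eta p k : ℝ) : 𝕜) * nablaNablaP g (mu - lam) P i i k k x := by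
    rw [Finset.sum_comm]
    exact Finset.sum_congr rfl fun j _ =>
      h.sum_inv_mul hx j (fun i k l => nablaNablaP g (mu - lam) P i j k l x)
  have e2 : ∑ j, (beta1 (n : 𝕜) lam mu * ∑ i, nablaP g (mu - lam) P i i j x
      + beta2 (n : 𝕜) lam mu * ∑ i, ∑ k, ∑ l,
          (((g x)⁻¹ i j * g x k l : ℝ) : 𝕜) * nablaP g (mu - lam) P i k l x)
      * nablaD g lam φ j x =
      ∑ j, (beta1 (n : 𝕜) lam mu * ∑ i, pd i (fun y => P y i j) x
        + beta2 (n : 𝕜) lam mu * (((eta p j : ℝ) : 𝕜) *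
          pd j (fun y => ∑ k, ((eta p k : ℝ) : 𝕜) * P y k k) x)) * pd j φ x
      + beta1 (n : 𝕜) lam mu * (n + 2 - n * (mu - lam)) *
        ∑ i, ∑ j, P x i j * (((pd i u x : ℝ) : 𝕜) * pd j φ x)
      - beta1 (n : 𝕜) lam mu * (n * lam) *
        (∑ l, ((pd l u x : ℝ) : 𝕜) * ∑ j, pd j (fun z => P z l j) x) * φ x
      - beta1 (n : 𝕜) lam mu * (n * lam) * (n + 2 - n * (mu - lam)) *
        (∑ i, ∑ j, P x i j * (((pd i u x : ℝ) : 𝕜) * ((pd j u x : ℝ) : 𝕜))) * φ x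
      - beta2 (n : 𝕜) lam mu * (n * lam) * (∑ k, ((eta p k : ℝ) : 𝕜) * (((pd k u x : ℝ) : 𝕜) *
        pd k (fun y => ∑ k, ((eta p k : ℝ) : 𝕜) * P y k k) x)) * φ x
      + (beta2 (n : 𝕜) lam mu * (2 - n * (mu - lam)) - beta1 (n : 𝕜) lam mu) *
        (∑ k, ((eta p k : ℝ) : 𝕜) * P x k k) *
        (∑ k, ((eta p k : ℝ) : 𝕜) * (((pd k u x : ℝ) : 𝕜) * pd k φ x)
        - n * lam * (∑ k, ((eta p k : ℝ) : 𝕜) * (((pd k u x : ℝ) : 𝕜) * ((pd k u x : ℝ) : 𝕜)))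
          * φ x) := by
    have e3 : ∀ w : Fin n → 𝕜, ∑ i, ∑ j, P x i j * (((pd i u x : ℝ) : 𝕜) * w j) =
        ∑ j, (∑ l, ((pd l u x : ℝ) : 𝕜) * P x j l) * w j := by
      intro w
      rw [Finset.sum_comm]
      refine Finset.sum_congr rfl fun j _ => ?_
      rw [Finset.sum_mul]
      exact Finset.sum_congr rfl fun i _ => by rw [hsym x hx i j]; ring
    rw [e3, e3, Finset.sum_congr rfl fun j _ => by
      rw [h.sum_inv_mul hx j fun i k l => nablaP g (mu - lam) P i k l x, hdiv, h.nablaD_eq hx]]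
    simp only [hdivP]
    exact sum_first_order_combination _ _ _ _ _ _ _ _ _ _ _ _ _ _ _
      (fun j => h.div_eq hx _ (hsym x hx) j) fun j => h.sum_eta_nablaP hx _ hPx (hsym x hx) j
  rw [quantFormula, flatFormula, e1, e2, h.sum_mul_nablaNablaD hx lam (hsym x hx) hφ,
    h.div_div_eq hx hP hsym, h.trace_eq hx hP hsym, h.sum_ricci_mul hx]
  have e4 := h.scalarCurv_mul hx (P x)
  rw [mul_assoc (beta6 (n : 𝕜) lam mu), e4]
  have b1 := beta1_rel hc
  have b2 := beta2_rel hc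
  have b3 := beta3_rel hc
  have b4 := beta4_rel hc
  have b5 := beta5_rel hc
  have b6 := beta6_rel hc
  -- The terms with $\Delta u\operatorname{tr}P$ and $|du|^2\operatorname{tr}P$ impose separate
  -- conditions on $\beta_6$, hence two relations.
  have b6' := beta6_rel' hc
  -- From here on only the relations between the coefficients matter, and the scalar invariants of
  -- $P$, $u$ and $\varphi$ are treated as independent variables.
  generalize beta1 (n : 𝕜) lam mu = β₁ at *
  generalize beta2 (n : 𝕜) lam mu = β₂ at *
  generalize beta3 (n : 𝕜) lam mu = β₃ at *
  generalize beta4 (n : 𝕜) lam mu = β₄ at *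
  generalize beta5 (n : 𝕜) lam mu = β₅ at *
  generalize beta6 (n : 𝕜) lam mu = β₆ at *
  generalize ∑ i, ∑ j, P x i j * ((pd i (fun y => pd j u y) x : ℝ) : 𝕜) = B
  generalize ∑ i, ∑ j, P x i j * (((pd i u x : ℝ) : 𝕜) * pd j φ x) = C
  generalize ∑ i, ∑ j, P x i j * (((pd i u x : ℝ) : 𝕜) * ((pd j u x : ℝ) : 𝕜)) = D
  generalize ∑ k, ((eta p k : ℝ) : 𝕜) * ((pd k (fun y => pd k u y) x : ℝ) : 𝕜) = L
  generalize ∑ k, ((eta p k : ℝ) : 𝕜) * (((pd k u x : ℝ) : 𝕜) * ((pd k u x : ℝ) : 𝕜)) = H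
  generalize ∑ k, ((eta p k : ℝ) : 𝕜) * (((pd k u x : ℝ) : 𝕜) * pd k φ x) = G
  generalize ∑ l, ((pd l u x : ℝ) : 𝕜) * ∑ j, pd j (fun z => P z l j) x = Y
  generalize ∑ k, ((eta p k : ℝ) : 𝕜) * (((pd k u x : ℝ) : 𝕜) *
        pd k (fun y => ∑ k, ((eta p k : ℝ) : 𝕜) * P y k k) x) = Z
  generalize ∑ k, ((eta p k : ℝ) : 𝕜) * P x k k = t
  generalize (n : 𝕜) = N at *
  generalize φ x = f
  -- The coefficient of $P^{ij}u_iu_j$ gives no new condition: it vanishes as a consequence of the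
  -- relations for $\beta_1$, $\beta_3$ and $\beta_5$.
  have hD : 2 * N * lam + N * lam * (N * lam) - N * lam * (2 * (N * lam + 1))
      + β₃ * (N - N * (mu - lam)) * (N + 2 - N * (mu - lam)) + (N - 2) * β₅ = 0 := by
    linear_combination b5 + (N + 2 - N * (mu - lam)) / 2 * b3 + N * lam / 2 * b1
  -- Each relation is multiplied by the invariant whose coefficient it makes vanish.
  linear_combination C * b1 + t * (G - N * lam * H * f) * b2 + Y * f * b3 + Z * f * b4
    - B * f * b5 + D * f * (hD - N * lam * b1) - L * t * f * b6'
    - (N - N * (mu - lam)) * H * t * f * b6' + H * t * f * b6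

end ConformalInvariance

/-! ### Conformal vector fields -/

section ConformalFields

variable {n : ℕ}

/-- A conformal vector field of the flat metric whose divergence is an affine function. -/
structure IsConfField (p : ℕ) (X : E n → E n) (s : E n → ℝ) (h : Fin n → ℝ) : Prop where
  smooth : ∀ x, ContDiffAt ℝ ∞ X x
  conf : ∀ x i k, eta p i * pd k (fun y => X y i) x + eta p k * pd i (fun y => X y k) x =
    if i = k then 2 * s x * eta p i else 0
  second : ∀ x m k i, pd m (fun y => pd k (fun z => X z i) y) x =
    (if i = k then h m else 0) + (if i = m then h k else 0)
      - (if m = k then eta p m * eta p i * h i else 0)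

variable {p : ℕ} {X Y : E n → E n} {s s' : E n → ℝ} {h h' : Fin n → ℝ}

theorem contDiffAt_component {X : E n → E n} {x : E n} (hX : ContDiffAt ℝ ∞ X x) (i : Fin n) :
    ContDiffAt ℝ ∞ (fun y => X y i) x :=
  (EuclideanSpace.proj (𝕜 := ℝ) i).contDiff.contDiffAt.comp x hX

theorem IsConfField.component (hX : IsConfField p X s h) (i : Fin n) (x : E n) :
    ContDiffAt ℝ ∞ (fun y => X y i) x :=
  contDiffAt_component (hX.smooth x) i

theorem pd_fun_congr {V : Type*} [NormedAddCommGroup V] [NormedSpace ℝ V] {f g : E n → V}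
    (h : ∀ y, f y = g y) (i : Fin n) (x : E n) : pd i f x = pd i g x := by
  rw [show f = g from funext h]

theorem IsConfField.zero : IsConfField (n := n) p 0 0 0 where
  smooth _ := contDiffAt_const
  conf x i k := by simp
  second x m k i := by simp

theorem IsConfField.add (hX : IsConfField p X s h) (hY : IsConfField p Y s' h') :
    IsConfField p (X + Y) (s + s') (h + h') where
  smooth x := (hX.smooth x).add (hY.smooth x)
  conf x i k := by
    have e : ∀ k i, pd k (fun y => (X + Y) y i) x =
        pd k (fun y => X y i) x + pd k (fun y => Y y i) x := fun k i =>
      pd_add (V := ℝ) k (hX.component i x) (hY.component i x)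
    have h1 := hX.conf x i k
    have h2 := hY.conf x i k
    rw [e, e]
    by_cases hik : i = k
    · simp only [hik, if_true, Pi.add_apply] at h1 h2 ⊢; linarith
    · simp only [hik, if_false] at h1 h2 ⊢; linarith
  second x m k i := by
    have e : ∀ y, pd k (fun y => (X + Y) y i) y =
        pd k (fun y => X y i) y + pd k (fun y => Y y i) y := fun y =>
      pd_add (V := ℝ) k (hX.component i y) (hY.component i y)
    have hXi := hX.component i x
    have hYi := hY.component i x
    rw [pd_fun_congr e, pd_add (V := ℝ) m (by fun_prop) (by fun_prop), hX.second, hY.second]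
    simp only [Pi.add_apply]
    split_ifs <;> ring

theorem IsConfField.smul (c : ℝ) (hX : IsConfField p X s h) :
    IsConfField p (c • X) (c • s) (c • h) where
  smooth x := (hX.smooth x).const_smul c
  conf x i k := by
    have e : ∀ k i, pd k (fun y => (c • X) y i) x = c * pd k (fun y => X y i) x := fun k i =>
      pd_const_mul (𝕜 := ℝ) k c (hX.component i x)
    have h1 := hX.conf x i k
    rw [e, e]
    by_cases hik : i = k
    · simp only [hik, if_true, Pi.smul_apply, smul_eq_mul] at h1 ⊢; linear_combination c * h1
    · simp only [hik, if_false] at h1 ⊢; linear_combination c * h1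
  second x m k i := by
    have e : ∀ y, pd k (fun y => (c • X) y i) y = c * pd k (fun y => X y i) y := fun y =>
      pd_const_mul (𝕜 := ℝ) k c (hX.component i y)
    have hXi := hX.component i x
    rw [pd_fun_congr e, pd_const_mul (𝕜 := ℝ) m c (by fun_prop), hX.second]
    simp only [Pi.smul_apply, smul_eq_mul]
    split_ifs <;> ring

/-- The properties in `IsConfField` are linear in $(X,s,h)$, so it suffices to check the generators.
Translations and rotations have $s=0$, $h=0$, the dilation has $s=1$, $h=0$; only inversions have
$h\ne0$. Everything later uses these properties and not the explicit fields. -/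
theorem isConfField_of_mem {X : E n → E n} (hX : X ∈ confAlgebra n p) :
    ∃ s h, IsConfField p X s h := by
  induction hX using Submodule.span_induction with
  | zero => exact ⟨_, _, .zero⟩
  | add X Y _ _ hX hY =>
    obtain ⟨s, h, hX⟩ := hX
    obtain ⟨s', h', hY⟩ := hY
    exact ⟨_, _, hX.add hY⟩
  | smul c X _ hX =>
    obtain ⟨s, h, hX⟩ := hX
    exact ⟨_, _, hX.smul c⟩
  | mem X hX =>
    have he := eta_mul_self (n := n) (p := p)
    rcases hX with ((⟨a, rfl⟩ | ⟨a, b, rfl⟩) | rfl) | ⟨a, rfl⟩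
    · refine ⟨0, 0, fun x => contDiffAt_const, fun x i k => by simp, fun x m k i => by simp⟩
    · have e : ∀ k i x, pd k (fun x : E n => ((eta p a * x a) • EuclideanSpace.single b (1 : ℝ)
          - (eta p b * x b) • EuclideanSpace.single a 1 : E n) i) x =
          (if a = k then (if i = b then eta p a else 0) else 0)
          - (if b = k then (if i = a then eta p b else 0) else 0) := by
        intro k i x
        simp only [PiLp.sub_apply, PiLp.smul_apply, smul_eq_mul, PiLp.single_apply]
        simp (disch := fun_prop) only [pd_sub, pd_mul_const (𝕜 := ℝ), pd_const_mul (𝕜 := ℝ),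
          pd_coord]
        split_ifs <;> simp
      refine ⟨0, 0, fun x => by fun_prop, fun x i k => ?_, fun x m k i => ?_⟩
      · rw [e, e]
        simp only [Pi.zero_apply, mul_zero, zero_mul, ite_self]
        by_cases h1 : i = a <;> by_cases h2 : i = b <;> by_cases h3 : k = a <;>
          by_cases h4 : k = b <;> simp_all [eq_comm] <;> ring
      · rw [pd_fun_congr (e k i)]
        simp
    · have e : ∀ k i x, pd k (fun x : E n => x i) x = if i = k then 1 else 0 := fun k i x =>
        pd_coord k i x
      refine ⟨1, 0, fun x => contDiffAt_id, fun x i k => ?_, fun x m k i => ?_⟩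
      · rw [e, e]
        by_cases hik : i = k
        · subst hik; simp; ring
        · simp [hik, Ne.symm hik]
      · rw [pd_fun_congr (e k i)]
        simp
    · have e : ∀ k i x, pd k (fun x : E n => ((∑ j, eta p j * x j * x j) •
          EuclideanSpace.single a (1 : ℝ) - (2 * (eta p a * x a)) • x : E n) i) x =
          (if i = a then 2 * (eta p k * x k) else 0)
          - (if a = k then 2 * (eta p a * x i) else 0)
          - (if i = k then 2 * (eta p a * x a) else 0) := by
        intro k i x
        simp only [PiLp.sub_apply, PiLp.smul_apply, smul_eq_mul, PiLp.single_apply]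
        rw [pd_sub k (by fun_prop) (by fun_prop), pd_mul_const (𝕜 := ℝ) k _ (by fun_prop),
          pd_sum k (fun j => by fun_prop)]
        simp (disch := fun_prop) only [pd_mul (𝕜 := ℝ), pd_const, pd_coord]
        simp [Finset.sum_add_distrib]
        split_ifs <;> ring
      -- For the inversion with index $a$ the diagonal derivatives are $s=-2x_a$, and $h$ is the
      -- differential of this linear function.
      refine ⟨fun x => -2 * (eta p a * x a), fun m => if a = m then -2 * eta p a else 0,
        fun x => by fun_prop, fun x i k => ?_, fun x m k i => ?_⟩
      · rw [e, e]
        by_cases h1 : i = a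
        · subst h1
          by_cases h2 : i = k
          · subst h2; simp only [if_true]; ring
          · simp only [h2, Ne.symm h2, if_true, if_false]; ring
        · by_cases h2 : a = k
          · subst h2; simp only [h1, Ne.symm h1, if_true, if_false]; ring
          · by_cases h3 : i = k
            · subst h3; simp only [h1, h2, if_true, if_false]; ring
            · simp only [h1, Ne.symm h1, h2, Ne.symm h2, h3, Ne.symm h3, if_false]; ring
      · rw [pd_fun_congr (e k i), pd_sub m (by split_ifs <;> fun_prop) (by split_ifs <;> fun_prop),
          pd_sub m (by split_ifs <;> fun_prop) (by split_ifs <;> fun_prop)]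
        have d : ∀ (Q : Prop) [Decidable Q] (b j : Fin n),
            pd m (fun y : E n => if Q then 2 * (eta p b * y j) else 0) x =
              if Q then (if j = m then 2 * eta p b else 0) else 0 := by
          intro Q _ b j
          split_ifs with h1 h2 <;> simp (disch := fun_prop) [pd_const_mul (𝕜 := ℝ), pd_coord, *]
        rw [d, d, d]
        have h1 := he i
        by_cases h2 : i = a
        · subst h2
          by_cases h3 : i = k
          · subst h3
            by_cases h4 : i = m
            · subst h4; simp only [if_true]; linear_combination (-2 * eta p i) * h1
            · simp only [h4, Ne.symm h4, if_true, if_false]; ring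
          · by_cases h4 : i = m
            · subst h4; simp only [h3, Ne.symm h3, if_true, if_false]; ring
            · by_cases h5 : m = k
              · subst h5
                simp only [h3, if_true, if_false]
                linear_combination (-2 * eta p m) * h1
              · simp only [h3, h4, h5, Ne.symm h5, if_true, if_false]; ring
        · simp only [h2, Ne.symm h2, if_false]
          split_ifs <;> ring

end ConformalFields

/-! ### Equivariance of the flat quantization formula -/

section Equivariance

variable {n p : ℕ} {𝕜 : Type*} [RCLike 𝕜] {X : E n → E n} {s : E n → ℝ} {h : Fin n → ℝ}

/-- The diagonal case of the conformal equation. Thus $s$ is the divergence divided by $n$. -/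
theorem IsConfField.pd_self (hX : IsConfField p X s h) (i : Fin n) (x : E n) :
    pd i (fun y => X y i) x = s x := by
  have h1 := hX.conf x i i
  rw [if_pos rfl] at h1
  refine mul_left_cancel₀ (mul_ne_zero two_ne_zero (eta_ne_zero (p := p) i)) ?_
  linear_combination h1

theorem IsConfField.contDiffAt_divergence (hX : IsConfField p X s h) (x : E n) :
    ContDiffAt ℝ ∞ (divergence X) x := by
  have := fun i => hX.component i x
  unfold divergence
  fun_prop

/-- In the trace of the second derivatives the last two terms cancel, so $h$ is the differential of
$\frac1n\operatorname{div}X$. -/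
theorem IsConfField.pd_divergence (hX : IsConfField p X s h) (m : Fin n) (x : E n) :
    pd m (divergence X) x = n * h m := by
  have := fun i => hX.component i x
  unfold divergence
  rw [pd_sum m (fun j => by fun_prop)]
  simp only [hX.second, Finset.sum_add_distrib, Finset.sum_sub_distrib]
  simp [eta_mul_self]

theorem IsConfField.contDiffAt_lieDensity (hX : IsConfField p X s h) (w : 𝕜) {f : E n → 𝕜}
    {x : E n} (hf : ContDiffAt ℝ ∞ f x) : ContDiffAt ℝ ∞ (lieDensity w X f) x := by
  have := fun i => hX.component i x
  have := hX.contDiffAt_divergence x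
  unfold lieDensity
  fun_prop

theorem IsConfField.contDiffAt_lieSymbol1 (hX : IsConfField p X s h) (w : 𝕜)
    {P : E n → Fin n → 𝕜} {x : E n} (hP : ∀ i, ContDiffAt ℝ ∞ (fun y => P y i) x) (i : Fin n) :
    ContDiffAt ℝ ∞ (fun y => lieSymbol1 w X P y i) x := by
  have h1 := fun i => hX.component i x
  have h2 := fun i => hX.contDiffAt_lieDensity w (hP i)
  unfold lieSymbol1
  fun_prop

theorem IsConfField.contDiffAt_lieSymbol2 (hX : IsConfField p X s h) (w : 𝕜)
    {P : E n → Fin n → Fin n → 𝕜} {x : E n}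
    (hP : ∀ i j, ContDiffAt ℝ ∞ (fun y => P y i j) x) (i j : Fin n) :
    ContDiffAt ℝ ∞ (fun y => lieSymbol2 w X P y i j) x := by
  have h1 := fun i => hX.component i x
  have h2 := fun i j => hX.contDiffAt_lieDensity w (hP i j)
  unfold lieSymbol2
  fun_prop

theorem lieDensity_mul (w w' : 𝕜) {f f' : E n → 𝕜} {x : E n} (hf : ContDiffAt ℝ ∞ f x)
    (hf' : ContDiffAt ℝ ∞ f' x) :
    lieDensity (w + w') X (fun y => f y * f' y) x =
      lieDensity w X f x * f' x + f x * lieDensity w' X f' x := by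
  simp (disch := fun_prop) only [lieDensity, pd_mul]
  simp only [mul_add, add_mul, Finset.sum_add_distrib, Finset.mul_sum, Finset.sum_mul]
  have e1 : ∑ k, ((X x k : ℝ) : 𝕜) * (pd k f x * f' x) = ∑ k, ((X x k : ℝ) : 𝕜) * pd k f x * f' x :=
    Finset.sum_congr rfl fun k _ => by ring
  have e2 : ∑ k, ((X x k : ℝ) : 𝕜) * (f x * pd k f' x) = ∑ k, f x * (((X x k : ℝ) : 𝕜) * pd k f' x) :=
    Finset.sum_congr rfl fun k _ => by ring
  rw [e1, e2]
  ring

theorem lieDensity_sum {ι : Type*} (t : Finset ι) (w : 𝕜) {f : ι → E n → 𝕜} {x : E n}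
    (hf : ∀ i, ContDiffAt ℝ ∞ (f i) x) :
    lieDensity w X (fun y => ∑ i ∈ t, f i y) x = ∑ i ∈ t, lieDensity w X (f i) x := by
  simp only [lieDensity, pd_sum _ hf, Finset.mul_sum, Finset.sum_add_distrib]
  rw [Finset.sum_comm]

theorem lieDensity_const_mul (w c : 𝕜) {f : E n → 𝕜} {x : E n}
    (hf : ContDiffAt ℝ ∞ f x) :
    lieDensity w X (fun y => c * f y) x = c * lieDensity w X f x := by
  simp only [lieDensity, pd_const_mul _ c hf, mul_add, Finset.mul_sum]
  congr 1
  · exact Finset.sum_congr rfl fun k _ => by ring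
  · ring

theorem lieDensity_add (w : 𝕜) {f f' : E n → 𝕜} {x : E n}
    (hf : ContDiffAt ℝ ∞ f x) (hf' : ContDiffAt ℝ ∞ f' x) :
    lieDensity w X (fun y => f y + f' y) x = lieDensity w X f x + lieDensity w X f' x := by
  simp only [lieDensity, pd_add _ hf hf', mul_add, Finset.sum_add_distrib]
  ring

theorem lieDensity_congr {U : Set (E n)} (hU : IsOpen U) (w : 𝕜) {f f' : E n → 𝕜}
    (hf : ∀ y ∈ U, f y = f' y) {x : E n} (hx : x ∈ U) :
    lieDensity w X f x = lieDensity w X f' x := by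
  simp only [lieDensity, hf x hx, pd_congr hU hf hx]

/-- The derivatives of $X$ supply the action on the new lower index; the divergence is not constant,
and its derivative is the obstruction to $\partial_j$ commuting with $L_X$. -/
theorem IsConfField.pd_lieDensity (hX : IsConfField p X s h) (w : 𝕜) {f : E n → 𝕜} {x : E n}
    (hf : ContDiffAt ℝ ∞ f x) (j : Fin n) :
    pd j (lieDensity w X f) x = lieDensity w X (pd j f) x
      + ∑ k, ((pd j (fun y => X y k) x : ℝ) : 𝕜) * pd k f x
      + w * n * ((h j : ℝ) : 𝕜) * f x := by
  have h1 := fun i => hX.component i x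
  have h2 := hX.contDiffAt_divergence x
  unfold lieDensity
  rw [pd_add j (by fun_prop) (by fun_prop), pd_sum j (fun k => by fun_prop),
    pd_mul (𝕜 := 𝕜) j (by fun_prop) (by fun_prop), pd_const_mul j _ (by fun_prop),
    pd_ofReal j (by fun_prop), hX.pd_divergence]
  simp (disch := fun_prop) only [pd_mul, pd_ofReal, Finset.sum_add_distrib]
  simp only [pd_comm j _ hf]
  push_cast
  ring

/-- The second derivatives of a conformal field, contracted with a covector. -/
theorem IsConfField.sum_second_mul (hX : IsConfField p X s h) (x : E n) (m k : Fin n)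
    (v : Fin n → 𝕜) :
    ∑ i, ((pd m (fun y => pd k (fun z => X z i) y) x : ℝ) : 𝕜) * v i =
      ((h m : ℝ) : 𝕜) * v k + ((h k : ℝ) : 𝕜) * v m
      - (if m = k then ((eta p m : ℝ) : 𝕜) *
          ∑ i, ((eta p i : ℝ) : 𝕜) * (((h i : ℝ) : 𝕜) * v i) else 0) := by
  simp only [hX.second, RCLike.ofReal_sub, RCLike.ofReal_add, apply_ite (RCLike.ofReal : ℝ → 𝕜),
    RCLike.ofReal_zero, RCLike.ofReal_mul, sub_mul, add_mul, ite_mul, zero_mul,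
    Finset.sum_sub_distrib, Finset.sum_add_distrib, Finset.sum_ite_eq', Finset.mem_univ,
    if_true, Finset.sum_ite_irrel, Finset.sum_const_zero, Finset.mul_sum, mul_assoc]

/-- The corrections linear in $h$ have two sources: the weight contributes $wn$ to each mixed term,
and the second derivatives of $X$ contribute $1$ to each together with the trace term. -/
theorem IsConfField.pd_pd_lieDensity (hX : IsConfField p X s h) (w : 𝕜) {f : E n → 𝕜}
    {U : Set (E n)} (hU : IsOpen U) (hf : ∀ y ∈ U, ContDiffAt ℝ ∞ f y) {x : E n} (hx : x ∈ U)
    (i j : Fin n) :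
    pd i (fun y => pd j (lieDensity w X f) y) x =
      lieDensity w X (fun y => pd i (fun z => pd j f z) y) x
      + ∑ k, ((pd i (fun y => X y k) x : ℝ) : 𝕜) * pd k (fun y => pd j f y) x
      + ∑ k, ((pd j (fun y => X y k) x : ℝ) : 𝕜) * pd i (fun y => pd k f y) x
      + (1 + w * n) * (((h i : ℝ) : 𝕜) * pd j f x + ((h j : ℝ) : 𝕜) * pd i f x)
      - (if i = j then ((eta p i : ℝ) : 𝕜) *
          ∑ k, ((eta p k : ℝ) : 𝕜) * (((h k : ℝ) : 𝕜) * pd k f x) else 0) := by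
  have hfx := hf x hx
  have h1 := fun i => hX.component i x
  have h2 := hX.contDiffAt_lieDensity w (f := pd j f) (contDiffAt_pd j hfx)
  rw [pd_congr hU (fun y hy => hX.pd_lieDensity w (hf y hy) j) hx,
    pd_add i (by fun_prop) (by fun_prop), pd_add i (by fun_prop) (by fun_prop),
    pd_const_mul i _ (by fun_prop), pd_sum i (fun k => by fun_prop),
    hX.pd_lieDensity w (contDiffAt_pd j hfx)]
  simp (disch := fun_prop) only [pd_mul, pd_ofReal, Finset.sum_add_distrib]
  rw [hX.sum_second_mul x i j (fun k => pd k f x)]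
  ring

/-! #### Vector fields with values in densities -/

/-- The actions on the index of $V$ and on the index of $df$ cancel, and only the weight of $f$
obstructs naturality. -/
theorem IsConfField.sum_lieSymbol1_mul_pd (hX : IsConfField p X s h) (w w' : 𝕜)
    {V : E n → Fin n → 𝕜} {f : E n → 𝕜} {x : E n} (hV : ∀ i, ContDiffAt ℝ ∞ (fun y => V y i) x)
    (hf : ContDiffAt ℝ ∞ f x) :
    ∑ j, lieSymbol1 w X V x j * pd j f x + ∑ j, V x j * pd j (lieDensity w' X f) x =
      lieDensity (w + w') X (fun y => ∑ j, V y j * pd j f y) x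
      + w' * n * (∑ j, ((h j : ℝ) : 𝕜) * V x j) * f x := by
  rw [lieDensity_sum _ _ (fun j => by fun_prop)]
  have e1 : ∑ j, (∑ k, V x k * ((pd k (fun y => X y j) x : ℝ) : 𝕜)) * pd j f x =
      ∑ j, V x j * ∑ k, ((pd j (fun y => X y k) x : ℝ) : 𝕜) * pd k f x := by
    simp only [Finset.sum_mul, Finset.mul_sum]
    rw [Finset.sum_comm]
    exact Finset.sum_congr rfl fun j _ => Finset.sum_congr rfl fun i _ => by ring
  have e2 : ∀ j, lieDensity (w + w') X (fun y => V y j * pd j f y) x =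
      lieDensity w X (fun y => V y j) x * pd j f x + V x j * lieDensity w' X (pd j f) x :=
    fun j => lieDensity_mul w w' (hV j) (contDiffAt_pd j hf)
  simp only [e2, lieSymbol1, sub_mul, Finset.sum_sub_distrib, Finset.sum_add_distrib, e1,
    hX.pd_lieDensity w' hf, mul_add]
  have e3 : ∑ j, V x j * (w' * n * ((h j : ℝ) : 𝕜) * f x) =
      w' * n * (∑ j, ((h j : ℝ) : 𝕜) * V x j) * f x := by
    simp only [Finset.sum_mul, Finset.mul_sum]
    exact Finset.sum_congr rfl fun j _ => by ring
  rw [e3]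
  ring

/-- The obstruction vanishes for $w=1$, reflecting that the divergence of a vector field with values
in densities of degree one needs no connection. -/
theorem IsConfField.div_lieSymbol1 (hX : IsConfField p X s h) (w : 𝕜)
    {V : E n → Fin n → 𝕜} {x : E n} (hV : ∀ i, ContDiffAt ℝ ∞ (fun y => V y i) x) :
    ∑ j, pd j (fun y => lieSymbol1 w X V y j) x =
      lieDensity w X (fun y => ∑ j, pd j (fun z => V z j) y) x
      + (n * w - n) * ∑ j, ((h j : ℝ) : 𝕜) * V x j := by
  have h1 := fun i => hX.component i x
  have h2 := fun i => hX.contDiffAt_lieDensity w (hV i)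
  rw [lieDensity_sum _ _ (fun j => by fun_prop)]
  have e1 : ∀ j, pd j (fun y => lieSymbol1 w X V y j) x =
      lieDensity w X (pd j fun y => V y j) x
      + ∑ k, ((pd j (fun y => X y k) x : ℝ) : 𝕜) * pd k (fun y => V y j) x
      + w * n * ((h j : ℝ) : 𝕜) * V x j
      - (∑ k, pd j (fun y => V y k) x * ((pd k (fun y => X y j) x : ℝ) : 𝕜)
        + ∑ k, V x k * ((pd j (fun y => pd k (fun z => X z j) y) x : ℝ) : 𝕜)) := by
    intro j
    unfold lieSymbol1
    rw [pd_sub j (by fun_prop) (by fun_prop), hX.pd_lieDensity w (hV j),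
      pd_sum j (fun k => by fun_prop)]
    simp (disch := fun_prop) only [pd_mul, pd_ofReal, Finset.sum_add_distrib]
  have e2 : ∑ j, ∑ k, ((pd j (fun y => X y k) x : ℝ) : 𝕜) * pd k (fun y => V y j) x =
      ∑ j, ∑ k, pd j (fun y => V y k) x * ((pd k (fun y => X y j) x : ℝ) : 𝕜) := by
    rw [Finset.sum_comm]
    exact Finset.sum_congr rfl fun j _ => Finset.sum_congr rfl fun i _ => by ring
  have e3 : ∑ j, ∑ k, V x k * ((pd j (fun y => pd k (fun z => X z j) y) x : ℝ) : 𝕜) =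
      n * ∑ j, ((h j : ℝ) : 𝕜) * V x j := by
    rw [Finset.sum_comm, Finset.mul_sum]
    refine Finset.sum_congr rfl fun k _ => ?_
    rw [← Finset.mul_sum, ← RCLike.ofReal_sum]
    have : ∑ j, pd j (fun y => pd k (fun z => X z j) y) x = n * h k := by
      simp only [hX.second, Finset.sum_add_distrib, Finset.sum_sub_distrib]
      simp [eta_mul_self]
    rw [this]
    push_cast
    ring
  simp only [e1, Finset.sum_add_distrib, Finset.sum_sub_distrib, e2, e3]
  have e4 : ∑ j, w * n * ((h j : ℝ) : 𝕜) * V x j = n * w * ∑ j, ((h j : ℝ) : 𝕜) * V x j := by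
    rw [Finset.mul_sum]
    exact Finset.sum_congr rfl fun j _ => by ring
  rw [e4]
  ring

end Equivariance

/-! ### Lie derivatives of quadratic symbols, their divergences and traces -/

section Equivariance

variable {n p : ℕ} {𝕜 : Type*} [RCLike 𝕜] {X : E n → E n} {s : E n → ℝ} {h : Fin n → ℝ}

theorem IsConfField.sum_lieSymbol2_mul_pd_pd (hX : IsConfField p X s h) (w w' : 𝕜)
    {P : E n → Fin n → Fin n → 𝕜} {f : E n → 𝕜} {U : Set (E n)} (hU : IsOpen U)
    (hf : ∀ y ∈ U, ContDiffAt ℝ ∞ f y) {x : E n} (hx : x ∈ U)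
    (hP : ∀ i j, ContDiffAt ℝ ∞ (fun y => P y i j) x) (hsym : ∀ i j, P x i j = P x j i) :
    ∑ i, ∑ j, lieSymbol2 w X P x i j * pd i (fun y => pd j f y) x
      + ∑ i, ∑ j, P x i j * pd i (fun y => pd j (lieDensity w' X f) y) x =
      lieDensity (w + w') X (fun y => ∑ i, ∑ j, P y i j * pd i (fun z => pd j f z) y) x
      + (2 + 2 * w' * n) * ∑ j, (∑ i, ((h i : ℝ) : 𝕜) * P x i j) * pd j f x
      - (∑ k, ((eta p k : ℝ) : 𝕜) * P x k k) *
          ∑ k, ((eta p k : ℝ) : 𝕜) * (((h k : ℝ) : 𝕜) * pd k f x) := by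
  have hfx := hf x hx
  rw [lieDensity_sum _ _ (fun j => by fun_prop)]
  have e0 : ∀ i, lieDensity (w + w') X (fun y => ∑ j, P y i j * pd i (fun z => pd j f z) y) x =
      ∑ j, (lieDensity w X (fun y => P y i j) x * pd i (fun z => pd j f z) x
        + P x i j * lieDensity w' X (fun y => pd i (fun z => pd j f z) y) x) := by
    intro i
    rw [lieDensity_sum _ _ (fun j => by fun_prop)]
    exact Finset.sum_congr rfl fun j _ => lieDensity_mul w w' (hP i j) (by fun_prop)
  have e1 : ∑ i, ∑ j, (∑ k, P x k j * ((pd k (fun y => X y i) x : ℝ) : 𝕜)) *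
        pd i (fun y => pd j f y) x =
      ∑ i, ∑ j, P x i j * ∑ k, ((pd i (fun y => X y k) x : ℝ) : 𝕜) *
        pd k (fun y => pd j f y) x := by
    simp only [Finset.sum_mul, Finset.mul_sum]
    rw [Finset.sum_comm, Finset.sum_congr rfl fun j _ => Finset.sum_comm, Finset.sum_comm]
    exact Finset.sum_congr rfl fun j _ => Finset.sum_congr rfl fun i _ =>
      Finset.sum_congr rfl fun k _ => by ring
  have e2 : ∑ i, ∑ j, (∑ k, P x i k * ((pd k (fun y => X y j) x : ℝ) : 𝕜)) *
        pd i (fun y => pd j f y) x =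
      ∑ i, ∑ j, P x i j * ∑ k, ((pd j (fun y => X y k) x : ℝ) : 𝕜) *
        pd i (fun y => pd k f y) x := by
    simp only [Finset.sum_mul, Finset.mul_sum]
    refine Finset.sum_congr rfl fun i _ => ?_
    rw [Finset.sum_comm]
    exact Finset.sum_congr rfl fun j _ => Finset.sum_congr rfl fun k _ => by ring
  have e3 : ∑ i, ∑ j, P x i j * ((1 + w' * n) *
      (((h i : ℝ) : 𝕜) * pd j f x + ((h j : ℝ) : 𝕜) * pd i f x)) =
      (2 + 2 * w' * n) * ∑ j, (∑ i, ((h i : ℝ) : 𝕜) * P x i j) * pd j f x := by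
    have e4 : ∑ i, ∑ j, P x i j * (((h i : ℝ) : 𝕜) * pd j f x) =
        ∑ j, (∑ i, ((h i : ℝ) : 𝕜) * P x i j) * pd j f x := by
      simp only [Finset.sum_mul]
      rw [Finset.sum_comm]
      exact Finset.sum_congr rfl fun j _ => Finset.sum_congr rfl fun i _ => by ring
    have e5 : ∑ i, ∑ j, P x i j * (((h j : ℝ) : 𝕜) * pd i f x) =
        ∑ j, (∑ i, ((h i : ℝ) : 𝕜) * P x i j) * pd j f x := by
      simp only [Finset.sum_mul]
      exact Finset.sum_congr rfl fun j _ => Finset.sum_congr rfl fun i _ => by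
        rw [hsym j i]; ring
    have : ∀ i j, P x i j * ((1 + w' * n) *
      (((h i : ℝ) : 𝕜) * pd j f x + ((h j : ℝ) : 𝕜) * pd i f x)) =
      (1 + w' * n) * (P x i j * (((h i : ℝ) : 𝕜) * pd j f x)) +
      (1 + w' * n) * (P x i j * (((h j : ℝ) : 𝕜) * pd i f x)) := fun i j => by ring
    simp only [this, Finset.sum_add_distrib, ← Finset.mul_sum, e4, e5]
    ring
  have e6 : ∀ c : 𝕜, ∑ i, ∑ j, P x i j * (if i = j then ((eta p i : ℝ) : 𝕜) * c else 0) =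
      (∑ k, ((eta p k : ℝ) : 𝕜) * P x k k) * c := by
    intro c
    simp only [mul_ite, mul_zero, Finset.sum_ite_eq, Finset.mem_univ, if_true, Finset.sum_mul]
    exact Finset.sum_congr rfl fun k _ => by ring
  simp only [e0, lieSymbol2, hX.pd_pd_lieDensity w' hU hf hx, sub_mul, mul_add, mul_sub,
    Finset.sum_sub_distrib, Finset.sum_add_distrib, e1, e2, e6]
  simp only [mul_add, Finset.sum_add_distrib] at e3
  linear_combination e3

/-- For fixed $j$ the columns of $P$ behave as vector fields, to which `div_lieSymbol1` applies. The
action of $X$ on the free index adds second derivatives of $X$ contracted with $P$; by symmetry of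
$P$ these give twice the pairing with $h$ and a trace term. -/
theorem IsConfField.div_lieSymbol2 (hX : IsConfField p X s h) (w : 𝕜)
    {P : E n → Fin n → Fin n → 𝕜} {x : E n} (hP : ∀ i j, ContDiffAt ℝ ∞ (fun y => P y i j) x)
    (hsym : ∀ i j, P x i j = P x j i) (j : Fin n) :
    ∑ i, pd i (fun y => lieSymbol2 w X P y i j) x =
      lieSymbol1 w X (fun y j => ∑ i, pd i (fun z => P z i j) y) x j
      + ((n * w - n - 2) * ∑ i, ((h i : ℝ) : 𝕜) * P x i j
        + ((eta p j : ℝ) : 𝕜) * ((h j : ℝ) : 𝕜) * ∑ k, ((eta p k : ℝ) : 𝕜) * P x k k) := by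
  have h1 := fun i => hX.component i x
  have h2 := fun i j => hX.contDiffAt_lieDensity w (hP i j)
  have key := hX.div_lieSymbol1 w (V := fun y i => P y i j) (fun i => hP i j)
  have e1 : ∀ i, pd i (fun y => lieSymbol2 w X P y i j) x =
      pd i (fun y => lieSymbol1 w X (fun z i => P z i j) y i) x
      - (∑ k, pd i (fun y => P y i k) x * ((pd k (fun y => X y j) x : ℝ) : 𝕜)
        + ∑ k, P x i k * ((pd i (fun y => pd k (fun z => X z j) y) x : ℝ) : 𝕜)) := by
    intro i
    have h3 := hX.contDiffAt_lieSymbol1 w (P := fun z i => P z i j) (fun i => hP i j) i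
    have : ∀ y, lieSymbol2 w X P y i j = lieSymbol1 w X (fun z i => P z i j) y i
      - ∑ k, P y i k * ((pd k (fun y => X y j) y : ℝ) : 𝕜) := fun y => rfl
    rw [pd_fun_congr this, pd_sub i (by fun_prop) (by fun_prop), pd_sum i (fun k => by fun_prop)]
    simp (disch := fun_prop) only [pd_mul, pd_ofReal, Finset.sum_add_distrib]
  have e2 : ∑ i, ∑ k, pd i (fun y => P y i k) x * ((pd k (fun y => X y j) x : ℝ) : 𝕜) =
      ∑ k, (∑ i, pd i (fun z => P z i k) x) * ((pd k (fun y => X y j) x : ℝ) : 𝕜) := by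
    rw [Finset.sum_comm]
    simp only [Finset.sum_mul]
  have e3 : ∑ i, ∑ k, P x i k * ((pd i (fun y => pd k (fun z => X z j) y) x : ℝ) : 𝕜) =
      ∑ i, ((h i : ℝ) : 𝕜) * P x i j + ∑ i, ((h i : ℝ) : 𝕜) * P x j i
      - ((eta p j : ℝ) : 𝕜) * ((h j : ℝ) : 𝕜) * ∑ k, ((eta p k : ℝ) : 𝕜) * P x k k := by
    simp only [hX.second, RCLike.ofReal_sub, RCLike.ofReal_add,
      apply_ite (RCLike.ofReal : ℝ → 𝕜), RCLike.ofReal_zero, RCLike.ofReal_mul, sub_mul, add_mul,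
      ite_mul, zero_mul, Finset.sum_sub_distrib, Finset.sum_add_distrib, Finset.sum_ite_eq,
      Finset.mem_univ, if_true, Finset.sum_ite_irrel, Finset.sum_const_zero, Finset.mul_sum,
      mul_comm (P x _ _)]
    congr 1
    exact Finset.sum_congr rfl fun k _ => by ring
  simp only [e1, Finset.sum_sub_distrib, Finset.sum_add_distrib, key, e2, e3]
  have e4 : ∑ i, ((h i : ℝ) : 𝕜) * P x j i = ∑ i, ((h i : ℝ) : 𝕜) * P x i j :=
    Finset.sum_congr rfl fun i _ => by rw [hsym j i]
  simp only [lieSymbol1, e4]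
  ring

/-- A conformal field rescales $\eta$ at the rate $2s$, so tracing with $\eta$ commutes with $L_X$
up to this factor. -/
theorem IsConfField.trace_lieSymbol2 (hX : IsConfField p X s h) (w : 𝕜)
    {P : E n → Fin n → Fin n → 𝕜} {x : E n} (hP : ∀ i j, ContDiffAt ℝ ∞ (fun y => P y i j) x) :
    ∑ k, ((eta p k : ℝ) : 𝕜) * lieSymbol2 w X P x k k =
      lieDensity w X (fun y => ∑ k, ((eta p k : ℝ) : 𝕜) * P y k k) x
      - 2 * ((s x : ℝ) : 𝕜) * ∑ k, ((eta p k : ℝ) : 𝕜) * P x k k := by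
  rw [lieDensity_sum _ _ (fun j => by fun_prop)]
  have e1 : ∑ k, ((eta p k : ℝ) : 𝕜) * (∑ m, P x m k * ((pd m (fun y => X y k) x : ℝ) : 𝕜))
      + ∑ k, ((eta p k : ℝ) : 𝕜) * (∑ m, P x k m * ((pd m (fun y => X y k) x : ℝ) : 𝕜)) =
      2 * ((s x : ℝ) : 𝕜) * ∑ k, ((eta p k : ℝ) : 𝕜) * P x k k := by
    simp only [Finset.mul_sum]
    rw [Finset.sum_comm, ← Finset.sum_add_distrib]
    simp only [← Finset.sum_add_distrib]
    -- After transposing one of the double sums, the two summands combine to the left side of the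
    -- conformal equation times $P^{mk}$.
    have : ∀ m k, ((eta p k : ℝ) : 𝕜) * (P x m k * ((pd m (fun y => X y k) x : ℝ) : 𝕜))
        + ((eta p m : ℝ) : 𝕜) * (P x m k * ((pd k (fun y => X y m) x : ℝ) : 𝕜)) =
        if m = k then 2 * ((s x : ℝ) : 𝕜) * (((eta p m : ℝ) : 𝕜) * P x m k) else 0 := by
      intro m k
      have h1 := congrArg (RCLike.ofReal : ℝ → 𝕜) (hX.conf x m k)
      by_cases hmk : m = k
      · subst hmk
        simp only [if_true] at h1 ⊢
        push_cast at h1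
        linear_combination P x m m * h1
      · simp only [hmk, if_false] at h1 ⊢
        push_cast at h1
        linear_combination P x m k * h1
    simp only [this, Finset.sum_ite_eq, Finset.mem_univ, if_true]
  have e2 : ∀ k, lieDensity w X (fun y => ((eta p k : ℝ) : 𝕜) * P y k k) x =
      ((eta p k : ℝ) : 𝕜) * lieDensity w X (fun y => P y k k) x := fun k =>
    lieDensity_const_mul w _ (hP k k)
  simp only [lieSymbol2, e2, mul_sub, Finset.sum_sub_distrib]
  linear_combination -e1

/-- The action on the raised index, compared with that on the lower index of the gradient, costs
$2s$ by the conformal equation. This compensates the $-2s$ from the trace, and only the derivatives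
of $s$ and of the divergence survive. -/
theorem IsConfField.grad_trace_lieSymbol2 (hX : IsConfField p X s h) (w : 𝕜)
    {P : E n → Fin n → Fin n → 𝕜} {U : Set (E n)} (hU : IsOpen U)
    (hP : ∀ y ∈ U, ∀ i j, ContDiffAt ℝ ∞ (fun y => P y i j) y)
    {x : E n} (hx : x ∈ U) (j : Fin n) :
    ((eta p j : ℝ) : 𝕜) * pd j (fun y => ∑ k, ((eta p k : ℝ) : 𝕜) * lieSymbol2 w X P y k k) x =
      lieSymbol1 w X (fun y j => ((eta p j : ℝ) : 𝕜) *
        pd j (fun y => ∑ k, ((eta p k : ℝ) : 𝕜) * P y k k) y) x j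
      + (n * w - 2) * (((eta p j : ℝ) : 𝕜) * ((h j : ℝ) : 𝕜) *
          ∑ k, ((eta p k : ℝ) : 𝕜) * P x k k) := by
  have hPx := hP x hx
  have h1 := fun i => hX.component i x
  rw [pd_congr hU (fun y hy => hX.trace_lieSymbol2 w (hP y hy)) hx]
  have ht : ContDiffAt ℝ ∞ (fun y => ∑ k, ((eta p k : ℝ) : 𝕜) * P y k k) x := by fun_prop
  have hts : ∀ t : E n → 𝕜, (fun y => ∑ k, ((eta p k : ℝ) : 𝕜) * P y k k) = t →
      ∑ k, ((eta p k : ℝ) : 𝕜) * P x k k = t x := by rintro t rfl; rfl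
  -- Smoothness of $s$ is not part of `IsConfField`; rewriting $s$ as a derivative of $X$ makes it
  -- available.
  have hs : ∀ y, ((s y : ℝ) : 𝕜) = ((pd j (fun y => X y j) y : ℝ) : 𝕜) := fun y => by
    rw [hX.pd_self]
  have hsd : pd j (fun y => pd j (fun z => X z j) y) x = h j := by
    have := eta_mul_self (p := p) j
    rw [hX.second]
    simp only [if_true]
    linear_combination (-h j) * this
  have key : ∀ t : E n → 𝕜, ContDiffAt ℝ ∞ t x →
      ((eta p j : ℝ) : 𝕜) * pd j (fun y => lieDensity w X t y - 2 * ((s y : ℝ) : 𝕜) * t y) x =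
      lieSymbol1 w X (fun y j => ((eta p j : ℝ) : 𝕜) * pd j t y) x j
      + (n * w - 2) * (((eta p j : ℝ) : 𝕜) * ((h j : ℝ) : 𝕜) * t x) := by
    intro t ht
    have h2 := hX.contDiffAt_lieDensity w ht
    simp only [hs]
    rw [pd_sub j (by fun_prop) (by fun_prop), hX.pd_lieDensity w ht,
      pd_mul (𝕜 := 𝕜) j (by fun_prop) (by fun_prop), pd_const_mul j _ (by fun_prop),
      pd_ofReal j (by fun_prop), hsd, lieSymbol1, lieDensity_const_mul _ _ (by fun_prop)]
    have e1 : ∑ k, ((eta p j : ℝ) : 𝕜) * (((pd j (fun y => X y k) x : ℝ) : 𝕜) * pd k t x)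
        + ∑ k, ((eta p k : ℝ) : 𝕜) * pd k t x * ((pd k (fun y => X y j) x : ℝ) : 𝕜) =
        2 * ((s x : ℝ) : 𝕜) * (((eta p j : ℝ) : 𝕜) * pd j t x) := by
      rw [← Finset.sum_add_distrib]
      have : ∀ k, ((eta p j : ℝ) : 𝕜) * (((pd j (fun y => X y k) x : ℝ) : 𝕜) * pd k t x)
          + ((eta p k : ℝ) : 𝕜) * pd k t x * ((pd k (fun y => X y j) x : ℝ) : 𝕜) =
          if j = k then 2 * ((s x : ℝ) : 𝕜) * (((eta p k : ℝ) : 𝕜) * pd k t x) else 0 := by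
        intro k
        have h1 := congrArg (RCLike.ofReal : ℝ → 𝕜) (hX.conf x j k)
        have hj := ofReal_eta_mul_self (𝕜 := 𝕜) (p := p) j
        have hk := ofReal_eta_mul_self (𝕜 := 𝕜) (p := p) k
        by_cases hjk : j = k
        · subst hjk
          simp only [if_true] at h1 ⊢
          push_cast at h1
          linear_combination pd j t x * h1
        · simp only [hjk, if_false] at h1 ⊢
          push_cast at h1
          linear_combination ((eta p j : ℝ) : 𝕜) * ((eta p k : ℝ) : 𝕜) * pd k t x * h1
            - ((eta p j : ℝ) : 𝕜) * ((pd j (fun y => X y k) x : ℝ) : 𝕜) * pd k t x * hk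
            - ((eta p k : ℝ) : 𝕜) * ((pd k (fun y => X y j) x : ℝ) : 𝕜) * pd k t x * hj
      simp only [this, Finset.sum_ite_eq, Finset.mem_univ, if_true]
    rw [← Finset.mul_sum] at e1
    rw [hX.pd_self]
    linear_combination e1
  exact key _ ht

end Equivariance

/-! ### Equivariance of the complete flat formula -/

section Equivariance

variable {n p : ℕ} {𝕜 : Type*} [RCLike 𝕜] {X : E n → E n} {s : E n → ℝ} {h : Fin n → ℝ}

/-- The divergence of a tensor field on `ℝⁿ`. -/
def tensorDiv (P : E n → Fin n → Fin n → 𝕜) (x : E n) (j : Fin n) : 𝕜 :=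
  ∑ i, pd i (fun y => P y i j) x

/-- The gradient of the trace of a tensor field on `ℝⁿ`. -/
def gradTrace (p : ℕ) (P : E n → Fin n → Fin n → 𝕜) (x : E n) (j : Fin n) : 𝕜 :=
  ((eta p j : ℝ) : 𝕜) * pd j (fun y => ∑ k, ((eta p k : ℝ) : 𝕜) * P y k k) x

/-- The divergence of a vector field with values in `𝕜`. -/
def vectorDiv (V : E n → Fin n → 𝕜) (x : E n) : 𝕜 := ∑ j, pd j (fun y => V y j) x

theorem contDiffAt_tensorDiv {P : E n → Fin n → Fin n → 𝕜} {x : E n}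
    (hP : ∀ i j, ContDiffAt ℝ ∞ (fun y => P y i j) x) (j : Fin n) :
    ContDiffAt ℝ ∞ (fun y => tensorDiv P y j) x := by
  unfold tensorDiv
  fun_prop

theorem contDiffAt_gradTrace {P : E n → Fin n → Fin n → 𝕜} {x : E n}
    (hP : ∀ i j, ContDiffAt ℝ ∞ (fun y => P y i j) x) (j : Fin n) :
    ContDiffAt ℝ ∞ (fun y => gradTrace p P y j) x := by
  unfold gradTrace
  fun_prop

@[fun_prop]
theorem contDiffAt_vectorDiv {V : E n → Fin n → 𝕜} {x : E n}
    (hV : ∀ j, ContDiffAt ℝ ∞ (fun y => V y j) x) :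
    ContDiffAt ℝ ∞ (vectorDiv V) x := by
  unfold vectorDiv
  fun_prop

/-- Expressing the formula through two vector fields and their divergences reduces its Lie
derivative to the rules for vector fields, up to the two corrections linear in $h$. -/
theorem flatFormula_eq {lam mu : 𝕜} {P : E n → Fin n → Fin n → 𝕜} {φ : E n → 𝕜} {U : Set (E n)}
    (hU : IsOpen U) (hP : ∀ y ∈ U, ∀ i j, ContDiffAt ℝ ∞ (fun y => P y i j) y)
    (hsym : ∀ y ∈ U, ∀ i j, P y i j = P y j i) {x : E n} (hx : x ∈ U) :
    flatFormula p lam mu P φ x = ∑ i, ∑ j, P x i j * pd i (fun y => pd j φ y) x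
      + (beta1 (n : 𝕜) lam mu * ∑ j, tensorDiv P x j * pd j φ x
        + beta2 (n : 𝕜) lam mu * ∑ j, gradTrace p P x j * pd j φ x)
      + (beta3 (n : 𝕜) lam mu * vectorDiv (tensorDiv P) x
        + beta4 (n : 𝕜) lam mu * vectorDiv (gradTrace p P) x) * φ x := by
  have hPx := hP x hx
  have e1 : ∀ i, pd i (fun y => ∑ j, pd j (fun z => P z i j) y) x =
      pd i (fun y => tensorDiv P y i) x := fun i =>
    pd_congr hU (fun y hy => Finset.sum_congr rfl fun j _ =>
      pd_congr hU (fun z hz => hsym z hz i j) hy j) hx i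
  have e2 : ∀ i, ((eta p i : ℝ) : 𝕜) *
      pd i (fun y => pd i (fun z => ∑ k, ((eta p k : ℝ) : 𝕜) * P z k k) y) x =
      pd i (fun y => gradTrace p P y i) x := by
    intro i
    unfold gradTrace
    rw [pd_const_mul i _ (by fun_prop)]
  have e3 : ∀ (a b : 𝕜) (S G v : Fin n → 𝕜), ∑ j, (a * S j + b * G j) * v j =
      a * ∑ j, S j * v j + b * ∑ j, G j * v j := by
    intro a b S G v
    simp only [add_mul, Finset.sum_add_distrib, Finset.mul_sum, mul_assoc]
  simp only [flatFormula, e1, e2]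
  rw [← e3]
  rfl

/-- The coefficient of $h$ collects $nw-n-2$ from the inner divergence and $nw-n$ from the outer
one. -/
theorem IsConfField.tensorDiv_lieSymbol2 (hX : IsConfField p X s h) (w : 𝕜)
    {P : E n → Fin n → Fin n → 𝕜} {U : Set (E n)} (hU : IsOpen U)
    (hP : ∀ y ∈ U, ∀ i j, ContDiffAt ℝ ∞ (fun y => P y i j) y)
    (hsym : ∀ y ∈ U, ∀ i j, P y i j = P y j i) {x : E n} (hx : x ∈ U) :
    vectorDiv (tensorDiv (lieSymbol2 w X P)) x = lieDensity w X (vectorDiv (tensorDiv P)) x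
      + (2 * n * w - 2 * n - 2) * ∑ j, ((h j : ℝ) : 𝕜) * tensorDiv P x j
      + ∑ j, ((h j : ℝ) : 𝕜) * gradTrace p P x j := by
  have hPx := hP x hx
  have h1 := contDiffAt_tensorDiv hPx
  have h2 := hX.contDiffAt_lieSymbol1 w h1
  have e1 : ∀ j, pd j (fun y => tensorDiv (lieSymbol2 w X P) y j) x =
      pd j (fun y => lieSymbol1 w X (tensorDiv P) y j) x
      + ((n * w - n - 2) * ∑ i, ((h i : ℝ) : 𝕜) * pd j (fun y => P y i j) x
        + ((h j : ℝ) : 𝕜) * gradTrace p P x j) := by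
    intro j
    rw [pd_congr (f := fun y => tensorDiv (lieSymbol2 w X P) y j) hU
      (fun y hy => hX.div_lieSymbol2 w (hP y hy) (hsym y hy) j) hx]
    change pd j (fun y => lieSymbol1 w X (tensorDiv P) y j + _) x = _
    rw [pd_add j (by fun_prop) (by fun_prop), pd_add j (by fun_prop) (by fun_prop),
      pd_const_mul j _ (by fun_prop), pd_const_mul j _ (by fun_prop),
      pd_sum j (f := fun i y => ((h i : ℝ) : 𝕜) * P y i j) (fun i => by fun_prop), gradTrace]
    simp (disch := fun_prop) only [pd_const_mul j _ (hPx _ j)]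
    ring
  have e2 : ∑ j, ∑ i, ((h i : ℝ) : 𝕜) * pd j (fun y => P y i j) x =
      ∑ j, ((h j : ℝ) : 𝕜) * tensorDiv P x j := by
    rw [Finset.sum_comm]
    refine Finset.sum_congr rfl fun j _ => ?_
    rw [tensorDiv, Finset.mul_sum]
    exact Finset.sum_congr rfl fun i _ => by
      rw [pd_congr hU (fun y hy => hsym y hy j i) hx]
  have e3 := hX.div_lieSymbol1 w h1
  rw [vectorDiv]
  simp only [e1, Finset.sum_add_distrib, ← Finset.mul_sum, e2, e3]
  change lieDensity w X (vectorDiv (tensorDiv P)) x + _ + _ = _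
  ring

/-- The coefficient of $h$ collects $nw-2$ from the gradient of the trace and $nw-n$ from the
divergence. -/
theorem IsConfField.gradTrace_lieSymbol2 (hX : IsConfField p X s h) (w : 𝕜)
    {P : E n → Fin n → Fin n → 𝕜} {U : Set (E n)} (hU : IsOpen U)
    (hP : ∀ y ∈ U, ∀ i j, ContDiffAt ℝ ∞ (fun y => P y i j) y)
    {x : E n} (hx : x ∈ U) :
    vectorDiv (gradTrace p (lieSymbol2 w X P)) x = lieDensity w X (vectorDiv (gradTrace p P)) x
      + (2 * n * w - n - 2) * ∑ j, ((h j : ℝ) : 𝕜) * gradTrace p P x j := by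
  have hPx := hP x hx
  have h1 := contDiffAt_gradTrace (p := p) hPx
  have h2 := hX.contDiffAt_lieSymbol1 w h1
  have e1 : ∀ j, pd j (fun y => gradTrace p (lieSymbol2 w X P) y j) x =
      pd j (fun y => lieSymbol1 w X (gradTrace p P) y j) x
      + (n * w - 2) * (((h j : ℝ) : 𝕜) * gradTrace p P x j) := by
    intro j
    rw [pd_congr (f := fun y => gradTrace p (lieSymbol2 w X P) y j) hU
      (fun y hy => hX.grad_trace_lieSymbol2 w hU hP hy j) hx]
    change pd j (fun y => lieSymbol1 w X (gradTrace p P) y j + _) x = _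
    rw [pd_add j (by fun_prop) (by fun_prop), pd_const_mul j _ (by fun_prop),
      pd_const_mul j _ (by fun_prop), gradTrace]
    ring
  have e3 := hX.div_lieSymbol1 w h1
  rw [vectorDiv]
  simp only [e1, Finset.sum_add_distrib, ← Finset.mul_sum, e3]
  change lieDensity w X (vectorDiv (gradTrace p P)) x + _ + _ = _
  ring

/-- The flat quantization formula is equivariant under conformal vector fields. -/
theorem IsConfField.flatFormula_lie (hX : IsConfField p X s h) {lam mu : 𝕜}
    (hc : CoeffDenoms (n : 𝕜) lam mu) {P : E n → Fin n → Fin n → 𝕜} {φ : E n → 𝕜}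
    {U : Set (E n)} (hU : IsOpen U)
    (hP : ∀ y ∈ U, ∀ i j, ContDiffAt ℝ ∞ (fun y => P y i j) y)
    (hsym : ∀ y ∈ U, ∀ i j, P y i j = P y j i)
    (hφ : ∀ y ∈ U, ContDiffAt ℝ ∞ φ y) {x : E n} (hx : x ∈ U) :
    flatFormula p lam mu (lieSymbol2 (mu - lam) X P) φ x =
      lieDensity mu X (flatFormula p lam mu P φ) x
        - flatFormula p lam mu P (lieDensity lam X φ) x := by
  have hPx := hP x hx
  have hφx := hφ x hx
  have hV := contDiffAt_tensorDiv hPx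
  have hW := contDiffAt_gradTrace (p := p) hPx
  have hsym' : ∀ y ∈ U, ∀ i j,
      lieSymbol2 (mu - lam) X P y i j = lieSymbol2 (mu - lam) X P y j i := by
    intro y hy i j
    have : lieDensity (mu - lam) X (fun y => P y i j) y =
        lieDensity (mu - lam) X (fun y => P y j i) y :=
      lieDensity_congr hU _ (fun z hz => hsym z hz i j) hy
    simp only [lieSymbol2, this, hsym y hy i, hsym y hy _ j]
    ring
  rw [flatFormula_eq hU (fun y hy => hX.contDiffAt_lieSymbol2 _ (hP y hy)) hsym' hx,
    flatFormula_eq hU hP hsym hx,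
    lieDensity_congr hU mu (fun y hy => flatFormula_eq hU hP hsym hy) hx,
    hX.tensorDiv_lieSymbol2 _ hU hP hsym hx, hX.gradTrace_lieSymbol2 _ hU hP hx]
  have e1 := hX.sum_lieSymbol2_mul_pd_pd (mu - lam) lam hU hφ hx hPx (hsym x hx)
  have e2 := hX.sum_lieSymbol1_mul_pd (mu - lam) lam hV hφx
  have e3 := hX.sum_lieSymbol1_mul_pd (mu - lam) lam hW hφx
  have hmu : mu - lam + lam = mu := sub_add_cancel _ _
  rw [hmu] at e1 e2 e3
  have e4 := lieDensity_mul (X := X) (mu - lam) lam (contDiffAt_vectorDiv hV) hφx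
  have e5 := lieDensity_mul (X := X) (mu - lam) lam (contDiffAt_vectorDiv hW) hφx
  rw [hmu] at e4 e5
  have e6 : ∑ j, tensorDiv (lieSymbol2 (mu - lam) X P) x j * pd j φ x =
      ∑ j, lieSymbol1 (mu - lam) X (tensorDiv P) x j * pd j φ x
      + (n * (mu - lam) - n - 2) * ∑ j, (∑ i, ((h i : ℝ) : 𝕜) * P x i j) * pd j φ x
      + (∑ k, ((eta p k : ℝ) : 𝕜) * P x k k) *
          ∑ k, ((eta p k : ℝ) : 𝕜) * (((h k : ℝ) : 𝕜) * pd k φ x) := by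
    have : ∀ j, tensorDiv (lieSymbol2 (mu - lam) X P) x j = _ := fun j =>
      hX.div_lieSymbol2 (mu - lam) hPx (hsym x hx) j
    simp only [this, add_mul, Finset.sum_add_distrib, mul_assoc, ← Finset.mul_sum]
    rw [Finset.mul_sum, Finset.mul_sum, add_assoc]
    congr 2
    exact Finset.sum_congr rfl fun k _ => by ring
  have e7 : ∑ j, gradTrace p (lieSymbol2 (mu - lam) X P) x j * pd j φ x =
      ∑ j, lieSymbol1 (mu - lam) X (gradTrace p P) x j * pd j φ x
      + (n * (mu - lam) - 2) * ((∑ k, ((eta p k : ℝ) : 𝕜) * P x k k) *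
          ∑ k, ((eta p k : ℝ) : 𝕜) * (((h k : ℝ) : 𝕜) * pd k φ x)) := by
    have : ∀ j, gradTrace p (lieSymbol2 (mu - lam) X P) x j = _ := fun j =>
      hX.grad_trace_lieSymbol2 (mu - lam) hU hP hx j
    simp only [this, add_mul, Finset.sum_add_distrib, mul_assoc, ← Finset.mul_sum]
    rw [Finset.mul_sum, Finset.mul_sum]
    congr 1
    rw [Finset.mul_sum]
    exact Finset.sum_congr rfl fun k _ => by ring
  have e8 : lieDensity mu X (fun y => ∑ i, ∑ j, P y i j * pd i (fun z => pd j φ z) y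
      + (beta1 (n : 𝕜) lam mu * ∑ j, tensorDiv P y j * pd j φ y
        + beta2 (n : 𝕜) lam mu * ∑ j, gradTrace p P y j * pd j φ y)
      + (beta3 (n : 𝕜) lam mu * vectorDiv (tensorDiv P) y
        + beta4 (n : 𝕜) lam mu * vectorDiv (gradTrace p P) y) * φ y) x =
      lieDensity mu X (fun y => ∑ i, ∑ j, P y i j * pd i (fun z => pd j φ z) y) x
      + (beta1 (n : 𝕜) lam mu * lieDensity mu X (fun y => ∑ j, tensorDiv P y j * pd j φ y) x
        + beta2 (n : 𝕜) lam mu * lieDensity mu X (fun y => ∑ j, gradTrace p P y j * pd j φ y) x)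
      + (beta3 (n : 𝕜) lam mu * lieDensity mu X (fun y => vectorDiv (tensorDiv P) y * φ y) x
        + beta4 (n : 𝕜) lam mu * lieDensity mu X (fun y => vectorDiv (gradTrace p P) y * φ y) x) := by
    have hr : ∀ y, (beta3 (n : 𝕜) lam mu * vectorDiv (tensorDiv P) y
        + beta4 (n : 𝕜) lam mu * vectorDiv (gradTrace p P) y) * φ y =
        beta3 (n : 𝕜) lam mu * (vectorDiv (tensorDiv P) y * φ y)
        + beta4 (n : 𝕜) lam mu * (vectorDiv (gradTrace p P) y * φ y) := fun y => by ring
    simp only [hr]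
    have hV' := contDiffAt_vectorDiv hV
    have hW' := contDiffAt_vectorDiv hW
    rw [lieDensity_add _ (by fun_prop) (by fun_prop), lieDensity_add _ (by fun_prop) (by fun_prop),
      lieDensity_add _ (by fun_prop) (by fun_prop), lieDensity_add _ (by fun_prop) (by fun_prop)]
    rw [lieDensity_const_mul _ _ (by fun_prop), lieDensity_const_mul _ _ (by fun_prop),
      lieDensity_const_mul _ _ (by fun_prop), lieDensity_const_mul _ _ (by fun_prop)]
  rw [e8, e6, e7, e4, e5]
  have b1 := beta1_rel hc
  have b2 := beta2_rel hc
  have b3 := beta3_rel hc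
  have b4 := beta4_rel hc
  set A := ∑ j, (∑ i, ((h i : ℝ) : 𝕜) * P x i j) * pd j φ x
  set B := (∑ k, ((eta p k : ℝ) : 𝕜) * P x k k) *
          ∑ k, ((eta p k : ℝ) : 𝕜) * (((h k : ℝ) : 𝕜) * pd k φ x)
  set C := ∑ j, ((h j : ℝ) : 𝕜) * tensorDiv P x j
  set D := ∑ j, ((h j : ℝ) : 𝕜) * gradTrace p P x j
  -- The remaining terms are linear in $h$ and of four types; the relation for one coefficient
  -- removes each type.
  linear_combination e1 + beta1 (n : 𝕜) lam mu * e2 + beta2 (n : 𝕜) lam mu * e3 - A * b1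
    - B * b2 - C * φ x * b3 - D * φ x * b4

/-- The quantization of a symbol of degree one is equivariant under conformal vector fields. -/
theorem IsConfField.firstOrder_lie (hX : IsConfField p X s h) {lam mu : 𝕜}
    (hc : 1 - (mu - lam) ≠ 0) {P : E n → Fin n → 𝕜} {φ : E n → 𝕜} {x : E n}
    (hP : ∀ j, ContDiffAt ℝ ∞ (fun y => P y j) x) (hφ : ContDiffAt ℝ ∞ φ x) :
    ∑ j, lieSymbol1 (mu - lam) X P x j * pd j φ x
        + lam / (1 - (mu - lam)) * vectorDiv (lieSymbol1 (mu - lam) X P) x * φ x =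
      lieDensity mu X (fun y => ∑ j, P y j * pd j φ y
        + lam / (1 - (mu - lam)) * vectorDiv P y * φ y) x
      - (∑ j, P x j * pd j (lieDensity lam X φ) x
        + lam / (1 - (mu - lam)) * vectorDiv P x * lieDensity lam X φ x) := by
  have hV := contDiffAt_vectorDiv hP
  have e1 := hX.sum_lieSymbol1_mul_pd (mu - lam) lam hP hφ
  have e2 := lieDensity_mul (X := X) (mu - lam) lam hV hφ
  rw [sub_add_cancel] at e1 e2
  have e3 : vectorDiv (lieSymbol1 (mu - lam) X P) x = _ := hX.div_lieSymbol1 (mu - lam) hP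
  simp only [mul_assoc (lam / (1 - (mu - lam)))]
  rw [lieDensity_add _ (by fun_prop) (by fun_prop), lieDensity_const_mul _ _ (by fun_prop), e2, e3]
  -- The weight of $\varphi$ leaves $n\lambda\,h(P)\varphi$ and the divergence leaves
  -- $-n(1-\delta)\,h(P)\varphi$; the constant is the one that balances them.
  have e4 : lam / (1 - (mu - lam)) * (1 - (mu - lam)) = lam := div_mul_cancel₀ _ hc
  change ∑ j, lieSymbol1 (mu - lam) X P x j * pd j φ x
        + lam / (1 - (mu - lam)) * ((lieDensity (mu - lam) X (vectorDiv P) x + _) * φ x) = _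
  linear_combination e1 - n * (∑ j, ((h j : ℝ) : 𝕜) * P x j) * φ x * e4

end Equivariance

/-! ### Powers of the Jacobian determinant -/

section AbsPow

variable {𝕜 : Type*} [RCLike 𝕜] {n : ℕ}

@[simp]
theorem absPow_one (w : 𝕜) : absPow 1 w = 1 := by simp [absPow]

@[simp]
theorem absPow_zero_right (J : ℝ) : absPow J (0 : 𝕜) = 1 := by simp [absPow]

theorem absPow_mul {J K : ℝ} (hJ : J ≠ 0) (hK : K ≠ 0) (w : 𝕜) :
    absPow (J * K) w = absPow J w * absPow K w := by
  rw [absPow, absPow, absPow, ← NormedSpace.exp_add, abs_mul,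
    Real.log_mul (abs_ne_zero.2 hJ) (abs_ne_zero.2 hK)]
  push_cast
  ring_nf

theorem absPow_add (J : ℝ) (w w' : 𝕜) : absPow J (w + w') = absPow J w * absPow J w' := by
  rw [absPow, absPow, absPow, ← NormedSpace.exp_add, add_mul]

theorem absPow_mul_absPow_neg (J : ℝ) (w : 𝕜) : absPow J w * absPow J (-w) = 1 := by
  rw [← absPow_add]; simp

theorem pd_absPow {f : E n → ℝ} {x : E n} (hf : ContDiffAt ℝ ∞ f x) (hx : f x ≠ 0)
    (w : 𝕜) (i : Fin n) : pd i (fun y => absPow (f y) w) x =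
      w * ((pd i f x / f x : ℝ) : 𝕜) * absPow (f x) w := by
  have h1 : ContDiffAt ℝ ∞ (fun y => Real.log (f y)) x := hf.log hx
  have h2 : pd i (fun y => Real.log (f y)) x = pd i f x / f x := by
    have := ((differentiableAt_of_smooth hf).hasFDerivAt.log hx).fderiv
    simp only [pd, this]
    simp [div_eq_inv_mul]
  have h3 : ContDiffAt ℝ ∞ (fun y => w * ((Real.log (f y) : ℝ) : 𝕜)) x := by fun_prop
  -- The exponential is differentiable over `𝕜`, while coordinates are real, so scalars are
  -- restricted.
  have h4 : HasFDerivAt (NormedSpace.exp : 𝕜 → 𝕜)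
      ((ContinuousLinearMap.toSpanSingleton 𝕜
        (NormedSpace.exp (w * ((Real.log (f x) : ℝ) : 𝕜)))).restrictScalars ℝ)
      (w * ((Real.log (f x) : ℝ) : 𝕜)) :=
    (hasDerivAt_exp (𝕂 := 𝕜)).hasFDerivAt.restrictScalars ℝ
  have h5 := (h4.comp x (differentiableAt_of_smooth h3).hasFDerivAt).fderiv
  have h6 : (fun y => absPow (f y) w) =
      NormedSpace.exp ∘ fun y => w * ((Real.log (f y) : ℝ) : 𝕜) := by
    funext y; simp [absPow]
  have h7 : pd i (fun y => w * ((Real.log (f y) : ℝ) : 𝕜)) x =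
      w * ((pd i f x / f x : ℝ) : 𝕜) := by
    rw [pd_const_mul i w (by fun_prop), pd_ofReal i h1, h2]
  have h8 : absPow (f x) w = NormedSpace.exp (w * ((Real.log (f x) : ℝ) : 𝕜)) := by
    simp [absPow]
  rw [← h7, h6, h8]
  simp only [pd]
  rw [h5]
  simp

theorem contDiffAt_absPow {f : E n → ℝ} {x : E n} (hf : ContDiffAt ℝ ∞ f x) (hx : f x ≠ 0)
    (w : 𝕜) : ContDiffAt ℝ ∞ (fun y => absPow (f y) w) x := by
  have h6 : (fun y => absPow (f y) w) =
      NormedSpace.exp ∘ fun y => w * ((Real.log (f y) : ℝ) : 𝕜) := by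
    funext y; simp [absPow]
  rw [h6]
  have h1 : ContDiffAt ℝ ∞ (fun y => Real.log (f y)) x := hf.log hx
  have h2 : ContDiffAt 𝕜 ∞ (NormedSpace.exp : 𝕜 → 𝕜) (w * ((Real.log (f x) : ℝ) : 𝕜)) :=
    (NormedSpace.exp_analytic (𝕂 := 𝕜) _).contDiffAt
  exact (h2.restrict_scalars ℝ).comp x (by fun_prop)

end AbsPow

/-! ### Changes of coordinates -/

section Charts

variable {n : ℕ} {M : Type*} [TopologicalSpace M] [ChartedSpace (E n) M]

theorem mem_overlap {e e' : Chart n M} {x : E n} :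
    x ∈ overlap e e' ↔ x ∈ e.1.target ∧ e.1.symm x ∈ e'.1.source := Iff.rfl

theorem isOpen_overlap (e e' : Chart n M) : IsOpen (overlap e e') :=
  e.1.isOpen_inter_preimage_symm e'.1.open_source

theorem trans_mem_overlap {e e' : Chart n M} {x : E n} (hx : x ∈ overlap e e') :
    trans e e' x ∈ overlap e' e := by
  refine ⟨e'.1.map_source hx.2, ?_⟩
  rw [trans, e'.1.left_inv hx.2]
  exact e.1.map_target hx.1

theorem trans_trans_self {e e' : Chart n M} {x : E n} (hx : x ∈ overlap e e') :
    trans e' e (trans e e' x) = x := by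
  rw [trans, trans, e'.1.left_inv hx.2, e.1.right_inv hx.1]

theorem symm_trans {e e' : Chart n M} {x : E n} (hx : x ∈ overlap e e') :
    e'.1.symm (trans e e' x) = e.1.symm x := by
  rw [trans, e'.1.left_inv hx.2]

theorem trans_trans {e e' : Chart n M} (e'' : Chart n M) {x : E n} (hx : x ∈ overlap e e') :
    trans e' e'' (trans e e' x) = trans e e'' x := by
  rw [trans, symm_trans hx, trans]

theorem mem_overlap_of_trans {e e' e'' : Chart n M} {x : E n} (hx : x ∈ overlap e e') :
    trans e e' x ∈ overlap e' e'' ↔ x ∈ overlap e e'' := by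
  rw [mem_overlap, mem_overlap, symm_trans hx]
  exact ⟨fun h => ⟨hx.1, h.2⟩, fun h => ⟨(trans_mem_overlap hx).1, h.2⟩⟩

theorem overlap_self (e : Chart n M) : overlap e e = e.1.target :=
  Set.ext fun _ => ⟨fun h => h.1, fun h => ⟨h, e.1.map_target h⟩⟩

theorem trans_self {e : Chart n M} {x : E n} (hx : x ∈ e.1.target) : trans e e x = x :=
  e.1.right_inv hx

theorem contDiffAt_trans {e e' : Chart n M} {x : E n} (hx : x ∈ overlap e e') :
    ContDiffAt ℝ ∞ (trans e e') x := by
  have h := (contDiffGroupoid ∞ 𝓘(ℝ, E n)).compatible_of_mem_maximalAtlas e.2 e'.2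
  have h1 : ContDiffOn ℝ ∞ (trans e e') (overlap e e') := by
    have h2 := h.1
    simp only [contDiffPregroupoid, modelWithCornersSelf_coe, modelWithCornersSelf_coe_symm,
      Function.comp_id, Function.id_comp, Set.preimage_id, Set.range_id, Set.inter_univ] at h2
    exact h2
  exact h1.contDiffAt ((isOpen_overlap e e').mem_nhds hx)

theorem contDiffAt_jac {e e' : Chart n M} {x : E n} (hx : x ∈ overlap e e') (i j : Fin n) :
    ContDiffAt ℝ ∞ (fun y => jac e e' y i j) x := by
  have := contDiffAt_component (contDiffAt_trans hx) i
  unfold jac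
  simp only [Matrix.of_apply]
  fun_prop

theorem contDiffAt_det {m : Type*} [Fintype m] [DecidableEq m] {A : E n → Matrix m m ℝ} {x : E n}
    (hA : ∀ i j, ContDiffAt ℝ ∞ (fun y => A y i j) x) :
    ContDiffAt ℝ ∞ (fun y => (A y).det) x := by
  simp only [Matrix.det_apply]
  refine ContDiffAt.sum fun σ _ => ?_
  simp only [Units.smul_def, zsmul_eq_mul]
  exact contDiffAt_const.mul (contDiffAt_prod fun i _ => hA _ _)

theorem jac_trans {e e' e'' : Chart n M} {x : E n} (hx : x ∈ overlap e e')
    (hx' : x ∈ overlap e e'') : jac e e'' x = jac e' e'' (trans e e' x) * jac e e' x := by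
  have h1 := (mem_overlap_of_trans hx).2 hx'
  ext i j
  simp only [Matrix.mul_apply, jac, Matrix.of_apply]
  -- The identity between the three changes of coordinates holds only where all of them are defined,
  -- which is an open set around $x$.
  rw [pd_congr ((isOpen_overlap e e').inter (isOpen_overlap e e''))
    (fun y hy => show trans e e'' y i = trans e' e'' (trans e e' y) i by rw [trans_trans _ hy.1])
    ⟨hx, hx'⟩]
  rw [pd_comp (f := fun y => trans e' e'' y i) j (contDiffAt_component (contDiffAt_trans h1) i)
    (contDiffAt_trans hx)]
  exact Finset.sum_congr rfl fun k _ => mul_comm _ _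

theorem jac_self {e : Chart n M} {x : E n} (hx : x ∈ e.1.target) : jac e e x = 1 := by
  ext i j
  simp only [jac, Matrix.of_apply]
  rw [pd_congr e.1.open_target (fun y hy => show trans e e y i = y i by rw [trans_self hy]) hx,
    pd_coord, Matrix.one_apply]

theorem jac_mul_jac {e e' : Chart n M} {x : E n} (hx : x ∈ overlap e e') :
    jac e' e (trans e e' x) * jac e e' x = 1 := by
  rw [← jac_trans hx (by rw [overlap_self]; exact hx.1), jac_self hx.1]

theorem det_jac_ne_zero {e e' : Chart n M} {x : E n} (hx : x ∈ overlap e e') :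
    (jac e e' x).det ≠ 0 := by
  have := congrArg Matrix.det (jac_mul_jac hx)
  rw [Matrix.det_mul, Matrix.det_one] at this
  exact right_ne_zero_of_mul_eq_one this

theorem absPow_jac_trans {𝕜 : Type*} [RCLike 𝕜] {e e' e'' : Chart n M} {x : E n}
    (hx : x ∈ overlap e e') (hx' : x ∈ overlap e e'') (w : 𝕜) :
    absPow (jac e e'' x).det w =
      absPow (jac e' e'' (trans e e' x)).det w * absPow (jac e e' x).det w := by
  rw [jac_trans hx hx', Matrix.det_mul,
    absPow_mul (det_jac_ne_zero ((mem_overlap_of_trans hx).2 hx')) (det_jac_ne_zero hx)]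

theorem contDiffAt_absPow_jac {𝕜 : Type*} [RCLike 𝕜] {e e' : Chart n M} {x : E n}
    (hx : x ∈ overlap e e') (w : 𝕜) :
    ContDiffAt ℝ ∞ (fun y => absPow (jac e e' y).det w) x :=
  contDiffAt_absPow (contDiffAt_det fun i j => contDiffAt_jac hx i j) (det_jac_ne_zero hx) w

end Charts

/-! ### Extension by zero of fields with compact support in a chart -/

section Extension

variable {n : ℕ} {M : Type*} [TopologicalSpace M] [ChartedSpace (E n) M] {𝕜 : Type*} [RCLike 𝕜]
  {V : Type*} [NormedAddCommGroup V] [NormedSpace ℝ V] [NormedSpace 𝕜 V]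

/-- The rule `R` according to which the components of a type of geometric object transform under
changes of coordinates. -/
structure IsTransition (𝕜 : Type*) [RCLike 𝕜] {V : Type*} [NormedAddCommGroup V]
    [NormedSpace ℝ V] [NormedSpace 𝕜 V] (R : Chart n M → Chart n M → E n → V → V) : Prop where
  map_add : ∀ e e' x v v', R e e' x (v + v') = R e e' x v + R e e' x v'
  map_smul : ∀ e e' x (c : 𝕜) v, R e e' x (c • v) = c • R e e' x v
  self : ∀ (e : Chart n M) x v, x ∈ e.1.target → R e e x v = v
  cocycle : ∀ (e e' e'' : Chart n M) x v, x ∈ overlap e e' → x ∈ overlap e e'' →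
    R e' e'' (trans e e' x) (R e e' x v) = R e e'' x v
  smooth : ∀ (e e' : Chart n M) x (f : E n → V), x ∈ overlap e e' → ContDiffAt ℝ ∞ f x →
    ContDiffAt ℝ ∞ (fun y => R e e' y (f y)) x

open Classical in
/-- The field which is `f` in the chart `e`, extended by zero. -/
def extField (R : Chart n M → Chart n M → E n → V → V) (e : Chart n M) (f : E n → V)
    (e' : Chart n M) (x : E n) : V :=
  if x ∈ overlap e' e then R e e' (trans e' e x) (f (trans e' e x)) else 0

variable {R : Chart n M → Chart n M → E n → V → V}

theorem IsTransition.map_zero (hR : IsTransition 𝕜 R) (e e' : Chart n M) (x : E n) :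
    R e e' x 0 = 0 := by
  simpa using hR.map_smul e e' x (0 : 𝕜) 0

theorem IsTransition.extField_self (hR : IsTransition 𝕜 R) (e : Chart n M) (f : E n → V)
    {x : E n} (hx : x ∈ e.1.target) : extField R e f e x = f x := by
  have h : x ∈ overlap e e := by rw [overlap_self]; exact hx
  rw [extField, if_pos h, trans_self hx, hR.self e x _ hx]

theorem extField_of_notMem (e : Chart n M) (f : E n → V) (e' : Chart n M) {x : E n}
    (hx : x ∉ e'.1.target) : extField R e f e' x = 0 :=
  if_neg fun h => hx h.1

theorem IsTransition.extField_add (hR : IsTransition 𝕜 R) (e : Chart n M) (f f' : E n → V) :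
    extField R e (f + f') = extField R e f + extField R e f' := by
  funext e' x
  simp only [extField, Pi.add_apply, hR.map_add]
  split_ifs <;> simp

theorem IsTransition.extField_smul (hR : IsTransition 𝕜 R) (e : Chart n M) (c : 𝕜) (f : E n → V) :
    extField R e (c • f) = c • extField R e f := by
  funext e' x
  simp only [extField, Pi.smul_apply, hR.map_smul]
  split_ifs <;> simp

theorem IsTransition.extField_transform (hR : IsTransition 𝕜 R) (e : Chart n M) (f : E n → V)
    (e' e'' : Chart n M) {x : E n} (hx : x ∈ overlap e' e'') :
    extField R e f e'' (trans e' e'' x) = R e' e'' x (extField R e f e' x) := by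
  by_cases h : x ∈ overlap e' e
  · have h1 : trans e' e'' x ∈ overlap e'' e := (mem_overlap_of_trans hx).2 h
    have h2 : trans e' e x ∈ overlap e e'' := (mem_overlap_of_trans h).2 hx
    have h3 : trans e' e x ∈ overlap e e' := trans_mem_overlap h
    have := hR.cocycle e e' e'' (trans e' e x) (f (trans e' e x)) h3 h2
    rw [trans_trans_self h] at this
    rw [extField, if_pos h1, extField, if_pos h, trans_trans e hx, this]
  · have h1 : trans e' e'' x ∉ overlap e'' e := fun h1 => h ((mem_overlap_of_trans hx).1 h1)
    rw [extField, if_neg h1, extField, if_neg h, hR.map_zero]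

/-- Smooth functions on `ℝⁿ` which vanish outside of the set `K`. -/
structure SupportedIn (K : Set (E n)) (f : E n → V) : Prop where
  smooth : ∀ x, ContDiffAt ℝ ∞ f x
  zero : ∀ x, x ∉ K → f x = 0

/-- On the overlap smoothness is inherited from $f$. At other points it depends on $M$ being
Hausdorff: the support is compact, hence closed in $M$, so the extension vanishes near such a point.
-/
theorem IsTransition.contDiffOn_extField [T2Space M] (hR : IsTransition 𝕜 R) (e : Chart n M)
    {K : Set (E n)} (hK : IsCompact K) (hKe : K ⊆ e.1.target) {f : E n → V}
    (hf : SupportedIn K f) (e' : Chart n M) : ContDiffOn ℝ ∞ (extField R e f e') e'.1.target := by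
  intro x hx
  refine ContDiffAt.contDiffWithinAt ?_
  by_cases h : x ∈ overlap e' e
  · have h1 := trans_mem_overlap h
    have h2 : ContDiffAt ℝ ∞ (fun y => R e e' (trans e' e y) (f (trans e' e y))) x :=
      ContDiffAt.comp (g := fun y => R e e' y (f y)) x (hR.smooth e e' _ f h1 (hf.smooth _))
        (contDiffAt_trans h)
    exact contDiffAt_congr (isOpen_overlap e' e) (fun y hy => if_pos hy) h h2
  -- The complement of the image of $K$ in $M$ is an open neighbourhood of the point on which the
  -- extended field is zero.
  · have hC : IsClosed (e.1.symm '' K) :=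
      (hK.image_of_continuousOn (e.1.continuousOn_symm.mono hKe)).isClosed
    have hU : IsOpen (e'.1.target ∩ e'.1.symm ⁻¹' (e.1.symm '' K)ᶜ) :=
      e'.1.isOpen_inter_preimage_symm hC.isOpen_compl
    refine contDiffAt_congr (g := fun _ => (0 : V)) hU (fun y hy => ?_) ⟨hx, ?_⟩ contDiffAt_const
    · by_cases hy' : y ∈ overlap e' e
      · rw [extField, if_pos hy', hf.zero, hR.map_zero]
        intro hk
        exact hy.2 ⟨_, hk, by rw [symm_trans hy']⟩
      · exact if_neg hy'
    · rintro ⟨y, hy, hyx⟩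
      exact h ⟨hx, by rw [← hyx]; exact e.1.map_target (hKe hy)⟩

/-! #### Densities and symbols -/

/-- The transformation rule of densities of degree `w`. -/
def transition0 (w : 𝕜) (e e' : Chart n M) (x : E n) (v : 𝕜) : 𝕜 :=
  absPow (jac e e' x).det (-w) * v

/-- The transformation rule of vectors with values in densities of degree `w`. -/
def transition1 (w : 𝕜) (e e' : Chart n M) (x : E n) (v : Fin n → 𝕜) (i : Fin n) : 𝕜 :=
  absPow (jac e e' x).det (-w) * ∑ k, ((jac e e' x i k : ℝ) : 𝕜) * v k

/-- The transformation rule of contravariant tensors of rank two with values in densities of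
degree `w`. -/
def transition2 (w : 𝕜) (e e' : Chart n M) (x : E n) (v : Fin n → Fin n → 𝕜) (i j : Fin n) : 𝕜 :=
  absPow (jac e e' x).det (-w) *
    ∑ k, ∑ l, ((jac e e' x i k : ℝ) : 𝕜) * ((jac e e' x j l : ℝ) : 𝕜) * v k l

theorem isTransition0 (w : 𝕜) : IsTransition 𝕜 (transition0 (n := n) (M := M) w) where
  map_add e e' x v v' := by simp only [transition0, mul_add]
  map_smul e e' x c v := by simp only [transition0, smul_eq_mul]; ring
  self e x v hx := by simp [transition0, jac_self hx]
  cocycle e e' e'' x v hx hx' := by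
    simp only [transition0, absPow_jac_trans hx hx', mul_assoc]
  smooth e e' x f hx hf := (contDiffAt_absPow_jac hx (-w)).mul hf

theorem isTransition1 (w : 𝕜) : IsTransition 𝕜 (transition1 (n := n) (M := M) w) where
  map_add e e' x v v' := by
    funext i
    simp only [transition1, Pi.add_apply, mul_add, Finset.sum_add_distrib]
  map_smul e e' x c v := by
    funext i
    simp only [transition1, Pi.smul_apply, smul_eq_mul, Finset.mul_sum]
    exact Finset.sum_congr rfl fun k _ => by ring
  self e x v hx := by
    funext i
    simp [transition1, jac_self hx, Matrix.one_apply, apply_ite (RCLike.ofReal : ℝ → 𝕜)]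
  cocycle e e' e'' x v hx hx' := by
    funext i
    have hj : ∀ k, ((jac e e'' x i k : ℝ) : 𝕜) = ∑ l, ((jac e' e'' (trans e e' x) i l : ℝ) : 𝕜) *
        ((jac e e' x l k : ℝ) : 𝕜) := fun k => by
      rw [jac_trans hx hx', Matrix.mul_apply]; push_cast; rfl
    simp only [transition1, absPow_jac_trans hx hx', hj, Finset.mul_sum, Finset.sum_mul]
    rw [Finset.sum_comm]
    exact Finset.sum_congr rfl fun k _ => Finset.sum_congr rfl fun l _ => by ring
  smooth e e' x f hx hf := by
    have h1 := contDiffAt_absPow_jac hx (-w)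
    have h2 := fun i j => contDiffAt_jac hx i j
    have h3 := contDiffAt_pi.1 hf
    refine contDiffAt_pi.2 fun i => ?_
    unfold transition1
    fun_prop

theorem sum_tensor_comp (a b : Fin n → 𝕜) (B : Fin n → Fin n → 𝕜) (c : 𝕜)
    (v : Fin n → Fin n → 𝕜) :
    ∑ k, ∑ l, a k * b l * (c * ∑ r, ∑ t, B k r * B l t * v r t) =
      c * ∑ r, ∑ t, (∑ k, a k * B k r) * (∑ l, b l * B l t) * v r t := by
  simp only [Finset.mul_sum, Finset.sum_mul]
  rw [Finset.sum_congr rfl fun k _ => Finset.sum_comm, Finset.sum_comm]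
  refine Finset.sum_congr rfl fun r _ => ?_
  rw [Finset.sum_congr rfl fun k _ => Finset.sum_comm, Finset.sum_comm]
  refine Finset.sum_congr rfl fun t _ => ?_
  rw [Finset.sum_comm]
  exact Finset.sum_congr rfl fun k _ => Finset.sum_congr rfl fun l _ => by ring

theorem isTransition2 (w : 𝕜) : IsTransition 𝕜 (transition2 (n := n) (M := M) w) where
  map_add e e' x v v' := by
    funext i j
    simp only [transition2, Pi.add_apply, mul_add, Finset.sum_add_distrib]
  map_smul e e' x c v := by
    funext i j
    simp only [transition2, Pi.smul_apply, smul_eq_mul, Finset.mul_sum]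
    exact Finset.sum_congr rfl fun k _ => Finset.sum_congr rfl fun l _ => by ring
  self e x v hx := by
    funext i j
    simp [transition2, jac_self hx, Matrix.one_apply, apply_ite (RCLike.ofReal : ℝ → 𝕜)]
  cocycle e e' e'' x v hx hx' := by
    funext i j
    have hj : ∀ i k, ((jac e e'' x i k : ℝ) : 𝕜) =
        ∑ l, ((jac e' e'' (trans e e' x) i l : ℝ) : 𝕜) * ((jac e e' x l k : ℝ) : 𝕜) :=
      fun i k => by rw [jac_trans hx hx', Matrix.mul_apply]; push_cast; rfl
    simp only [transition2, absPow_jac_trans hx hx', hj, sum_tensor_comp]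
    ring
  smooth e e' x f hx hf := by
    have h1 := contDiffAt_absPow_jac hx (-w)
    have h2 := fun i j => contDiffAt_jac hx i j
    have h3 := fun i => contDiffAt_pi.1 (contDiffAt_pi.1 hf i)
    refine contDiffAt_pi.2 fun i => contDiffAt_pi.2 fun j => ?_
    unfold transition2
    fun_prop

variable [T2Space M] {e : Chart n M} {K : Set (E n)}

/-- The density which is `f` in the chart `e`, extended by zero. -/
def extDensity (w : 𝕜) (hK : IsCompact K) (hKe : K ⊆ e.1.target) {f : E n → 𝕜}
    (hf : SupportedIn K f) : Density n M w :=
  ⟨extField (transition0 w) e f, fun e' => (isTransition0 w).contDiffOn_extField e hK hKe hf e',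
    fun e' _ hx => extField_of_notMem e f e' hx,
    fun e' e'' _ hx => (isTransition0 w).extField_transform e f e' e'' hx⟩

/-- The symbol of degree one which is `f` in the chart `e`, extended by zero. -/
def extSymbol1 (w : 𝕜) (hK : IsCompact K) (hKe : K ⊆ e.1.target) {f : E n → Fin n → 𝕜}
    (hf : SupportedIn K f) : Symbol1 n M w :=
  ⟨extField (transition1 w) e f,
    fun e' => contDiffOn_pi.1 ((isTransition1 w).contDiffOn_extField e hK hKe hf e'),
    fun e' _ hx => extField_of_notMem e f e' hx,
    fun e' e'' _ hx i => congrFun ((isTransition1 w).extField_transform e f e' e'' hx) i⟩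

theorem transition2_symm (w : 𝕜) (e e' : Chart n M) (x : E n) {v : Fin n → Fin n → 𝕜}
    (hv : ∀ i j, v i j = v j i) (i j : Fin n) :
    transition2 w e e' x v i j = transition2 w e e' x v j i := by
  simp only [transition2]
  rw [Finset.sum_comm]
  congr 1
  exact Finset.sum_congr rfl fun k _ => Finset.sum_congr rfl fun l _ => by rw [hv l k]; ring

/-- The symmetric symbol of degree two which is `f` in the chart `e`, extended by zero. -/
def extSymbol2 (w : 𝕜) (hK : IsCompact K) (hKe : K ⊆ e.1.target) {f : E n → Fin n → Fin n → 𝕜}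
    (hf : SupportedIn K f) (hsym : ∀ x i j, f x i j = f x j i) : Symbol2 n M w :=
  ⟨extField (transition2 w) e f,
    fun e' i => contDiffOn_pi.1
      (contDiffOn_pi.1 ((isTransition2 w).contDiffOn_extField e hK hKe hf e') i),
    fun e' _ hx => extField_of_notMem e f e' hx,
    fun e' x i j => by
      simp only [extField]
      split_ifs
      · exact transition2_symm w _ _ _ (hsym _) i j
      · rfl,
    fun e' e'' _ hx i j =>
      congrFun (congrFun ((isTransition2 w).extField_transform e f e' e'' hx) i) j⟩

end Extension

/-! ### Cut-off functions and test densities -/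

section Cutoff

variable {n : ℕ} {V : Type*} [NormedAddCommGroup V] [NormedSpace ℝ V]

theorem exists_cutoff {U : Set (E n)} (hU : IsOpen U) {x : E n} (hx : x ∈ U) :
    ∃ (K : Set (E n)) (χ : E n → ℝ) (W : Set (E n)), IsCompact K ∧ K ⊆ U ∧ SupportedIn K χ ∧
      IsOpen W ∧ x ∈ W ∧ W ⊆ K ∧ ∀ y ∈ W, χ y = 1 := by
  obtain ⟨r, hr, hrU⟩ := Metric.nhds_basis_closedBall.mem_iff.1 (hU.mem_nhds hx)
  let χ : ContDiffBump x := ⟨r / 2, r, by positivity, by linarith⟩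
  refine ⟨Metric.closedBall x r, χ, Metric.ball x (r / 2), isCompact_closedBall x r, hrU,
    ⟨fun y => χ.contDiffAt, fun y hy => χ.zero_of_le_dist ?_⟩, Metric.isOpen_ball,
    Metric.mem_ball_self (by positivity), fun y hy => ?_, fun y hy => ?_⟩
  · exact (not_le.1 hy).le
  · exact Metric.closedBall_subset_closedBall (by linarith) (Metric.ball_subset_closedBall hy)
  · exact χ.one_of_mem_closedBall (Metric.ball_subset_closedBall hy)

/-- The function $f$ need be smooth only on $U$: at points outside of $U$ the product vanishes in a
neighbourhood, since $K$ is closed and contained in $U$. -/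
theorem SupportedIn.smul {K U : Set (E n)} (hK : IsCompact K) (hU : IsOpen U) (hKU : K ⊆ U)
    {χ : E n → ℝ} (hχ : SupportedIn K χ) {f : E n → V} (hf : ContDiffOn ℝ ∞ f U) :
    SupportedIn K (fun x => χ x • f x) where
  smooth x := by
    by_cases hx : x ∈ U
    · exact (hχ.smooth x).smul (hf.contDiffAt (hU.mem_nhds hx))
    · exact contDiffAt_congr (g := fun _ => (0 : V)) hK.isClosed.isOpen_compl
        (fun y hy => by rw [hχ.zero y hy, zero_smul]) (fun h => hx (hKU h)) contDiffAt_const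
  zero x hx := by rw [hχ.zero x hx, zero_smul]

theorem SupportedIn.add {K : Set (E n)} {f f' : E n → V} (hf : SupportedIn K f)
    (hf' : SupportedIn K f') : SupportedIn K (fun x => f x + f' x) :=
  ⟨fun x => (hf.smooth x).add (hf'.smooth x), fun x hx => by
    rw [hf.zero x hx, hf'.zero x hx, add_zero]⟩

theorem SupportedIn.pd {K : Set (E n)} (hK : IsClosed K) {f : E n → V} (hf : SupportedIn K f)
    (i : Fin n) : SupportedIn K (fun x => pd i f x) :=
  ⟨fun x => contDiffAt_pd i (hf.smooth x), fun x hx => by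
    rw [pd_congr (f := f) (g := fun _ => 0) hK.isOpen_compl (fun y hy => hf.zero y hy) hx, pd_const]⟩

variable {M : Type*} [TopologicalSpace M] [ChartedSpace (E n) M] {𝕜 : Type*} [RCLike 𝕜]

theorem contDiffAt_density {w : 𝕜} (φ : Density n M w) {e : Chart n M} {x : E n}
    (hx : x ∈ e.1.target) : ContDiffAt ℝ ∞ (φ.1 e) x :=
  (φ.2.1 e).contDiffAt (e.1.open_target.mem_nhds hx)

theorem contDiffAt_symbol1 {w : 𝕜} (P : Symbol1 n M w) {e : Chart n M} {x : E n}
    (hx : x ∈ e.1.target) (i : Fin n) : ContDiffAt ℝ ∞ (fun y => P.1 e y i) x :=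
  (P.2.1 e i).contDiffAt (e.1.open_target.mem_nhds hx)

theorem contDiffAt_symbol2 {w : 𝕜} (P : Symbol2 n M w) {e : Chart n M} {x : E n}
    (hx : x ∈ e.1.target) (i j : Fin n) : ContDiffAt ℝ ∞ (fun y => P.1 e y i j) x :=
  (P.2.1 e i j).contDiffAt (e.1.open_target.mem_nhds hx)

theorem density_transform {w : 𝕜} (φ : Density n M w) {e e' : Chart n M} {x : E n}
    (hx : x ∈ overlap e e') :
    φ.1 e x = absPow (jac e e' x).det w * φ.1 e' (trans e e' x) := by
  rw [φ.2.2.2 e e' x hx, ← mul_assoc, absPow_mul_absPow_neg, one_mul]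

variable [T2Space M] {e : Chart n M}

theorem extDensity_apply (w : 𝕜) {K : Set (E n)} (hK : IsCompact K) (hKe : K ⊆ e.1.target)
    {f : E n → 𝕜} (hf : SupportedIn K f) {x : E n} (hx : x ∈ e.1.target) :
    (extDensity w hK hKe hf).1 e x = f x :=
  (isTransition0 w).extField_self e f hx

theorem extSymbol1_apply (w : 𝕜) {K : Set (E n)} (hK : IsCompact K) (hKe : K ⊆ e.1.target)
    {f : E n → Fin n → 𝕜} (hf : SupportedIn K f) {x : E n} (hx : x ∈ e.1.target) :
    (extSymbol1 w hK hKe hf).1 e x = f x :=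
  (isTransition1 w).extField_self e f hx

theorem extSymbol2_apply (w : 𝕜) {K : Set (E n)} (hK : IsCompact K) (hKe : K ⊆ e.1.target)
    {f : E n → Fin n → Fin n → 𝕜} (hf : SupportedIn K f) (hs : ∀ x i j, f x i j = f x j i)
    {x : E n} (hx : x ∈ e.1.target) : (extSymbol2 w hK hKe hf hs).1 e x = f x :=
  (isTransition2 w).extField_self e f hx

/-- Near `x` the density `φ` is given by the function `u` in the chart `e`, and it has compact
support in the domain of this chart. -/
structure IsTest {w : 𝕜} (φ : Density n M w) (e : Chart n M) (u : E n → 𝕜) (x : E n) : Prop where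
  eq_near : ∃ W : Set (E n), IsOpen W ∧ x ∈ W ∧ W ⊆ e.1.target ∧ ∀ y ∈ W, φ.1 e y = u y
  lie : ∀ X : E n → E n, (∀ y i, ContDiffAt ℝ ∞ (fun z => X z i) y) → ∃ φ' : Density n M w,
    ∀ y ∈ e.1.target, φ'.1 e y = lieDensity w X (φ.1 e) y

/-- Cutting off $u$ gives a function with compact support, and its Lie derivative along a smooth
field has support in the same compact set, so both extend to global densities. The second extension
is required because equivariance refers to global densities only. -/
theorem exists_isTest (w : 𝕜) {u : E n → 𝕜} (hu : ContDiffOn ℝ ∞ u e.1.target) {x : E n}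
    (hx : x ∈ e.1.target) : ∃ φ : Density n M w, IsTest φ e u x := by
  obtain ⟨K, χ, W, hK, hKe, hχ, hW, hxW, hWK, h1⟩ := exists_cutoff e.1.open_target hx
  have hf := hχ.smul hK e.1.open_target hKe hu
  refine ⟨extDensity w hK hKe hf, ⟨W, hW, hxW, hWK.trans hKe, fun y hy => ?_⟩, fun X hX => ?_⟩
  · rw [extDensity_apply w hK hKe hf (hKe (hWK hy)), h1 y hy, one_smul]
  · have hf' : SupportedIn K (lieDensity w X (fun y => χ y • u y)) := by
      refine ⟨fun y => ?_, fun y hy => ?_⟩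
      · have h1 := hf.smooth y
        have h2 := hX y
        unfold lieDensity divergence
        fun_prop
      · have h2 : ∀ i, pd i (fun y => χ y • u y) y = 0 := fun i =>
          (hf.pd hK.isClosed i).zero y hy
        simp only [lieDensity, h2, hf.zero y hy, mul_zero, Finset.sum_const_zero, add_zero]
    refine ⟨extDensity w hK hKe hf', fun y hy => ?_⟩
    rw [extDensity_apply w hK hKe hf' hy]
    simp only [lieDensity, extDensity_apply w hK hKe hf hy]
    congr 1
    refine Finset.sum_congr rfl fun k _ => ?_
    rw [pd_congr e.1.open_target (fun z hz => extDensity_apply w hK hKe hf hz) hy]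

end Cutoff

/-! ### Principal symbols -/

section PrincipalSymbols

variable {𝕜 : Type*} [RCLike 𝕜] {n : ℕ} {a₂ b₂ : E n → Fin n → Fin n → 𝕜}
  {a₁ b₁ : E n → Fin n → 𝕜} {a₀ b₀ : E n → 𝕜}

theorem coordOp_congr {W : Set (E n)} (hW : IsOpen W) {f f' : E n → 𝕜} (h : ∀ y ∈ W, f y = f' y)
    {x : E n} (hx : x ∈ W) : coordOp a₂ a₁ a₀ f x = coordOp a₂ a₁ a₀ f' x := by
  have h1 : ∀ j, ∀ y ∈ W, pd j f y = pd j f' y := fun j y hy => pd_congr hW h hy j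
  simp only [coordOp, h x hx, h1 _ x hx, pd_congr hW (h1 _) hx]

/-- As two factors vanish at $x$, only second derivatives that hit both of them survive. The factor
$c$ stays undifferentiated; it will be a power of the Jacobian determinant. -/
theorem coordOp_mul_mul {W : Set (E n)} (hW : IsOpen W) {c u v : E n → 𝕜}
    (hc : ∀ y ∈ W, ContDiffAt ℝ ∞ c y) (hu : ∀ y ∈ W, ContDiffAt ℝ ∞ u y)
    (hv : ∀ y ∈ W, ContDiffAt ℝ ∞ v y) {x : E n} (hx : x ∈ W) (hux : u x = 0) (hvx : v x = 0) :
    coordOp a₂ a₁ a₀ (fun y => c y * (u y * v y)) x =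
      c x * ∑ i, ∑ j, a₂ x i j * (pd i u x * pd j v x + pd j u x * pd i v x) := by
  have h1 : ∀ j, ∀ y ∈ W, pd j (fun y => c y * (u y * v y)) y =
      pd j c y * (u y * v y) + c y * (pd j u y * v y + u y * pd j v y) := fun j y hy => by
    have := hc y hy; have := hu y hy; have := hv y hy
    simp (disch := fun_prop) only [pd_mul]
  have h2 : ∀ i j, pd i (pd j (fun y => c y * (u y * v y))) x =
      c x * (pd i u x * pd j v x + pd j u x * pd i v x) := fun i j => by
    rw [pd_congr hW (h1 j) hx]
    have := hc x hx; have := hu x hx; have := hv x hx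
    simp (disch := fun_prop) only [pd_mul, pd_add, hux, hvx]
    ring
  simp only [coordOp, h2, h1 _ x hx, hux, hvx, Finset.mul_sum]
  simp only [mul_zero, zero_mul, add_zero, Finset.sum_const_zero]
  exact Finset.sum_congr rfl fun i _ => Finset.sum_congr rfl fun j _ => by ring

theorem coordOp_mul {c u : E n → 𝕜} {x : E n} (hc : ContDiffAt ℝ ∞ c x)
    (hu : ContDiffAt ℝ ∞ u x) (hux : u x = 0) (h₂ : a₂ x = 0) :
    coordOp a₂ a₁ a₀ (fun y => c y * u y) x = c x * ∑ i, a₁ x i * pd i u x := by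
  simp only [coordOp, h₂, Pi.zero_apply, zero_mul, Finset.sum_const_zero, pd_mul _ hc hu, hux,
    mul_zero, zero_add, add_zero, Finset.mul_sum]
  exact Finset.sum_congr rfl fun i _ => by ring

theorem coordOp_zero {f : E n → 𝕜} {x : E n} (h₂ : a₂ x = 0) (h₁ : a₁ x = 0) :
    coordOp a₂ a₁ a₀ f x = a₀ x * f x := by
  simp [coordOp, h₂, h₁]

variable {M : Type*} [TopologicalSpace M] [ChartedSpace (E n) M]

theorem isOpen_overlap_preimage (e e' : Chart n M) {W : Set (E n)} (hW : IsOpen W) :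
    IsOpen (overlap e e' ∩ trans e e' ⁻¹' W) :=
  ContinuousOn.isOpen_inter_preimage
    (fun _ hy => (contDiffAt_trans hy).continuousAt.continuousWithinAt) (isOpen_overlap e e') hW

variable {lam mu : 𝕜} {A : Density n M lam →ₗ[𝕜] Density n M mu} {e e' : Chart n M}

theorem HasCoeffs.apply_isTest (h : HasCoeffs A e a₂ a₁ a₀) {φ : Density n M lam} {u : E n → 𝕜}
    {x : E n} (hφ : IsTest φ e u x) : (A φ).1 e x = coordOp a₂ a₁ a₀ u x := by
  obtain ⟨W, hW, hx, hWe, heq⟩ := hφ.eq_near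
  rw [h.apply_eq φ x (hWe hx), coordOp_congr hW heq hx]

variable [T2Space M]

/-- The values of one operator on a test density are computed in both charts, which turns the
transformation law of densities into a relation between the coefficients. -/
theorem HasCoeffs.coordOp_trans (h : HasCoeffs A e a₂ a₁ a₀) (h' : HasCoeffs A e' b₂ b₁ b₀)
    {u : E n → 𝕜} (hu : ContDiffOn ℝ ∞ u e'.1.target) {x : E n} (hx : x ∈ overlap e e') :
    coordOp b₂ b₁ b₀ u (trans e e' x) = absPow (jac e e' x).det (-mu) *
      coordOp a₂ a₁ a₀ (fun y => absPow (jac e e' y).det lam * u (trans e e' y)) x := by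
  obtain ⟨φ, hφ⟩ := exists_isTest lam hu (trans_mem_overlap hx).1
  rw [← h'.apply_isTest hφ, (A φ).2.2.2 e e' x hx, h.apply_eq φ x hx.1]
  obtain ⟨W, hW, hxW, hWe, heq⟩ := hφ.eq_near
  congr 1
  refine coordOp_congr (isOpen_overlap_preimage e e' hW) (fun y hy => ?_) ⟨hx, hxW⟩
  rw [density_transform φ hy.1, heq _ hy.2]

/-- The function `x'^k - c^k` of the coordinates. -/
def coordFun (c : E n) (k : Fin n) (y : E n) : 𝕜 := ((y k - c k : ℝ) : 𝕜)

@[fun_prop]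
theorem contDiffAt_coordFun (c : E n) (k : Fin n) (x : E n) :
    ContDiffAt ℝ ∞ (coordFun (𝕜 := 𝕜) c k) x := by
  have := contDiffAt_coord k (x := x)
  unfold coordFun
  fun_prop

theorem coordFun_self (c : E n) (k : Fin n) : coordFun (𝕜 := 𝕜) c k c = 0 := by simp [coordFun]

theorem pd_coordFun (c : E n) (k i : Fin n) (x : E n) :
    pd i (coordFun (𝕜 := 𝕜) c k) x = if k = i then 1 else 0 := by
  have h := contDiffAt_coord k (x := x)
  have h1 : coordFun (𝕜 := 𝕜) c k = fun y => ((y k - c k : ℝ) : 𝕜) := rfl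
  rw [h1, pd_ofReal i (by fun_prop), pd_sub i h contDiffAt_const, pd_coord, pd_const]
  split_ifs <;> simp

theorem contDiffAt_coordFun_trans (c : E n) (k : Fin n) {x : E n} (hx : x ∈ overlap e e') :
    ContDiffAt ℝ ∞ (fun y => coordFun (𝕜 := 𝕜) c k (trans e e' y)) x :=
  (contDiffAt_coordFun c k _).comp x (contDiffAt_trans hx)

theorem pd_coordFun_trans (c : E n) (k i : Fin n) {x : E n} (hx : x ∈ overlap e e') :
    pd i (fun y => coordFun (𝕜 := 𝕜) c k (trans e e' y)) x = ((jac e e' x k i : ℝ) : 𝕜) := by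
  rw [pd_comp_mul i (contDiffAt_coordFun c k _) (contDiffAt_trans hx)]
  simp [pd_coordFun, jac]

/-- The operator is tested on products of two coordinate functions of $e'$ vanishing at the point.
These detect only the leading coefficients, and their derivatives in the chart $e$ are entries of
the Jacobian matrix. -/
theorem HasCoeffs.principal₂ (h : HasCoeffs A e a₂ a₁ a₀) (h' : HasCoeffs A e' b₂ b₁ b₀)
    {x : E n} (hx : x ∈ overlap e e') :
    b₂ (trans e e' x) = transition2 (mu - lam) e e' x (a₂ x) := by
  funext k l
  have hx' := (trans_mem_overlap hx).1
  set c := trans e e' x with hc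
  -- The factor $1$ brings the test function into the form required by `coordOp_mul_mul`.
  have h1 := h.coordOp_trans h' (u := fun y => 1 * (coordFun c k y * coordFun c l y))
    (fun y _ => ContDiffAt.contDiffWithinAt (by fun_prop)) hx
  rw [coordOp_mul_mul isOpen_univ (fun _ _ => contDiffAt_const) (fun y _ => contDiffAt_coordFun c k y)
    (fun y _ => contDiffAt_coordFun c l y) (Set.mem_univ _) (coordFun_self c k)
    (coordFun_self c l)] at h1
  simp only [one_mul] at h1
  rw [coordOp_mul_mul (isOpen_overlap e e') (fun y hy => contDiffAt_absPow_jac hy lam)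
    (fun y hy => contDiffAt_coordFun_trans c k hy) (fun y hy => contDiffAt_coordFun_trans c l hy)
    hx (coordFun_self c k) (coordFun_self c l)] at h1
  simp only [pd_coordFun, pd_coordFun_trans c _ _ hx] at h1
  simp only [mul_add, Finset.sum_add_distrib] at h1
  simp only [mul_ite, mul_one, mul_zero, Finset.sum_ite_eq,
    Finset.sum_ite_irrel, Finset.sum_const_zero, Finset.mem_univ, if_true] at h1
  -- Only the symmetric part of the coefficients is detected, twice; the symmetry required in
  -- `HasCoeffs` makes this sufficient.
  have h2 : b₂ c k l + b₂ c l k = 2 * b₂ c k l := by rw [h'.symm c hx' l k]; ring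
  have h3 : ∑ i, ∑ j, a₂ x i j * (((jac e e' x k j : ℝ) : 𝕜) * ((jac e e' x l i : ℝ) : 𝕜)) =
      ∑ i, ∑ j, a₂ x i j * (((jac e e' x k i : ℝ) : 𝕜) * ((jac e e' x l j : ℝ) : 𝕜)) := by
    rw [Finset.sum_comm]
    exact Finset.sum_congr rfl fun i _ => Finset.sum_congr rfl fun j _ => by
      rw [h.symm x hx.1 j i]
  rw [h2, h3] at h1
  -- The exponent $-\mu$ comes from the target densities and $\lambda$ from the source densities, so
  -- leading coefficients have weight $\mu-\lambda$.
  rw [transition2, show -(mu - lam) = -mu + lam by ring, absPow_add]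
  have h4 : ∑ i, ∑ j, a₂ x i j * (((jac e e' x k i : ℝ) : 𝕜) * ((jac e e' x l j : ℝ) : 𝕜)) =
      ∑ i, ∑ j, ((jac e e' x k i : ℝ) : 𝕜) * ((jac e e' x l j : ℝ) : 𝕜) * a₂ x i j :=
    Finset.sum_congr rfl fun i _ => Finset.sum_congr rfl fun j _ => by ring
  rw [h4] at h1
  have h5 : (2 : 𝕜) ≠ 0 := two_ne_zero
  apply mul_left_cancel₀ h5
  rw [h1]
  ring

theorem HasCoeffs.principal₁ (h : HasCoeffs A e a₂ a₁ a₀) (h' : HasCoeffs A e' b₂ b₁ b₀)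
    {x : E n} (hx : x ∈ overlap e e') (ha₂ : a₂ x = 0) (hb₂ : b₂ (trans e e' x) = 0) :
    b₁ (trans e e' x) = transition1 (mu - lam) e e' x (a₁ x) := by
  funext k
  set c := trans e e' x with hc
  have h1 := h.coordOp_trans h' (u := fun y => 1 * coordFun c k y)
    (fun y _ => ContDiffAt.contDiffWithinAt (by fun_prop)) hx
  rw [coordOp_mul contDiffAt_const (contDiffAt_coordFun c k _) (coordFun_self c k) hb₂] at h1
  simp only [one_mul] at h1
  rw [coordOp_mul (contDiffAt_absPow_jac hx lam) (contDiffAt_coordFun_trans c k hx)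
    (coordFun_self c k) ha₂] at h1
  simp only [pd_coordFun, pd_coordFun_trans c _ _ hx, mul_ite, mul_one, mul_zero,
    Finset.sum_ite_eq, Finset.mem_univ, if_true] at h1
  rw [h1, transition1, show -(mu - lam) = -mu + lam by ring, absPow_add, ← mul_assoc]
  congr 1
  exact Finset.sum_congr rfl fun i _ => by ring

theorem HasCoeffs.principal₀ (h : HasCoeffs A e a₂ a₁ a₀) (h' : HasCoeffs A e' b₂ b₁ b₀)
    {x : E n} (hx : x ∈ overlap e e') (ha₂ : a₂ x = 0) (hb₂ : b₂ (trans e e' x) = 0)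
    (ha₁ : a₁ x = 0) (hb₁ : b₁ (trans e e' x) = 0) :
    b₀ (trans e e' x) = transition0 (mu - lam) e e' x (a₀ x) := by
  have h1 := h.coordOp_trans h' (u := fun _ => 1) contDiffOn_const hx
  rw [coordOp_zero hb₂ hb₁, coordOp_zero ha₂ ha₁] at h1
  rw [transition0, show -(mu - lam) = -mu + lam by ring, absPow_add]
  linear_combination h1

/-- Uniqueness of the leading coefficients is the transformation law for the trivial change of
coordinates. -/
theorem HasCoeffs.eq₂ (h : HasCoeffs A e a₂ a₁ a₀) (h' : HasCoeffs A e b₂ b₁ b₀) {x : E n}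
    (hx : x ∈ e.1.target) : b₂ x = a₂ x := by
  have h1 := h.principal₂ h' (x := x) (by rwa [overlap_self])
  rwa [trans_self hx, (isTransition2 _).self e x _ hx] at h1

theorem HasCoeffs.eq₁ (h : HasCoeffs A e a₂ a₁ a₀) (h' : HasCoeffs A e b₂ b₁ b₀) {x : E n}
    (hx : x ∈ e.1.target) (h₂ : a₂ x = 0) : b₁ x = a₁ x := by
  have h1 := h.principal₁ h' (x := x) (by rwa [overlap_self]) h₂
    (by rw [trans_self hx, h.eq₂ h' hx, h₂])
  rwa [trans_self hx, (isTransition1 _).self e x _ hx] at h1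

theorem HasCoeffs.eq₀ (h : HasCoeffs A e a₂ a₁ a₀) (h' : HasCoeffs A e b₂ b₁ b₀) {x : E n}
    (hx : x ∈ e.1.target) (h₂ : a₂ x = 0) (h₁ : a₁ x = 0) : b₀ x = a₀ x := by
  have h1 := h.principal₀ h' (x := x) (by rwa [overlap_self]) h₂
    (by rw [trans_self hx, h.eq₂ h' hx, h₂]) h₁ (by rw [trans_self hx, h.eq₁ h' hx h₂, h₁])
  rwa [trans_self hx, (isTransition0 _).self e x _ hx] at h1

end PrincipalSymbols

/-! ### The Casimir operator of the conformal Lie algebra -/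

section Casimir

variable {n : ℕ} {V : Type*} [NormedAddCommGroup V] [NormedSpace ℝ V]

/-- The differential of a vector field. -/
def dmat (X : E n → E n) (x : E n) : Matrix (Fin n) (Fin n) ℝ :=
  Matrix.of fun i k => pd k (fun y => X y i) x

/-- The Lie derivative of fields with values in the representation `ρ` of `gl(n)`. -/
def lieGen (ρ : Matrix (Fin n) (Fin n) ℝ →ₗ[ℝ] (V →L[ℝ] V)) (X : E n → E n) (f : E n → V)
    (x : E n) : V :=
  ∑ k, X x k • pd k f x + ρ (dmat X x) (f x)

/-- The constant vector fields. -/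
def constField (i : Fin n) : E n → E n := fun _ => EuclideanSpace.single i 1

/-- The infinitesimal rotations. -/
def rotField (p : ℕ) (i j : Fin n) : E n → E n := fun x =>
  (eta p i * x i) • EuclideanSpace.single j 1 - (eta p j * x j) • EuclideanSpace.single i 1

/-- The infinitesimal inversions. -/
def invField (p : ℕ) (i : Fin n) : E n → E n := fun x =>
  (∑ j, eta p j * x j * x j) • EuclideanSpace.single i 1 - (2 * (eta p i * x i)) • x

theorem constField_mem (p : ℕ) (i : Fin n) : constField i ∈ confAlgebra n p :=
  Submodule.subset_span (Or.inl (Or.inl (Or.inl ⟨i, rfl⟩)))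

theorem rotField_mem (p : ℕ) (i j : Fin n) : rotField p i j ∈ confAlgebra n p :=
  Submodule.subset_span (Or.inl (Or.inl (Or.inr ⟨i, j, rfl⟩)))

theorem id_mem (p : ℕ) : (fun x => x) ∈ confAlgebra n p :=
  Submodule.subset_span (Or.inl (Or.inr rfl))

theorem invField_mem (p : ℕ) (i : Fin n) : invField p i ∈ confAlgebra n p :=
  Submodule.subset_span (Or.inr ⟨i, rfl⟩)

/-- The matrices of the infinitesimal rotations. -/
def rotMat (p : ℕ) (a b : Fin n) : Matrix (Fin n) (Fin n) ℝ :=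
  Matrix.of fun m k => (if b = m then if a = k then eta p a else 0 else 0)
    - (if a = m then if b = k then eta p b else 0 else 0)

theorem rotMat_swap (p : ℕ) (a b : Fin n) : rotMat p b a = -rotMat p a b := by
  ext m k; simp [rotMat]

theorem dmat_constField (i : Fin n) (x : E n) : dmat (constField i) x = 0 := by
  ext m k; simp [dmat, constField]

theorem dmat_id (x : E n) : dmat (fun y : E n => y) x = 1 := by
  ext m k; simp [dmat, pd_coord, Matrix.one_apply]

theorem dmat_rotField (p : ℕ) (a b : Fin n) (x : E n) :
    dmat (rotField p a b) x = rotMat p a b := by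
  ext m k
  have h := fun i => contDiffAt_coord i (x := x)
  simp only [dmat, rotField, rotMat, Matrix.of_apply, PiLp.sub_apply, PiLp.smul_apply, smul_eq_mul,
    PiLp.single_apply]
  simp (disch := fun_prop) only [pd_sub, pd_mul_const, pd_const_mul, pd_coord]
  congr 1 <;> simp [eq_comm]

theorem dmat_invField (p : ℕ) (i : Fin n) (x : E n) :
    dmat (invField p i) x = (2 : ℝ) • ∑ a, x a • rotMat p a i - (2 * (eta p i * x i)) • 1 := by
  ext m k
  have h := fun i => contDiffAt_coord i (x := x)
  simp only [dmat, invField, rotMat, Matrix.of_apply, PiLp.sub_apply, PiLp.smul_apply, smul_eq_mul,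
    PiLp.single_apply]
  simp (disch := fun_prop) only [pd_sub, pd_mul_const, pd_const_mul, pd_coord, pd_sum, pd_mul]
  simp only [Matrix.sub_apply, Matrix.smul_apply, Matrix.sum_apply, Matrix.of_apply, smul_eq_mul,
    Matrix.one_apply, mul_ite, ite_mul, mul_one, mul_zero, zero_mul, mul_sub,
    Finset.sum_add_distrib, Finset.sum_sub_distrib, Finset.sum_ite_eq',
    Finset.mem_univ, if_true, Finset.sum_ite_irrel, Finset.sum_const_zero]
  by_cases h1 : m = i <;> by_cases h2 : i = k <;> by_cases h3 : m = k <;> simp_all [eq_comm] <;>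
    ring

variable (ρ : Matrix (Fin n) (Fin n) ℝ →ₗ[ℝ] (V →L[ℝ] V)) (p : ℕ) (f : E n → V) (x : E n)

theorem lieGen_constField (i : Fin n) : lieGen ρ (constField i) f x = pd i f x := by
  rw [lieGen, dmat_constField]
  simp [constField, PiLp.single_apply, ite_smul]

theorem lieGen_id : lieGen ρ (fun y => y) f x = ∑ k, x k • pd k f x + ρ 1 (f x) := by
  rw [lieGen, dmat_id]

theorem lieGen_rotField (a b : Fin n) : lieGen ρ (rotField p a b) f x =
    (eta p a * x a) • pd b f x - (eta p b * x b) • pd a f x + ρ (rotMat p a b) (f x) := by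
  rw [lieGen, dmat_rotField]
  simp [rotField, PiLp.single_apply, sub_smul, ite_smul, Finset.sum_sub_distrib]

theorem lieGen_invField (i : Fin n) : lieGen ρ (invField p i) f x =
    (∑ j, eta p j * x j * x j) • pd i f x - (2 * (eta p i * x i)) • ∑ k, x k • pd k f x +
      ((2 : ℝ) • ∑ a, x a • ρ (rotMat p a i) (f x) - (2 * (eta p i * x i)) • ρ 1 (f x)) := by
  rw [lieGen, dmat_invField]
  congr 1
  · simp [invField, PiLp.single_apply, sub_smul, ite_smul, Finset.sum_sub_distrib, Finset.smul_sum,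
      mul_smul]
  · simp [map_sub, map_smul, map_sum, sum_apply]

/-- The Casimir operator. -/
def casimir : V :=
  -lieGen ρ (fun y => y) (lieGen ρ (fun y => y) f) x + (n : ℝ) • lieGen ρ (fun y => y) f x
    - ∑ i, eta p i • lieGen ρ (invField p i) (lieGen ρ (constField i) f) x
    + ∑ a, ∑ b, (eta p a * eta p b / 2) •
      lieGen ρ (rotField p a b) (lieGen ρ (rotField p a b) f) x

variable {f x}

/-- A double sum only sees the symmetrization of its summand, so an expression symmetric in $a,b$
may be replaced by a shorter one that is not. -/
theorem sum_sum_eq_of_half (T U G : Fin n → Fin n → V)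
    (h : ∀ a b, T a b = (1 / 2 : ℝ) • (U a b + U b a) + G a b) :
    ∑ a, ∑ b, T a b = ∑ a, ∑ b, U a b + ∑ a, ∑ b, G a b := by
  have h1 : ∑ a, ∑ b, U b a = ∑ a, ∑ b, U a b := Finset.sum_comm
  simp only [h, Finset.sum_add_distrib, ← Finset.smul_sum, h1]
  congr 1
  module

/-- All terms with derivatives of $f$ cancel. The terms $x_a^2\partial_b^2$ cancel between rotations
and inversions; the terms $x_ax_b\partial_a\partial_b$ and $x_a\partial_a$ cancel once the Euler
field is included. The mixed terms with $\rho$ of a rotation cancel between rotations and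
inversions, those with $\rho(1)$ between the Euler field and inversions. -/
theorem casimir_eq (hf : ContDiffAt ℝ ∞ f x) :
    casimir ρ p f x = (n : ℝ) • ρ 1 (f x) - ρ 1 (ρ 1 (f x)) + ∑ a, ∑ b, (eta p a * eta p b / 2) •
      ρ (rotMat p a b) (ρ (rotMat p a b) (f x)) := by
  have hc := fun i (y : E n) => contDiffAt_coord i (x := y)
  have hH : ∀ i j, pd i (fun y => pd j f y) x = pd j (fun y => pd i f y) x :=
    fun i j => pd_comm i j hf
  have hρ : ∀ (A : V →L[ℝ] V) i, pd i (fun y => A (f y)) x = A (pd i f x) := fun A i =>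
    pd_clm A i hf
  have hρs : ∀ (A : V →L[ℝ] V), ContDiffAt ℝ ∞ (fun y => A (f y)) x := fun A =>
    A.contDiff.contDiffAt.comp x hf
  have hcx := fun i => hc i x
  have hE : lieGen ρ (fun y => y) (lieGen ρ (fun y => y) f) x =
      ∑ a, x a • pd a f x + ∑ a, ∑ b, (x a * x b) • pd a (fun y => pd b f y) x +
        (2 : ℝ) • ∑ a, x a • ρ 1 (pd a f x) + ρ 1 (ρ 1 (f x)) := by
    rw [lieGen_id]
    have h1 : lieGen ρ (fun y => y) f = fun y => ∑ k, y k • pd k f y + ρ 1 (f y) :=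
      funext fun y => lieGen_id ρ f y
    rw [h1]
    have h2 : ∀ k, pd k (fun y => ∑ k, y k • pd k f y + ρ 1 (f y)) x =
        pd k f x + ∑ b, x b • pd k (fun y => pd b f y) x + ρ 1 (pd k f x) := fun k => by
      have h3 := hρs (ρ 1)
      rw [pd_add k (by fun_prop) h3, pd_sum k (by fun_prop), hρ]
      congr 1
      simp (disch := fun_prop) only [pd_smul, pd_coord, Finset.sum_add_distrib, ite_smul, one_smul,
        zero_smul, Finset.sum_ite_eq', Finset.mem_univ, if_true]
    simp only [h2, smul_add, Finset.sum_add_distrib, map_add, map_sum, map_smul, Finset.smul_sum,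
      mul_smul, two_smul]
    abel
  have hI : ∑ i, eta p i • lieGen ρ (invField p i) (lieGen ρ (constField i) f) x =
      ∑ a, ∑ b, (eta p a * eta p b * x a * x a) • pd b (fun y => pd b f y) x
      - (2 : ℝ) • ∑ a, ∑ b, (x a * x b) • pd a (fun y => pd b f y) x
      + (2 : ℝ) • ∑ a, ∑ b, (x a * eta p b) • ρ (rotMat p a b) (pd b f x)
      - (2 : ℝ) • ∑ a, x a • ρ 1 (pd a f x) := by
    have h1 : ∀ i, lieGen ρ (constField i) f = fun y => pd i f y :=
      fun i => funext fun y => lieGen_constField ρ f y i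
    simp only [h1, lieGen_invField]
    rw [Finset.sum_comm (f := fun a b => (eta p a * eta p b * x a * x a) • _),
      Finset.sum_comm (f := fun a b => (x a * eta p b) • _),
      Finset.sum_comm (f := fun a b => (x a * x b) • _)]
    simp only [smul_add, smul_sub, Finset.smul_sum, Finset.sum_smul, Finset.sum_add_distrib,
      Finset.sum_sub_distrib, smul_smul]
    have h2 : ∀ i, eta p i * (2 * (eta p i * x i)) = 2 * x i := fun i => by
      linear_combination (2 * x i) * eta_mul_self (p := p) i
    have e1 : ∀ i j : Fin n, eta p i * (eta p j * x j * x j) = eta p j * eta p i * x j * x j :=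
      fun i j => by ring
    have e2 : ∀ i j : Fin n, eta p i * (2 * (eta p i * x i) * x j) = 2 * (x j * x i) := fun i j => by
      linear_combination (2 * x i * x j) * eta_mul_self (p := p) i
    have e3 : ∀ i j : Fin n, eta p i * (2 * x j) = 2 * (x j * eta p i) := fun i j => by ring
    simp only [h2, e1, e2, e3]
    abel
  have hR : ∑ a, ∑ b, (eta p a * eta p b / 2) •
      lieGen ρ (rotField p a b) (lieGen ρ (rotField p a b) f) x =
      ∑ a, x a • pd a f x
      + ∑ a, ∑ b, (eta p a * eta p b * x a * x a) • pd b (fun y => pd b f y) x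
      - (n : ℝ) • ∑ a, x a • pd a f x
      - ∑ a, ∑ b, (x a * x b) • pd a (fun y => pd b f y) x
      + (2 : ℝ) • ∑ a, ∑ b, (x a * eta p b) • ρ (rotMat p a b) (pd b f x)
      + ∑ a, ∑ b, (eta p a * eta p b / 2) • ρ (rotMat p a b) (ρ (rotMat p a b) (f x)) := by
    -- The representative chosen is not symmetric; the case $a=b$ records the derivative of a
    -- coordinate along its own direction.
    rw [sum_sum_eq_of_half _ (fun a b => (if a = b then x a else 0) • pd b f x
      + (eta p a * eta p b * x a * x a) • pd b (fun y => pd b f y) x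
      - x a • pd a f x - (x a * x b) • pd a (fun y => pd b f y) x
      + (2 * (x a * eta p b)) • ρ (rotMat p a b) (pd b f x))
      (fun a b => (eta p a * eta p b / 2) • ρ (rotMat p a b) (ρ (rotMat p a b) (f x)))]
    · simp only [Finset.sum_add_distrib, Finset.sum_sub_distrib, ite_smul, zero_smul,
        Finset.sum_ite_eq, Finset.mem_univ, if_true, Finset.sum_const, Finset.card_univ,
        Fintype.card_fin, Finset.smul_sum, mul_smul, Nat.cast_smul_eq_nsmul]
    · intro a b
      have h1 : lieGen ρ (rotField p a b) f = fun y => (eta p a * y a) • pd b f y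
          - (eta p b * y b) • pd a f y + ρ (rotMat p a b) (f y) :=
        funext fun y => lieGen_rotField ρ p f y a b
      have h3 := hρs (ρ (rotMat p a b))
      have h2 : ∀ k, pd k (fun y => (eta p a * y a) • pd b f y
          - (eta p b * y b) • pd a f y + ρ (rotMat p a b) (f y)) x =
          (eta p a * if a = k then 1 else 0) • pd b f x
          + (eta p a * x a) • pd k (fun y => pd b f y) x
          - ((eta p b * if b = k then 1 else 0) • pd a f x
          + (eta p b * x b) • pd k (fun y => pd a f y) x) + ρ (rotMat p a b) (pd k f x) := fun k => by
        rw [pd_add k (by fun_prop) h3, hρ]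
        simp (disch := fun_prop) only [pd_smul, pd_sub, pd_const_mul, pd_coord]
      rw [lieGen_rotField, h1, h2, h2, hH b a]
      have h4 := eta_mul_self (p := p) a
      have h5 := eta_mul_self (p := p) b
      rw [rotMat_swap p a b]
      simp only [map_add, map_sub, map_smul, map_neg, neg_apply, if_true,
        mul_one]
      by_cases hab : a = b
      · subst hab
        simp only [if_true, mul_one]
        match_scalars <;> grind
      · simp only [if_neg hab, if_neg (Ne.symm hab), mul_zero, zero_smul]
        match_scalars <;> grind
  rw [casimir, hE, hI, hR, lieGen_id]
  module

end Casimir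

/-! ### Vanishing of intertwiners between different Casimir eigenvalues -/

section Intertwiners

variable {n : ℕ} {V W : Type*} [NormedAddCommGroup V] [NormedSpace ℝ V]
  [NormedAddCommGroup W] [NormedSpace ℝ W]

/-- The action of the Casimir operator on the fibre. -/
def casimirFibre (ρ : Matrix (Fin n) (Fin n) ℝ →ₗ[ℝ] (V →L[ℝ] V)) (p : ℕ) (v : V) : V :=
  (n : ℝ) • ρ 1 v - ρ 1 (ρ 1 v) + ∑ a, ∑ b, (eta p a * eta p b / 2) •
    ρ (rotMat p a b) (ρ (rotMat p a b) v)

theorem lieGen_congr (ρ : Matrix (Fin n) (Fin n) ℝ →ₗ[ℝ] (V →L[ℝ] V)) (X : E n → E n)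
    {U : Set (E n)} (hU : IsOpen U) {f f' : E n → V} (h : ∀ y ∈ U, f y = f' y) {x : E n}
    (hx : x ∈ U) : lieGen ρ X f x = lieGen ρ X f' x := by
  simp only [lieGen, h x hx, pd_congr hU h hx]

variable {𝕜 : Type*} [RCLike 𝕜] [NormedSpace 𝕜 V] [NormedSpace 𝕜 W]
  [IsScalarTower ℝ 𝕜 V] [IsScalarTower ℝ 𝕜 W]

/-- A linear map which commutes with the conformal Lie algebra vanishes if the Casimir operators
have no common eigenvalue. -/
theorem eq_zero_of_intertwines {p : ℕ} {ρ : Matrix (Fin n) (Fin n) ℝ →ₗ[ℝ] (V →L[ℝ] V)}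
    {σ : Matrix (Fin n) (Fin n) ℝ →ₗ[ℝ] (W →L[ℝ] W)} {S : Submodule 𝕜 (E n → V)}
    (hS : ∀ f ∈ S, ∀ x, ContDiffAt ℝ ∞ f x)
    (hL : ∀ X ∈ confAlgebra n p, ∀ f ∈ S, lieGen ρ X f ∈ S) (b : S →ₗ[𝕜] (E n → W))
    {U : Set (E n)} (hU : IsOpen U) (hb : ∀ f, ∀ x ∈ U, ContDiffAt ℝ ∞ (b f) x)
    (hint : ∀ X ∈ confAlgebra n p, ∀ f f' : S, f'.1 = lieGen ρ X f.1 →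
      ∀ x ∈ U, b f' x = lieGen σ X (b f) x)
    {c γ γ' : 𝕜} (hc : ∀ v, casimirFibre σ p v = c • v)
    (hγ : ∀ f ∈ S, ∀ x, casimirFibre ρ p (casimirFibre ρ p (f x)) =
      (γ + γ') • casimirFibre ρ p (f x) - (γ * γ') • f x)
    (h1 : c ≠ γ) (h2 : c ≠ γ') (f : S) {x : E n} (hx : x ∈ U) : b f x = 0 := by
  let L : ∀ X ∈ confAlgebra n p, S → S := fun X hX f => ⟨lieGen ρ X f.1, hL X hX f.1 f.2⟩
  have hLL : ∀ X Y (hX : X ∈ confAlgebra n p) (hY : Y ∈ confAlgebra n p) (f : S),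
      ∀ x ∈ U, b (L X hX (L Y hY f)) x = lieGen σ X (lieGen σ Y (b f)) x := by
    intro X Y hX hY f x hx
    rw [hint X hX _ _ rfl x hx, lieGen_congr σ X hU (fun y hy => hint Y hY f _ rfl y hy) hx]
  -- The Casimir operator as a self-map of the space of fields: it is available before $b$ is
  -- applied because the space is stable under all Lie derivatives.
  let C : S → S := fun f => -L _ (id_mem p) (L _ (id_mem p) f) + (n : ℝ) • L _ (id_mem p) f
    - ∑ i, eta p i • L _ (invField_mem p i) (L _ (constField_mem p i) f)
    + ∑ i, ∑ j, (eta p i * eta p j / 2) • L _ (rotField_mem p i j) (L _ (rotField_mem p i j) f)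
  have hC : ∀ f : S, ∀ x, (C f).1 x = casimirFibre ρ p (f.1 x) := fun f x => by
    have := casimir_eq ρ p (hS f.1 f.2 x)
    rw [casimirFibre, ← this, casimir]
    simp [C, L, Finset.sum_apply]
  have hbC : ∀ f : S, ∀ x ∈ U, b (C f) x = c • b f x := fun f x hx => by
    have := casimir_eq σ p (hb f x hx)
    rw [← hc, casimirFibre, ← this, casimir]
    simp only [C, map_add, map_sub, map_neg, map_sum, LinearMap.map_smul_of_tower, Pi.add_apply,
      Pi.sub_apply, Pi.neg_apply, Pi.smul_apply, Finset.sum_apply, hLL _ _ _ _ f x hx,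
      map_neg]
    rw [hint _ (id_mem p) f (L _ (id_mem p) f) rfl x hx]
  have h3 : C (C f) = (γ + γ') • C f - (γ * γ') • f := by
    ext1
    funext y
    simp only [hC, Submodule.coe_sub, Submodule.coe_smul, Pi.sub_apply, Pi.smul_apply]
    exact hγ f.1 f.2 y
  have h4 := congrFun (congrArg b h3) x
  simp only [map_sub, map_smul, Pi.sub_apply, Pi.smul_apply, hbC _ x hx] at h4
  -- Since $b$ turns the Casimir operator into multiplication by $c$, applying $b$ to its quadratic
  -- equation gives this product.
  have h5 : ((c - γ) * (c - γ')) • b f x = 0 := by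
    have h6 : ((c - γ) * (c - γ')) • b f x =
      c • c • b f x - ((γ + γ') • c • b f x - (γ * γ') • b f x) := by module
    rw [h6, h4, sub_self]
  exact (smul_eq_zero.1 h5).resolve_left (mul_ne_zero (sub_ne_zero.2 h1) (sub_ne_zero.2 h2))

end Intertwiners

/-! ### Casimir eigenvalues on densities and symbols -/

section Representations

variable {n : ℕ} {𝕜 : Type*} [RCLike 𝕜]

/-- The representation of `gl(n)` defining the densities of degree `w`. -/
def rep0 (w : 𝕜) : Matrix (Fin n) (Fin n) ℝ →ₗ[ℝ] (𝕜 →L[ℝ] 𝕜) where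
  toFun A :=
    { toFun := fun v => w * ((A.trace : ℝ) : 𝕜) * v
      map_add' := fun u v => mul_add _ _ _
      map_smul' := fun r v => by simp [RCLike.real_smul_eq_coe_mul]; ring
      cont := by fun_prop }
  map_add' A B := by ext v; simp [Matrix.trace_add, mul_add, add_mul]
  map_smul' r A := by ext v; simp [Matrix.trace_smul, RCLike.real_smul_eq_coe_mul]; ring

/-- The representation of `gl(n)` defining the symbols of degree one. -/
def rep1 (w : 𝕜) : Matrix (Fin n) (Fin n) ℝ →ₗ[ℝ] ((Fin n → 𝕜) →L[ℝ] (Fin n → 𝕜)) where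
  toFun A :=
    { toFun := fun v i => w * ((A.trace : ℝ) : 𝕜) * v i - ∑ k, v k * ((A i k : ℝ) : 𝕜)
      map_add' := fun u v => by
        funext i; simp only [Pi.add_apply, add_mul, mul_add, Finset.sum_add_distrib]; ring
      map_smul' := fun r v => by
        funext i
        simp only [Pi.smul_apply, RCLike.real_smul_eq_coe_mul, RingHom.id_apply, mul_sub,
          Finset.mul_sum, mul_assoc, mul_left_comm]
      cont := by fun_prop }
  map_add' A B := by
    ext v i
    simp [Matrix.trace_add, mul_add, add_mul, Finset.sum_add_distrib]; ring
  map_smul' r A := by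
    ext v i
    simp [Matrix.trace_smul, RCLike.real_smul_eq_coe_mul, mul_sub, Finset.mul_sum, mul_assoc,
      mul_left_comm]

/-- The representation of `gl(n)` defining the symbols of degree two. -/
def rep2 (w : 𝕜) :
    Matrix (Fin n) (Fin n) ℝ →ₗ[ℝ] ((Fin n → Fin n → 𝕜) →L[ℝ] (Fin n → Fin n → 𝕜)) where
  toFun A :=
    { toFun := fun v i j => w * ((A.trace : ℝ) : 𝕜) * v i j - ∑ k, v k j * ((A i k : ℝ) : 𝕜)
        - ∑ k, v i k * ((A j k : ℝ) : 𝕜)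
      map_add' := fun u v => by
        funext i j; simp only [Pi.add_apply, add_mul, mul_add, Finset.sum_add_distrib]; ring
      map_smul' := fun r v => by
        funext i j
        simp only [Pi.smul_apply, RCLike.real_smul_eq_coe_mul, RingHom.id_apply, mul_sub,
          Finset.mul_sum, mul_assoc, mul_left_comm]
      cont := by fun_prop }
  map_add' A B := by
    ext v i j
    simp [Matrix.trace_add, mul_add, add_mul, Finset.sum_add_distrib]; ring
  map_smul' r A := by
    ext v i j
    simp [Matrix.trace_smul, RCLike.real_smul_eq_coe_mul, mul_sub, Finset.mul_sum, mul_assoc,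
      mul_left_comm]

theorem rep0_apply (w : 𝕜) (A : Matrix (Fin n) (Fin n) ℝ) (v : 𝕜) :
    rep0 w A v = w * ((A.trace : ℝ) : 𝕜) * v := rfl

theorem rep1_apply (w : 𝕜) (A : Matrix (Fin n) (Fin n) ℝ) (v : Fin n → 𝕜) (i : Fin n) :
    rep1 w A v i = w * ((A.trace : ℝ) : 𝕜) * v i - ∑ k, v k * ((A i k : ℝ) : 𝕜) := rfl

theorem rep2_apply (w : 𝕜) (A : Matrix (Fin n) (Fin n) ℝ) (v : Fin n → Fin n → 𝕜)
    (i j : Fin n) : rep2 w A v i j = w * ((A.trace : ℝ) : 𝕜) * v i j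
      - ∑ k, v k j * ((A i k : ℝ) : 𝕜) - ∑ k, v i k * ((A j k : ℝ) : 𝕜) := rfl

theorem lieGen_rep0 (w : 𝕜) (X : E n → E n) (f : E n → 𝕜) (x : E n) :
    lieGen (rep0 w) X f x = lieDensity w X f x := by
  simp [lieGen, lieDensity, rep0_apply, RCLike.real_smul_eq_coe_mul, Matrix.trace, dmat,
    divergence]

theorem lieGen_rep1 (w : 𝕜) (X : E n → E n) {f : E n → Fin n → 𝕜} {x : E n}
    (hf : ContDiffAt ℝ ∞ f x) (i : Fin n) :
    lieGen (rep1 w) X f x i = lieSymbol1 w X f x i := by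
  simp [lieGen, lieSymbol1, lieDensity, rep1_apply, RCLike.real_smul_eq_coe_mul, Matrix.trace,
    dmat, divergence, Finset.sum_apply, pd_pi _ hf]
  ring

theorem lieGen_rep2 (w : 𝕜) (X : E n → E n) {f : E n → Fin n → Fin n → 𝕜} {x : E n}
    (hf : ContDiffAt ℝ ∞ f x) (i j : Fin n) :
    lieGen (rep2 w) X f x i j = lieSymbol2 w X f x i j := by
  simp [lieGen, lieSymbol2, lieDensity, rep2_apply, RCLike.real_smul_eq_coe_mul, Matrix.trace,
    dmat, divergence, Finset.sum_apply, pd_pi _ hf, pd_pi _ (contDiffAt_pi.1 hf i)]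
  ring

theorem trace_rotMat (p : ℕ) (a b : Fin n) : (rotMat p a b).trace = 0 := by
  simp [Matrix.trace, rotMat, Finset.sum_sub_distrib]
  by_cases h : a = b <;> simp [h, eq_comm]

theorem casimirFibre_rep0 (p : ℕ) (w v : 𝕜) :
    casimirFibre (n := n) (rep0 w) p v = (n * w * (n - n * w)) • v := by
  simp [casimirFibre, rep0_apply, trace_rotMat, RCLike.real_smul_eq_coe_mul]
  ring

theorem rep1_rotMat (p : ℕ) (w : 𝕜) (a b : Fin n) (v : Fin n → 𝕜) (m : Fin n) :
    rep1 w (rotMat p a b) v m = (if a = m then (eta p b : 𝕜) * v b else 0)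
      - (if b = m then (eta p a : 𝕜) * v a else 0) := by
  rw [rep1_apply, trace_rotMat]
  simp only [rotMat, Matrix.of_apply]
  by_cases h1 : a = m <;> by_cases h2 : b = m <;>
    simp [h1, h2, apply_ite (RCLike.ofReal : ℝ → 𝕜), mul_comm]

/-- The dilation acts by $nw-1$, and the rotations contribute the Casimir operator $-(n-1)$ of the
vector representation; together they give one eigenvalue, so no symmetry type has to be separated.
-/
theorem casimirFibre_rep1 (p : ℕ) (w : 𝕜) (v : Fin n → 𝕜) :
    casimirFibre (rep1 w) p v = ((n * w - 2) * (n - n * w)) • v := by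
  funext m
  simp only [casimirFibre, Pi.add_apply, Pi.sub_apply, Pi.smul_apply, Finset.sum_apply,
    rep1_rotMat, rep1_apply (A := 1), RCLike.real_smul_eq_coe_mul, if_true]
  have h : ∀ a b : Fin n, ((eta p a * eta p b / 2 : ℝ) : 𝕜) *
      ((if a = m then (eta p b : 𝕜) * ((if a = b then (eta p b : 𝕜) * v b else 0)
        - (eta p a : 𝕜) * v a) else 0) -
        if b = m then (eta p a : 𝕜) * ((eta p b : 𝕜) * v b
          - if b = a then (eta p a : 𝕜) * v a else 0) else 0) =
      (if a = m then (if b = m then v m / 2 else 0) - v m / 2 else 0)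
        + (if b = m then (if a = m then v m / 2 else 0) - v m / 2 else 0) := fun a b => by
    have h1 := ofReal_eta_mul_self (p := p) (𝕜 := 𝕜) a
    have h2 := ofReal_eta_mul_self (p := p) (𝕜 := 𝕜) b
    push_cast
    split_ifs <;> grind
  simp only [h, Finset.sum_add_distrib, Finset.sum_sub_distrib, Finset.sum_ite_irrel,
    Finset.sum_ite_eq', Finset.mem_univ, if_true, Finset.sum_const, Finset.card_univ,
    Fintype.card_fin, nsmul_eq_mul, Matrix.trace_one, Matrix.one_apply,
    apply_ite (RCLike.ofReal : ℝ → 𝕜), mul_ite, mul_one, mul_zero, Finset.sum_ite_eq,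
    RCLike.ofReal_one, RCLike.ofReal_zero, RCLike.ofReal_natCast, smul_eq_mul]
  ring

theorem rep2_rotMat (p : ℕ) (w : 𝕜) (a b : Fin n) (v : Fin n → Fin n → 𝕜) (m l : Fin n) :
    rep2 w (rotMat p a b) v m l = (if a = m then (eta p b : 𝕜) * v b l else 0)
      - (if b = m then (eta p a : 𝕜) * v a l else 0)
      + ((if a = l then (eta p b : 𝕜) * v m b else 0)
      - (if b = l then (eta p a : 𝕜) * v m a else 0)) := by
  have h1 := rep1_rotMat p w a b (fun i => v i l) m
  have h2 := rep1_rotMat p w a b (fun i => v m i) l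
  rw [rep1_apply, trace_rotMat] at h1 h2
  rw [rep2_apply, trace_rotMat, ← h1, ← h2]
  simp
  ring

/-- Here the operator is not scalar. On trace-free tensors the last term vanishes; on multiples of
$\eta$ it adds $2n$, so the two eigenvalues differ by exactly $2n$. -/
theorem casimirFibre_rep2 (p : ℕ) (w : 𝕜) {v : Fin n → Fin n → 𝕜} (hv : ∀ i j, v i j = v j i)
    (m l : Fin n) : casimirFibre (rep2 w) p v m l =
      ((n * w - 2) * (n + 2 - n * w) - 2 * n) * v m l
        + 2 * if m = l then (eta p m : 𝕜) * ∑ a, (eta p a : 𝕜) * v a a else 0 := by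
  simp only [casimirFibre, Pi.add_apply, Pi.sub_apply, Pi.smul_apply, Finset.sum_apply,
    rep2_rotMat, rep2_apply (A := 1), RCLike.real_smul_eq_coe_mul, if_true]
  have h : ∀ a b : Fin n, ((eta p a * eta p b / 2 : ℝ) : 𝕜) *
      ((if a = m then (eta p b : 𝕜) *
          ((if a = b then (eta p b : 𝕜) * v b l else 0)
            - (eta p a : 𝕜) * v a l
            + ((if a = l then (eta p b : 𝕜) * v b b else 0)
            - (if b = l then (eta p a : 𝕜) * v b a else 0))) else 0)
        - (if b = m then (eta p a : 𝕜) *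
          ((eta p b : 𝕜) * v b l
            - (if b = a then (eta p a : 𝕜) * v a l else 0)
            + ((if a = l then (eta p b : 𝕜) * v a b else 0)
            - (if b = l then (eta p a : 𝕜) * v a a else 0))) else 0)
        + ((if a = l then (eta p b : 𝕜) *
          ((if a = m then (eta p b : 𝕜) * v b b else 0)
            - (if b = m then (eta p a : 𝕜) * v a b else 0)
            + ((if a = b then (eta p b : 𝕜) * v m b else 0)
            - (eta p a : 𝕜) * v m a)) else 0)
        - (if b = l then (eta p a : 𝕜) *
          ((if a = m then (eta p b : 𝕜) * v b a else 0)
            - (if b = m then (eta p a : 𝕜) * v a a else 0)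
            + ((eta p b : 𝕜) * v m b
            - (if b = a then (eta p a : 𝕜) * v m a else 0))) else 0))) =
      (if a = m then (if b = m then v m l / 2 else 0) - v m l / 2 else 0)
      + (if b = m then (if a = m then v m l / 2 else 0) - v m l / 2 else 0)
      + (if a = l then (if b = l then v m l / 2 else 0) - v m l / 2 else 0)
      + (if b = l then (if a = l then v m l / 2 else 0) - v m l / 2 else 0)
      + (if a = m then if a = l then (eta p m : 𝕜) * (eta p b : 𝕜) * v b b else 0 else 0)
      + (if b = m then if b = l then (eta p m : 𝕜) * (eta p a : 𝕜) * v a a else 0 else 0)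
      - (if a = m then if b = l then v m l else 0 else 0)
      - (if b = m then if a = l then v m l else 0 else 0) := fun a b => by
    have h1 := ofReal_eta_mul_self (p := p) (𝕜 := 𝕜) a
    have h2 := ofReal_eta_mul_self (p := p) (𝕜 := 𝕜) b
    have h3 := hv a b
    have h4 := hv m l
    push_cast
    by_cases e1 : a = m <;> by_cases e2 : b = m <;> by_cases e3 : a = l <;> by_cases e4 : b = l <;>
      by_cases e5 : a = b <;> grind
  simp only [h, Finset.sum_add_distrib, Finset.sum_sub_distrib, Finset.sum_ite_irrel,
    Finset.sum_ite_eq', Finset.mem_univ, if_true, Finset.sum_const, Finset.card_univ,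
    Fintype.card_fin, nsmul_eq_mul, Matrix.trace_one, Matrix.one_apply,
    apply_ite (RCLike.ofReal : ℝ → 𝕜), mul_ite, mul_one, mul_zero, Finset.sum_ite_eq,
    RCLike.ofReal_one, RCLike.ofReal_zero, RCLike.ofReal_natCast, mul_assoc,
    ← Finset.mul_sum]
  by_cases h0 : m = l
  · simp only [h0, if_true]
    ring
  · simp only [h0, if_false]
    ring

end Representations

/-! ### Locality of equivariant maps and equivariance of principal symbols -/

section Locality

variable {𝕜 : Type*} [RCLike 𝕜] {n : ℕ} {M : Type*} [TopologicalSpace M] [ChartedSpace (E n) M]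

/-- The restricted chart has the same coordinates, so on $W$ the change of coordinates and its
Jacobian matrix are trivial. This lets statements about whole chart domains be applied to
arbitrarily small open sets. -/
theorem exists_restrict (e : Chart n M) {W : Set (E n)} (hW : IsOpen W) (hWe : W ⊆ e.1.target) :
    ∃ e' : Chart n M, e'.1.target = W ∧ ∀ x ∈ W, x ∈ overlap e e' ∧ trans e e' x = x ∧
      jac e e' x = 1 := by
  have hs : IsOpen (e.1.source ∩ e.1 ⁻¹' W) := e.1.isOpen_inter_preimage hW
  let e' : Chart n M := ⟨e.1.restr (e.1.source ∩ e.1 ⁻¹' W), restr_mem_maximalAtlas _ e.2 hs⟩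
  have h1 : ∀ x ∈ W, x ∈ overlap e e' := fun x hx => by
    refine ⟨hWe hx, ?_⟩
    simp only [e', OpenPartialHomeomorph.restr_source, hs.interior_eq]
    have := e.1.map_target (hWe hx)
    exact ⟨this, this, by simpa [e.1.right_inv (hWe hx)] using hx⟩
  have h2 : ∀ x ∈ W, trans e e' x = x := fun x hx => e.1.right_inv (hWe hx)
  refine ⟨e', ?_, fun x hx => ⟨h1 x hx, h2 x hx, ?_⟩⟩
  · ext x
    constructor
    · intro hx
      have h3 := e'.1.map_target hx
      have h4 : e'.1 (e'.1.symm x) = x := e'.1.right_inv hx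
      simp only [e', OpenPartialHomeomorph.restr_source, hs.interior_eq] at h3
      rw [← h4]
      exact h3.2.2
    · intro hx
      have := (trans_mem_overlap (h1 x hx)).1
      rwa [h2 x hx] at this
  · ext i j
    simp only [jac, Matrix.of_apply]
    rw [pd_congr hW (fun y hy => show trans e e' y i = y i by rw [h2 y hy]) hx, pd_coord,
      Matrix.one_apply]

variable {p : ℕ} {g : PseudoMetric n M} {lam mu : 𝕜}

/-- The value of an equivariant map at a point only depends on the germ of the symbol there. -/
theorem IsConfEquivariant.apply_eq_zero {T : Symbols n M (mu - lam) →ₗ[𝕜] DiffOp2 n M lam mu}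
    (hT : IsConfEquivariant p g T) {e : Chart n M} (he : IsAdapted p g e) {W : Set (E n)}
    (hW : IsOpen W) (hWe : W ⊆ e.1.target) {P : Symbols n M (mu - lam)}
    (hP : ∀ x ∈ W, P.1.1 e x = 0 ∧ P.2.1.1 e x = 0 ∧ P.2.2.1 e x = 0) (φ : Density n M lam)
    {x : E n} (hx : x ∈ W) : ((T P).1 φ).1 e x = 0 := by
  obtain ⟨e', hT', h⟩ := exists_restrict e hW hWe
  have he' : IsAdapted p g e' := by
    obtain ⟨F, hF⟩ := he
    refine ⟨F, fun y hy => ?_⟩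
    rw [hT'] at hy
    obtain ⟨h1, h2, h3⟩ := h y hy
    have h4 := g.transform e e' y h1
    rw [h2, h3, Matrix.transpose_one, Matrix.one_mul, Matrix.mul_one] at h4
    rw [← h4]
    exact hF y (hWe hy)
  -- For $X=0$ the Lie derivative of any symbol is zero. On the small chart $P$ is zero too, so it
  -- may serve as the Lie derivative, and equivariance reads $T(P)\varphi=0$ there.
  have hX : (0 : E n → E n) ∈ confAlgebra n p := Submodule.zero_mem _
  have h0 : ∀ (w : 𝕜) (f : E n → 𝕜) y, lieDensity w 0 f y = 0 := fun w f y => by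
    simp [lieDensity, divergence]
  have key := hT e' he' 0 hX 0 P (fun y hy => ?_) φ 0 (fun y _ => ?_) x (by rwa [hT'])
  · obtain ⟨h1, h2, h3⟩ := h x hx
    have h4 := density_transform ((T P).1 φ) h1
    rw [h2, key] at h4
    rw [h4, h0]
    simp
  · rw [hT'] at hy
    obtain ⟨h1, h2, h3⟩ := h y hy
    obtain ⟨hP2, hP1, hP0⟩ := hP y hy
    refine ⟨?_, ?_, ?_⟩
    · funext i j
      have := P.1.2.2.2.2 e e' y h1 i j
      rw [h2] at this
      rw [this, hP2]
      simp [lieSymbol2, lieDensity, divergence]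
    · funext i
      have := P.2.1.2.2.2 e e' y h1 i
      rw [h2] at this
      rw [this, hP1]
      simp [lieSymbol1, lieDensity, divergence]
    · have := P.2.2.2.2.2 e e' y h1
      rw [h2] at this
      rw [this, hP0, h0]
      simp
  · rw [h0]
    rfl

end Locality

/-! ### Coefficients of an operator and of its commutator with a Lie derivative -/

section LieCoefficients

variable {𝕜 : Type*} [RCLike 𝕜] {n : ℕ} {M : Type*} [TopologicalSpace M] [ChartedSpace (E n) M]
  {lam mu : 𝕜} {A B : Density n M lam →ₗ[𝕜] Density n M mu} {e : Chart n M}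
  {a₂ b₂ : E n → Fin n → Fin n → 𝕜} {a₁ b₁ : E n → Fin n → 𝕜} {a₀ b₀ : E n → 𝕜}

theorem HasCoeffs.congr (h : HasCoeffs A e a₂ a₁ a₀) (h₂ : ∀ x ∈ e.1.target, b₂ x = a₂ x)
    (h₁ : ∀ x ∈ e.1.target, b₁ x = a₁ x) (h₀ : ∀ x ∈ e.1.target, b₀ x = a₀ x) :
    HasCoeffs A e b₂ b₁ b₀ where
  smooth₂ i j := (h.smooth₂ i j).congr fun x hx => by rw [h₂ x hx]
  smooth₁ i := (h.smooth₁ i).congr fun x hx => by rw [h₁ x hx]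
  smooth₀ := h.smooth₀.congr h₀
  symm x hx i j := by rw [h₂ x hx, h.symm x hx]
  apply_eq φ x hx := by rw [h.apply_eq φ x hx, coordOp, coordOp, h₂ x hx, h₁ x hx, h₀ x hx]

theorem HasCoeffs.sub (h : HasCoeffs A e a₂ a₁ a₀) (h' : HasCoeffs B e b₂ b₁ b₀) :
    HasCoeffs (A - B) e (a₂ - b₂) (a₁ - b₁) (a₀ - b₀) where
  smooth₂ i j := (h.smooth₂ i j).sub (h'.smooth₂ i j)
  smooth₁ i := (h.smooth₁ i).sub (h'.smooth₁ i)
  smooth₀ := h.smooth₀.sub h'.smooth₀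
  symm x hx i j := by simp only [Pi.sub_apply, h.symm x hx i j, h'.symm x hx i j]
  apply_eq φ x hx := by
    have h1 := h.apply_eq φ x hx
    have h2 := h'.apply_eq φ x hx
    simp only [coordOp] at h1 h2
    simp only [LinearMap.sub_apply, Submodule.coe_sub, Pi.sub_apply, h1, h2, coordOp, sub_mul,
      Finset.sum_sub_distrib]
    ring

theorem HasCoeffs.eq_zero (h : HasCoeffs A e a₂ a₁ a₀) {x : E n} (hx : x ∈ e.1.target)
    (h₂ : a₂ x = 0) (h₁ : a₁ x = 0) (h₀ : a₀ x = 0) (φ : Density n M lam) :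
    (A φ).1 e x = 0 := by
  rw [h.apply_eq φ x hx, coordOp_zero h₂ h₁, h₀, zero_mul]

variable [T2Space M]

/-- The operator `B` is the commutator of the operator `A` with the Lie derivative along `X`. -/
def IsLieDeriv (e : Chart n M) (X : E n → E n) (A B : Density n M lam →ₗ[𝕜] Density n M mu) :
    Prop :=
  ∀ φ φ' : Density n M lam, (∀ x ∈ e.1.target, φ'.1 e x = lieDensity lam X (φ.1 e) x) →
    ∀ x ∈ e.1.target, (B φ).1 e x = lieDensity mu X ((A φ).1 e) x - (A φ').1 e x

/-- Passes from global densities to functions of the coordinates: a test density agreeing with $u$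
near $x$ has a global Lie derivative, so the commutator can be evaluated on it. -/
theorem IsLieDeriv.coordOp_eq {X : E n → E n} (hX : ∀ y i, ContDiffAt ℝ ∞ (fun z => X z i) y)
    (h : IsLieDeriv e X A B) (hA : HasCoeffs A e a₂ a₁ a₀) (hB : HasCoeffs B e b₂ b₁ b₀)
    {u : E n → 𝕜} (hu : ∀ y, ContDiffAt ℝ ∞ u y) {x : E n} (hx : x ∈ e.1.target) :
    coordOp b₂ b₁ b₀ u x =
      lieDensity mu X (coordOp a₂ a₁ a₀ u) x - coordOp a₂ a₁ a₀ (lieDensity lam X u) x := by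
  obtain ⟨φ, hφ⟩ := exists_isTest lam (fun y _ => (hu y).contDiffWithinAt) hx
  obtain ⟨φ', hφ'⟩ := hφ.lie X hX
  rw [← hB.apply_isTest hφ, h φ φ' hφ' x hx, hA.apply_eq φ' x hx]
  obtain ⟨W, hW, hxW, hWe, heq⟩ := hφ.eq_near
  congr 1
  · exact lieDensity_congr hW mu (fun y hy => by
      rw [hA.apply_eq φ y (hWe hy), coordOp_congr hW heq hy]) hxW
  · exact coordOp_congr hW (fun y hy => by
      rw [hφ' y (hWe hy), lieDensity_congr hW lam heq hy]) hxW

/-- The coordinate function vanishing at $x$ picks out one first-order coefficient; the terms with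
the zeroth-order coefficient drop out or cancel. -/
theorem IsLieDeriv.coeff₁ {X : E n → E n} (hX : ∀ y i, ContDiffAt ℝ ∞ (fun z => X z i) y)
    (h : IsLieDeriv e X A B) (hA : HasCoeffs A e 0 a₁ a₀) (hB : HasCoeffs B e 0 b₁ b₀)
    {x : E n} (hx : x ∈ e.1.target) (m : Fin n) :
    b₁ x m = lieSymbol1 (mu - lam) X a₁ x m := by
  have h1 := h.coordOp_eq hX hA hB (fun y => contDiffAt_coordFun x m y) hx
  have ha₁ : ∀ i, ContDiffAt ℝ ∞ (fun y => a₁ y i) x := fun i =>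
    (hA.smooth₁ i).contDiffAt (e.1.open_target.mem_nhds hx)
  have ha₀ : ContDiffAt ℝ ∞ a₀ x := hA.smooth₀.contDiffAt (e.1.open_target.mem_nhds hx)
  have hc := contDiffAt_coordFun (𝕜 := 𝕜) x m x
  have hXx := hX x
  have hd : ContDiffAt ℝ ∞ (divergence X) x := by unfold divergence; fun_prop
  have e1 : coordOp 0 a₁ a₀ (coordFun (𝕜 := 𝕜) x m) =
      fun y => a₁ y m + a₀ y * coordFun x m y := by
    funext y; simp [coordOp, pd_coordFun]
  have e2 : lieDensity lam X (coordFun (𝕜 := 𝕜) x m) = fun y =>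
      ((X y m : ℝ) : 𝕜) + lam * ((divergence X y : ℝ) : 𝕜) * coordFun x m y := by
    funext y; simp [lieDensity, pd_coordFun]
  have e3 : coordOp 0 b₁ b₀ (coordFun (𝕜 := 𝕜) x m) x = b₁ x m := by
    simp [coordOp, pd_coordFun, coordFun_self]
  rw [e3, e1, e2] at h1
  rw [h1, lieSymbol1, lieDensity, lieDensity, coordOp]
  simp (disch := fun_prop) only [pd_add, pd_mul, pd_ofReal, pd_const, pd_coordFun, coordFun_self]
  simp [mul_add, Finset.sum_add_distrib, sub_mul]
  ring

/-- Tested on the constant function $1$, whose Lie derivative contributes the weight $\lambda$ to be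
subtracted from $\mu$. -/
theorem IsLieDeriv.coeff₀ {X : E n → E n} (hX : ∀ y i, ContDiffAt ℝ ∞ (fun z => X z i) y)
    (h : IsLieDeriv e X A B) (hA : HasCoeffs A e 0 0 a₀) (hB : HasCoeffs B e 0 0 b₀)
    {x : E n} (hx : x ∈ e.1.target) : b₀ x = lieDensity (mu - lam) X a₀ x := by
  have h1 := h.coordOp_eq hX hA hB (u := fun _ => 1) (fun y => contDiffAt_const) hx
  have e1 : coordOp 0 0 a₀ (fun _ => (1 : 𝕜)) = a₀ := by
    funext y; rw [coordOp_zero rfl rfl, mul_one]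
  rw [e1, coordOp_zero rfl rfl, coordOp_zero rfl rfl, mul_one] at h1
  rw [h1]
  simp [lieDensity]
  ring

open Classical in
/-- The coefficient of order zero of an operator of order zero. -/
def coeff₀ (e : Chart n M) :
    (Density n M lam →ₗ[𝕜] Density n M mu) →ₗ[𝕜] (E n → 𝕜) where
  -- The test density is chosen independently of $A$, so the expression is linear in $A$ on all
  -- operators; it is the coefficient only for operators of order zero.
  toFun A x := if hx : x ∈ e.1.target then
    (A (exists_isTest lam (u := fun _ => 1) contDiffOn_const hx).choose).1 e x else 0
  map_add' A B := by funext x; simp only [Pi.add_apply]; split_ifs <;> simp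
  map_smul' c A := by funext x; simp only [Pi.smul_apply]; split_ifs <;> simp

open Classical in
/-- The coefficients of order one of an operator of order one. -/
def coeff₁ (e : Chart n M) :
    (Density n M lam →ₗ[𝕜] Density n M mu) →ₗ[𝕜] (E n → Fin n → 𝕜) where
  toFun A x i := if hx : x ∈ e.1.target then
    (A (exists_isTest lam (u := coordFun x i)
      (fun y _ => (contDiffAt_coordFun x i y).contDiffWithinAt) hx).choose).1 e x else 0
  map_add' A B := by funext x i; simp only [Pi.add_apply]; split_ifs <;> simp
  map_smul' c A := by funext x i; simp only [Pi.smul_apply]; split_ifs <;> simp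

theorem HasCoeffs.coeff₀_eq (h : HasCoeffs A e 0 0 a₀) {x : E n} (hx : x ∈ e.1.target) :
    coeff₀ e A x = a₀ x := by
  have h1 := (exists_isTest lam (u := fun _ => (1 : 𝕜)) contDiffOn_const hx).choose_spec
  simp only [coeff₀, LinearMap.coe_mk, AddHom.coe_mk, dif_pos hx]
  rw [h.apply_isTest h1, coordOp_zero rfl rfl, mul_one]

theorem HasCoeffs.coeff₁_eq (h : HasCoeffs A e 0 a₁ a₀) {x : E n} (hx : x ∈ e.1.target) :
    coeff₁ e A x = a₁ x := by
  funext i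
  have h1 := (exists_isTest lam (u := coordFun (𝕜 := 𝕜) x i)
      (fun y _ => (contDiffAt_coordFun x i y).contDiffWithinAt) hx).choose_spec
  simp only [coeff₁, LinearMap.coe_mk, AddHom.coe_mk, dif_pos hx]
  rw [h.apply_isTest h1]
  simp [coordOp, pd_coordFun, coordFun_self]

end LieCoefficients

/-! ### Uniqueness of the equivariant quantization -/

section Uniqueness

variable {𝕜 : Type*} [RCLike 𝕜] {n : ℕ}

/-- The smooth fields of vectors supported in `K`. -/
def supported₁ (𝕜 : Type*) [RCLike 𝕜] {n : ℕ} (K : Set (E n)) :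
    Submodule 𝕜 (E n → Fin n → 𝕜) where
  carrier := {f | SupportedIn K f}
  add_mem' hf hf' := hf.add hf'
  zero_mem' := ⟨fun _ => contDiffAt_const, fun _ _ => rfl⟩
  smul_mem' c f hf := ⟨fun x => (hf.smooth x).const_smul c, fun x hx => by
    rw [Pi.smul_apply, hf.zero x hx, smul_zero]⟩

/-- The smooth fields of symmetric tensors of rank two supported in `K`. -/
def supported₂ (𝕜 : Type*) [RCLike 𝕜] {n : ℕ} (K : Set (E n)) :
    Submodule 𝕜 (E n → Fin n → Fin n → 𝕜) where
  carrier := {f | SupportedIn K f ∧ ∀ x i j, f x i j = f x j i}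
  add_mem' hf hf' := ⟨hf.1.add hf'.1, fun x i j => by
    simp only [Pi.add_apply, hf.2 x i j, hf'.2 x i j]⟩
  zero_mem' := ⟨⟨fun _ => contDiffAt_const, fun _ _ => rfl⟩, fun _ _ _ => rfl⟩
  smul_mem' c f hf := ⟨⟨fun x => (hf.1.smooth x).const_smul c, fun x hx => by
    rw [Pi.smul_apply, hf.1.zero x hx, smul_zero]⟩, fun x i j => by
    simp only [Pi.smul_apply, hf.2 x i j]⟩

/-- Stability under Lie derivatives allows the Casimir operator to be formed inside the space of
compactly supported fields. -/
theorem lieGen_mem_supported₁ {p : ℕ} {X : E n → E n} (hX : X ∈ confAlgebra n p) {K : Set (E n)}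
    (hK : IsClosed K) (w : 𝕜) {f : E n → Fin n → 𝕜} (hf : f ∈ supported₁ 𝕜 K) :
    lieGen (rep1 w) X f ∈ supported₁ 𝕜 K := by
  obtain ⟨s, h, hXc⟩ := isConfField_of_mem hX
  refine ⟨fun x => ?_, fun x hx => ?_⟩
  · have h1 : lieGen (rep1 w) X f = fun y => lieSymbol1 w X f y :=
      funext fun y => funext fun i => lieGen_rep1 w X (hf.smooth y) i
    rw [h1]
    exact contDiffAt_pi.2 fun i => hXc.contDiffAt_lieSymbol1 w (contDiffAt_pi.1 (hf.smooth x)) i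
  · have h2 : ∀ i, pd i f x = 0 := fun i => (hf.pd hK i).zero x hx
    simp [lieGen, h2, hf.zero x hx]

theorem lieSymbol2_symm (w : 𝕜) (X : E n → E n) {f : E n → Fin n → Fin n → 𝕜}
    (hf : ∀ x i j, f x i j = f x j i) (x : E n) (i j : Fin n) :
    lieSymbol2 w X f x i j = lieSymbol2 w X f x j i := by
  have h1 : (fun y => f y i j) = fun y => f y j i := funext fun y => hf y i j
  simp only [lieSymbol2, h1, hf x j, hf x _ i]
  ring

theorem lieGen_mem_supported₂ {p : ℕ} {X : E n → E n} (hX : X ∈ confAlgebra n p) {K : Set (E n)}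
    (hK : IsClosed K) (w : 𝕜) {f : E n → Fin n → Fin n → 𝕜} (hf : f ∈ supported₂ 𝕜 K) :
    lieGen (rep2 w) X f ∈ supported₂ 𝕜 K := by
  obtain ⟨s, h, hXc⟩ := isConfField_of_mem hX
  obtain ⟨hf, hs⟩ := hf
  have h1 : lieGen (rep2 w) X f = fun y => lieSymbol2 w X f y :=
    funext fun y => funext fun i => funext fun j => lieGen_rep2 w X (hf.smooth y) i j
  refine ⟨⟨fun x => ?_, fun x hx => ?_⟩, fun x i j => ?_⟩
  · rw [h1]
    exact contDiffAt_pi.2 fun i => contDiffAt_pi.2 fun j => hXc.contDiffAt_lieSymbol2 w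
      (fun i => contDiffAt_pi.1 (contDiffAt_pi.1 (hf.smooth x) i)) i j
  · have h2 : ∀ i, pd i f x = 0 := fun i => (hf.pd hK i).zero x hx
    simp [lieGen, h2, hf.zero x hx]
  · rw [h1]
    exact lieSymbol2_symm w X hs x i j

/-- Taking the trace of `casimirFibre_rep2` shows that the trace is an eigenvector of the induced
action, so the operator satisfies the quadratic equation of its two eigenvalues. In this form no
projection to the trace-free part is needed. -/
theorem casimirFibre_rep2_sq (p : ℕ) (w : 𝕜) {v : Fin n → Fin n → 𝕜} (hv : ∀ i j, v i j = v j i) :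
    casimirFibre (rep2 w) p (casimirFibre (rep2 w) p v) =
      ((((n * w - 2) * (n + 2 - n * w) - 2 * n) + (n * w - 2) * (n + 2 - n * w)) : 𝕜) •
        casimirFibre (rep2 w) p v
      - ((((n * w - 2) * (n + 2 - n * w) - 2 * n) * ((n * w - 2) * (n + 2 - n * w))) : 𝕜) • v := by
  have h1 := casimirFibre_rep2 p w hv
  have h2 : ∀ i j, casimirFibre (rep2 w) p v i j = casimirFibre (rep2 w) p v j i := fun i j => by
    rw [h1, h1, hv i j]
    by_cases h : i = j
    · rw [h]
    · rw [if_neg h, if_neg (Ne.symm h)]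
  have h3 := casimirFibre_rep2 p w h2
  have h4 : ∑ a, (eta p a : 𝕜) * casimirFibre (rep2 w) p v a a =
      (n * w - 2) * (n + 2 - n * w) * ∑ a, (eta p a : 𝕜) * v a a := by
    simp only [h1, if_true, mul_add, Finset.sum_add_distrib]
    have h5 : ∀ a : Fin n, (eta p a : 𝕜) * (2 * ((eta p a : 𝕜) * ∑ a, (eta p a : 𝕜) * v a a)) =
        2 * ∑ a, (eta p a : 𝕜) * v a a := fun a => by
      linear_combination (2 * ∑ a, (eta p a : 𝕜) * v a a) * ofReal_eta_mul_self (p := p) (𝕜 := 𝕜) a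
    simp only [h5, mul_left_comm ((eta p _ : ℝ) : 𝕜), ← Finset.mul_sum, Finset.sum_const,
      Finset.card_univ, Fintype.card_fin, nsmul_eq_mul]
    ring
  funext m l
  rw [h3, h4]
  simp only [Pi.sub_apply, Pi.smul_apply, smul_eq_mul, h1]
  by_cases h : m = l
  · simp only [h, if_true]; ring
  · simp only [h, if_false]; ring

variable {M : Type*} [TopologicalSpace M] [ChartedSpace (E n) M] [T2Space M] {e : Chart n M}

/-- Extension by zero as a linear map. -/
def extLin₁ (w : 𝕜) {K : Set (E n)} (hK : IsCompact K) (hKe : K ⊆ e.1.target) :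
    supported₁ 𝕜 K →ₗ[𝕜] Symbol1 n M w where
  toFun f := extSymbol1 w hK hKe f.2
  map_add' f f' := Subtype.ext ((isTransition1 w).extField_add e f.1 f'.1)
  map_smul' c f := Subtype.ext ((isTransition1 w).extField_smul e c f.1)

/-- Extension by zero as a linear map. -/
def extLin₂ (w : 𝕜) {K : Set (E n)} (hK : IsCompact K) (hKe : K ⊆ e.1.target) :
    supported₂ 𝕜 K →ₗ[𝕜] Symbol2 n M w where
  toFun f := extSymbol2 w hK hKe f.2.1 f.2.2
  map_add' f f' := Subtype.ext ((isTransition2 w).extField_add e f.1 f'.1)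
  map_smul' c f := Subtype.ext ((isTransition2 w).extField_smul e c f.1)

variable {p : ℕ} {g : PseudoMetric n M} {lam mu : 𝕜}

/-- The additive group of differential operators of order at most two. -/
abbrev DiffOp2.addCommGroup : AddCommGroup (DiffOp2 n M lam mu) :=
  Module.addCommMonoidToAddCommGroup 𝕜

attribute [local instance] DiffOp2.addCommGroup

/-- Subtraction on the left comes from the module structure, so it is compared with subtraction of
linear maps through addition. -/
theorem DiffOp2.coe_sub (A B : DiffOp2 n M lam mu) : (A - B).1 = A.1 - B.1 := by
  refine LinearMap.ext fun φ => ?_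
  rw [LinearMap.sub_apply]
  refine eq_sub_of_add_eq ?_
  rw [← LinearMap.add_apply, ← Submodule.coe_add, sub_add_cancel]

variable {T : Symbols n M (mu - lam) →ₗ[𝕜] DiffOp2 n M lam mu}

theorem lieDensity_zero (w : 𝕜) (X : E n → E n) (x : E n) : lieDensity w X 0 x = 0 := by
  have h : ∀ k, pd k (0 : E n → 𝕜) x = 0 := fun k => pd_const k 0 x
  simp [lieDensity, h]

theorem contDiffAt_field_of_mem {X : E n → E n} (hX : X ∈ confAlgebra n p) (y : E n) (i : Fin n) :
    ContDiffAt ℝ ∞ (fun z => X z i) y := by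
  obtain ⟨s, h, hXc⟩ := isConfField_of_mem hX
  exact hXc.component i y

theorem IsConfEquivariant.isLieDeriv₁ (hT : IsConfEquivariant p g T) (he : IsAdapted p g e)
    {X : E n → E n} (hX : X ∈ confAlgebra n p) {P P' : Symbol1 n M (mu - lam)}
    (h : ∀ x ∈ e.1.target, P'.1 e x = lieSymbol1 (mu - lam) X (P.1 e) x) :
    IsLieDeriv e X (T (0, P, 0)).1 (T (0, P', 0)).1 := by
  refine hT e he X hX (0, P, 0) (0, P', 0) fun x hx => ⟨?_, h x hx, ?_⟩
  · funext i j; simp [lieSymbol2, lieDensity]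
  · exact (lieDensity_zero _ X x).symm

theorem IsConfEquivariant.isLieDeriv₂ (hT : IsConfEquivariant p g T) (he : IsAdapted p g e)
    {X : E n → E n} (hX : X ∈ confAlgebra n p) {P P' : Symbol2 n M (mu - lam)}
    (h : ∀ x ∈ e.1.target, P'.1 e x = lieSymbol2 (mu - lam) X (P.1 e) x) :
    IsLieDeriv e X (T (P, 0, 0)).1 (T (P', 0, 0)).1 := by
  refine hT e he X hX (P, 0, 0) (P', 0, 0) fun x hx => ⟨h x hx, ?_, ?_⟩
  · funext i; simp [lieSymbol1, lieDensity]
  · exact (lieDensity_zero _ X x).symm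

theorem extLin₁_apply (w : 𝕜) {K : Set (E n)} (hK : IsCompact K) (hKe : K ⊆ e.1.target)
    (f : supported₁ 𝕜 K) {x : E n} (hx : x ∈ e.1.target) : (extLin₁ w hK hKe f).1 e x = f.1 x :=
  extSymbol1_apply w hK hKe f.2 hx

theorem extLin₂_apply (w : 𝕜) {K : Set (E n)} (hK : IsCompact K) (hKe : K ⊆ e.1.target)
    (f : supported₂ 𝕜 K) {x : E n} (hx : x ∈ e.1.target) : (extLin₂ w hK hKe f).1 e x = f.1 x :=
  extSymbol2_apply w hK hKe f.2.1 f.2.2 hx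

theorem extLin₁_lie {X : E n → E n} (w : 𝕜) {K : Set (E n)} (hK : IsCompact K)
    (hKe : K ⊆ e.1.target) {f f' : supported₁ 𝕜 K} (h : f'.1 = lieGen (rep1 w) X f.1) {x : E n}
    (hx : x ∈ e.1.target) :
    (extLin₁ w hK hKe f').1 e x = lieSymbol1 w X ((extLin₁ w hK hKe f).1 e) x := by
  rw [extLin₁_apply w hK hKe f' hx, h]
  funext i
  rw [lieGen_rep1 w X (f.2.smooth x)]
  simp only [lieSymbol1, extLin₁_apply w hK hKe f hx]
  rw [lieDensity_congr e.1.open_target w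
    (fun y hy => congrFun (extLin₁_apply w hK hKe f hy).symm i) hx]

theorem extLin₂_lie {X : E n → E n} (w : 𝕜) {K : Set (E n)} (hK : IsCompact K)
    (hKe : K ⊆ e.1.target) {f f' : supported₂ 𝕜 K} (h : f'.1 = lieGen (rep2 w) X f.1) {x : E n}
    (hx : x ∈ e.1.target) :
    (extLin₂ w hK hKe f').1 e x = lieSymbol2 w X ((extLin₂ w hK hKe f).1 e) x := by
  rw [extLin₂_apply w hK hKe f' hx, h]
  funext i j
  rw [lieGen_rep2 w X (f.2.1.smooth x)]
  simp only [lieSymbol2, extLin₂_apply w hK hKe f hx]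
  rw [lieDensity_congr e.1.open_target w
    (fun y hy => congrFun (congrFun (extLin₂_apply w hK hKe f hy).symm i) j) hx]

theorem contDiffAt_of_eq {V : Type*} [NormedAddCommGroup V] [NormedSpace ℝ V] {f f' : E n → V}
    (h : ∀ x ∈ e.1.target, f x = f' x) (hf : ContDiffOn ℝ ∞ f' e.1.target) {x : E n}
    (hx : x ∈ e.1.target) : ContDiffAt ℝ ∞ f x :=
  (hf.congr h).contDiffAt (e.1.open_target.mem_nhds hx)

/-- An equivariant map sending symbols of degree one to operators of order zero vanishes on symbols
with compact support in an adapted chart. -/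
theorem IsConfEquivariant.coeff_eq_zero₁ (hT : IsConfEquivariant p g T) (he : IsAdapted p g e)
    (hc : CoeffDenoms (n : 𝕜) lam mu)
    (h₁ : ∀ P : Symbol1 n M (mu - lam), ∃ a₀, HasCoeffs (T (0, P, 0)).1 e 0 0 a₀)
    {K : Set (E n)} (hK : IsCompact K) (hKe : K ⊆ e.1.target) (f : supported₁ 𝕜 K)
    (φ : Density n M lam) {x : E n} (hx : x ∈ e.1.target) :
    ((T (0, extLin₁ (mu - lam) hK hKe f, 0)).1 φ).1 e x = 0 := by
  -- The zeroth-order coefficient of $T$ as a linear function of compactly supported vector fields;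
  -- this is the intertwiner to which the Casimir argument applies.
  let b : supported₁ 𝕜 K →ₗ[𝕜] (E n → 𝕜) := coeff₀ e ∘ₗ (DiffOp2 n M lam mu).subtype ∘ₗ T ∘ₗ
    LinearMap.inr 𝕜 _ _ ∘ₗ LinearMap.inl 𝕜 _ _ ∘ₗ extLin₁ (mu - lam) hK hKe
  choose a ha using h₁
  have hb : ∀ f, ∀ x ∈ e.1.target, b f x = a (extLin₁ (mu - lam) hK hKe f) x := fun f x hx =>
    (ha _).coeff₀_eq hx
  have key : b f x = 0 := by
    -- On vector fields there is a single eigenvalue, so $\gamma=\gamma'$ is taken in the quadratic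
    -- equation.
    refine eq_zero_of_intertwines (p := p) (ρ := rep1 (mu - lam)) (σ := rep0 (mu - lam))
      (fun f (hf : f ∈ supported₁ 𝕜 K) x => hf.smooth x) (fun X hX f hf => lieGen_mem_supported₁ hX hK.isClosed _ hf) b
      e.1.open_target (fun f x hx => contDiffAt_of_eq (hb f) (ha _).smooth₀ hx) ?_
      (casimirFibre_rep0 p (mu - lam))
      (γ := (n * (mu - lam) - 2) * (n - n * (mu - lam)))
      (γ' := (n * (mu - lam) - 2) * (n - n * (mu - lam))) (fun f _ x => ?_) ?_ ?_ f hx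
    · intro X hX f f' hff' x hx
      have h1 := (hT.isLieDeriv₁ he hX fun x hx => extLin₁_lie (mu - lam) hK hKe hff' hx).coeff₀
        (contDiffAt_field_of_mem hX) (ha _) (ha _) hx
      rw [hb f' x hx, h1, lieGen_rep0]
      exact lieDensity_congr e.1.open_target _ (fun y hy => (hb f y hy).symm) hx
    · simp only [casimirFibre_rep1]
      module
    -- The eigenvalues on densities and on vector fields differ by $2n(1-\delta)$.
    all_goals
      intro h
      have h1 := mul_ne_zero hc.dim hc.top
      have h2 : (2 : 𝕜) ≠ 0 := two_ne_zero
      exact mul_ne_zero h2 h1 (by linear_combination h)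
  rw [hb f x hx] at key
  exact (ha _).eq_zero hx rfl rfl key φ

/-- An equivariant map sending quadratic symbols to operators of order one vanishes on symbols
with compact support in an adapted chart. -/
theorem IsConfEquivariant.coeff_eq_zero₂ (hT : IsConfEquivariant p g T) (he : IsAdapted p g e)
    (hc : CoeffDenoms (n : 𝕜) lam mu)
    (h₂ : ∀ P : Symbol2 n M (mu - lam), ∃ a₁ a₀, HasCoeffs (T (P, 0, 0)).1 e 0 a₁ a₀)
    {K : Set (E n)} (hK : IsCompact K) (hKe : K ⊆ e.1.target) (f : supported₂ 𝕜 K)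
    (φ : Density n M lam) {x : E n} (hx : x ∈ e.1.target) :
    ((T (extLin₂ (mu - lam) hK hKe f, 0, 0)).1 φ).1 e x = 0 := by
  let t : supported₂ 𝕜 K →ₗ[𝕜] (Density n M lam →ₗ[𝕜] Density n M mu) :=
    (DiffOp2 n M lam mu).subtype ∘ₗ T ∘ₗ LinearMap.inl 𝕜 _ _ ∘ₗ extLin₂ (mu - lam) hK hKe
  choose a₁ a₀ ha using h₂
  have hlie : ∀ X ∈ confAlgebra n p, ∀ f f' : supported₂ 𝕜 K,
      f'.1 = lieGen (rep2 (mu - lam)) X f.1 → IsLieDeriv e X (t f) (t f') :=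
    fun X hX f f' hff' => hT.isLieDeriv₂ he hX fun x hx => extLin₂_lie (mu - lam) hK hKe hff' hx
  have hb : ∀ f, ∀ x ∈ e.1.target, coeff₁ e (t f) x = a₁ (extLin₂ (mu - lam) hK hKe f) x :=
    fun f x hx => (ha _).coeff₁_eq hx
  have hS : ∀ f ∈ supported₂ 𝕜 K, ∀ x, ContDiffAt ℝ ∞ f x := fun f hf x => hf.1.smooth x
  have hL : ∀ X ∈ confAlgebra n p, ∀ f ∈ supported₂ 𝕜 K,
      lieGen (rep2 (mu - lam)) X f ∈ supported₂ 𝕜 K :=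
    fun X hX f hf => lieGen_mem_supported₂ hX hK.isClosed _ hf
  have hcas := fun f (hf : f ∈ supported₂ 𝕜 K) x =>
    casimirFibre_rep2_sq p (mu - lam) (v := f x) fun i j => hf.2 x i j
  have h2 : (2 : 𝕜) ≠ 0 := two_ne_zero
  have key : ∀ f, ∀ x ∈ e.1.target, coeff₁ e (t f) x = 0 := by
    intro f x hx
    refine eq_zero_of_intertwines (p := p) (ρ := rep2 (mu - lam)) (σ := rep1 (mu - lam))
      hS hL (coeff₁ e ∘ₗ t) e.1.open_target
      (fun f x hx => contDiffAt_of_eq (hb f) (contDiffOn_pi.2 (ha _).smooth₁) hx) ?_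
      (casimirFibre_rep1 p (mu - lam)) hcas ?_ ?_ f hx
    · intro X hX f f' hff' x hx
      have hs : ContDiffAt ℝ ∞ (coeff₁ e (t f)) x :=
        contDiffAt_of_eq (hb f) (contDiffOn_pi.2 (ha _).smooth₁) hx
      funext i
      have h1 := (hlie X hX f f' hff').coeff₁ (contDiffAt_field_of_mem hX)
        (ha (extLin₂ (mu - lam) hK hKe f)) (ha (extLin₂ (mu - lam) hK hKe f')) hx i
      simp only [LinearMap.comp_apply]
      rw [lieGen_rep1 _ X hs, hb f' x hx, h1]
      simp only [lieSymbol1, hb f x hx]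
      rw [lieDensity_congr e.1.open_target _ (fun y hy => congrFun (hb f y hy) i) hx]
    -- The trace-free eigenvalue differs from that of vector fields by $2(2+n(1-\delta))$, the trace
    -- eigenvalue, treated next, by $2(2-n\delta)$.
    · intro h
      exact mul_ne_zero h2 hc.two (by linear_combination h)
    · intro h
      exact mul_ne_zero h2 hc.trace (by linear_combination h)
  -- Once the first-order coefficients vanish the operator has order zero. Only now is its remaining
  -- coefficient equivariant as a density.
  have ha' : ∀ f, HasCoeffs (t f) e 0 0 (a₀ (extLin₂ (mu - lam) hK hKe f)) := fun f =>
    (ha (extLin₂ (mu - lam) hK hKe f)).congr (fun _ _ => rfl)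
      (fun x hx => ((hb f x hx).symm.trans (key f x hx)).symm) fun _ _ => rfl
  have hb₀ : ∀ f, ∀ x ∈ e.1.target, coeff₀ e (t f) x = a₀ (extLin₂ (mu - lam) hK hKe f) x :=
    fun f x hx => (ha' _).coeff₀_eq hx
  have key₀ : coeff₀ e (t f) x = 0 := by
    refine eq_zero_of_intertwines (p := p) (ρ := rep2 (mu - lam)) (σ := rep0 (mu - lam))
      hS hL (coeff₀ e ∘ₗ t) e.1.open_target
      (fun f x hx => contDiffAt_of_eq (hb₀ f) (ha' _).smooth₀ hx) ?_
      (casimirFibre_rep0 p (mu - lam)) hcas ?_ ?_ f hx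
    · intro X hX f f' hff' x hx
      have h1 := (hlie X hX f f' hff').coeff₀ (contDiffAt_field_of_mem hX) (ha' _) (ha' _) hx
      simp only [LinearMap.comp_apply]
      rw [hb₀ f' x hx, h1, lieGen_rep0]
      exact lieDensity_congr e.1.open_target _ (fun y hy => (hb₀ f y hy).symm) hx
    -- The two differences with the eigenvalue on densities are $4(1+n(1-\delta))$ and then
    -- $2(2+n(1-2\delta))$.
    · intro h
      exact mul_ne_zero (mul_ne_zero h2 h2) hc.one (by linear_combination h)
    · intro h
      exact mul_ne_zero h2 hc.half (by linear_combination h)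
  rw [hb₀ f x hx] at key₀
  exact (ha' f).eq_zero hx rfl rfl key₀ φ

/-- Two densities agree if they do so in a family of charts covering the manifold. -/
theorem density_eq_zero (hg : IsConformallyFlat p g) {w : 𝕜} (ψ : Density n M w)
    (h : ∀ e : Chart n M, IsAdapted p g e → ∀ x ∈ e.1.target, ψ.1 e x = 0) : ψ = 0 := by
  refine Subtype.ext (funext fun e => funext fun x => ?_)
  by_cases hx : x ∈ e.1.target
  · obtain ⟨e', hm, he'⟩ := hg (e.1.symm x)
    have hx' : x ∈ overlap e e' := ⟨hx, hm⟩
    rw [density_transform ψ hx', h e' he' _ (trans_mem_overlap hx').1, mul_zero]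
    rfl
  · exact ψ.2.2.1 e x hx

/-- An equivariant map which lowers the order vanishes. -/
theorem IsConfEquivariant.eq_zero (hT : IsConfEquivariant p g T) (hg : IsConformallyFlat p g)
    (hc : CoeffDenoms (n : 𝕜) lam mu)
    (h₂ : ∀ (P : Symbol2 n M (mu - lam)) e, ∃ a₁ a₀, HasCoeffs (T (P, 0, 0)).1 e 0 a₁ a₀)
    (h₁ : ∀ (P : Symbol1 n M (mu - lam)) e, ∃ a₀, HasCoeffs (T (0, P, 0)).1 e 0 0 a₀)
    (h₀ : ∀ (P : Density n M (mu - lam)) e, HasCoeffs (T (0, 0, P)).1 e 0 0 0) : T = 0 := by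
  have k₀ : ∀ P, T (0, 0, P) = 0 := fun P => Subtype.ext (LinearMap.ext fun φ =>
    density_eq_zero hg _ fun e he x hx => (h₀ P e).eq_zero hx rfl rfl rfl φ)
  have k₁ : ∀ P, T (0, P, 0) = 0 := fun P => Subtype.ext (LinearMap.ext fun φ =>
    density_eq_zero hg _ fun e he x hx => by
      -- The symbol agrees near $x$ with its product with a cut-off function. The product is killed
      -- by the Casimir argument, and the difference does not contribute at $x$ by locality.
      obtain ⟨K, χ, W, hK, hKe, hχ, hW, hxW, hWK, hone⟩ := exists_cutoff e.1.open_target hx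
      let f : supported₁ 𝕜 K :=
        ⟨fun y => χ y • P.1 e y, hχ.smul hK e.1.open_target hKe (contDiffOn_pi.2 (P.2.1 e))⟩
      have e1 := hT.coeff_eq_zero₁ he hc (fun P => h₁ P e) hK hKe f φ hx
      have e2 := hT.apply_eq_zero he hW (hWK.trans hKe)
        (P := (0, P, 0) - (0, extLin₁ (mu - lam) hK hKe f, 0)) (fun y hy => by
          refine ⟨by simp, ?_, by simp⟩
          have := extLin₁_apply (mu - lam) hK hKe f (hKe (hWK hy))
          simp [this, f, hone y hy]) φ hxW
      rw [map_sub, DiffOp2.coe_sub] at e2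
      simpa [e1] using e2)
  have k₂ : ∀ P, T (P, 0, 0) = 0 := fun P => Subtype.ext (LinearMap.ext fun φ =>
    density_eq_zero hg _ fun e he x hx => by
      obtain ⟨K, χ, W, hK, hKe, hχ, hW, hxW, hWK, hone⟩ := exists_cutoff e.1.open_target hx
      let f : supported₂ 𝕜 K :=
        ⟨fun y => χ y • P.1 e y, hχ.smul hK e.1.open_target hKe
          (contDiffOn_pi.2 fun i => contDiffOn_pi.2 (P.2.1 e i)),
          fun y i j => by simp [P.2.2.2.1 e y i j]⟩
      have e1 := hT.coeff_eq_zero₂ he hc (fun P => h₂ P e) hK hKe f φ hx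
      have e2 := hT.apply_eq_zero he hW (hWK.trans hKe)
        (P := (P, 0, 0) - (extLin₂ (mu - lam) hK hKe f, 0, 0)) (fun y hy => by
          refine ⟨?_, by simp, by simp⟩
          have := extLin₂_apply (mu - lam) hK hKe f (hKe (hWK hy))
          simp [this, f, hone y hy]) φ hxW
      rw [map_sub, DiffOp2.coe_sub] at e2
      simpa [e1] using e2)
  refine LinearMap.ext fun P => ?_
  have h : P = (P.1, 0, 0) + (0, P.2.1, 0) + (0, 0, P.2.2) := by ext <;> simp
  rw [h, map_add, map_add, k₀, k₁, k₂]
  simp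

/-- Equal principal symbols cancel in the difference, which is again equivariant and therefore falls
under `IsConfEquivariant.eq_zero`. -/
theorem PreservesPrincipalSymbol.unique {Q Q' : Symbols n M (mu - lam) →ₗ[𝕜] DiffOp2 n M lam mu}
    (hg : IsConformallyFlat p g) (hc : CoeffDenoms (n : 𝕜) lam mu)
    (hQ : PreservesPrincipalSymbol Q) (hQ' : PreservesPrincipalSymbol Q')
    (hE : IsConfEquivariant p g Q) (hE' : IsConfEquivariant p g Q') : Q' = Q := by
  rw [← sub_eq_zero]
  refine IsConfEquivariant.eq_zero (p := p) (g := g) ?_ hg hc (fun P e => ?_) (fun P e => ?_)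
    (fun P e => ?_)
  · intro e he X hX P P' hP φ φ' hφ x hx
    have e1 := hE e he X hX P P' hP φ φ' hφ x hx
    have e2 := hE' e he X hX P P' hP φ φ' hφ x hx
    have d1 := contDiffAt_density ((Q P).1 φ) hx
    have d2 := contDiffAt_density ((Q' P).1 φ) hx
    have e3 : lieDensity mu X ((((Q' - Q) P).1 φ).1 e) x = lieDensity mu X (((Q' P).1 φ).1 e) x
        - lieDensity mu X (((Q P).1 φ).1 e) x := by
      have : (((Q' - Q) P).1 φ).1 e = fun y => ((Q' P).1 φ).1 e y - ((Q P).1 φ).1 e y := by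
        funext y; simp [DiffOp2.coe_sub]
      rw [this]
      simp only [lieDensity, pd_sub _ d2 d1, mul_sub, Finset.sum_sub_distrib]
      ring
    rw [e3]
    simp only [LinearMap.sub_apply, DiffOp2.coe_sub, Submodule.coe_sub, Pi.sub_apply] at e1 e2 ⊢
    rw [e1, e2]
    ring
  · obtain ⟨a₁, a₀, h⟩ := hQ.1 P e
    obtain ⟨b₁, b₀, h'⟩ := hQ'.1 P e
    exact ⟨_, _, by simpa [DiffOp2.coe_sub] using h'.sub h⟩
  · obtain ⟨a₀, h⟩ := hQ.2.1 P e
    obtain ⟨b₀, h'⟩ := hQ'.2.1 P e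
    exact ⟨_, by simpa [DiffOp2.coe_sub] using h'.sub h⟩
  · simpa [DiffOp2.coe_sub] using (hQ'.2.2 P e).sub (hQ.2.2 P e)

end Uniqueness

/-! ### The derivative of the determinant -/

section Det

variable {n : ℕ} {m : Type*} [Fintype m] [DecidableEq m]

theorem pd_prod (i : Fin n) (s : Finset m) {f : m → E n → ℝ} {x : E n}
    (hf : ∀ k, ContDiffAt ℝ ∞ (f k) x) :
    pd i (fun y => ∏ k ∈ s, f k y) x = ∑ k ∈ s, (∏ j ∈ s.erase k, f j x) * pd i (f k) x := by
  have := (HasFDerivAt.finsetProd (u := s) fun k _ =>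
    (differentiableAt_of_smooth (hf k)).hasFDerivAt).fderiv
  simp only [pd, this]
  simp

/-- A permutation other than the identity moves at least two points, so it moves one besides $k$,
where the identity matrix has the entry zero. -/
theorem prod_erase_one_perm (σ : Equiv.Perm m) (k : m) :
    ∏ j ∈ Finset.univ.erase k, (1 : Matrix m m ℝ) (σ j) j = if σ = 1 then 1 else 0 := by
  split_ifs with h
  · subst h
    exact Finset.prod_eq_one fun j _ => Matrix.one_apply_eq j
  · obtain ⟨a, ha⟩ : ∃ a, σ a ≠ a := by
      by_contra hc
      push Not at hc
      exact h (Equiv.ext hc)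
    obtain ⟨b, hb, hbk⟩ : ∃ b, σ b ≠ b ∧ b ≠ k := by
      by_cases hak : a = k
      · refine ⟨σ a, fun h1 => ha (σ.injective h1), fun h1 => ha (h1.trans hak.symm)⟩
      · exact ⟨a, ha, hak⟩
    exact Finset.prod_eq_zero (Finset.mem_erase.2 ⟨hbk, Finset.mem_univ b⟩)
      (Matrix.one_apply_ne hb)

/-- Multiplying by the inverse of the value at $x$ reduces to a matrix function equal to the
identity at $x$. There only the identity permutation contributes, and the derivative of the
determinant is the trace. -/
theorem pd_det {A : E n → Matrix m m ℝ} {x : E n}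
    (hA : ∀ i j, ContDiffAt ℝ ∞ (fun y => A y i j) x) (hx : (A x).det ≠ 0) (i : Fin n) :
    pd i (fun y => (A y).det) x =
      (A x).det * ∑ k, ∑ l, (A x)⁻¹ k l * pd i (fun y => A y l k) x := by
  have hu : IsUnit (A x).det := isUnit_iff_ne_zero.2 hx
  let B : E n → Matrix m m ℝ := fun y => (A x)⁻¹ * A y
  have hB1 : B x = 1 := Matrix.nonsing_inv_mul _ hu
  have hB : ∀ k l, ContDiffAt ℝ ∞ (fun y => B y k l) x := fun k l => by
    simp only [B, Matrix.mul_apply]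
    fun_prop
  have hAB : ∀ y, (A y).det = (A x).det * (B y).det := fun y => by
    rw [← Matrix.det_mul, Matrix.mul_nonsing_inv_cancel_left _ _ hu]
  have hBd : ∀ k, pd i (fun y => B y k k) x = ∑ l, (A x)⁻¹ k l * pd i (fun y => A y l k) x :=
    fun k => by
      simp only [B, Matrix.mul_apply]
      simp (disch := fun_prop) only [pd_sum, pd_const_mul]
  rw [pd_fun_congr hAB, pd_const_mul i _ (contDiffAt_det hB)]
  congr 1
  simp only [Matrix.det_apply']
  rw [pd_sum i fun σ => contDiffAt_const.mul (contDiffAt_prod fun k _ => hB _ _)]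
  have h1 : ∀ σ : Equiv.Perm m, pd i (fun y => ((σ.sign : ℤ) : ℝ) * ∏ k, B y (σ k) k) x =
      if σ = 1 then ∑ k, pd i (fun y => B y k k) x else 0 := fun σ => by
    rw [pd_const_mul i _ (contDiffAt_prod fun k _ => hB _ _), pd_prod i _ fun k => hB _ _]
    simp only [hB1, prod_erase_one_perm]
    split_ifs with h
    · subst h; simp
    · simp
  simp only [h1, Finset.sum_ite_eq', Finset.mem_univ, if_true, hBd]

end Det

/-! ### Metrics in coordinates -/

section Metric

variable {n : ℕ}

/-- The matrix-valued function `g` is a smooth metric on the open set `U`. -/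
structure IsMetricOn (g : E n → Matrix (Fin n) (Fin n) ℝ) (U : Set (E n)) : Prop where
  isOpen : IsOpen U
  smooth : ∀ y ∈ U, ∀ i j, ContDiffAt ℝ ∞ (fun z => g z i j) y
  symm : ∀ y ∈ U, ∀ i j, g y i j = g y j i
  det_ne_zero : ∀ y ∈ U, (g y).det ≠ 0

theorem PseudoMetric.isMetricOn {M : Type*} [TopologicalSpace M] [ChartedSpace (E n) M]
    (g : PseudoMetric n M) (e : Chart n M) : IsMetricOn (g.comp e) e.1.target where
  isOpen := e.1.open_target
  smooth y hy i j := (g.smooth e i j).contDiffAt (e.1.open_target.mem_nhds hy)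
  symm y hy i j := ((g.symm e y hy).apply i j).symm
  det_ne_zero := g.nondeg e

/-- By Cramer's rule the entries are determinants divided by a non-vanishing determinant. -/
theorem contDiffAt_inv {A : E n → Matrix (Fin n) (Fin n) ℝ} {x : E n}
    (hA : ∀ i j, ContDiffAt ℝ ∞ (fun y => A y i j) x) (hx : (A x).det ≠ 0) (i j : Fin n) :
    ContDiffAt ℝ ∞ (fun y => (A y)⁻¹ i j) x := by
  have h1 : ∀ y, (A y)⁻¹ i j = ((A y).det)⁻¹ * ((A y).updateRow j (Pi.single i 1)).det := fun y => by
    rw [Matrix.inv_def, Matrix.smul_apply, Matrix.adjugate_apply, Ring.inverse_eq_inv', smul_eq_mul]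
  rw [funext h1]
  refine ((contDiffAt_det hA).inv hx).mul (contDiffAt_det fun k l => ?_)
  by_cases h : k = j
  · subst h
    simp only [Matrix.updateRow_self]
    exact contDiffAt_const
  · simp only [Matrix.updateRow_ne h]
    exact hA k l

variable {g g' : E n → Matrix (Fin n) (Fin n) ℝ} {U U' : Set (E n)}

theorem IsMetricOn.contDiffAt_inv (h : IsMetricOn g U) {x : E n} (hx : x ∈ U) (i j : Fin n) :
    ContDiffAt ℝ ∞ (fun y => (g y)⁻¹ i j) x :=
  ConfQuant.contDiffAt_inv (h.smooth x hx) (h.det_ne_zero x hx) i j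

theorem IsMetricOn.contDiffAt_christoffel (h : IsMetricOn g U) {x : E n} (hx : x ∈ U)
    (k i j : Fin n) : ContDiffAt ℝ ∞ (christoffel g k i j) x := by
  have h2 := h.smooth x hx
  exact contDiffAt_const.mul (contDiffAt_sum fun l => (h.contDiffAt_inv hx k l).mul (by fun_prop))

theorem IsMetricOn.contDiffAt_christoffelTr (h : IsMetricOn g U) {x : E n} (hx : x ∈ U)
    (i : Fin n) : ContDiffAt ℝ ∞ (christoffelTr g i) x := by
  have h1 := h.contDiffAt_christoffel hx
  unfold christoffelTr
  fun_prop

theorem IsMetricOn.contDiffAt_ricci (h : IsMetricOn g U) {x : E n} (hx : x ∈ U)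
    (i j : Fin n) : ContDiffAt ℝ ∞ (ricci g i j) x := by
  have h1 := h.contDiffAt_christoffel hx
  unfold ricci
  fun_prop

theorem IsMetricOn.contDiffAt_scalarCurv (h : IsMetricOn g U) {x : E n} (hx : x ∈ U) :
    ContDiffAt ℝ ∞ (scalarCurv g) x := by
  exact contDiffAt_sum fun i => contDiffAt_sum fun j =>
    (h.contDiffAt_inv hx i j).mul (h.contDiffAt_ricci hx i j)

/-- The Christoffel symbols with all indices lowered. -/
def christoffelLow (g : E n → Matrix (Fin n) (Fin n) ℝ) (l i j : Fin n) (x : E n) : ℝ :=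
  (1 / 2) * (pd i (fun y => g y j l) x + pd j (fun y => g y i l) x - pd l (fun y => g y i j) x)

theorem christoffel_eq_sum (k i j : Fin n) (x : E n) :
    christoffel g k i j x = ∑ l, (g x)⁻¹ k l * christoffelLow g l i j x := by
  simp only [christoffel, christoffelLow, Finset.mul_sum]
  exact Finset.sum_congr rfl fun l _ => by ring

theorem IsMetricOn.christoffel_comm (h : IsMetricOn g U) {x : E n} (hx : x ∈ U) (k i j : Fin n) :
    christoffel g k i j x = christoffel g k j i x := by
  simp only [christoffel]
  congr 1
  refine Finset.sum_congr rfl fun l _ => ?_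
  rw [pd_congr h.isOpen (fun y hy => h.symm y hy i j) hx l]
  ring

/-- The Levi-Civita connection is compatible with the metric. -/
theorem IsMetricOn.pd_eq (h : IsMetricOn g U) {x : E n} (hx : x ∈ U) (i k l : Fin n) :
    pd i (fun y => g y k l) x = ∑ m, christoffel g m i k x * g x m l
      + ∑ m, christoffel g m i l x * g x k m := by
  -- Lowering the index removes the inverse metric; in the sum of the two lowered symbols all
  -- derivatives but $\partial_i\mathrm g_{kl}$ cancel.
  have h1 : ∀ j l, ∑ m, christoffel g m i j x * g x m l = christoffelLow g l i j x := fun j l => by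
    have h2 : ∀ s, ∑ m, g x l m * (g x)⁻¹ m s = if l = s then 1 else 0 := fun s => by
      rw [← Matrix.mul_apply, Matrix.mul_nonsing_inv _ (isUnit_iff_ne_zero.2 (h.det_ne_zero x hx)),
        Matrix.one_apply]
    simp only [christoffel_eq_sum, Finset.sum_mul]
    rw [Finset.sum_comm]
    have h3 : ∀ s, ∑ m, (g x)⁻¹ m s * christoffelLow g s i j x * g x m l =
        (if l = s then 1 else 0) * christoffelLow g s i j x := fun s => by
      rw [← h2 s, Finset.sum_mul]
      exact Finset.sum_congr rfl fun m _ => by rw [h.symm x hx m l]; ring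
    simp [h3]
  have h4 : ∑ m, christoffel g m i l x * g x k m = christoffelLow g k i l x := by
    rw [← h1]
    exact Finset.sum_congr rfl fun m _ => by rw [h.symm x hx k m]
  rw [h1, h4, christoffelLow, christoffelLow, pd_congr h.isOpen (fun y hy => h.symm y hy l k) hx i]
  ring

end Metric

/-! ### Change of coordinates for the Levi-Civita connection -/

section MetricChange

variable {n : ℕ}

/-- The metrics `g` on `U` and `g'` on `U'` correspond to each other under the change of
coordinates `ψ` with Jacobian matrix `J`. -/
structure IsMetricChange (ψ : E n → E n) (J : E n → Matrix (Fin n) (Fin n) ℝ)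
    (g g' : E n → Matrix (Fin n) (Fin n) ℝ) (U U' : Set (E n)) : Prop where
  isMetric : IsMetricOn g U
  isMetric' : IsMetricOn g' U'
  mapsTo : ∀ y ∈ U, ψ y ∈ U'
  smooth : ∀ y ∈ U, ContDiffAt ℝ ∞ ψ y
  jac_eq : ∀ y ∈ U, ∀ a i, pd i (fun z => ψ z a) y = J y a i
  smooth_jac : ∀ y ∈ U, ∀ a i, ContDiffAt ℝ ∞ (fun z => J z a i) y
  det_ne_zero : ∀ y ∈ U, (J y).det ≠ 0
  eq : ∀ y ∈ U, g y = (J y).transpose * g' (ψ y) * J y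

theorem PseudoMetric.isMetricChange {M : Type*} [TopologicalSpace M] [ChartedSpace (E n) M]
    (g : PseudoMetric n M) (e e' : Chart n M) :
    IsMetricChange (trans e e') (jac e e') (g.comp e) (g.comp e') (overlap e e') e'.1.target where
  isMetric :=
    have h := g.isMetricOn e
    ⟨isOpen_overlap e e', fun y hy => h.smooth y hy.1, fun y hy => h.symm y hy.1,
      fun y hy => h.det_ne_zero y hy.1⟩
  isMetric' := g.isMetricOn e'
  mapsTo y hy := (trans_mem_overlap hy).1
  smooth y hy := contDiffAt_trans hy
  jac_eq y _ a i := rfl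
  smooth_jac y hy a i := contDiffAt_jac hy a i
  det_ne_zero y hy := det_jac_ne_zero hy
  eq := g.transform e e'

namespace IsMetricChange

variable {ψ : E n → E n} {J g g' : E n → Matrix (Fin n) (Fin n) ℝ} {U U' : Set (E n)}
  (h : IsMetricChange ψ J g g' U U') {x : E n} (hx : x ∈ U)

include h hx

theorem pd_comp_mul {𝕜 : Type*} [RCLike 𝕜] {f : E n → 𝕜} (hf : ContDiffAt ℝ ∞ f (ψ x))
    (i : Fin n) :
    pd i (fun y => f (ψ y)) x = ∑ c, ((J x c i : ℝ) : 𝕜) * pd c f (ψ x) := by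
  rw [ConfQuant.pd_comp_mul i hf (h.smooth x hx)]
  simp only [h.jac_eq x hx]

theorem pd_comp_real {f : E n → ℝ} (hf : ContDiffAt ℝ ∞ f (ψ x)) (i : Fin n) :
    pd i (fun y => f (ψ y)) x = ∑ c, J x c i * pd c f (ψ x) :=
  h.pd_comp_mul (𝕜 := ℝ) hx hf i

theorem pd_jac_comm (a i j : Fin n) :
    pd i (fun y => J y a j) x = pd j (fun y => J y a i) x := by
  have hc := contDiffAt_component (h.smooth x hx) a
  rw [pd_congr h.isMetric.isOpen (fun y hy => (h.jac_eq y hy a j).symm) hx, pd_comm i j hc,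
    pd_congr h.isMetric.isOpen (fun y hy => h.jac_eq y hy a i) hx]

theorem comp_apply (j l : Fin n) :
    g x j l = ∑ a, ∑ b, J x a j * g' (ψ x) a b * J x b l := by
  rw [h.eq x hx]
  simp only [Matrix.mul_apply, Matrix.transpose_apply, Finset.sum_mul]
  exact Finset.sum_comm

theorem pd_metric (i j l : Fin n) :
    pd i (fun y => g y j l) x =
      ∑ a, ∑ b, pd i (fun y => J y a j) x * g' (ψ x) a b * J x b l
      + ∑ a, ∑ b, pd i (fun y => J y a l) x * g' (ψ x) a b * J x b j
      + ∑ a, ∑ b, ∑ c, J x a j * J x b l * J x c i * pd c (fun z => g' z a b) (ψ x) := by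
  have hJ := h.smooth_jac x hx
  have hg := fun a b => h.isMetric'.smooth _ (h.mapsTo x hx) a b
  have hgc : ∀ a b, ContDiffAt ℝ ∞ (fun y => g' (ψ y) a b) x := fun a b =>
    (hg a b).comp x (h.smooth x hx)
  have e2 : ∑ a, ∑ b, pd i (fun y => J y a l) x * g' (ψ x) a b * J x b j =
      ∑ a, ∑ b, J x a j * g' (ψ x) a b * pd i (fun y => J y b l) x := by
    rw [Finset.sum_comm]
    exact Finset.sum_congr rfl fun a _ => Finset.sum_congr rfl fun b _ => by
      rw [h.isMetric'.symm _ (h.mapsTo x hx) b a]; ring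
  rw [pd_congr h.isMetric.isOpen (fun y hy => h.comp_apply hy j l) hx, e2]
  rw [pd_sum i fun a => contDiffAt_sum fun b => ((hJ a j).mul (hgc a b)).mul (hJ b l)]
  simp only [← Finset.sum_add_distrib]
  refine Finset.sum_congr rfl fun a _ => ?_
  rw [pd_sum i fun b => ((hJ a j).mul (hgc a b)).mul (hJ b l)]
  refine Finset.sum_congr rfl fun b _ => ?_
  rw [pd_mul (𝕜 := ℝ) i ((hJ a j).mul (hgc a b)) (hJ b l), pd_mul (𝕜 := ℝ) i (hJ a j) (hgc a b),
    h.pd_comp_real hx (hg _ _)]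
  have e3 : ∑ c, J x a j * J x b l * J x c i * pd c (fun z => g' z a b) (ψ x) =
      J x a j * (∑ c, J x c i * pd c (fun z => g' z a b) (ψ x)) * J x b l := by
    rw [Finset.mul_sum, Finset.sum_mul]
    exact Finset.sum_congr rfl fun c _ => by ring
  rw [e3]
  ring

theorem christoffelLow_eq (l i j : Fin n) :
    christoffelLow g l i j x = ∑ b, J x b l * (∑ c, ∑ a, J x c i * J x a j *
      christoffelLow g' b c a (ψ x) + ∑ a, g' (ψ x) b a * pd i (fun y => J y a j) x) := by
  rw [christoffelLow, h.pd_metric hx, h.pd_metric hx, h.pd_metric hx]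
  have c1 : ∀ a, pd j (fun y => J y a i) x = pd i (fun y => J y a j) x := fun a =>
    h.pd_jac_comm hx a j i
  have c2 : ∀ a, pd l (fun y => J y a i) x = pd i (fun y => J y a l) x := fun a =>
    h.pd_jac_comm hx a l i
  have c3 : ∀ a, pd l (fun y => J y a j) x = pd j (fun y => J y a l) x := fun a =>
    h.pd_jac_comm hx a l j
  simp only [c1, c2, c3]
  have e1 : ∑ b, J x b l * ∑ a, g' (ψ x) b a * pd i (fun y => J y a j) x =
      ∑ a, ∑ b, pd i (fun y => J y a j) x * g' (ψ x) a b * J x b l := by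
    simp only [Finset.mul_sum]
    rw [Finset.sum_comm]
    exact Finset.sum_congr rfl fun a _ => Finset.sum_congr rfl fun b _ => by
      rw [h.isMetric'.symm _ (h.mapsTo x hx) b a]; ring
  have e2 : ∑ b, J x b l * ∑ c, ∑ a, J x c i * J x a j * christoffelLow g' b c a (ψ x) =
      (1 / 2) * (∑ a, ∑ b, ∑ c, J x a j * J x b l * J x c i * pd c (fun z => g' z a b) (ψ x)
      + ∑ a, ∑ b, ∑ c, J x a i * J x b l * J x c j * pd c (fun z => g' z a b) (ψ x)
      - ∑ a, ∑ b, ∑ c, J x a i * J x b j * J x c l * pd c (fun z => g' z a b) (ψ x)) := by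
    have d1 : ∑ a, ∑ b, ∑ c, J x a j * J x b l * J x c i * pd c (fun z => g' z a b) (ψ x) =
        ∑ b, ∑ c, ∑ a, J x a j * J x b l * J x c i * pd c (fun z => g' z a b) (ψ x) := by
      rw [Finset.sum_comm]
      exact Finset.sum_congr rfl fun b _ => Finset.sum_comm
    have d2 : ∑ a, ∑ b, ∑ c, J x a i * J x b l * J x c j * pd c (fun z => g' z a b) (ψ x) =
        ∑ b, ∑ c, ∑ a, J x c i * J x b l * J x a j * pd a (fun z => g' z c b) (ψ x) :=
      Finset.sum_comm
    have d3 : ∑ a, ∑ b, ∑ c, J x a i * J x b j * J x c l * pd c (fun z => g' z a b) (ψ x) =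
        ∑ b, ∑ c, ∑ a, J x c i * J x a j * J x b l * pd b (fun z => g' z c a) (ψ x) := by
      rw [Finset.sum_comm' (t' := Finset.univ) (s' := fun _ => Finset.univ) (by simp)]
      rw [Finset.sum_congr rfl fun b _ => Finset.sum_comm, Finset.sum_comm]
      exact Finset.sum_congr rfl fun b _ => Finset.sum_comm
    rw [d1, d2, d3]
    simp only [christoffelLow, Finset.mul_sum, ← Finset.sum_add_distrib, ← Finset.sum_sub_distrib]
    exact Finset.sum_congr rfl fun b _ => Finset.sum_congr rfl fun c _ =>
      Finset.sum_congr rfl fun a _ => by ring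
  simp only [mul_add, Finset.sum_add_distrib]
  rw [e1, e2]
  ring

theorem inv_eq (d b : Fin n) :
    ∑ k, ∑ l, J x d k * J x b l * (g x)⁻¹ k l = (g' (ψ x))⁻¹ d b := by
  have hu := isUnit_iff_ne_zero.2 (h.det_ne_zero x hx)
  have h1 : J x * (g x)⁻¹ * (J x).transpose = (g' (ψ x))⁻¹ := by
    rw [h.eq x hx, Matrix.mul_inv_rev, Matrix.mul_inv_rev,
      Matrix.mul_nonsing_inv_cancel_left _ _ hu, Matrix.mul_assoc,
      Matrix.nonsing_inv_mul _ (by rwa [Matrix.det_transpose]), Matrix.mul_one]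
  rw [← h1]
  simp only [Matrix.mul_apply, Matrix.transpose_apply, Finset.sum_mul]
  rw [Finset.sum_comm]
  exact Finset.sum_congr rfl fun l _ => Finset.sum_congr rfl fun k _ => by ring

/-- The transformation of the Christoffel symbols. -/
theorem sum_jac_christoffel (d i j : Fin n) :
    ∑ k, J x d k * christoffel g k i j x =
      ∑ c, ∑ a, christoffel g' d c a (ψ x) * J x c i * J x a j + pd i (fun y => J y d j) x := by
  set v : Fin n → ℝ := fun b => ∑ c, ∑ a, J x c i * J x a j *
      christoffelLow g' b c a (ψ x) + ∑ a, g' (ψ x) b a * pd i (fun y => J y a j) x with hv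
  have e1 : ∑ k, J x d k * christoffel g k i j x = ∑ b, (g' (ψ x))⁻¹ d b * v b := by
    simp only [christoffel_eq_sum, h.christoffelLow_eq hx, ← h.inv_eq hx, Finset.mul_sum,
      Finset.sum_mul]
    rw [Finset.sum_comm' (t' := Finset.univ) (s' := fun _ => Finset.univ) (by simp)]
    rw [Finset.sum_congr rfl fun l _ => Finset.sum_comm, Finset.sum_comm]
    refine Finset.sum_congr rfl fun b _ => ?_
    rw [Finset.sum_comm]
    exact Finset.sum_congr rfl fun k _ => Finset.sum_congr rfl fun l _ => by
      simp only [hv]; ring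
  have hu := isUnit_iff_ne_zero.2 (h.isMetric'.det_ne_zero _ (h.mapsTo x hx))
  have e2 : ∀ a, ∑ b, (g' (ψ x))⁻¹ d b * g' (ψ x) b a = if d = a then 1 else 0 := fun a => by
    rw [← Matrix.mul_apply, Matrix.nonsing_inv_mul _ hu, Matrix.one_apply]
  rw [e1]
  simp only [hv, mul_add, Finset.sum_add_distrib]
  congr 1
  · simp only [christoffel_eq_sum, Finset.mul_sum, Finset.sum_mul]
    rw [Finset.sum_comm]
    refine Finset.sum_congr rfl fun c _ => ?_
    rw [Finset.sum_comm]
    exact Finset.sum_congr rfl fun a _ => Finset.sum_congr rfl fun b _ => by ring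
  · simp only [Finset.mul_sum]
    rw [Finset.sum_comm]
    simp only [← mul_assoc, ← Finset.sum_mul, e2]
    simp

theorem sum_inv_jac (a b : Fin n) : ∑ i, (J x)⁻¹ i a * J x b i = if a = b then 1 else 0 := by
  have hu := isUnit_iff_ne_zero.2 (h.det_ne_zero x hx)
  have h1 := congrFun (congrFun (Matrix.mul_nonsing_inv (J x) hu) b) a
  rw [Matrix.mul_apply, Matrix.one_apply] at h1
  simp only [eq_comm (a := a)]
  rw [← h1]
  exact Finset.sum_congr rfl fun i _ => mul_comm _ _

theorem sum_jac_inv (i j : Fin n) : ∑ a, (J x)⁻¹ i a * J x a j = if i = j then 1 else 0 := by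
  have hu := isUnit_iff_ne_zero.2 (h.det_ne_zero x hx)
  rw [← Matrix.mul_apply, Matrix.nonsing_inv_mul _ hu, Matrix.one_apply]

theorem sum_jac_christoffelTr (i : Fin n) :
    ∑ c, J x c i * christoffelTr g' c (ψ x) =
      christoffelTr g i x - pd i (fun y => (J y).det) x / (J x).det := by
  have hd := h.det_ne_zero x hx
  have e1 : ∀ j, christoffel g j i j x = ∑ d, (J x)⁻¹ j d *
      (∑ c, ∑ a, christoffel g' d c a (ψ x) * J x c i * J x a j + pd i (fun y => J y d j) x) := by
    intro j
    simp only [← h.sum_jac_christoffel hx, Finset.mul_sum]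
    rw [Finset.sum_comm]
    simp only [← mul_assoc, ← Finset.sum_mul, h.sum_jac_inv hx]
    simp
  have e2 : pd i (fun y => (J y).det) x / (J x).det =
      ∑ j, ∑ d, (J x)⁻¹ j d * pd i (fun y => J y d j) x := by
    rw [pd_det (h.smooth_jac x hx) hd, mul_div_cancel_left₀ _ hd]
  have e3 : ∑ j, ∑ d, (J x)⁻¹ j d * ∑ c, ∑ a, christoffel g' d c a (ψ x) * J x c i * J x a j =
      ∑ c, J x c i * christoffelTr g' c (ψ x) := by
    rw [Finset.sum_comm]
    simp only [Finset.mul_sum, christoffelTr]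
    rw [Finset.sum_comm (f := fun c d => J x c i * christoffel g' d c d (ψ x))]
    refine Finset.sum_congr rfl fun d _ => ?_
    rw [Finset.sum_comm]
    refine Finset.sum_congr rfl fun c _ => ?_
    rw [Finset.sum_comm]
    have e4 : ∀ a, ∑ j, (J x)⁻¹ j d * (christoffel g' d c a (ψ x) * J x c i * J x a j) =
        christoffel g' d c a (ψ x) * J x c i * if d = a then 1 else 0 := fun a => by
      rw [← h.sum_inv_jac hx d a, Finset.mul_sum]
      exact Finset.sum_congr rfl fun j _ => by ring
    simp only [e4]
    simp [mul_comm]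
  rw [e2, christoffelTr]
  simp only [e1, mul_add, Finset.sum_add_distrib]
  rw [e3]
  ring

end IsMetricChange

end MetricChange

/-! ### Traces of covariant derivatives -/

section Traces

variable {n : ℕ} {𝕜 : Type*} [RCLike 𝕜] {g : E n → Matrix (Fin n) (Fin n) ℝ} {U : Set (E n)}
  {w : 𝕜} {P : E n → Fin n → Fin n → 𝕜}

/-- The trace `g_{kl} P^{kl}`. -/
def metricTrace (g : E n → Matrix (Fin n) (Fin n) ℝ) (P : E n → Fin n → Fin n → 𝕜) (y : E n) : 𝕜 :=
  ∑ k, ∑ l, ((g y k l : ℝ) : 𝕜) * P y k l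

theorem IsMetricOn.contDiffAt_metricTrace (h : IsMetricOn g U) {x : E n} (hx : x ∈ U)
    (hP : ∀ k l, ContDiffAt ℝ ∞ (fun y => P y k l) x) : ContDiffAt ℝ ∞ (metricTrace g P) x := by
  have hg := h.smooth x hx
  exact contDiffAt_sum fun k => contDiffAt_sum fun l => (contDiffAt_ofReal (hg k l)).mul (hP k l)

theorem IsMetricOn.pd_metricTrace (h : IsMetricOn g U) {x : E n} (hx : x ∈ U)
    (hP : ∀ k l, ContDiffAt ℝ ∞ (fun y => P y k l) x) (i : Fin n) :
    pd i (metricTrace g P) x = ∑ k, ∑ l, ((g x k l : ℝ) : 𝕜) *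
      (pd i (fun y => P y k l) x + ∑ m, ((christoffel g k i m x : ℝ) : 𝕜) * P x m l
        + ∑ m, ((christoffel g l i m x : ℝ) : 𝕜) * P x k m) := by
  have hg := fun k l => contDiffAt_ofReal (𝕜 := 𝕜) (h.smooth x hx k l)
  have e1 : pd i (metricTrace g P) x = ∑ k, ∑ l, (((pd i (fun y => g y k l) x : ℝ) : 𝕜) * P x k l
      + ((g x k l : ℝ) : 𝕜) * pd i (fun y => P y k l) x) := by
    unfold metricTrace
    rw [pd_sum i fun k => contDiffAt_sum fun l => (hg k l).mul (hP k l)]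
    refine Finset.sum_congr rfl fun k _ => ?_
    rw [pd_sum i fun l => (hg k l).mul (hP k l)]
    refine Finset.sum_congr rfl fun l _ => ?_
    rw [pd_mul i (hg k l) (hP k l), pd_ofReal i (h.smooth x hx k l)]
  have e2 : ∑ k, ∑ l, ((g x k l : ℝ) : 𝕜) * ∑ m, ((christoffel g k i m x : ℝ) : 𝕜) * P x m l =
      ∑ k, ∑ l, (∑ m, ((christoffel g m i k x : ℝ) : 𝕜) * ((g x m l : ℝ) : 𝕜)) * P x k l := by
    simp only [Finset.mul_sum, Finset.sum_mul]
    rw [Finset.sum_congr rfl fun k _ => Finset.sum_comm, Finset.sum_comm]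
    refine Finset.sum_congr rfl fun m _ => ?_
    rw [Finset.sum_comm]
    exact Finset.sum_congr rfl fun l _ => Finset.sum_congr rfl fun k _ => by ring
  have e3 : ∑ k, ∑ l, ((g x k l : ℝ) : 𝕜) * ∑ m, ((christoffel g l i m x : ℝ) : 𝕜) * P x k m =
      ∑ k, ∑ l, (∑ m, ((christoffel g m i l x : ℝ) : 𝕜) * ((g x k m : ℝ) : 𝕜)) * P x k l := by
    simp only [Finset.mul_sum, Finset.sum_mul]
    refine Finset.sum_congr rfl fun k _ => ?_
    rw [Finset.sum_comm]
    exact Finset.sum_congr rfl fun l _ => Finset.sum_congr rfl fun m _ => by ring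
  rw [e1]
  simp only [mul_add, Finset.sum_add_distrib]
  rw [e2, e3]
  simp only [h.pd_eq hx, RCLike.ofReal_add, RCLike.ofReal_sum, RCLike.ofReal_mul, add_mul,
    Finset.sum_add_distrib]
  ring

theorem IsMetricOn.sum_metric_nablaP (h : IsMetricOn g U) {x : E n} (hx : x ∈ U)
    (hP : ∀ k l, ContDiffAt ℝ ∞ (fun y => P y k l) x) (i : Fin n) :
    ∑ k, ∑ l, ((g x k l : ℝ) : 𝕜) * nablaP g w P i k l x = nablaD g w (metricTrace g P) i x := by
  rw [nablaD, h.pd_metricTrace hx hP, metricTrace]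
  simp only [nablaP, Finset.mul_sum, ← Finset.sum_sub_distrib]
  refine Finset.sum_congr rfl fun k _ => Finset.sum_congr rfl fun l _ => ?_
  ring

theorem IsMetricOn.sum_metric_nablaNablaP (h : IsMetricOn g U) {x : E n} (hx : x ∈ U)
    (hP : ∀ y ∈ U, ∀ k l, ContDiffAt ℝ ∞ (fun y => P y k l) y) (i j : Fin n) :
    ∑ k, ∑ l, ((g x k l : ℝ) : 𝕜) * nablaNablaP g w P i j k l x =
      nablaNablaD g w (metricTrace g P) i j x := by
  have hN : ∀ k l, ContDiffAt ℝ ∞ (nablaP g w P j k l) x :=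
    contDiffAt_nablaP (h.contDiffAt_christoffel hx) (hP x hx) j
  have hd : ∀ m, nablaD g w (metricTrace g P) m x = ∑ k, ∑ l, ((g x k l : ℝ) : 𝕜) *
      nablaP g w P m k l x := fun m => (h.sum_metric_nablaP hx (hP x hx) m).symm
  have e0 : pd i (nablaD g w (metricTrace g P) j) x =
      pd i (metricTrace g fun y k l => nablaP g w P j k l y) x :=
    pd_congr h.isOpen (fun y hy => (h.sum_metric_nablaP (w := w) hy (hP y hy) j).symm) hx i
  rw [nablaNablaD, e0, h.pd_metricTrace hx (P := fun y k l => nablaP g w P j k l y) hN i]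
  simp only [hd]
  have e2 : ∑ m, ((christoffel g m i j x : ℝ) : 𝕜) *
      ∑ k, ∑ l, ((g x k l : ℝ) : 𝕜) * nablaP g w P m k l x =
      ∑ k, ∑ l, ((g x k l : ℝ) : 𝕜) *
        ∑ m, ((christoffel g m i j x : ℝ) : 𝕜) * nablaP g w P m k l x := by
    simp only [Finset.mul_sum]
    rw [Finset.sum_comm]
    refine Finset.sum_congr rfl fun k _ => ?_
    rw [Finset.sum_comm]
    exact Finset.sum_congr rfl fun l _ => Finset.sum_congr rfl fun m _ => by ring
  rw [e2]
  simp only [nablaNablaP]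
  rw [Finset.mul_sum, ← Finset.sum_sub_distrib, ← Finset.sum_sub_distrib]
  refine Finset.sum_congr rfl fun k _ => ?_
  rw [Finset.mul_sum, ← Finset.sum_sub_distrib, ← Finset.sum_sub_distrib]
  exact Finset.sum_congr rfl fun l _ => by ring

end Traces

/-! ### Covariant derivatives and changes of coordinates -/

section Covariance

variable {n : ℕ} {𝕜 : Type*} [RCLike 𝕜]

namespace IsMetricChange

variable {ψ : E n → E n} {J g g' : E n → Matrix (Fin n) (Fin n) ℝ} {U U' : Set (E n)}
  (h : IsMetricChange ψ J g g' U U') {x : E n} (hx : x ∈ U)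

include h hx

theorem pd_absPow_det (w : 𝕜) (i : Fin n) : pd i (fun y => absPow (J y).det w) x =
    w * (((christoffelTr g i x : ℝ) : 𝕜)
      - ∑ c, ((J x c i : ℝ) : 𝕜) * ((christoffelTr g' c (ψ x) : ℝ) : 𝕜)) *
      absPow (J x).det w := by
  have h1 := congrArg (fun r : ℝ => (r : 𝕜)) (h.sum_jac_christoffelTr hx i)
  simp only [RCLike.ofReal_sum, RCLike.ofReal_mul, RCLike.ofReal_sub] at h1
  rw [pd_absPow (contDiffAt_det (h.smooth_jac x hx)) (h.det_ne_zero x hx), h1]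
  ring

theorem contDiffAt_absPow_det (w : 𝕜) : ContDiffAt ℝ ∞ (fun y => absPow (J y).det w) x :=
  contDiffAt_absPow (contDiffAt_det (h.smooth_jac x hx)) (h.det_ne_zero x hx) w

theorem contDiffAt_comp {f : E n → 𝕜} (hf : ContDiffAt ℝ ∞ f (ψ x)) :
    ContDiffAt ℝ ∞ (fun y => f (ψ y)) x :=
  hf.comp x (h.smooth x hx)

theorem ofReal_sum_jac_christoffel (d i j : Fin n) :
    ∑ k, ((J x d k : ℝ) : 𝕜) * ((christoffel g k i j x : ℝ) : 𝕜) =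
      ∑ c, ∑ a, ((christoffel g' d c a (ψ x) : ℝ) : 𝕜) * ((J x c i : ℝ) : 𝕜) * ((J x a j : ℝ) : 𝕜)
        + ((pd i (fun y => J y d j) x : ℝ) : 𝕜) := by
  have h1 := congrArg (fun r : ℝ => (r : 𝕜)) (h.sum_jac_christoffel hx d i j)
  simpa only [RCLike.ofReal_sum, RCLike.ofReal_mul, RCLike.ofReal_add] using h1

theorem pd_of_eq {w : 𝕜} {f f' : E n → 𝕜} (hf : ∀ y ∈ U, f y = absPow (J y).det w * f' (ψ y))
    (hf' : ContDiffAt ℝ ∞ f' (ψ x)) (i : Fin n) :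
    pd i f x = absPow (J x).det w * (∑ c, ((J x c i : ℝ) : 𝕜) * pd c f' (ψ x)
      + w * (((christoffelTr g i x : ℝ) : 𝕜)
      - ∑ c, ((J x c i : ℝ) : 𝕜) * ((christoffelTr g' c (ψ x) : ℝ) : 𝕜)) * f' (ψ x)) := by
  rw [pd_congr h.isMetric.isOpen hf hx, pd_mul i (h.contDiffAt_absPow_det hx w)
    (h.contDiffAt_comp hx hf'), h.pd_absPow_det hx, h.pd_comp_mul hx hf']
  ring

theorem nablaD_eq {w : 𝕜} {φ φ' : E n → 𝕜} (hφ : ∀ y ∈ U, φ y = absPow (J y).det w * φ' (ψ y))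
    (hφ' : ContDiffAt ℝ ∞ φ' (ψ x)) (i : Fin n) :
    nablaD g w φ i x = absPow (J x).det w *
      ∑ c, ((J x c i : ℝ) : 𝕜) * nablaD g' w φ' c (ψ x) := by
  rw [nablaD, h.pd_of_eq hx hφ hφ', hφ x hx]
  simp only [nablaD, mul_sub, Finset.sum_sub_distrib, Finset.mul_sum]
  have e : ∀ c, ((J x c i : ℝ) : 𝕜) * (w * ((christoffelTr g' c (ψ x) : ℝ) : 𝕜) * φ' (ψ x)) =
    w * (((J x c i : ℝ) : 𝕜) * ((christoffelTr g' c (ψ x) : ℝ) : 𝕜)) * φ' (ψ x) := fun c => by ring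
  simp only [e, ← Finset.mul_sum, ← Finset.sum_mul]
  ring

theorem covector_eq {w : 𝕜} {X X' : Fin n → E n → 𝕜}
    (hX : ∀ y ∈ U, ∀ j, X j y = absPow (J y).det w * ∑ b, ((J y b j : ℝ) : 𝕜) * X' b (ψ y))
    (hX' : ∀ b, ContDiffAt ℝ ∞ (X' b) (ψ x)) (i j : Fin n) :
    pd i (X j) x - ∑ k, ((christoffel g k i j x : ℝ) : 𝕜) * X k x
        - w * ((christoffelTr g i x : ℝ) : 𝕜) * X j x =
      absPow (J x).det w * ∑ a, ∑ b, ((J x a i : ℝ) : 𝕜) * ((J x b j : ℝ) : 𝕜) *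
        (pd a (X' b) (ψ x) - ∑ k, ((christoffel g' k a b (ψ x) : ℝ) : 𝕜) * X' k (ψ x)
        - w * ((christoffelTr g' a (ψ x) : ℝ) : 𝕜) * X' b (ψ x)) := by
  have hJ := h.smooth_jac x hx
  have hJc := fun b j => contDiffAt_ofReal (𝕜 := 𝕜) (hJ b j)
  have hc := fun b => h.contDiffAt_comp hx (hX' b)
  have hs : ∀ b, ContDiffAt ℝ ∞ (fun y => ((J y b j : ℝ) : 𝕜) * X' b (ψ y)) x := fun b =>
    (hJc b j).mul (hc b)
  have e1 : pd i (X j) x = absPow (J x).det w *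
      (w * (((christoffelTr g i x : ℝ) : 𝕜)
        - ∑ c, ((J x c i : ℝ) : 𝕜) * ((christoffelTr g' c (ψ x) : ℝ) : 𝕜)) *
          ∑ b, ((J x b j : ℝ) : 𝕜) * X' b (ψ x)
      + ∑ b, ((pd i (fun y => J y b j) x : ℝ) : 𝕜) * X' b (ψ x)
      + ∑ a, ∑ b, ((J x a i : ℝ) : 𝕜) * ((J x b j : ℝ) : 𝕜) * pd a (X' b) (ψ x)) := by
    rw [pd_congr h.isMetric.isOpen (fun y hy => hX y hy j) hx, pd_mul i
      (h.contDiffAt_absPow_det hx w) (contDiffAt_sum hs), h.pd_absPow_det hx, pd_sum i hs]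
    have e : ∀ b, pd i (fun y => ((J y b j : ℝ) : 𝕜) * X' b (ψ y)) x =
        ((pd i (fun y => J y b j) x : ℝ) : 𝕜) * X' b (ψ x)
        + ∑ a, ((J x a i : ℝ) : 𝕜) * ((J x b j : ℝ) : 𝕜) * pd a (X' b) (ψ x) := fun b => by
      rw [pd_mul i (hJc b j) (hc b), pd_ofReal i (hJ b j), h.pd_comp_mul hx (hX' b),
        Finset.mul_sum]
      congr 1
      exact Finset.sum_congr rfl fun a _ => by ring
    simp only [e, Finset.sum_add_distrib]
    rw [Finset.sum_comm (f := fun a b => ((J x a i : ℝ) : 𝕜) * ((J x b j : ℝ) : 𝕜) * _)]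
    ring
  have e2 : ∑ k, ((christoffel g k i j x : ℝ) : 𝕜) * X k x = absPow (J x).det w *
      (∑ a, ∑ b, ((J x a i : ℝ) : 𝕜) * ((J x b j : ℝ) : 𝕜) *
        ∑ k, ((christoffel g' k a b (ψ x) : ℝ) : 𝕜) * X' k (ψ x)
      + ∑ b, ((pd i (fun y => J y b j) x : ℝ) : 𝕜) * X' b (ψ x)) := by
    have e3 : ∑ k, ((christoffel g k i j x : ℝ) : 𝕜) * X k x = absPow (J x).det w *
        ∑ b, (∑ k, ((J x b k : ℝ) : 𝕜) * ((christoffel g k i j x : ℝ) : 𝕜)) * X' b (ψ x) := by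
      simp only [hX x hx, Finset.mul_sum, Finset.sum_mul]
      rw [Finset.sum_comm]
      exact Finset.sum_congr rfl fun b _ => Finset.sum_congr rfl fun k _ => by ring
    rw [e3]
    simp only [h.ofReal_sum_jac_christoffel hx, add_mul, Finset.sum_add_distrib]
    congr 2
    simp only [Finset.mul_sum, Finset.sum_mul]
    rw [Finset.sum_comm]
    refine Finset.sum_congr rfl fun a _ => ?_
    rw [Finset.sum_comm]
    exact Finset.sum_congr rfl fun b _ => Finset.sum_congr rfl fun k _ => by ring
  have e4 : ∑ a, ∑ b, ((J x a i : ℝ) : 𝕜) * ((J x b j : ℝ) : 𝕜) *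
      (w * ((christoffelTr g' a (ψ x) : ℝ) : 𝕜) * X' b (ψ x)) =
      w * (∑ c, ((J x c i : ℝ) : 𝕜) * ((christoffelTr g' c (ψ x) : ℝ) : 𝕜)) *
          ∑ b, ((J x b j : ℝ) : 𝕜) * X' b (ψ x) := by
    rw [mul_assoc, Finset.sum_mul_sum]
    simp only [Finset.mul_sum]
    exact Finset.sum_congr rfl fun a _ => Finset.sum_congr rfl fun b _ => by ring
  rw [e1, e2, hX x hx j]
  simp only [mul_sub, Finset.sum_sub_distrib]
  rw [e4]
  ring

theorem nablaNablaD_eq {w : 𝕜} {φ φ' : E n → 𝕜}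
    (hφ : ∀ y ∈ U, φ y = absPow (J y).det w * φ' (ψ y))
    (hφ' : ∀ y ∈ U', ContDiffAt ℝ ∞ φ' y) (i j : Fin n) :
    nablaNablaD g w φ i j x = absPow (J x).det w *
      ∑ a, ∑ b, ((J x a i : ℝ) : 𝕜) * ((J x b j : ℝ) : 𝕜) * nablaNablaD g' w φ' a b (ψ x) := by
  refine h.covector_eq hx (X := nablaD g w φ) (X' := nablaD g' w φ')
    (fun y hy j => h.nablaD_eq hy hφ (hφ' _ (h.mapsTo y hy)) j) (fun b => ?_) i j
  have h1 := h.isMetric'.contDiffAt_christoffelTr (h.mapsTo x hx)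
  have h2 := hφ' _ (h.mapsTo x hx)
  unfold nablaD
  fun_prop

theorem vector_eq {w : 𝕜} {V V' : E n → Fin n → 𝕜}
    (hV : ∀ y ∈ U, ∀ a, ∑ i, ((J y a i : ℝ) : 𝕜) * V y i = absPow (J y).det w * V' (ψ y) a)
    (hVs : ∀ i, ContDiffAt ℝ ∞ (fun y => V y i) x)
    (hV' : ∀ a, ContDiffAt ℝ ∞ (fun y => V' y a) (ψ x)) (k a : Fin n) :
    ∑ i, ((J x a i : ℝ) : 𝕜) * (pd k (fun y => V y i) x
        + ∑ l, ((christoffel g i k l x : ℝ) : 𝕜) * V x l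
        - w * ((christoffelTr g k x : ℝ) : 𝕜) * V x i) =
      absPow (J x).det w * ∑ c, ((J x c k : ℝ) : 𝕜) * (pd c (fun y => V' y a) (ψ x)
        + ∑ l, ((christoffel g' a c l (ψ x) : ℝ) : 𝕜) * V' (ψ x) l
        - w * ((christoffelTr g' c (ψ x) : ℝ) : 𝕜) * V' (ψ x) a) := by
  have hJ := h.smooth_jac x hx
  have hJc := fun b j => contDiffAt_ofReal (𝕜 := 𝕜) (hJ b j)
  have e1 := h.pd_of_eq hx (f := fun y => ∑ i, ((J y a i : ℝ) : 𝕜) * V y i)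
    (f' := fun y => V' y a) (fun y hy => hV y hy a) (hV' a) k
  rw [pd_sum k fun i => (hJc a i).mul (hVs i)] at e1
  simp only [pd_mul k (hJc a _) (hVs _), pd_ofReal k (hJ a _), Finset.sum_add_distrib] at e1
  have e2 : ∑ i, ((J x a i : ℝ) : 𝕜) * ∑ l, ((christoffel g i k l x : ℝ) : 𝕜) * V x l =
      absPow (J x).det w * ∑ c, ((J x c k : ℝ) : 𝕜) *
        ∑ l, ((christoffel g' a c l (ψ x) : ℝ) : 𝕜) * V' (ψ x) l
      + ∑ i, ((pd k (fun y => J y a i) x : ℝ) : 𝕜) * V x i := by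
    have e3 : ∑ i, ((J x a i : ℝ) : 𝕜) * ∑ l, ((christoffel g i k l x : ℝ) : 𝕜) * V x l =
        ∑ l, (∑ i, ((J x a i : ℝ) : 𝕜) * ((christoffel g i k l x : ℝ) : 𝕜)) * V x l := by
      simp only [Finset.mul_sum, Finset.sum_mul]
      rw [Finset.sum_comm]
      exact Finset.sum_congr rfl fun l _ => Finset.sum_congr rfl fun i _ => by ring
    have e4 : ∀ c l, absPow (J x).det w * (((J x c k : ℝ) : 𝕜) *
        (((christoffel g' a c l (ψ x) : ℝ) : 𝕜) * V' (ψ x) l)) =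
        ((J x c k : ℝ) : 𝕜) * ((christoffel g' a c l (ψ x) : ℝ) : 𝕜) *
          ∑ i, ((J x l i : ℝ) : 𝕜) * V x i := fun c l => by
      rw [hV x hx l]; ring
    rw [e3]
    simp only [h.ofReal_sum_jac_christoffel hx, add_mul, Finset.sum_add_distrib]
    congr 1
    simp only [Finset.mul_sum (s := Finset.univ) (a := absPow (J x).det w)]
    simp only [Finset.mul_sum, e4]
    simp only [Finset.sum_mul]
    rw [Finset.sum_comm]
    refine Finset.sum_congr rfl fun c _ => ?_
    rw [Finset.sum_comm]
    exact Finset.sum_congr rfl fun b _ => Finset.sum_congr rfl fun l _ => by ring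
  have e5 : ∑ i, ((J x a i : ℝ) : 𝕜) * (w * ((christoffelTr g k x : ℝ) : 𝕜) * V x i) =
      w * ((christoffelTr g k x : ℝ) : 𝕜) * (absPow (J x).det w * V' (ψ x) a) := by
    rw [← hV x hx a, Finset.mul_sum]
    exact Finset.sum_congr rfl fun i _ => by ring
  have e6 : ∑ c, ((J x c k : ℝ) : 𝕜) * (w * ((christoffelTr g' c (ψ x) : ℝ) : 𝕜) * V' (ψ x) a) =
      w * (∑ c, ((J x c k : ℝ) : 𝕜) * ((christoffelTr g' c (ψ x) : ℝ) : 𝕜)) * V' (ψ x) a := by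
    rw [Finset.mul_sum, Finset.sum_mul]
    exact Finset.sum_congr rfl fun i _ => by ring
  simp only [mul_add, mul_sub, Finset.sum_add_distrib, Finset.sum_sub_distrib]
  rw [e2, e5, e6]
  linear_combination e1

end IsMetricChange

end Covariance

/-! ### Covariance of the curvature and of divergences -/

section Curvature

variable {n : ℕ}

/-- The curvature tensor `∂_l Γ_k - ∂_k Γ_l + [Γ_l, Γ_k]`. -/
def curvature (g : E n → Matrix (Fin n) (Fin n) ℝ) (l k d a : Fin n) (x : E n) : ℝ :=
  pd l (christoffel g d k a) x - pd k (christoffel g d l a) x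
    + ∑ m, christoffel g d l m x * christoffel g m k a x
    - ∑ m, christoffel g d k m x * christoffel g m l a x

theorem IsMetricOn.ricci_eq {g : E n → Matrix (Fin n) (Fin n) ℝ} {U : Set (E n)}
    (h : IsMetricOn g U) {x : E n} (hx : x ∈ U) (i j : Fin n) :
    ricci g i j x = ∑ k, curvature g k j k i x := by
  have e : ∀ k, pd k (christoffel g k i j) x = pd k (christoffel g k j i) x := fun k =>
    pd_congr h.isOpen (fun y hy => h.christoffel_comm hy k i j) hx k
  have e' : ∀ k, pd j (christoffel g k i k) x = pd j (christoffel g k k i) x := fun k =>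
    pd_congr h.isOpen (fun y hy => h.christoffel_comm hy k i k) hx j
  simp only [ricci, curvature, ← Finset.sum_add_distrib]
  refine Finset.sum_congr rfl fun k _ => ?_
  rw [e k, e' k, Finset.sum_sub_distrib]
  simp only [h.christoffel_comm hx _ i]
  ring

namespace IsMetricChange

variable {ψ : E n → E n} {J g g' : E n → Matrix (Fin n) (Fin n) ℝ} {U U' : Set (E n)}
  (h : IsMetricChange ψ J g g' U U') {x : E n} (hx : x ∈ U)

include h hx

theorem contract {𝕜 : Type*} [RCLike 𝕜] {V V' : Fin n → Fin n → 𝕜} {c : 𝕜}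
    (hV : ∀ k a, ∑ i, ((J x a i : ℝ) : 𝕜) * V k i = c * ∑ d, ((J x d k : ℝ) : 𝕜) * V' d a) :
    ∑ i, V i i = c * ∑ a, V' a a := by
  have h1 : ∀ a b, ∑ i, (((J x)⁻¹ i a : ℝ) : 𝕜) * ((J x b i : ℝ) : 𝕜) = if a = b then 1 else 0 :=
    fun a b => by
      have := congrArg (fun r : ℝ => (r : 𝕜)) (h.sum_inv_jac hx a b)
      simpa only [RCLike.ofReal_sum, RCLike.ofReal_mul, apply_ite (RCLike.ofReal : ℝ → 𝕜),
        RCLike.ofReal_one, RCLike.ofReal_zero] using this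
  have h2 : ∀ i j, ∑ a, (((J x)⁻¹ i a : ℝ) : 𝕜) * ((J x a j : ℝ) : 𝕜) = if i = j then 1 else 0 :=
    fun i j => by
      have := congrArg (fun r : ℝ => (r : 𝕜)) (h.sum_jac_inv hx i j)
      simpa only [RCLike.ofReal_sum, RCLike.ofReal_mul, apply_ite (RCLike.ofReal : ℝ → 𝕜),
        RCLike.ofReal_one, RCLike.ofReal_zero] using this
  have e1 : ∀ k, V k k = ∑ a, (((J x)⁻¹ k a : ℝ) : 𝕜) * ∑ i, ((J x a i : ℝ) : 𝕜) * V k i := by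
    intro k
    simp only [Finset.mul_sum]
    rw [Finset.sum_comm]
    simp only [← mul_assoc, ← Finset.sum_mul, h2]
    simp
  simp only [e1, hV]
  rw [Finset.sum_comm, Finset.mul_sum]
  refine Finset.sum_congr rfl fun a _ => ?_
  simp only [Finset.mul_sum]
  rw [Finset.sum_comm]
  have e2 : ∀ d, ∑ k, (((J x)⁻¹ k a : ℝ) : 𝕜) * (c * (((J x d k : ℝ) : 𝕜) * V' d a)) =
      (if a = d then 1 else 0) * (c * V' d a) := fun d => by
    rw [← h1 a d, Finset.sum_mul]
    exact Finset.sum_congr rfl fun k _ => by ring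
  simp only [e2]
  simp

theorem pd_conn (l k d a : Fin n) :
    pd l (fun y => ∑ c, J y c k * christoffel g' d c a (ψ y)) x =
      ∑ c, pd l (fun y => J y c k) x * christoffel g' d c a (ψ x)
      + ∑ c, ∑ e, J x e l * J x c k * pd e (christoffel g' d c a) (ψ x) := by
  have hG := fun c => h.isMetric'.contDiffAt_christoffel (h.mapsTo x hx) d c a
  have hJ := fun c => h.smooth_jac x hx c k
  have hs : ∀ c, ContDiffAt ℝ ∞ (fun y => christoffel g' d c a (ψ y)) x := fun c =>
    h.contDiffAt_comp (𝕜 := ℝ) hx (hG c)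
  rw [pd_sum l fun c => (hJ c).mul (hs c), ← Finset.sum_add_distrib]
  refine Finset.sum_congr rfl fun c _ => ?_
  rw [pd_mul (𝕜 := ℝ) l (hJ c) (hs c), h.pd_comp_real hx (hG c), Finset.mul_sum]
  congr 1
  exact Finset.sum_congr rfl fun e _ => by ring

theorem curvature_eq (l k a i : Fin n) :
    ∑ m, J x a m * curvature g l k m i x =
      ∑ e, ∑ c, ∑ b, J x e l * J x c k * curvature g' e c a b (ψ x) * J x b i := by
  have hJs := h.smooth_jac x hx
  have hG := h.isMetric.contDiffAt_christoffel hx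
  have hG' := h.isMetric'.contDiffAt_christoffel (h.mapsTo x hx)
  set A : Fin n → Matrix (Fin n) (Fin n) ℝ := fun k => Matrix.of fun d a => christoffel g d k a x
    with hA
  set B : Fin n → Matrix (Fin n) (Fin n) ℝ := fun k => Matrix.of fun d a =>
    ∑ c, J x c k * christoffel g' d c a (ψ x) with hB
  set dA : Fin n → Fin n → Matrix (Fin n) (Fin n) ℝ := fun l k => Matrix.of fun d a =>
    pd l (christoffel g d k a) x with hdA
  set dB : Fin n → Fin n → Matrix (Fin n) (Fin n) ℝ := fun l k => Matrix.of fun d a =>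
    pd l (fun y => ∑ c, J y c k * christoffel g' d c a (ψ y)) x with hdB
  set dJ : Fin n → Matrix (Fin n) (Fin n) ℝ := fun k => Matrix.of fun d a =>
    pd k (fun y => J y d a) x with hdJ
  set ddJ : Fin n → Fin n → Matrix (Fin n) (Fin n) ℝ := fun l k => Matrix.of fun d a =>
    pd l (pd k (fun y => J y d a)) x with hddJ
  have key : ∀ y ∈ U, ∀ k d a, ∑ m, J y d m * christoffel g m k a y =
      ∑ m, (∑ c, J y c k * christoffel g' d c m (ψ y)) * J y m a + pd k (fun y => J y d a) y := by
    intro y hy k d a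
    rw [h.sum_jac_christoffel hy, Finset.sum_comm]
    simp only [Finset.sum_mul]
    congr 1
    exact Finset.sum_congr rfl fun _ _ => Finset.sum_congr rfl fun _ _ => by ring
  have E0 : ∀ k, dJ k = J x * A k - B k * J x := fun k => by
    ext d a
    have := key x hx k d a
    simp only [hdJ, hA, hB, Matrix.sub_apply, Matrix.mul_apply, Matrix.of_apply]
    linarith
  have E1 : ∀ l k, dJ l * A k + J x * dA l k = dB l k * J x + B k * dJ l + ddJ l k := fun l k => by
    ext d a
    have h1 := pd_congr h.isMetric.isOpen (fun y hy => key y hy k d a) hx l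
    have hs : ∀ m, ContDiffAt ℝ ∞ (fun y => ∑ c, J y c k * christoffel g' d c m (ψ y)) x := fun m =>
      contDiffAt_sum fun c => (hJs c k).mul (h.contDiffAt_comp (𝕜 := ℝ) hx (hG' d c m))
    rw [pd_sum l fun m => (hJs d m).mul (hG m k a), pd_add l
      (contDiffAt_sum fun m => (hs m).mul (hJs m a)) (contDiffAt_pd k (hJs d a)),
      pd_sum l fun m => (hs m).mul (hJs m a)] at h1
    have h2 : ∀ m, pd l (fun y => J y d m * christoffel g m k a y) x =
        pd l (fun y => J y d m) x * christoffel g m k a x + J x d m * pd l (christoffel g m k a) x :=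
      fun m => pd_mul (𝕜 := ℝ) l (hJs d m) (hG m k a)
    have h3 := fun m => pd_mul (𝕜 := ℝ) l (hs m) (hJs m a)
    simp only [h2, h3, Finset.sum_add_distrib] at h1
    simpa only [hdJ, hA, hB, hdA, hdB, hddJ, Matrix.add_apply, Matrix.mul_apply, Matrix.of_apply]
      using h1
  have E2 : ddJ l k = ddJ k l := by
    ext d a
    exact pd_comm l k (hJs d a)
  have E3 : J x * (dA l k - dA k l + A l * A k - A k * A l) =
      (dB l k - dB k l + B l * B k - B k * B l) * J x := by
    have h1 := E1 l k
    have h2 := E1 k l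
    rw [E0] at h1 h2
    rw [E2] at h1
    have h1' := eq_sub_of_add_eq' h1
    have h2' := eq_sub_of_add_eq' h2
    rw [mul_sub, mul_add, mul_sub, h1', h2']
    noncomm_ring
  have E4 := congrFun (congrFun E3 a) i
  have h5 : ∀ b, (dB l k - dB k l + B l * B k - B k * B l) a b =
      ∑ e, ∑ c, J x e l * J x c k * curvature g' e c a b (ψ x) := by
    intro b
    have f1 : ∀ c, pd l (fun y => J y c k) x = pd k (fun y => J y c l) x := fun c =>
      h.pd_jac_comm hx c l k
    have f2 : ∀ l k, (B l * B k) a b = ∑ e, ∑ c, J x e l * J x c k *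
        ∑ m, christoffel g' a e m (ψ x) * christoffel g' m c b (ψ x) := by
      intro l k
      simp only [hB, Matrix.mul_apply, Matrix.of_apply, Finset.sum_mul_sum]
      simp only [Finset.mul_sum]
      rw [Finset.sum_comm]
      refine Finset.sum_congr rfl fun e _ => ?_
      rw [Finset.sum_comm]
      exact Finset.sum_congr rfl fun c _ => Finset.sum_congr rfl fun m _ => by ring
    have f3 : (B k * B l) a b = ∑ e, ∑ c, J x e l * J x c k *
        ∑ m, christoffel g' a c m (ψ x) * christoffel g' m e b (ψ x) := by
      rw [f2, Finset.sum_comm]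
      exact Finset.sum_congr rfl fun e _ => Finset.sum_congr rfl fun c _ => by ring
    rw [Matrix.sub_apply, Matrix.add_apply, Matrix.sub_apply, f3, f2]
    simp only [hdB, Matrix.of_apply, h.pd_conn hx, f1, curvature, mul_add, mul_sub,
      Finset.sum_add_distrib, Finset.sum_sub_distrib]
    rw [Finset.sum_comm (f := fun c e => J x e l * J x c k * pd e (christoffel g' a c b) (ψ x))]
    have f4 : ∑ c, ∑ e, J x e k * J x c l * pd e (christoffel g' a c b) (ψ x) =
        ∑ e, ∑ c, J x e l * J x c k * pd c (christoffel g' a e b) (ψ x) :=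
      Finset.sum_congr rfl fun e _ => Finset.sum_congr rfl fun c _ => by ring
    rw [f4]
    ring
  have h6 : ∀ m, (dA l k - dA k l + A l * A k - A k * A l) m i = curvature g l k m i x := by
    intro m
    simp only [hdA, hA, Matrix.sub_apply, Matrix.add_apply, Matrix.mul_apply, Matrix.of_apply,
      curvature]
  rw [Matrix.mul_apply, Matrix.mul_apply] at E4
  simp only [h5, h6] at E4
  rw [E4]
  simp only [Finset.sum_mul]
  rw [Finset.sum_comm]
  exact Finset.sum_congr rfl fun e _ => Finset.sum_comm

theorem ricci_eq (i j : Fin n) :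
    ricci g i j x = ∑ a, ∑ b, J x a i * J x b j * ricci g' a b (ψ x) := by
  rw [h.isMetric.ricci_eq hx]
  have h1 := h.contract (𝕜 := ℝ) hx (c := 1) (V := fun k m => curvature g k j m i x)
    (V' := fun e a => ∑ c, ∑ b, J x c j * J x b i * curvature g' e c a b (ψ x)) fun k a => by
      simp only [RCLike.ofReal_real_eq_id, id_eq, h.curvature_eq hx, one_mul, Finset.mul_sum]
      exact Finset.sum_congr rfl fun e _ => Finset.sum_congr rfl fun c _ =>
        Finset.sum_congr rfl fun b _ => by ring
  rw [h1, one_mul, Finset.sum_comm]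
  simp only [h.isMetric'.ricci_eq (h.mapsTo x hx), Finset.mul_sum]
  rw [Finset.sum_comm (f := fun a b => ∑ k, J x a i * J x b j * _)]
  refine Finset.sum_congr rfl fun c _ => ?_
  rw [Finset.sum_comm]
  exact Finset.sum_congr rfl fun b _ => Finset.sum_congr rfl fun e _ => by ring

/-- The complete contraction of a covariant and a contravariant tensor of rank two. -/
theorem contract₂ {𝕜 : Type*} [RCLike 𝕜] {A A' B B' : Fin n → Fin n → 𝕜} {c d : 𝕜}
    (hA : ∀ i j, A i j = c * ∑ a, ∑ b, ((J x a i : ℝ) : 𝕜) * ((J x b j : ℝ) : 𝕜) * A' a b)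
    (hB : ∀ a b, ∑ i, ∑ j, ((J x a i : ℝ) : 𝕜) * ((J x b j : ℝ) : 𝕜) * B i j = d * B' a b) :
    ∑ i, ∑ j, A i j * B i j = c * d * ∑ a, ∑ b, A' a b * B' a b := by
  have e : ∀ a b, c * d * (A' a b * B' a b) =
      ∑ i, ∑ j, c * (((J x a i : ℝ) : 𝕜) * ((J x b j : ℝ) : 𝕜) * A' a b) * B i j := fun a b => by
    rw [show c * d * (A' a b * B' a b) = c * A' a b * (d * B' a b) by ring, ← hB, Finset.mul_sum]
    refine Finset.sum_congr rfl fun i _ => ?_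
    rw [Finset.mul_sum]
    exact Finset.sum_congr rfl fun j _ => by ring
  simp only [hA, Finset.mul_sum, Finset.sum_mul, e]
  rw [Finset.sum_congr rfl fun i _ => Finset.sum_comm, Finset.sum_comm]
  refine Finset.sum_congr rfl fun a _ => ?_
  rw [Finset.sum_congr rfl fun i _ => Finset.sum_comm, Finset.sum_comm]

theorem contract₁ {𝕜 : Type*} [RCLike 𝕜] {A A' B B' : Fin n → 𝕜} {c d : 𝕜}
    (hA : ∀ i, A i = c * ∑ a, ((J x a i : ℝ) : 𝕜) * A' a)
    (hB : ∀ a, ∑ i, ((J x a i : ℝ) : 𝕜) * B i = d * B' a) :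
    ∑ i, A i * B i = c * d * ∑ a, A' a * B' a := by
  have e : ∀ a, c * d * (A' a * B' a) = ∑ i, c * (((J x a i : ℝ) : 𝕜) * A' a) * B i := fun a => by
    rw [show c * d * (A' a * B' a) = c * A' a * (d * B' a) by ring, ← hB, Finset.mul_sum]
    exact Finset.sum_congr rfl fun i _ => by ring
  simp only [hA, Finset.mul_sum, Finset.sum_mul, e]
  rw [Finset.sum_comm]

theorem scalarCurv_eq : scalarCurv g x = scalarCurv g' (ψ x) := by
  have h1 := h.contract₂ (𝕜 := ℝ) hx (c := 1) (d := 1) (A := fun i j => ricci g i j x)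
    (A' := fun a b => ricci g' a b (ψ x)) (B := fun i j => (g x)⁻¹ i j)
    (B' := fun a b => (g' (ψ x))⁻¹ a b)
    (fun i j => by rw [one_mul]; exact h.ricci_eq hx i j)
    (fun a b => by rw [one_mul]; exact h.inv_eq hx a b)
  simp only [scalarCurv, mul_comm ((g _)⁻¹ _ _), mul_comm ((g' _)⁻¹ _ _)]
  rw [h1]
  ring

theorem tensor_eq {𝕜 : Type*} [RCLike 𝕜] {w : 𝕜} {P P' : E n → Fin n → Fin n → 𝕜}
    (hP : ∀ y ∈ U, ∀ a b, ∑ i, ∑ j, ((J y a i : ℝ) : 𝕜) * ((J y b j : ℝ) : 𝕜) * P y i j =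
      absPow (J y).det w * P' (ψ y) a b)
    (hPs : ∀ i j, ContDiffAt ℝ ∞ (fun y => P y i j) x)
    (hP' : ∀ a b, ContDiffAt ℝ ∞ (fun y => P' y a b) (ψ x)) (k a b : Fin n) :
    ∑ i, ∑ j, ((J x a i : ℝ) : 𝕜) * ((J x b j : ℝ) : 𝕜) * nablaP g w P k i j x =
      absPow (J x).det w * ∑ c, ((J x c k : ℝ) : 𝕜) * nablaP g' w P' c a b (ψ x) := by
  have hJ := h.smooth_jac x hx
  have hJc := fun b j => contDiffAt_ofReal (𝕜 := 𝕜) (hJ b j)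
  have e1 := h.pd_of_eq hx
    (f := fun y => ∑ i, ∑ j, ((J y a i : ℝ) : 𝕜) * ((J y b j : ℝ) : 𝕜) * P y i j)
    (f' := fun y => P' y a b) (fun y hy => hP y hy a b) (hP' a b) k
  rw [pd_sum k fun i => contDiffAt_sum fun j => ((hJc a i).mul (hJc b j)).mul (hPs i j)] at e1
  have e1' : ∀ i, pd k (fun y => ∑ j, ((J y a i : ℝ) : 𝕜) * ((J y b j : ℝ) : 𝕜) * P y i j) x =
      ∑ j, ((pd k (fun y => J y a i) x : ℝ) : 𝕜) * ((J x b j : ℝ) : 𝕜) * P x i j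
      + ∑ j, ((J x a i : ℝ) : 𝕜) * ((pd k (fun y => J y b j) x : ℝ) : 𝕜) * P x i j
      + ∑ j, ((J x a i : ℝ) : 𝕜) * ((J x b j : ℝ) : 𝕜) * pd k (fun y => P y i j) x := fun i => by
    rw [pd_sum k fun j => ((hJc a i).mul (hJc b j)).mul (hPs i j)]
    simp only [← Finset.sum_add_distrib]
    refine Finset.sum_congr rfl fun j _ => ?_
    rw [pd_mul k ((hJc a i).mul (hJc b j)) (hPs i j), pd_mul k (hJc a i) (hJc b j),
      pd_ofReal k (hJ a i), pd_ofReal k (hJ b j)]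
    ring
  simp only [e1', Finset.sum_add_distrib] at e1
  have e4 : ∀ d f, absPow (J x).det w * P' (ψ x) d f =
      ∑ i, ∑ j, ((J x d i : ℝ) : 𝕜) * ((J x f j : ℝ) : 𝕜) * P x i j := fun d f => (hP x hx d f).symm
  have e2 : ∑ i, ∑ j, ((J x a i : ℝ) : 𝕜) * ((J x b j : ℝ) : 𝕜) *
      ∑ l, ((christoffel g i k l x : ℝ) : 𝕜) * P x l j =
      ∑ c, ((J x c k : ℝ) : 𝕜) *
        ∑ l, ((christoffel g' a c l (ψ x) : ℝ) : 𝕜) * (absPow (J x).det w * P' (ψ x) l b)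
      + ∑ i, ∑ j, ((pd k (fun y => J y a i) x : ℝ) : 𝕜) * ((J x b j : ℝ) : 𝕜) * P x i j := by
    have e3 : ∑ i, ∑ j, ((J x a i : ℝ) : 𝕜) * ((J x b j : ℝ) : 𝕜) *
        ∑ l, ((christoffel g i k l x : ℝ) : 𝕜) * P x l j =
        ∑ l, ∑ j, (∑ i, ((J x a i : ℝ) : 𝕜) * ((christoffel g i k l x : ℝ) : 𝕜)) *
          (((J x b j : ℝ) : 𝕜) * P x l j) := by
      simp only [Finset.mul_sum, Finset.sum_mul]
      rw [Finset.sum_congr rfl fun i _ => Finset.sum_comm, Finset.sum_comm]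
      refine Finset.sum_congr rfl fun l _ => ?_
      rw [Finset.sum_comm]
      exact Finset.sum_congr rfl fun j _ => Finset.sum_congr rfl fun i _ => by ring
    rw [e3]
    simp only [h.ofReal_sum_jac_christoffel hx, add_mul, Finset.sum_add_distrib, e4]
    congr 1
    · simp only [Finset.mul_sum, Finset.sum_mul]
      have s1 : ∀ l, ∑ j, ∑ c, ∑ d, ((christoffel g' a c d (ψ x) : ℝ) : 𝕜) * ((J x c k : ℝ) : 𝕜) *
          ((J x d l : ℝ) : 𝕜) * (((J x b j : ℝ) : 𝕜) * P x l j) =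
          ∑ c, ∑ d, ∑ j, ((christoffel g' a c d (ψ x) : ℝ) : 𝕜) * ((J x c k : ℝ) : 𝕜) *
          ((J x d l : ℝ) : 𝕜) * (((J x b j : ℝ) : 𝕜) * P x l j) := fun l => by
        rw [Finset.sum_comm]
        exact Finset.sum_congr rfl fun c _ => Finset.sum_comm
      simp only [s1]
      rw [Finset.sum_comm]
      refine Finset.sum_congr rfl fun c _ => ?_
      rw [Finset.sum_comm]
      exact Finset.sum_congr rfl fun d _ => Finset.sum_congr rfl fun l _ =>
        Finset.sum_congr rfl fun j _ => by ring
    · exact Finset.sum_congr rfl fun _ _ => Finset.sum_congr rfl fun _ _ => by ring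
  have e5 : ∑ i, ∑ j, ((J x a i : ℝ) : 𝕜) * ((J x b j : ℝ) : 𝕜) *
      ∑ l, ((christoffel g j k l x : ℝ) : 𝕜) * P x i l =
      ∑ c, ((J x c k : ℝ) : 𝕜) *
        ∑ l, ((christoffel g' b c l (ψ x) : ℝ) : 𝕜) * (absPow (J x).det w * P' (ψ x) a l)
      + ∑ i, ∑ j, ((J x a i : ℝ) : 𝕜) * ((pd k (fun y => J y b j) x : ℝ) : 𝕜) * P x i j := by
    have e3 : ∑ i, ∑ j, ((J x a i : ℝ) : 𝕜) * ((J x b j : ℝ) : 𝕜) *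
        ∑ l, ((christoffel g j k l x : ℝ) : 𝕜) * P x i l =
        ∑ l, ∑ i, (∑ j, ((J x b j : ℝ) : 𝕜) * ((christoffel g j k l x : ℝ) : 𝕜)) *
          (((J x a i : ℝ) : 𝕜) * P x i l) := by
      simp only [Finset.mul_sum, Finset.sum_mul]
      rw [Finset.sum_congr rfl fun i _ => Finset.sum_comm, Finset.sum_comm]
      exact Finset.sum_congr rfl fun l _ =>
        Finset.sum_congr rfl fun j _ => Finset.sum_congr rfl fun i _ => by ring
    rw [e3]
    simp only [h.ofReal_sum_jac_christoffel hx, add_mul, Finset.sum_add_distrib, e4]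
    congr 1
    · simp only [Finset.mul_sum, Finset.sum_mul]
      have s1 : ∀ l, ∑ j, ∑ c, ∑ d, ((christoffel g' b c d (ψ x) : ℝ) : 𝕜) * ((J x c k : ℝ) : 𝕜) *
          ((J x d l : ℝ) : 𝕜) * (((J x a j : ℝ) : 𝕜) * P x j l) =
          ∑ c, ∑ d, ∑ j, ((christoffel g' b c d (ψ x) : ℝ) : 𝕜) * ((J x c k : ℝ) : 𝕜) *
          ((J x d l : ℝ) : 𝕜) * (((J x a j : ℝ) : 𝕜) * P x j l) := fun l => by
        rw [Finset.sum_comm]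
        exact Finset.sum_congr rfl fun c _ => Finset.sum_comm
      simp only [s1]
      rw [Finset.sum_comm]
      refine Finset.sum_congr rfl fun c _ => ?_
      rw [Finset.sum_comm]
      refine Finset.sum_congr rfl fun d _ => ?_
      rw [Finset.sum_comm]
      exact Finset.sum_congr rfl fun l _ =>
        Finset.sum_congr rfl fun j _ => by ring
    · rw [Finset.sum_comm]
      exact Finset.sum_congr rfl fun _ _ => Finset.sum_congr rfl fun _ _ => by ring
  have e6 : ∑ i, ∑ j, ((J x a i : ℝ) : 𝕜) * ((J x b j : ℝ) : 𝕜) *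
      (w * ((christoffelTr g k x : ℝ) : 𝕜) * P x i j) =
      w * ((christoffelTr g k x : ℝ) : 𝕜) * (absPow (J x).det w * P' (ψ x) a b) := by
    simp only [← hP x hx a b, Finset.mul_sum]
    exact Finset.sum_congr rfl fun i _ => Finset.sum_congr rfl fun j _ => by ring
  have e7 : ∑ c, ((J x c k : ℝ) : 𝕜) *
      (w * ((christoffelTr g' c (ψ x) : ℝ) : 𝕜) * P' (ψ x) a b) =
      w * (∑ c, ((J x c k : ℝ) : 𝕜) * ((christoffelTr g' c (ψ x) : ℝ) : 𝕜)) * P' (ψ x) a b := by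
    rw [Finset.mul_sum, Finset.sum_mul]
    exact Finset.sum_congr rfl fun i _ => by ring
  have e8 : ∀ (G : Fin n → Fin n → 𝕜) (p : Fin n → 𝕜), ∑ c, ((J x c k : ℝ) : 𝕜) *
      ∑ l, G c l * (absPow (J x).det w * p l) =
      absPow (J x).det w * ∑ c, ((J x c k : ℝ) : 𝕜) * ∑ l, G c l * p l := fun G p => by
    simp only [Finset.mul_sum]
    exact Finset.sum_congr rfl fun c _ => Finset.sum_congr rfl fun l _ => by ring
  rw [e8] at e2 e5
  simp only [nablaP, mul_add, mul_sub, Finset.sum_add_distrib, Finset.sum_sub_distrib]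
  rw [e2, e5, e6, e7]
  linear_combination e1

end IsMetricChange

end Curvature

/-! ### Covariance of the quantization formula -/

section FormulaCovariance

variable {n : ℕ} {𝕜 : Type*} [RCLike 𝕜]

/-- The covariant divergence of a vector field with values in the densities of degree `w`. -/
def covDiv (g : E n → Matrix (Fin n) (Fin n) ℝ) (w : 𝕜) (V : E n → Fin n → 𝕜) (x : E n) : 𝕜 :=
  ∑ i, (pd i (fun y => V y i) x + ∑ l, ((christoffel g i i l x : ℝ) : 𝕜) * V x l
    - w * ((christoffelTr g i x : ℝ) : 𝕜) * V x i)

/-- The operator of order one with principal symbol `V`. -/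
def firstOrderFormula (lam mu : 𝕜) (V : E n → Fin n → 𝕜) (φ : E n → 𝕜) (x : E n) : 𝕜 :=
  ∑ i, V x i * pd i φ x + lam / (1 - (mu - lam)) * vectorDiv V x * φ x

namespace IsMetricOn

variable {g : E n → Matrix (Fin n) (Fin n) ℝ} {U : Set (E n)} (h : IsMetricOn g U) {x : E n}
  (hx : x ∈ U)

include h hx

theorem covDiv_eq (w : 𝕜) (V : E n → Fin n → 𝕜) :
    covDiv g w V x = vectorDiv V x + (1 - w) * ∑ i, ((christoffelTr g i x : ℝ) : 𝕜) * V x i := by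
  have e : ∑ i, ∑ l, ((christoffel g i i l x : ℝ) : 𝕜) * V x l =
      ∑ l, ((christoffelTr g l x : ℝ) : 𝕜) * V x l := by
    rw [Finset.sum_comm]
    simp only [← Finset.sum_mul, christoffelTr, RCLike.ofReal_sum]
    exact Finset.sum_congr rfl fun l _ => by
      congr 1
      exact Finset.sum_congr rfl fun i _ => by rw [h.christoffel_comm hx]
  rw [covDiv, Finset.sum_sub_distrib, Finset.sum_add_distrib, e, vectorDiv, sub_mul, one_mul]
  simp only [mul_assoc, ← Finset.mul_sum]
  ring

theorem firstOrderFormula_eq {lam mu : 𝕜} (hδ : mu - lam ≠ 1) (V : E n → Fin n → 𝕜)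
    (φ : E n → 𝕜) :
    firstOrderFormula lam mu V φ x =
      ∑ i, nablaD g lam φ i x * V x i + lam / (1 - (mu - lam)) * covDiv g (mu - lam) V x * φ x := by
  have h1 : 1 - (mu - lam) ≠ 0 := sub_ne_zero.2 hδ.symm
  rw [firstOrderFormula, h.covDiv_eq hx]
  have e : ∑ i, nablaD g lam φ i x * V x i = ∑ i, V x i * pd i φ x
      - lam * (∑ i, ((christoffelTr g i x : ℝ) : 𝕜) * V x i) * φ x := by
    simp only [nablaD, Finset.mul_sum, Finset.sum_mul, ← Finset.sum_sub_distrib]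
    exact Finset.sum_congr rfl fun i _ => by ring
  rw [e]
  field_simp
  ring

/-- The iterated divergence of a tensor field in terms of divergences of vector fields. -/
theorem sum_nablaNablaP {w : 𝕜} {P : E n → Fin n → Fin n → 𝕜}
    (hP : ∀ i j, ContDiffAt ℝ ∞ (fun y => P y i j) x) :
    ∑ i, ∑ j, nablaNablaP g w P i j i j x =
      covDiv g w (fun y i => ∑ j, nablaP g w P j i j y) x := by
  simp only [sum_nablaNablaP_right (h.contDiffAt_christoffel hx) hP, covDiv]

/-- The quantization formula, with all traces expressed through `g_{kl} P^{kl}`. -/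
theorem quantFormula_eq {lam mu : 𝕜} {P : E n → Fin n → Fin n → 𝕜} (φ : E n → 𝕜)
    (hP : ∀ y ∈ U, ∀ i j, ContDiffAt ℝ ∞ (fun z => P z i j) y) :
    quantFormula lam mu g P φ x =
      ∑ i, ∑ j, nablaNablaD g lam φ i j x * P x i j
      + beta1 (n : 𝕜) lam mu * ∑ j, nablaD g lam φ j x * ∑ i, nablaP g (mu - lam) P i i j x
      + beta2 (n : 𝕜) lam mu * ∑ i, ∑ j, nablaD g (mu - lam) (metricTrace g P) i x *
          nablaD g lam φ j x * (((g x)⁻¹ i j : ℝ) : 𝕜)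
      + (beta3 (n : 𝕜) lam mu * covDiv g (mu - lam)
            (fun y i => ∑ j, nablaP g (mu - lam) P j i j y) x
        + beta4 (n : 𝕜) lam mu * ∑ i, ∑ j, nablaNablaD g (mu - lam) (metricTrace g P) i j x *
            (((g x)⁻¹ i j : ℝ) : 𝕜)
        + beta5 (n : 𝕜) lam mu * ∑ i, ∑ j, ((ricci g i j x : ℝ) : 𝕜) * P x i j
        + beta6 (n : 𝕜) lam mu * ((scalarCurv g x : ℝ) : 𝕜) * metricTrace g P x) * φ x := by
  have e1 : ∀ j, ∑ i, ∑ k, ∑ l,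
      (((g x)⁻¹ i j * g x k l : ℝ) : 𝕜) * nablaP g (mu - lam) P i k l x =
      ∑ i, (((g x)⁻¹ i j : ℝ) : 𝕜) * nablaD g (mu - lam) (metricTrace g P) i x := fun j => by
    simp only [← h.sum_metric_nablaP hx (hP x hx), Finset.mul_sum, RCLike.ofReal_mul, mul_assoc]
  have e2 : ∀ i j, ∑ k, ∑ l,
      (((g x)⁻¹ i j * g x k l : ℝ) : 𝕜) * nablaNablaP g (mu - lam) P i j k l x =
      nablaNablaD g (mu - lam) (metricTrace g P) i j x * (((g x)⁻¹ i j : ℝ) : 𝕜) := fun i j => by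
    simp only [← h.sum_metric_nablaNablaP hx hP, RCLike.ofReal_mul, Finset.sum_mul]
    exact Finset.sum_congr rfl fun k _ => Finset.sum_congr rfl fun l _ => by ring
  rw [quantFormula, h.sum_nablaNablaP hx (hP x hx)]
  simp only [e1, e2]
  have e3 : ∑ j, (beta1 (n : 𝕜) lam mu * ∑ i, nablaP g (mu - lam) P i i j x
      + beta2 (n : 𝕜) lam mu * ∑ i, (((g x)⁻¹ i j : ℝ) : 𝕜) *
          nablaD g (mu - lam) (metricTrace g P) i x) * nablaD g lam φ j x =
      beta1 (n : 𝕜) lam mu * ∑ j, nablaD g lam φ j x * ∑ i, nablaP g (mu - lam) P i i j x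
      + beta2 (n : 𝕜) lam mu * ∑ i, ∑ j, nablaD g (mu - lam) (metricTrace g P) i x *
          nablaD g lam φ j x * (((g x)⁻¹ i j : ℝ) : 𝕜) := by
    rw [Finset.sum_comm (f := fun i j => nablaD g (mu - lam) (metricTrace g P) i x *
          nablaD g lam φ j x * (((g x)⁻¹ i j : ℝ) : 𝕜)), Finset.mul_sum, Finset.mul_sum,
      ← Finset.sum_add_distrib]
    refine Finset.sum_congr rfl fun j _ => ?_
    rw [add_mul, mul_assoc _ (∑ i, _), mul_assoc _ (∑ i, _)]
    congr 1
    · rw [mul_comm (∑ i, _)]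
    · rw [Finset.sum_mul]
      congr 1
      exact Finset.sum_congr rfl fun i _ => by ring
  rw [e3]
  simp only [mul_comm (P x _ _) (nablaNablaD g lam φ _ _ x), metricTrace]
  ring

end IsMetricOn

namespace IsMetricChange

variable {ψ : E n → E n} {J g g' : E n → Matrix (Fin n) (Fin n) ℝ} {U U' : Set (E n)}
  (h : IsMetricChange ψ J g g' U U') {x : E n} (hx : x ∈ U)

include h hx

theorem covDiv_eq {w : 𝕜} {V V' : E n → Fin n → 𝕜}
    (hV : ∀ y ∈ U, ∀ a, ∑ i, ((J y a i : ℝ) : 𝕜) * V y i = absPow (J y).det w * V' (ψ y) a)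
    (hVs : ∀ i, ContDiffAt ℝ ∞ (fun y => V y i) x)
    (hV' : ∀ a, ContDiffAt ℝ ∞ (fun y => V' y a) (ψ x)) :
    covDiv g w V x = absPow (J x).det w * covDiv g' w V' (ψ x) :=
  h.contract hx (V := fun k i => pd k (fun y => V y i) x
      + ∑ l, ((christoffel g i k l x : ℝ) : 𝕜) * V x l
      - w * ((christoffelTr g k x : ℝ) : 𝕜) * V x i)
    (V' := fun c a => pd c (fun y => V' y a) (ψ x)
      + ∑ l, ((christoffel g' a c l (ψ x) : ℝ) : 𝕜) * V' (ψ x) l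
      - w * ((christoffelTr g' c (ψ x) : ℝ) : 𝕜) * V' (ψ x) a)
    fun k a => h.vector_eq hx hV hVs hV' k a

theorem firstOrderFormula_eq {lam mu : 𝕜} (hδ : mu - lam ≠ 1) {V V' : E n → Fin n → 𝕜}
    {φ φ' : E n → 𝕜}
    (hV : ∀ y ∈ U, ∀ a, ∑ i, ((J y a i : ℝ) : 𝕜) * V y i =
      absPow (J y).det (mu - lam) * V' (ψ y) a)
    (hVs : ∀ i, ContDiffAt ℝ ∞ (fun y => V y i) x)
    (hV' : ∀ a, ContDiffAt ℝ ∞ (fun y => V' y a) (ψ x))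
    (hφ : ∀ y ∈ U, φ y = absPow (J y).det lam * φ' (ψ y)) (hφ' : ContDiffAt ℝ ∞ φ' (ψ x)) :
    firstOrderFormula lam mu V φ x =
      absPow (J x).det mu * firstOrderFormula lam mu V' φ' (ψ x) := by
  rw [h.isMetric.firstOrderFormula_eq hx hδ, h.isMetric'.firstOrderFormula_eq (h.mapsTo x hx) hδ,
    h.covDiv_eq hx hV hVs hV', hφ x hx,
    h.contract₁ hx (h.nablaD_eq hx hφ hφ') (hV x hx),
    show absPow (J x).det mu = absPow (J x).det (mu - lam) * absPow (J x).det lam by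
      rw [← absPow_add, sub_add_cancel]]
  ring

variable {w : 𝕜} {P P' : E n → Fin n → Fin n → 𝕜}

theorem metricTrace_eq
    (hP : ∀ a b, ∑ i, ∑ j, ((J x a i : ℝ) : 𝕜) * ((J x b j : ℝ) : 𝕜) * P x i j =
      absPow (J x).det w * P' (ψ x) a b) :
    metricTrace g P x = absPow (J x).det w * metricTrace g' P' (ψ x) := by
  have h1 := h.contract₂ (𝕜 := 𝕜) hx (c := 1) (A := fun i j => ((g x i j : ℝ) : 𝕜))
    (A' := fun a b => ((g' (ψ x) a b : ℝ) : 𝕜)) (fun i j => by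
      rw [h.comp_apply hx]
      simp only [RCLike.ofReal_sum, RCLike.ofReal_mul, one_mul]
      exact Finset.sum_congr rfl fun _ _ => Finset.sum_congr rfl fun _ _ => by ring) hP
  rw [one_mul] at h1
  exact h1

variable
  (hP : ∀ y ∈ U, ∀ a b, ∑ i, ∑ j, ((J y a i : ℝ) : 𝕜) * ((J y b j : ℝ) : 𝕜) * P y i j =
      absPow (J y).det w * P' (ψ y) a b)
  (hPs : ∀ i j, ContDiffAt ℝ ∞ (fun y => P y i j) x)
  (hP' : ∀ a b, ContDiffAt ℝ ∞ (fun y => P' y a b) (ψ x))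

include hP hPs hP'

theorem tensorDivLeft_eq (b : Fin n) :
    ∑ j, ((J x b j : ℝ) : 𝕜) * ∑ i, nablaP g w P i i j x =
      absPow (J x).det w * ∑ a, nablaP g' w P' a a b (ψ x) := by
  have h1 := h.contract hx (c := absPow (J x).det w)
    (V := fun k i => ∑ j, ((J x b j : ℝ) : 𝕜) * nablaP g w P k i j x)
    (V' := fun c a => nablaP g' w P' c a b (ψ x)) fun k a => by
      rw [← h.tensor_eq hx hP hPs hP']
      simp only [Finset.mul_sum, mul_assoc]
  rw [← h1]
  simp only [Finset.mul_sum]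
  exact Finset.sum_comm

theorem tensorDivRight_eq (a : Fin n) :
    ∑ i, ((J x a i : ℝ) : 𝕜) * ∑ j, nablaP g w P j i j x =
      absPow (J x).det w * ∑ b, nablaP g' w P' b a b (ψ x) := by
  have h1 := h.contract hx (c := absPow (J x).det w)
    (V := fun k j => ∑ i, ((J x a i : ℝ) : 𝕜) * nablaP g w P k i j x)
    (V' := fun c b => nablaP g' w P' c a b (ψ x)) fun k b => by
      rw [← h.tensor_eq hx hP hPs hP', Finset.sum_comm]
      simp only [Finset.mul_sum]
      exact Finset.sum_congr rfl fun _ _ => Finset.sum_congr rfl fun _ _ => by ring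
  rw [← h1]
  simp only [Finset.mul_sum]
  exact Finset.sum_comm

omit hPs hP' in
theorem quantFormula_eq {lam mu : 𝕜} (hw : w = mu - lam) {φ φ' : E n → 𝕜}
    (hPs : ∀ y ∈ U, ∀ i j, ContDiffAt ℝ ∞ (fun z => P z i j) y)
    (hP' : ∀ y ∈ U', ∀ i j, ContDiffAt ℝ ∞ (fun z => P' z i j) y)
    (hφ : ∀ y ∈ U, φ y = absPow (J y).det lam * φ' (ψ y))
    (hφ' : ∀ y ∈ U', ContDiffAt ℝ ∞ φ' y) :
    quantFormula lam mu g P φ x = absPow (J x).det mu * quantFormula lam mu g' P' φ' (ψ x) := by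
  subst hw
  have hψ := h.mapsTo x hx
  have ht : ∀ y ∈ U, metricTrace g P y = absPow (J y).det (mu - lam) * metricTrace g' P' (ψ y) :=
    fun y hy => h.metricTrace_eq hy (hP y hy)
  have ht' : ∀ y ∈ U', ContDiffAt ℝ ∞ (metricTrace g' P') y := fun y hy =>
    h.isMetric'.contDiffAt_metricTrace hy (hP' y hy)
  have hinv : ∀ a b, ∑ i, ∑ j, ((J x a i : ℝ) : 𝕜) * ((J x b j : ℝ) : 𝕜) *
      (((g x)⁻¹ i j : ℝ) : 𝕜) = 1 * (((g' (ψ x))⁻¹ a b : ℝ) : 𝕜) := fun a b => by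
    rw [← h.inv_eq hx, one_mul]
    simp only [RCLike.ofReal_sum, RCLike.ofReal_mul]
  have hD := h.nablaD_eq hx hφ (hφ' _ hψ)
  have hDt := h.nablaD_eq hx ht (ht' _ hψ)
  have hdiv := h.covDiv_eq hx (w := mu - lam)
    (V := fun y i => ∑ j, nablaP g (mu - lam) P j i j y)
    (V' := fun y i => ∑ j, nablaP g' (mu - lam) P' j i j y)
    (fun y hy a => h.tensorDivRight_eq hy hP (hPs y hy) (hP' _ (h.mapsTo y hy)) a)
    (fun i => contDiffAt_sum fun j =>
      contDiffAt_nablaP (h.isMetric.contDiffAt_christoffel hx) (hPs x hx) j i j)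
    (fun i => contDiffAt_sum fun j =>
      contDiffAt_nablaP (h.isMetric'.contDiffAt_christoffel hψ) (hP' _ hψ) j i j)
  have t1 := h.contract₂ hx (h.nablaNablaD_eq hx hφ hφ') (hP x hx)
  have t2 := h.contract₁ hx hD (h.tensorDivLeft_eq hx hP (hPs x hx) (hP' _ hψ))
  have t3 := h.contract₂ hx (c := absPow (J x).det (mu - lam) * absPow (J x).det lam)
    (A := fun i j => nablaD g (mu - lam) (metricTrace g P) i x * nablaD g lam φ j x)
    (A' := fun i j => nablaD g' (mu - lam) (metricTrace g' P') i (ψ x) * nablaD g' lam φ' j (ψ x))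
    (fun i j => by
      rw [hDt, hD]
      rw [mul_mul_mul_comm, Finset.sum_mul_sum]
      congr 1
      exact Finset.sum_congr rfl fun a _ => Finset.sum_congr rfl fun b _ => by ring) hinv
  have t4 := h.contract₂ hx (h.nablaNablaD_eq hx ht ht') hinv
  have t5 := h.contract₂ (𝕜 := 𝕜) hx (c := 1) (A := fun i j => ((ricci g i j x : ℝ) : 𝕜))
    (A' := fun i j => ((ricci g' i j (ψ x) : ℝ) : 𝕜)) (fun i j => by
      rw [h.ricci_eq hx]
      simp only [RCLike.ofReal_sum, RCLike.ofReal_mul, one_mul]) (hP x hx)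
  rw [h.isMetric.quantFormula_eq hx φ hPs, h.isMetric'.quantFormula_eq hψ φ' hP', t1, t2, t3, t4,
    t5, hdiv, h.scalarCurv_eq hx, ht x hx, hφ x hx,
    show absPow (J x).det mu = absPow (J x).det (mu - lam) * absPow (J x).det lam by
      rw [← absPow_add, sub_add_cancel]]
  ring

end IsMetricChange

end FormulaCovariance

/-! ### The coefficients of the quantization formula -/

section Coefficients

variable {n : ℕ} {𝕜 : Type*} [RCLike 𝕜] {g : E n → Matrix (Fin n) (Fin n) ℝ} {U : Set (E n)}

theorem coordOp_smul_add {a₂ : E n → Fin n → Fin n → 𝕜} {a₁ : E n → Fin n → 𝕜}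
    {a₀ f f' : E n → 𝕜} {c : 𝕜} (hU : IsOpen U) (hf : ∀ y ∈ U, ContDiffAt ℝ ∞ f y)
    (hf' : ∀ y ∈ U, ContDiffAt ℝ ∞ f' y) {x : E n} (hx : x ∈ U) :
    coordOp a₂ a₁ a₀ (c • f + f') x = c * coordOp a₂ a₁ a₀ f x + coordOp a₂ a₁ a₀ f' x := by
  have h1 : ∀ j, ∀ y ∈ U, pd j (c • f + f') y = c * pd j f y + pd j f' y := fun j y hy => by
    rw [← pd_const_mul j c (hf y hy), ← pd_add j (contDiffAt_const.mul (hf y hy)) (hf' y hy)]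
    rfl
  have h2 : ∀ i j, pd i (pd j (c • f + f')) x = c * pd i (pd j f) x + pd i (pd j f') x :=
    fun i j => by
      have d1 := contDiffAt_pd j (hf x hx)
      have d2 := contDiffAt_pd j (hf' x hx)
      rw [pd_congr hU (h1 j) hx, pd_add i (contDiffAt_const.mul d1) d2, pd_const_mul i c d1]
  simp only [coordOp, h2, h1 _ x hx, Pi.add_apply, Pi.smul_apply, smul_eq_mul, mul_add,
    Finset.sum_add_distrib, mul_left_comm _ c, ← Finset.mul_sum]
  ring

/-- The coefficients of `∇_j φ` in the quantization formula. -/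
def quantVec (lam mu : 𝕜) (g : E n → Matrix (Fin n) (Fin n) ℝ) (P : E n → Fin n → Fin n → 𝕜)
    (x : E n) (j : Fin n) : 𝕜 :=
  beta1 (n : 𝕜) lam mu * ∑ i, nablaP g (mu - lam) P i i j x
    + beta2 (n : 𝕜) lam mu * ∑ i, ∑ k, ∑ l,
        (((g x)⁻¹ i j * g x k l : ℝ) : 𝕜) * nablaP g (mu - lam) P i k l x

/-- The coefficient of `φ` in the quantization formula. -/
def quantScal (lam mu : 𝕜) (g : E n → Matrix (Fin n) (Fin n) ℝ) (P : E n → Fin n → Fin n → 𝕜)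
    (x : E n) : 𝕜 :=
  beta3 (n : 𝕜) lam mu * ∑ i, ∑ j, nablaNablaP g (mu - lam) P i j i j x
    + beta4 (n : 𝕜) lam mu * ∑ i, ∑ j, ∑ k, ∑ l,
        (((g x)⁻¹ i j * g x k l : ℝ) : 𝕜) * nablaNablaP g (mu - lam) P i j k l x
    + beta5 (n : 𝕜) lam mu * ∑ i, ∑ j, ((ricci g i j x : ℝ) : 𝕜) * P x i j
    + beta6 (n : 𝕜) lam mu * ((scalarCurv g x : ℝ) : 𝕜) *
        ∑ i, ∑ j, ((g x i j : ℝ) : 𝕜) * P x i j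

theorem quantFormula_eq_quantVec (lam mu : 𝕜) (P : E n → Fin n → Fin n → 𝕜) (φ : E n → 𝕜) (x : E n) :
    quantFormula lam mu g P φ x = ∑ i, ∑ j, P x i j * nablaNablaD g lam φ i j x
      + ∑ j, quantVec lam mu g P x j * nablaD g lam φ j x + quantScal lam mu g P x * φ x :=
  rfl

/-- The coefficients of `∂_j φ` in the quantization formula. -/
def quantCoeff₁ (lam mu : 𝕜) (g : E n → Matrix (Fin n) (Fin n) ℝ) (P : E n → Fin n → Fin n → 𝕜)
    (x : E n) (j : Fin n) : 𝕜 :=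
  quantVec lam mu g P x j - lam * ∑ i, ((christoffelTr g i x : ℝ) : 𝕜) * (P x i j + P x j i)
    - ∑ a, ∑ b, ((christoffel g j a b x : ℝ) : 𝕜) * P x a b

/-- The coefficient of order zero in the quantization formula. -/
def quantCoeff₀ (lam mu : 𝕜) (g : E n → Matrix (Fin n) (Fin n) ℝ) (P : E n → Fin n → Fin n → 𝕜)
    (x : E n) : 𝕜 :=
  quantScal lam mu g P x - lam * ∑ j, quantVec lam mu g P x j * ((christoffelTr g j x : ℝ) : 𝕜)
    + ∑ i, ∑ j, P x i j * (-lam * ((pd i (christoffelTr g j) x : ℝ) : 𝕜)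
      + lam * ∑ k, ((christoffel g k i j x : ℝ) : 𝕜) * ((christoffelTr g k x : ℝ) : 𝕜)
      + lam * lam * (((christoffelTr g i x : ℝ) : 𝕜) * ((christoffelTr g j x : ℝ) : 𝕜)))

namespace IsMetricOn

variable (h : IsMetricOn g U) {x : E n} (hx : x ∈ U)

include h hx

theorem nablaNablaD_eq (lam : 𝕜) {φ : E n → 𝕜} (hφ : ContDiffAt ℝ ∞ φ x) (i j : Fin n) :
    nablaNablaD g lam φ i j x = pd i (pd j φ) x
      - lam * (((christoffelTr g j x : ℝ) : 𝕜) * pd i φ x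
        + ((christoffelTr g i x : ℝ) : 𝕜) * pd j φ x)
      - ∑ k, ((christoffel g k i j x : ℝ) : 𝕜) * pd k φ x
      + (-lam * ((pd i (christoffelTr g j) x : ℝ) : 𝕜)
      + lam * ∑ k, ((christoffel g k i j x : ℝ) : 𝕜) * ((christoffelTr g k x : ℝ) : 𝕜)
      + lam * lam * (((christoffelTr g i x : ℝ) : 𝕜) * ((christoffelTr g j x : ℝ) : 𝕜))) * φ x := by
  have hΓ := h.contDiffAt_christoffelTr hx j
  have hΓ' := contDiffAt_ofReal (𝕜 := 𝕜) hΓ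
  have e1 : pd i (nablaD g lam φ j) x = pd i (pd j φ) x
      - (lam * ((pd i (christoffelTr g j) x : ℝ) : 𝕜) * φ x
        + lam * ((christoffelTr g j x : ℝ) : 𝕜) * pd i φ x) := by
    unfold nablaD
    rw [pd_sub i (contDiffAt_pd j hφ) ((contDiffAt_const.mul hΓ').mul hφ),
      pd_mul i (contDiffAt_const.mul hΓ') hφ, pd_const_mul i lam hΓ', pd_ofReal i hΓ]
  have e2 : ∑ k, ((christoffel g k i j x : ℝ) : 𝕜) * nablaD g lam φ k x =
      ∑ k, ((christoffel g k i j x : ℝ) : 𝕜) * pd k φ x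
      - lam * (∑ k, ((christoffel g k i j x : ℝ) : 𝕜) * ((christoffelTr g k x : ℝ) : 𝕜)) * φ x := by
    simp only [nablaD, Finset.mul_sum, Finset.sum_mul, ← Finset.sum_sub_distrib]
    exact Finset.sum_congr rfl fun k _ => by ring
  rw [nablaNablaD, e1, e2, nablaD]
  ring

theorem quantFormula_eq_coordOp (lam mu : 𝕜) (P : E n → Fin n → Fin n → 𝕜) {φ : E n → 𝕜}
    (hφ : ContDiffAt ℝ ∞ φ x) :
    quantFormula lam mu g P φ x =
      coordOp P (quantCoeff₁ lam mu g P) (quantCoeff₀ lam mu g P) φ x := by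
  have s1 : ∑ i, ∑ j, P x i j * (((christoffelTr g j x : ℝ) : 𝕜) * pd i φ x
        + ((christoffelTr g i x : ℝ) : 𝕜) * pd j φ x) =
      ∑ j, (∑ i, ((christoffelTr g i x : ℝ) : 𝕜) * (P x i j + P x j i)) * pd j φ x := by
    simp only [mul_add, Finset.sum_add_distrib, Finset.sum_mul, add_mul]
    rw [Finset.sum_comm (f := fun i j => P x i j * (((christoffelTr g i x : ℝ) : 𝕜) * pd j φ x)),
      add_comm]
    congr 1 <;> exact Finset.sum_congr rfl fun i _ => Finset.sum_congr rfl fun j _ => by ring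
  have s2 : ∑ i, ∑ j, P x i j * ∑ k, ((christoffel g k i j x : ℝ) : 𝕜) * pd k φ x =
      ∑ k, (∑ i, ∑ j, ((christoffel g k i j x : ℝ) : 𝕜) * P x i j) * pd k φ x := by
    simp only [Finset.mul_sum, Finset.sum_mul]
    rw [Finset.sum_congr rfl fun i _ => Finset.sum_comm, Finset.sum_comm]
    exact Finset.sum_congr rfl fun k _ => Finset.sum_congr rfl fun i _ =>
      Finset.sum_congr rfl fun j _ => by ring
  have s3 : ∑ j, quantVec lam mu g P x j * nablaD g lam φ j x =
      ∑ j, quantVec lam mu g P x j * pd j φ x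
      - lam * (∑ j, quantVec lam mu g P x j * ((christoffelTr g j x : ℝ) : 𝕜)) * φ x := by
    simp only [nablaD, Finset.mul_sum, Finset.sum_mul, ← Finset.sum_sub_distrib]
    exact Finset.sum_congr rfl fun k _ => by ring
  rw [quantFormula_eq_quantVec, s3]
  simp only [h.nablaNablaD_eq hx lam hφ, mul_add (P x _ _) (_ - _), mul_sub (P x _ _),
    Finset.sum_add_distrib, Finset.sum_sub_distrib, mul_left_comm (P x _ _) lam (_ + _),
    ← Finset.mul_sum]
  rw [s1, s2]
  simp only [coordOp, quantCoeff₁, quantCoeff₀, sub_mul, add_mul, Finset.sum_sub_distrib,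
    Finset.sum_mul, mul_assoc, ← Finset.mul_sum]
  ring

theorem contDiffAt_nablaNablaP {w : 𝕜} {P : E n → Fin n → Fin n → 𝕜}
    (hP : ∀ i j, ContDiffAt ℝ ∞ (fun y => P y i j) x) (l k i j : Fin n) :
    ContDiffAt ℝ ∞ (nablaNablaP g w P l k i j) x := by
  have hG := h.contDiffAt_christoffel hx
  have hT := h.contDiffAt_christoffelTr hx
  have hN := contDiffAt_nablaP (w := w) hG hP
  unfold nablaNablaP
  fun_prop

theorem contDiffAt_quantVec (lam mu : 𝕜) {P : E n → Fin n → Fin n → 𝕜}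
    (hP : ∀ i j, ContDiffAt ℝ ∞ (fun y => P y i j) x) (j : Fin n) :
    ContDiffAt ℝ ∞ (fun y => quantVec lam mu g P y j) x := by
  have hN := contDiffAt_nablaP (w := mu - lam) (h.contDiffAt_christoffel hx) hP
  exact (contDiffAt_const.mul (contDiffAt_sum fun i => hN i i j)).add
    (contDiffAt_const.mul (contDiffAt_sum fun i => contDiffAt_sum fun k => contDiffAt_sum fun l =>
      (contDiffAt_ofReal ((h.contDiffAt_inv hx i j).mul (h.smooth x hx k l))).mul (hN i k l)))

theorem contDiffAt_quantScal (lam mu : 𝕜) {P : E n → Fin n → Fin n → 𝕜}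
    (hP : ∀ i j, ContDiffAt ℝ ∞ (fun y => P y i j) x) :
    ContDiffAt ℝ ∞ (quantScal lam mu g P) x := by
  have hN := h.contDiffAt_nablaNablaP hx (w := mu - lam) hP
  exact (((contDiffAt_const.mul (contDiffAt_sum fun i => contDiffAt_sum fun j => hN i j i j)).add
    (contDiffAt_const.mul (contDiffAt_sum fun i => contDiffAt_sum fun j => contDiffAt_sum fun k =>
      contDiffAt_sum fun l => (contDiffAt_ofReal ((h.contDiffAt_inv hx i j).mul
        (h.smooth x hx k l))).mul (hN i j k l)))).add
    (contDiffAt_const.mul (contDiffAt_sum fun i => contDiffAt_sum fun j =>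
      (contDiffAt_ofReal (h.contDiffAt_ricci hx i j)).mul (hP i j)))).add
    ((contDiffAt_const.mul (contDiffAt_ofReal (h.contDiffAt_scalarCurv hx))).mul
      (contDiffAt_sum fun i => contDiffAt_sum fun j =>
        (contDiffAt_ofReal (h.smooth x hx i j)).mul (hP i j)))

theorem contDiffAt_quantCoeff₁ (lam mu : 𝕜) {P : E n → Fin n → Fin n → 𝕜}
    (hP : ∀ i j, ContDiffAt ℝ ∞ (fun y => P y i j) x) (j : Fin n) :
    ContDiffAt ℝ ∞ (fun y => quantCoeff₁ lam mu g P y j) x := by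
  have hG := h.contDiffAt_christoffel hx
  have hT := h.contDiffAt_christoffelTr hx
  have hV := h.contDiffAt_quantVec hx lam mu hP
  unfold quantCoeff₁
  fun_prop

theorem contDiffAt_quantCoeff₀ (lam mu : 𝕜) {P : E n → Fin n → Fin n → 𝕜}
    (hP : ∀ i j, ContDiffAt ℝ ∞ (fun y => P y i j) x) :
    ContDiffAt ℝ ∞ (quantCoeff₀ lam mu g P) x := by
  have hG := h.contDiffAt_christoffel hx
  have hT := h.contDiffAt_christoffelTr hx
  have hV := h.contDiffAt_quantVec hx lam mu hP
  have hS := h.contDiffAt_quantScal hx lam mu hP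
  unfold quantCoeff₀
  fun_prop

variable {w c : 𝕜} {P P' : E n → Fin n → Fin n → 𝕜}

omit h hx in
theorem nablaP_smul_add (hP : ∀ i j, ContDiffAt ℝ ∞ (fun y => P y i j) x)
    (hP' : ∀ i j, ContDiffAt ℝ ∞ (fun y => P' y i j) x) (k i j : Fin n) :
    nablaP g w (c • P + P') k i j x = c * nablaP g w P k i j x + nablaP g w P' k i j x := by
  have e1 : pd k (fun y => (c • P + P') y i j) x =
      c * pd k (fun y => P y i j) x + pd k (fun y => P' y i j) x := by
    rw [← pd_const_mul k c (hP i j), ← pd_add k (contDiffAt_const.mul (hP i j)) (hP' i j)]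
    rfl
  rw [nablaP, e1, nablaP, nablaP]
  simp only [Pi.add_apply, Pi.smul_apply, smul_eq_mul, mul_add, Finset.sum_add_distrib,
    mul_left_comm _ c, ← Finset.mul_sum]
  ring

theorem nablaNablaP_smul_add (hP : ∀ y ∈ U, ∀ i j, ContDiffAt ℝ ∞ (fun z => P z i j) y)
    (hP' : ∀ y ∈ U, ∀ i j, ContDiffAt ℝ ∞ (fun z => P' z i j) y) (l k i j : Fin n) :
    nablaNablaP g w (c • P + P') l k i j x =
      c * nablaNablaP g w P l k i j x + nablaNablaP g w P' l k i j x := by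
  have hG := h.contDiffAt_christoffel hx
  have hN := contDiffAt_nablaP (w := w) hG (hP x hx)
  have hN' := contDiffAt_nablaP (w := w) hG (hP' x hx)
  have e1 : pd l (nablaP g w (c • P + P') k i j) x =
      c * pd l (nablaP g w P k i j) x + pd l (nablaP g w P' k i j) x := by
    rw [pd_congr h.isOpen (fun y hy => nablaP_smul_add (hP y hy) (hP' y hy) k i j) hx,
      pd_add l (contDiffAt_const.mul (hN k i j)) (hN' k i j), pd_const_mul l c (hN k i j)]
  simp only [nablaNablaP, e1, nablaP_smul_add (hP x hx) (hP' x hx), mul_add,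
    Finset.sum_add_distrib, mul_left_comm _ c, ← Finset.mul_sum]
  ring

theorem quantFormula_smul_add (lam mu : 𝕜) (φ : E n → 𝕜)
    (hP : ∀ y ∈ U, ∀ i j, ContDiffAt ℝ ∞ (fun z => P z i j) y)
    (hP' : ∀ y ∈ U, ∀ i j, ContDiffAt ℝ ∞ (fun z => P' z i j) y) :
    quantFormula lam mu g (c • P + P') φ x =
      c * quantFormula lam mu g P φ x + quantFormula lam mu g P' φ x := by
  have e1 : ∀ j, quantVec lam mu g (c • P + P') x j =
      c * quantVec lam mu g P x j + quantVec lam mu g P' x j := fun j => by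
    simp only [quantVec, nablaP_smul_add (hP x hx) (hP' x hx), mul_add (_ : 𝕜) (c * _),
      Finset.sum_add_distrib, mul_left_comm _ c, ← Finset.mul_sum]
    ring
  have e2 : quantScal lam mu g (c • P + P') x =
      c * quantScal lam mu g P x + quantScal lam mu g P' x := by
    simp only [quantScal, h.nablaNablaP_smul_add hx hP hP', mul_add (_ : 𝕜) (c * _),
      Finset.sum_add_distrib, mul_left_comm _ c, ← Finset.mul_sum, Pi.add_apply, Pi.smul_apply,
      smul_eq_mul]
    ring
  simp only [quantFormula_eq_quantVec, e1, e2, Pi.add_apply, Pi.smul_apply, smul_eq_mul, add_mul,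
    Finset.sum_add_distrib, mul_assoc, ← Finset.mul_sum]
  ring

end IsMetricOn

end Coefficients

/-! ### The quantization map -/

section QuantizationMap

variable {n : ℕ} {𝕜 : Type*} [RCLike 𝕜] {M : Type*} [TopologicalSpace M] [ChartedSpace (E n) M]

theorem vectorDiv_smul_add {c : 𝕜} {V V' : E n → Fin n → 𝕜} {x : E n}
    (hV : ∀ i, ContDiffAt ℝ ∞ (fun y => V y i) x) (hV' : ∀ i, ContDiffAt ℝ ∞ (fun y => V' y i) x) :
    vectorDiv (c • V + V') x = c * vectorDiv V x + vectorDiv V' x := by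
  simp only [vectorDiv, Finset.mul_sum, ← Finset.sum_add_distrib]
  refine Finset.sum_congr rfl fun i _ => ?_
  rw [← pd_const_mul i c (hV i), ← pd_add i (contDiffAt_const.mul (hV i)) (hV' i)]
  rfl

theorem firstOrderFormula_eq_coordOp (lam mu : 𝕜) (V : E n → Fin n → 𝕜) (φ : E n → 𝕜) (x : E n) :
    firstOrderFormula lam mu V φ x =
      coordOp 0 V (fun y => lam / (1 - (mu - lam)) * vectorDiv V y) φ x := by
  simp [firstOrderFormula, coordOp]

theorem contDiffAt_coordOp {a₂ : E n → Fin n → Fin n → 𝕜} {a₁ : E n → Fin n → 𝕜}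
    {a₀ φ : E n → 𝕜} {x : E n} (h₂ : ∀ i j, ContDiffAt ℝ ∞ (fun y => a₂ y i j) x)
    (h₁ : ∀ i, ContDiffAt ℝ ∞ (fun y => a₁ y i) x) (h₀ : ContDiffAt ℝ ∞ a₀ x)
    (hφ : ContDiffAt ℝ ∞ φ x) : ContDiffAt ℝ ∞ (coordOp a₂ a₁ a₀ φ) x := by
  have h3 : ∀ i j, ContDiffAt ℝ ∞ (pd i (pd j φ)) x := fun i j =>
    contDiffAt_pd i (contDiffAt_pd j hφ)
  unfold coordOp
  fun_prop

variable {lam mu : 𝕜}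

/-- The value at the coordinates `x` of the quantization of `P` applied to a density with component
`φ`. -/
def symbolFormula (g : PseudoMetric n M) (P : Symbols n M (mu - lam)) (e : Chart n M)
    (φ : E n → 𝕜) (x : E n) : 𝕜 :=
  quantFormula lam mu (g.comp e) (P.1.1 e) φ x + firstOrderFormula lam mu (P.2.1.1 e) φ x
    + P.2.2.1 e x * φ x

/-- The coefficients of order one of the quantization of `P`. -/
def symbolCoeff₁ (g : PseudoMetric n M) (P : Symbols n M (mu - lam)) (e : Chart n M) (x : E n)
    (j : Fin n) : 𝕜 :=
  quantCoeff₁ lam mu (g.comp e) (P.1.1 e) x j + P.2.1.1 e x j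

/-- The coefficient of order zero of the quantization of `P`. -/
def symbolCoeff₀ (g : PseudoMetric n M) (P : Symbols n M (mu - lam)) (e : Chart n M) (x : E n) :
    𝕜 :=
  quantCoeff₀ lam mu (g.comp e) (P.1.1 e) x
    + lam / (1 - (mu - lam)) * vectorDiv (P.2.1.1 e) x + P.2.2.1 e x

theorem symbolFormula_eq_coordOp (g : PseudoMetric n M) (P : Symbols n M (mu - lam))
    {e : Chart n M} {φ : E n → 𝕜} {x : E n} (hx : x ∈ e.1.target) (hφ : ContDiffAt ℝ ∞ φ x) :
    symbolFormula g P e φ x =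
      coordOp (P.1.1 e) (symbolCoeff₁ g P e) (symbolCoeff₀ g P e) φ x := by
  rw [symbolFormula, (g.isMetricOn e).quantFormula_eq_coordOp hx lam mu _ hφ]
  simp only [firstOrderFormula, coordOp, symbolCoeff₁, symbolCoeff₀, add_mul,
    Finset.sum_add_distrib]
  ring

theorem contDiffAt_symbolCoeff₁ (g : PseudoMetric n M) (P : Symbols n M (mu - lam))
    {e : Chart n M} {x : E n} (hx : x ∈ e.1.target) (j : Fin n) :
    ContDiffAt ℝ ∞ (fun y => symbolCoeff₁ g P e y j) x :=
  ((g.isMetricOn e).contDiffAt_quantCoeff₁ hx lam mu (contDiffAt_symbol2 P.1 hx) j).add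
    (contDiffAt_symbol1 P.2.1 hx j)

theorem contDiffAt_symbolCoeff₀ (g : PseudoMetric n M) (P : Symbols n M (mu - lam))
    {e : Chart n M} {x : E n} (hx : x ∈ e.1.target) :
    ContDiffAt ℝ ∞ (symbolCoeff₀ g P e) x :=
  (((g.isMetricOn e).contDiffAt_quantCoeff₀ hx lam mu (contDiffAt_symbol2 P.1 hx)).add
    (contDiffAt_const.mul (contDiffAt_vectorDiv (contDiffAt_symbol1 P.2.1 hx)))).add
    (contDiffAt_density P.2.2 hx)

theorem contDiffAt_symbolFormula (g : PseudoMetric n M) (P : Symbols n M (mu - lam))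
    {e : Chart n M} {φ : E n → 𝕜} (hφ : ∀ y ∈ e.1.target, ContDiffAt ℝ ∞ φ y) {x : E n}
    (hx : x ∈ e.1.target) : ContDiffAt ℝ ∞ (symbolFormula g P e φ) x :=
  contDiffAt_congr e.1.open_target (fun y hy => symbolFormula_eq_coordOp g P hy (hφ y hy)) hx
    (contDiffAt_coordOp (contDiffAt_symbol2 P.1 hx) (contDiffAt_symbolCoeff₁ g P hx)
      (contDiffAt_symbolCoeff₀ g P hx) (hφ x hx))

theorem symbolFormula_smul_add (g : PseudoMetric n M) (c : 𝕜) (P P' : Symbols n M (mu - lam))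
    {e : Chart n M} (φ : E n → 𝕜) {x : E n} (hx : x ∈ e.1.target) :
    symbolFormula g (c • P + P') e φ x = c * symbolFormula g P e φ x + symbolFormula g P' e φ x := by
  have h1 := (g.isMetricOn e).quantFormula_smul_add hx (c := c) lam mu φ
    (fun y hy => contDiffAt_symbol2 P.1 hy) (fun y hy => contDiffAt_symbol2 P'.1 hy)
  have h2 := vectorDiv_smul_add (c := c) (contDiffAt_symbol1 P.2.1 hx)
    (contDiffAt_symbol1 P'.2.1 hx)
  have e1 : (c • P + P').1.1 e = c • P.1.1 e + P'.1.1 e := rfl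
  have e2 : (c • P + P').2.1.1 e = c • P.2.1.1 e + P'.2.1.1 e := rfl
  have e3 : (c • P + P').2.2.1 e x = c * P.2.2.1 e x + P'.2.2.1 e x := rfl
  rw [symbolFormula, e1, e2, e3, h1, firstOrderFormula, h2]
  simp only [symbolFormula, firstOrderFormula, Pi.add_apply, Pi.smul_apply, smul_eq_mul, add_mul,
    Finset.sum_add_distrib, mul_assoc, ← Finset.mul_sum]
  ring

theorem symbolFormula_trans (hδ : mu - lam ≠ 1) (g : PseudoMetric n M)
    (P : Symbols n M (mu - lam)) (φ : Density n M lam) {e e' : Chart n M} {x : E n}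
    (hx : x ∈ overlap e e') :
    symbolFormula g P e (φ.1 e) x =
      absPow (jac e e' x).det mu * symbolFormula g P e' (φ.1 e') (trans e e' x) := by
  have h := g.isMetricChange e e'
  have hx' := (trans_mem_overlap hx).1
  have hφ : ∀ y ∈ overlap e e', φ.1 e y = absPow (jac e e' y).det lam * φ.1 e' (trans e e' y) :=
    fun y hy => density_transform φ hy
  have hφ' : ∀ y ∈ e'.1.target, ContDiffAt ℝ ∞ (φ.1 e') y := fun y hy => contDiffAt_density φ hy
  have h2 := h.quantFormula_eq hx (P := P.1.1 e) (P' := P.1.1 e') (fun y hy a b => by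
      rw [P.1.2.2.2.2 e e' y hy, ← mul_assoc, absPow_mul_absPow_neg, one_mul]) rfl
    (fun y hy => contDiffAt_symbol2 P.1 hy.1) (fun y hy => contDiffAt_symbol2 P.1 hy) hφ hφ'
  have h1 := h.firstOrderFormula_eq hx hδ (V := P.2.1.1 e) (V' := P.2.1.1 e') (fun y hy a => by
      rw [P.2.1.2.2.2 e e' y hy, ← mul_assoc, absPow_mul_absPow_neg, one_mul])
    (contDiffAt_symbol1 P.2.1 hx.1) (contDiffAt_symbol1 P.2.1 hx') hφ (hφ' _ hx')
  rw [symbolFormula, symbolFormula, h1, h2, density_transform P.2.2 hx, hφ x hx,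
    show absPow (jac e e' x).det mu =
        absPow (jac e e' x).det (mu - lam) * absPow (jac e e' x).det lam by
      rw [← absPow_add, sub_add_cancel]]
  ring

/-- The quantization of `P` applied to a density. -/
def quantDensity (hδ : mu - lam ≠ 1) (g : PseudoMetric n M) (P : Symbols n M (mu - lam))
    (φ : Density n M lam) : Density n M mu :=
  ⟨fun e => e.1.target.indicator (symbolFormula g P e (φ.1 e)),
    fun e x hx => ((contDiffAt_symbolFormula g P (fun y hy => contDiffAt_density φ hy)
      hx).contDiffWithinAt.congr_of_eventuallyEq
        (Filter.eventually_of_mem self_mem_nhdsWithin fun y hy => Set.indicator_of_mem hy _)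
        (Set.indicator_of_mem hx _)),
    fun e x hx => Set.indicator_of_notMem hx _,
    fun e e' x hx => by
      beta_reduce
      rw [Set.indicator_of_mem hx.1, Set.indicator_of_mem (trans_mem_overlap hx).1,
        symbolFormula_trans hδ g P φ hx, ← mul_assoc, mul_comm (absPow _ (-mu)),
        absPow_mul_absPow_neg, one_mul]⟩

theorem quantDensity_apply (hδ : mu - lam ≠ 1) (g : PseudoMetric n M) (P : Symbols n M (mu - lam))
    (φ : Density n M lam) {e : Chart n M} {x : E n} (hx : x ∈ e.1.target) :
    (quantDensity hδ g P φ).1 e x = symbolFormula g P e (φ.1 e) x :=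
  Set.indicator_of_mem hx _

theorem density_ext {w : 𝕜} {φ ψ : Density n M w}
    (h : ∀ e : Chart n M, ∀ x ∈ e.1.target, φ.1 e x = ψ.1 e x) : φ = ψ := by
  refine Subtype.ext (funext fun e => funext fun x => ?_)
  by_cases hx : x ∈ e.1.target
  · exact h e x hx
  · rw [φ.2.2.1 e x hx, ψ.2.2.1 e x hx]

theorem quantDensity_smul_add_right (hδ : mu - lam ≠ 1) (g : PseudoMetric n M)
    (P : Symbols n M (mu - lam)) (c : 𝕜) (φ φ' : Density n M lam) :
    quantDensity hδ g P (c • φ + φ') = c • quantDensity hδ g P φ + quantDensity hδ g P φ' := by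
  refine density_ext fun e x hx => ?_
  have e1 : (c • φ + φ').1 e = c • φ.1 e + φ'.1 e := rfl
  have e2 : (c • quantDensity hδ g P φ + quantDensity hδ g P φ').1 e x =
      c * (quantDensity hδ g P φ).1 e x + (quantDensity hδ g P φ').1 e x := rfl
  have d : ∀ φ : Density n M lam, ∀ y ∈ e.1.target, ContDiffAt ℝ ∞ (φ.1 e) y :=
    fun φ y hy => contDiffAt_density φ hy
  rw [e2, quantDensity_apply _ _ _ _ hx, quantDensity_apply _ _ _ _ hx,
    quantDensity_apply _ _ _ _ hx, symbolFormula_eq_coordOp g P hx (d _ x hx),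
    symbolFormula_eq_coordOp g P hx (d _ x hx), symbolFormula_eq_coordOp g P hx (d _ x hx), e1,
    coordOp_smul_add e.1.open_target (d φ) (d φ') hx]

theorem quantDensity_smul_add_left (hδ : mu - lam ≠ 1) (g : PseudoMetric n M)
    (P P' : Symbols n M (mu - lam)) (c : 𝕜) (φ : Density n M lam) :
    quantDensity hδ g (c • P + P') φ = c • quantDensity hδ g P φ + quantDensity hδ g P' φ := by
  refine density_ext fun e x hx => ?_
  have e2 : (c • quantDensity hδ g P φ + quantDensity hδ g P' φ).1 e x =
      c * (quantDensity hδ g P φ).1 e x + (quantDensity hδ g P' φ).1 e x := rfl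
  rw [e2, quantDensity_apply _ _ _ _ hx, quantDensity_apply _ _ _ _ hx,
    quantDensity_apply _ _ _ _ hx, symbolFormula_smul_add g c P P' _ hx]

/-- A map between modules that is compatible with `c • x + y` is linear. -/
theorem isLinearMap_of_smul_add {V W : Type*} [AddCommGroup V] [Module 𝕜 V] [AddCommGroup W]
    [Module 𝕜 W] {f : V → W} (h : ∀ (c : 𝕜) x y, f (c • x + y) = c • f x + f y) :
    IsLinearMap 𝕜 f where
  map_add x y := by simpa using h 1 x y
  map_smul c x := by
    have h0 : f 0 = 0 := by simpa using h 1 0 0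
    simpa [h0] using h c x 0

/-- The quantization of `P` as an operator. -/
def quantOp (hδ : mu - lam ≠ 1) (g : PseudoMetric n M) (P : Symbols n M (mu - lam)) :
    Density n M lam →ₗ[𝕜] Density n M mu :=
  (isLinearMap_of_smul_add (quantDensity_smul_add_right hδ g P)).mk'

theorem hasCoeffs_quantOp (hδ : mu - lam ≠ 1) (g : PseudoMetric n M) (P : Symbols n M (mu - lam))
    (e : Chart n M) :
    HasCoeffs (quantOp hδ g P) e (P.1.1 e) (symbolCoeff₁ g P e) (symbolCoeff₀ g P e) where
  smooth₂ i j := P.1.2.1 e i j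
  smooth₁ i x hx := (contDiffAt_symbolCoeff₁ g P hx i).contDiffWithinAt
  smooth₀ x hx := (contDiffAt_symbolCoeff₀ g P hx).contDiffWithinAt
  symm x _ i j := P.1.2.2.2.1 e x i j
  apply_eq φ x hx := (quantDensity_apply hδ g P φ hx).trans
    (symbolFormula_eq_coordOp g P hx (contDiffAt_density φ hx))

/-- The quantization map. -/
def quantMap (hδ : mu - lam ≠ 1) (g : PseudoMetric n M) :
    Symbols n M (mu - lam) →ₗ[𝕜] DiffOp2 n M lam mu :=
  LinearMap.codRestrict _ (isLinearMap_of_smul_add (f := quantOp hδ g) fun c P P' =>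
      LinearMap.ext fun φ => by
        rw [LinearMap.add_apply, LinearMap.smul_apply]
        exact quantDensity_smul_add_left hδ g P P' c φ).mk'
    fun P e => ⟨_, _, _, hasCoeffs_quantOp hδ g P e⟩

theorem quantMap_apply (hδ : mu - lam ≠ 1) (g : PseudoMetric n M) (P : Symbols n M (mu - lam))
    (φ : Density n M lam) {e : Chart n M} {x : E n} (hx : x ∈ e.1.target) :
    ((quantMap hδ g P).1 φ).1 e x = symbolFormula g P e (φ.1 e) x :=
  quantDensity_apply hδ g P φ hx

theorem quantFormula_zero (g : PseudoMetric n M) (e : Chart n M) (φ : E n → 𝕜) {x : E n}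
    (hx : x ∈ e.1.target) : quantFormula lam mu (g.comp e) 0 φ x = 0 := by
  have h := (g.isMetricOn e).quantFormula_smul_add hx (c := (1 : 𝕜)) lam mu φ (P := 0) (P' := 0)
    (fun y hy i j => contDiffAt_const) (fun y hy i j => contDiffAt_const)
  simpa using h

theorem firstOrderFormula_zero (φ : E n → 𝕜) (x : E n) : firstOrderFormula lam mu 0 φ x = 0 := by
  simp [firstOrderFormula, vectorDiv]

theorem quantMap_apply_symbol2 (hδ : mu - lam ≠ 1) (g : PseudoMetric n M)
    (P : Symbol2 n M (mu - lam)) (φ : Density n M lam) {e : Chart n M} {x : E n}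
    (hx : x ∈ e.1.target) :
    ((quantMap hδ g (P, 0, 0)).1 φ).1 e x = quantFormula lam mu (g.comp e) (P.1 e) (φ.1 e) x := by
  rw [quantMap_apply hδ g _ φ hx, symbolFormula]
  change _ + firstOrderFormula lam mu 0 (φ.1 e) x + 0 * φ.1 e x = _
  rw [firstOrderFormula_zero]
  ring

theorem preservesPrincipalSymbol_quantMap (hδ : mu - lam ≠ 1) (g : PseudoMetric n M) :
    PreservesPrincipalSymbol (quantMap hδ g) := by
  refine ⟨fun P e => ⟨_, _, hasCoeffs_quantOp hδ g (P, 0, 0) e⟩, fun P e =>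
    ⟨fun y => lam / (1 - (mu - lam)) * vectorDiv (P.1 e) y, ?_⟩, fun P e => ?_⟩
  · refine ⟨fun _ _ => contDiffOn_const, fun i => P.2.1 e i, fun x hx => (contDiffAt_const.mul
      (contDiffAt_vectorDiv (contDiffAt_symbol1 P hx))).contDiffWithinAt, fun _ _ _ _ => rfl,
      fun φ x hx => ?_⟩
    rw [quantMap_apply hδ g _ φ hx, symbolFormula, ← firstOrderFormula_eq_coordOp]
    change quantFormula lam mu (g.comp e) 0 (φ.1 e) x + _ + 0 * φ.1 e x = _
    rw [quantFormula_zero g e _ hx]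
    ring
  · refine ⟨fun _ _ => contDiffOn_const, fun _ => contDiffOn_const, P.2.1 e, fun _ _ _ _ => rfl,
      fun φ x hx => ?_⟩
    rw [quantMap_apply hδ g _ φ hx, symbolFormula, coordOp_zero rfl rfl]
    change quantFormula lam mu (g.comp e) 0 (φ.1 e) x + firstOrderFormula lam mu 0 (φ.1 e) x + _ = _
    rw [quantFormula_zero g e _ hx, firstOrderFormula_zero]
    ring

end QuantizationMap

/-! ### Equivariance of the quantization map -/

section QuantizationEquivariance

variable {n : ℕ} {𝕜 : Type*} [RCLike 𝕜] {p : ℕ} {lam mu : 𝕜} {U : Set (E n)}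

theorem flatFormula_congr (hU : IsOpen U) {P P' : E n → Fin n → Fin n → 𝕜} {φ φ' : E n → 𝕜}
    (hP : ∀ y ∈ U, P y = P' y) (hφ : ∀ y ∈ U, φ y = φ' y) {x : E n} (hx : x ∈ U) :
    flatFormula p lam mu P φ x = flatFormula p lam mu P' φ' x := by
  have hP' : ∀ i j, ∀ y ∈ U, P y i j = P' y i j := fun i j y hy => by rw [hP y hy]
  have h1 : ∀ j, ∀ y ∈ U, pd j φ y = pd j φ' y := fun j y hy => pd_congr hU hφ hy j
  have h2 : ∀ i, ∀ y ∈ U, ∑ j, pd j (fun z => P z i j) y = ∑ j, pd j (fun z => P' z i j) y :=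
    fun i y hy => Finset.sum_congr rfl fun j _ => pd_congr hU (hP' i j) hy j
  have h3 : ∀ y ∈ U, ∑ k, ((eta p k : ℝ) : 𝕜) * P y k k = ∑ k, ((eta p k : ℝ) : 𝕜) * P' y k k :=
    fun y hy => by rw [hP y hy]
  simp only [flatFormula, hP x hx, hφ x hx, h1 _ x hx, fun i j => pd_congr hU (h1 j) hx i,
    fun i j => pd_congr hU (hP' i j) hx i, fun i => pd_congr hU (h2 i) hx i,
    fun i => pd_congr hU h3 hx i, fun i => pd_congr hU (fun y hy => pd_congr hU h3 hy i) hx i]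

theorem firstOrderFormula_congr (hU : IsOpen U) {V V' : E n → Fin n → 𝕜} {φ φ' : E n → 𝕜}
    (hV : ∀ y ∈ U, V y = V' y) (hφ : ∀ y ∈ U, φ y = φ' y) {x : E n} (hx : x ∈ U) :
    firstOrderFormula lam mu V φ x = firstOrderFormula lam mu V' φ' x := by
  have hV' : ∀ i, ∀ y ∈ U, V y i = V' y i := fun i y hy => by rw [hV y hy]
  simp only [firstOrderFormula, vectorDiv, hV x hx, hφ x hx, pd_congr hU hφ hx,
    fun i => pd_congr hU (hV' i) hx i]

variable {M : Type*} [TopologicalSpace M] [ChartedSpace (E n) M] {g : PseudoMetric n M}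

theorem IsAdapted.isConformalTo (hn : 0 < n) {e : Chart n M} (he : IsAdapted p g e) :
    ∃ u, IsConformalTo p (g.comp e) u e.1.target := by
  obtain ⟨F, hF⟩ := he
  let i : Fin n := ⟨0, hn⟩
  have e1 : ∀ y ∈ e.1.target, F y = eta p i * g.comp e y i i := fun y hy => by
    rw [(hF y hy).2, Matrix.smul_apply, Matrix.diagonal_apply_eq, smul_eq_mul, mul_left_comm,
      eta_mul_self, mul_one]
  have hs : ∀ y ∈ e.1.target, ContDiffAt ℝ ∞ F y := fun y hy =>
    contDiffAt_congr e.1.open_target e1 hy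
      (contDiffAt_const.mul ((g.isMetricOn e).smooth y hy i i))
  refine ⟨fun y => 1 / 2 * Real.log (F y), e.1.open_target, fun y hy =>
    contDiffAt_const.mul ((hs y hy).log (hF y hy).1.ne'), fun y hy => ?_⟩
  rw [← mul_assoc, mul_one_div_cancel two_ne_zero, one_mul, Real.exp_log (hF y hy).1,
    (hF y hy).2]

theorem isConfEquivariant_quantMap (hn : 0 < n) (hδ : mu - lam ≠ 1)
    (hc : CoeffDenoms (n : 𝕜) lam mu) (g : PseudoMetric n M) :
    IsConfEquivariant p g (quantMap hδ g) := by
  intro e he X hX P P' hP φ φ' hφ x hx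
  obtain ⟨s, h, hX⟩ := isConfField_of_mem hX
  obtain ⟨u, hu⟩ := he.isConformalTo hn
  have hU := e.1.open_target
  have s2 : ∀ P : Symbols n M (mu - lam), ∀ y ∈ e.1.target, ∀ i j,
      ContDiffAt ℝ ∞ (fun z => P.1.1 e z i j) y := fun P y hy => contDiffAt_symbol2 P.1 hy
  have s1 : ∀ y ∈ e.1.target, ∀ i, ContDiffAt ℝ ∞ (fun z => P.2.1.1 e z i) y :=
    fun y hy => contDiffAt_symbol1 P.2.1 hy
  have s0 : ∀ φ : Density n M lam, ∀ y ∈ e.1.target, ContDiffAt ℝ ∞ (φ.1 e) y :=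
    fun φ y hy => contDiffAt_density φ hy
  have key : ∀ (P : Symbols n M (mu - lam)) (φ : Density n M lam), ∀ y ∈ e.1.target,
      ((quantMap hδ g P).1 φ).1 e y = flatFormula p lam mu (P.1.1 e) (φ.1 e) y
        + firstOrderFormula lam mu (P.2.1.1 e) (φ.1 e) y + P.2.2.1 e y * φ.1 e y :=
    fun P φ y hy => by
      rw [quantMap_apply hδ g P φ hy, symbolFormula, hu.quantFormula_eq hy hc (s2 P)
        (fun y _ => P.1.2.2.2.1 e y) (s0 φ y hy)]
  have d2 : ContDiffAt ℝ ∞ (flatFormula p lam mu (P.1.1 e) (φ.1 e)) x := by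
    refine contDiffAt_congr hU (fun y hy => (hu.quantFormula_eq hy hc (s2 P)
      (fun y _ => P.1.2.2.2.1 e y) (s0 φ y hy)).symm) hx ?_
    refine contDiffAt_congr hU (fun y hy => (g.isMetricOn e).quantFormula_eq_coordOp hy lam mu _
      (s0 φ y hy)) hx (contDiffAt_coordOp (s2 P x hx)
        ((g.isMetricOn e).contDiffAt_quantCoeff₁ hx lam mu (s2 P x hx))
        ((g.isMetricOn e).contDiffAt_quantCoeff₀ hx lam mu (s2 P x hx)) (s0 φ x hx))
  have d1 : ContDiffAt ℝ ∞ (firstOrderFormula lam mu (P.2.1.1 e) (φ.1 e)) x := by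
    rw [funext (firstOrderFormula_eq_coordOp lam mu (P.2.1.1 e) (φ.1 e))]
    exact contDiffAt_coordOp (fun _ _ => contDiffAt_const) (s1 x hx)
      (contDiffAt_const.mul (contDiffAt_vectorDiv (s1 x hx))) (s0 φ x hx)
  have d0 := contDiffAt_density P.2.2 hx
  have e2 := hX.flatFormula_lie hc hU (s2 P) (fun y _ => P.1.2.2.2.1 e y) (s0 φ) hx
  have e1 : firstOrderFormula lam mu (lieSymbol1 (mu - lam) X (P.2.1.1 e)) (φ.1 e) x =
      lieDensity mu X (firstOrderFormula lam mu (P.2.1.1 e) (φ.1 e)) x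
        - firstOrderFormula lam mu (P.2.1.1 e) (lieDensity lam X (φ.1 e)) x :=
    hX.firstOrder_lie hc.top (s1 x hx) (s0 φ x hx)
  have e0 := lieDensity_mul (X := X) (mu - lam) lam d0 (s0 φ x hx)
  rw [sub_add_cancel] at e0
  rw [key P' φ x hx, key P φ' x hx, lieDensity_congr hU mu (key P φ) hx,
    lieDensity_add mu (d2.add d1) (d0.mul (s0 φ x hx)), lieDensity_add mu d2 d1, e0,
    flatFormula_congr hU (fun y hy => funext fun i => funext fun j => congrFun (congrFun
      (hP y hy).1 i) j) (fun _ _ => rfl) hx, e2,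
    firstOrderFormula_congr hU (fun y hy => (hP y hy).2.1) (fun _ _ => rfl) hx, e1,
    (hP x hx).2.2, flatFormula_congr hU (fun _ _ => rfl) hφ hx,
    firstOrderFormula_congr hU (fun _ _ => rfl) hφ hx, hφ x hx]
  ring

end QuantizationEquivariance

/-! ### Bijectivity of the quantization map -/

section Bijectivity

variable {n : ℕ} {𝕜 : Type*} [RCLike 𝕜] {M : Type*} [TopologicalSpace M] [ChartedSpace (E n) M]
  [T2Space M] {lam mu : 𝕜} {A : Density n M lam →ₗ[𝕜] Density n M mu}

theorem exists_principalSymbol₂ (hA : ∀ e : Chart n M, ∃ a₂ a₁ a₀, HasCoeffs A e a₂ a₁ a₀) :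
    ∃ P : Symbol2 n M (mu - lam), ∀ e, ∃ a₁ a₀, HasCoeffs A e (P.1 e) a₁ a₀ := by
  choose a₂ a₁ a₀ h using hA
  obtain ⟨b, hi, hb⟩ : ∃ b : Chart n M → E n → Fin n → Fin n → 𝕜,
      (∀ e, ∀ x ∈ e.1.target, b e x = a₂ e x) ∧ ∀ e, ∀ x ∉ e.1.target, b e x = 0 :=
    ⟨fun e => e.1.target.indicator (a₂ e), fun e x hx => Set.indicator_of_mem hx _,
      fun e x hx => Set.indicator_of_notMem hx _⟩
  refine ⟨⟨b, fun e i j =>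
    ((h e).smooth₂ i j).congr fun x hx => by rw [hi e x hx], hb, fun e x i j => ?_, fun e e' x hx i j => ?_⟩, fun e =>
    ⟨a₁ e, a₀ e, (h e).congr (hi e) (fun _ _ => rfl) fun _ _ => rfl⟩⟩
  · by_cases hx : x ∈ e.1.target
    · rw [hi e x hx, (h e).symm x hx]
    · rw [hb e x hx]; rfl
  · rw [hi e' _ (trans_mem_overlap hx).1, hi e x hx.1, (h e).principal₂ (h e') hx]
    rfl

theorem exists_principalSymbol₁ (hA : ∀ e : Chart n M, ∃ a₁ a₀, HasCoeffs A e 0 a₁ a₀) :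
    ∃ P : Symbol1 n M (mu - lam), ∀ e, ∃ a₀, HasCoeffs A e 0 (P.1 e) a₀ := by
  choose a₁ a₀ h using hA
  obtain ⟨b, hi, hb⟩ : ∃ b : Chart n M → E n → Fin n → 𝕜,
      (∀ e, ∀ x ∈ e.1.target, b e x = a₁ e x) ∧ ∀ e, ∀ x ∉ e.1.target, b e x = 0 :=
    ⟨fun e => e.1.target.indicator (a₁ e), fun e x hx => Set.indicator_of_mem hx _,
      fun e x hx => Set.indicator_of_notMem hx _⟩
  refine ⟨⟨b, fun e i =>
    ((h e).smooth₁ i).congr fun x hx => by rw [hi e x hx], hb, fun e e' x hx i => ?_⟩, fun e =>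
    ⟨a₀ e, (h e).congr (fun _ _ => rfl) (hi e) fun _ _ => rfl⟩⟩
  rw [hi e' _ (trans_mem_overlap hx).1, hi e x hx.1, (h e).principal₁ (h e') hx rfl rfl]
  rfl

theorem exists_principalSymbol₀ (hA : ∀ e : Chart n M, ∃ a₀, HasCoeffs A e 0 0 a₀) :
    ∃ P : Density n M (mu - lam), ∀ e, HasCoeffs A e 0 0 (P.1 e) := by
  choose a₀ h using hA
  obtain ⟨b, hi, hb⟩ : ∃ b : Chart n M → E n → 𝕜,
      (∀ e, ∀ x ∈ e.1.target, b e x = a₀ e x) ∧ ∀ e, ∀ x ∉ e.1.target, b e x = 0 :=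
    ⟨fun e => e.1.target.indicator (a₀ e), fun e x hx => Set.indicator_of_mem hx _,
      fun e x hx => Set.indicator_of_notMem hx _⟩
  refine ⟨⟨b, fun e =>
    (h e).smooth₀.congr (hi e), hb,
    fun e e' x hx => ?_⟩, fun e => (h e).congr (fun _ _ => rfl) (fun _ _ => rfl) (hi e)⟩
  rw [hi e' _ (trans_mem_overlap hx).1, hi e x hx.1, (h e).principal₀ (h e') hx rfl rfl rfl rfl]
  rfl

variable {Q : Symbols n M (mu - lam) →ₗ[𝕜] DiffOp2 n M lam mu}

theorem symbols_eq_add (P : Symbols n M (mu - lam)) :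
    P = (P.1, 0, 0) + (0, P.2.1, 0) + (0, 0, P.2.2) := by
  ext <;> simp

theorem hasCoeffs_zero (e : Chart n M) :
    HasCoeffs (0 : Density n M lam →ₗ[𝕜] Density n M mu) e 0 0 0 :=
  ⟨fun _ _ => contDiffOn_const, fun _ => contDiffOn_const, contDiffOn_const, fun _ _ _ _ => rfl,
    fun φ x _ => by simp [coordOp]⟩

theorem PreservesPrincipalSymbol.injective (hQ : PreservesPrincipalSymbol Q) :
    Function.Injective Q := by
  refine (injective_iff_map_eq_zero Q).2 fun P hP => ?_
  obtain ⟨P₂, P₁, P₀⟩ := P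
  have h0 : (Q (P₂, 0, 0)).1 + (Q (0, P₁, 0)).1 + (Q (0, 0, P₀)).1 = 0 := by
    rw [← Submodule.coe_add, ← Submodule.coe_add, ← map_add, ← map_add,
      ← symbols_eq_add (P₂, P₁, P₀), hP]
    rfl
  have h₂ : P₂ = 0 := by
    refine Subtype.ext (funext fun e => funext fun x => ?_)
    by_cases hx : x ∈ e.1.target
    · obtain ⟨a₁, a₀, ha⟩ := hQ.1 P₂ e
      obtain ⟨b₀, hb⟩ := hQ.2.1 P₁ e
      have h := ((hasCoeffs_zero e).sub (hQ.2.2 P₀ e)).sub hb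
      have e1 : 0 - (Q (0, 0, P₀)).1 - (Q (0, P₁, 0)).1 = (Q (P₂, 0, 0)).1 :=
        LinearMap.ext fun φ => (eq_sub_of_add_eq (eq_sub_of_add_eq (LinearMap.congr_fun h0 φ))).symm
      rw [e1] at h
      simpa using h.eq₂ ha hx
    · exact P₂.2.2.1 e x hx
  subst h₂
  have h1 : (Q (0, P₁, 0)).1 + (Q (0, 0, P₀)).1 = 0 := by
    rwa [show ((0, 0, 0) : Symbols n M (mu - lam)) = 0 from rfl, map_zero, Submodule.coe_zero,
      zero_add] at h0
  have h₁ : P₁ = 0 := by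
    refine Subtype.ext (funext fun e => funext fun x => ?_)
    by_cases hx : x ∈ e.1.target
    · obtain ⟨a₀, ha⟩ := hQ.2.1 P₁ e
      have h := (hasCoeffs_zero e).sub (hQ.2.2 P₀ e)
      have e1 : 0 - (Q (0, 0, P₀)).1 = (Q (0, P₁, 0)).1 :=
        LinearMap.ext fun φ => (eq_sub_of_add_eq (LinearMap.congr_fun h1 φ)).symm
      rw [e1] at h
      simpa using h.eq₁ ha hx (by simp)
    · exact P₁.2.2.1 e x hx
  subst h₁
  have h2 : (Q (0, 0, P₀)).1 = 0 := by
    rwa [show ((0, 0, 0) : Symbols n M (mu - lam)) = 0 from rfl, map_zero, Submodule.coe_zero,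
      zero_add] at h1
  have h₀ : P₀ = 0 := by
    refine density_ext fun e x hx => ?_
    have ha := hQ.2.2 P₀ e
    rw [h2] at ha
    exact (hasCoeffs_zero e).eq₀ ha hx rfl rfl
  rw [h₀]
  rfl

theorem PreservesPrincipalSymbol.surjective (hQ : PreservesPrincipalSymbol Q) :
    Function.Surjective Q := by
  intro A
  obtain ⟨P₂, h₂⟩ := exists_principalSymbol₂ A.2
  obtain ⟨P₁, h₁⟩ := exists_principalSymbol₁ (A := A.1 - (Q (P₂, 0, 0)).1) fun e => by
    obtain ⟨a₁, a₀, ha⟩ := h₂ e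
    obtain ⟨b₁, b₀, hb⟩ := hQ.1 P₂ e
    exact ⟨_, _, (sub_self (P₂.1 e)) ▸ ha.sub hb⟩
  obtain ⟨P₀, h₀⟩ := exists_principalSymbol₀
    (A := A.1 - (Q (P₂, 0, 0)).1 - (Q (0, P₁, 0)).1) fun e => by
    obtain ⟨a₀, ha⟩ := h₁ e
    obtain ⟨b₀, hb⟩ := hQ.2.1 P₁ e
    have := ha.sub hb
    rw [sub_self, sub_self] at this
    exact ⟨_, this⟩
  refine ⟨(P₂, P₁, P₀), Subtype.ext (LinearMap.ext fun φ => density_ext fun e x hx => ?_)⟩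
  have h := (h₀ e).sub (hQ.2.2 P₀ e)
  rw [sub_self, sub_self, sub_self] at h
  have e1 := h.eq_zero hx rfl rfl rfl φ
  rw [symbols_eq_add (P₂, P₁, P₀), map_add, map_add]
  simp only [LinearMap.sub_apply, Submodule.coe_sub, Submodule.coe_add, LinearMap.add_apply,
    Pi.sub_apply, Pi.add_apply] at e1 ⊢
  linear_combination -e1

end Bijectivity

end ConfQuant

end

theorem theorem3p7 {𝕜 : Type*} [RCLike 𝕜] (n p q : ℕ) (hn : 3 ≤ n) (hpq : p + q = n)
    (M : Type*) [TopologicalSpace M] [T2Space M] [SecondCountableTopology M]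
    [ChartedSpace (ConfQuant.E n) M] [IsManifold 𝓘(ℝ, ConfQuant.E n) ∞ M]
    (g : ConfQuant.PseudoMetric n M) (hg : ConfQuant.IsConformallyFlat p g)
    (lam mu : 𝕜) (hδ : ConfQuant.NonResonant n (mu - lam)) :
    ∃ Q : ConfQuant.Symbols n M (mu - lam) ≃ₗ[𝕜] ConfQuant.DiffOp2 n M lam mu,
      (ConfQuant.IsConfEquivariant p g Q.toLinearMap ∧
        ConfQuant.PreservesPrincipalSymbol Q.toLinearMap) ∧
      (∀ Q' : ConfQuant.Symbols n M (mu - lam) ≃ₗ[𝕜] ConfQuant.DiffOp2 n M lam mu,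
        ConfQuant.IsConfEquivariant p g Q'.toLinearMap →
        ConfQuant.PreservesPrincipalSymbol Q'.toLinearMap → Q' = Q) ∧
      (∀ (P : ConfQuant.Symbol2 n M (mu - lam)) (φ : ConfQuant.Density n M lam)
        (e : ConfQuant.Chart n M), ∀ x ∈ e.1.target,
        ((Q (P, 0, 0)).1 φ).1 e x =
          ConfQuant.quantFormula lam mu (g.comp e) (P.1 e) (φ.1 e) x) := by
  have hc := hδ.coeffDenoms hn
  have h1 : mu - lam ≠ 1 := hδ.2.2.1
  have hQ := ConfQuant.preservesPrincipalSymbol_quantMap h1 g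
  have hE := ConfQuant.isConfEquivariant_quantMap (p := p) (by omega) h1 hc g
  refine ⟨LinearEquiv.ofBijective (ConfQuant.quantMap h1 g) ⟨hQ.injective, hQ.surjective⟩,
    ⟨hE, hQ⟩, fun Q' hE' hQ' => LinearEquiv.toLinearMap_injective ?_, fun P φ e x hx =>
    ConfQuant.quantMap_apply_symbol2 h1 g P φ hx⟩
  exact hQ.unique hg hc hQ' hE hE'
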